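/- **Setting.** For distinct points $x,y$ of the oriented circle $\mathbb S^1=\mathbb R/2\pi\mathbb Z$ let $[x,y]$ denote the closed arc going from $x$ to $y$ in the positive direction. A *rectangle* in $\mathbb T^2=\mathbb S^1\times\mathbb S^1$ (coordinates $(\theta,\varphi)$) is a set $r=[\theta_1,\theta_2]\times[\varphi_1,\varphi_2]$ with $\theta_1\ne\theta_2$, $\varphi_1\ne\varphi_2$. Two rectangles are *compatible* if their intersection is empty, or consists of vertices of the first one, or is a rectangle disjoint from the vertices of both. A *rectangular diagram of a surface* is a finite collection $\Pi$ of pairwise compatible rectangles such that every meridian $\{\theta\}\times\mathbb S^1$ and every longitude $\mathbb S^1\times\{\varphi\}$ contains at most two free vertices, i.e. points that are vertices of exactly one rectangle of $\Pi$. For a rectangle $r$ let $h_r$ be the unique bounded harmonic function on $\operatorname{int}(r)$ that tends to $0$ as $\varphi\to\varphi_1$ or $\varphi\to\varphi_2$ with $\theta\in(\theta_1,\theta_2)$ fixed, and to $1$ as $\theta\to\theta_1$ or $\theta\to\theta_2$ with $\varphi\in(\varphi_1,\varphi_2)$ fixed. For $\kappa\ge 0$ put $$\widetilde h_r(v)=\tfrac2\pi\arctan\Bigl(\bigl(\tan(\pi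 h_r(v)/2)\bigr)^{1/(2+\kappa)}\Bigr),$$ let $\widehat r^{\,\kappa}\subset\mathbb S^3$ be the image of the closure of $\{(v,\widetilde h_r(v)) : v\in\operatorname{int}(r)\}\subset\mathbb T^2\times[0,1]$ under $$(\theta,\varphi,\tau)\mapsto\bigl(\cos\tfrac{\pi\tau}2\cos\varphi,\ \cos\tfrac{\pi\tau}2\sin\varphi,\ \sin\tfrac{\pi\tau}2\cos\theta,\ \sin\tfrac{\pi\tau}2\sin\theta\bigr)\in\mathbb S^3\subset\mathbb R^4,$$ and let $\widehat\Pi^\kappa=\bigcup_{r\in\Pi}\widehat r^{\,\kappa}$. A *surface with corners* is a compact $F\subset\mathbb S^3$ lying in an embedded $C^1$ surface and bounded in it by disjoint piecewise smooth simple closed curves without cusps; equivalently, near each of its points $F$ is taken by a local $C^1$ diffeomorphism of $\mathbb R^4$ to a plane, a half-plane, or a plane sector with angle in $(0,2\pi)\setminus\{\pi\}$ with the point at its apex (the last case: the point is a singularity of $\partial F$). Let $\xi_+=\ker\alpha_+$, $\alpha_+=\cos^2(\pi\tau/2)\,d\varphi+\sin^2(\pi\tau/2)\,d\theta$, be the standard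 contact structure of $\mathbb S^3$, cooriented by $\alpha_+$. The *characteristic foliation* $\mathscr F(F)$ is the singular foliation of $F$ defined by $T_pF\cap\xi_+(p)$, with the coorientation inherited from $\xi_+$; its singularities are the points with $T_pF=\xi_+(p)$. A singularity is a *node* if in suitable $C^1$ local coordinates of $F$ centered at it the foliation is radial (by straight rays from the origin), and a (simple) *saddle* if in suitable $C^1$ local coordinates the foliation is directed by a $C^1$ vector field vanishing only at the singularity, whose linear part there has negative determinant. The foliation $\mathscr F(F)$ is *nice* if it has finitely many singularities, each of them is a node or a saddle, and every singularity of $\partial F$ is a node of $\mathscr F(F)$. It is *very nice* if it is nice and has neither a closed regular leaf nor a cooriented saddle connection cycle, i.e. a cyclic sequence of regular leaves $\gamma_i$ going from a saddle $p_i$ to a saddle $p_{i+1}$ such that at each $p_{i+1}$ the coorientations of $\gamma_i$ and $\gamma_{i+1}$ agree: for a local orientation of $F$ near $p_{i+1}$, both leaves run in the direction defined by that orientation and the coorientation of $\mathscr F(F)$. A regular leaf that is an arc approaching singularities at both ends is a *$1$-arc* if, along it, the contact plane rotates relative to the tangent plane of $F$ by the total angle $+\pi$ (right-hand rule, for the orientation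 of $\mathbb S^3$ in which $\alpha_+\wedge d\alpha_+>0$). **Proposition.** Let $\Pi$ be a rectangular diagram of a surface. For every $\kappa\ge0$ the set $\widehat\Pi^\kappa$ is a surface with corners and its characteristic foliation has no $1$-arcs. If $\kappa>0$, the characteristic foliation of $\widehat\Pi^\kappa$ is moreover very nice. -/

import Mathlib

namespace RectSurface

open Filter Topology

/-! ### Rectangular diagrams of a surface -/

/-- The torus `𝕋² = 𝕊¹ × 𝕊¹`, with coordinates `(θ, φ)`. -/
abbrev Torus : Type := Real.Angle × Real.Angle

/-- A rectangle `[θ₁, θ₂] × [φ₁, φ₂]` in the torus. -/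
@[ext]
structure Rect where
  θ₁ : Real.Angle
  θ₂ : Real.Angle
  φ₁ : Real.Angle
  φ₂ : Real.Angle
  hθ : θ₁ ≠ θ₂
  hφ : φ₁ ≠ φ₂

namespace Rect

/-- The rectangle as a subset of the torus; `Set.cIcc x y` is the closed arc of the circle that
goes from `x` to `y` in the positive direction. -/
def carrier (r : Rect) : Set Torus := Set.cIcc r.θ₁ r.θ₂ ×ˢ Set.cIcc r.φ₁ r.φ₂

/-- The interior of the rectangle. -/
def inner (r : Rect) : Set Torus := Set.cIoo r.θ₁ r.θ₂ ×ˢ Set.cIoo r.φ₁ r.φ₂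

/-- The four vertices of the rectangle. -/
def vertices (r : Rect) : Set Torus := {r.θ₁, r.θ₂} ×ˢ {r.φ₁, r.φ₂}

/-- Compatibility of two rectangles: the intersection is empty, or consists of vertices of the
first one, or is a rectangle that contains no vertex of either. -/
def Compatible (r₁ r₂ : Rect) : Prop :=
  r₁.carrier ∩ r₂.carrier = ∅ ∨
  r₁.carrier ∩ r₂.carrier ⊆ r₁.vertices ∨
  ∃ r₃ : Rect, r₁.carrier ∩ r₂.carrier = r₃.carrier ∧
    Disjoint r₃.carrier r₁.vertices ∧ Disjoint r₃.carrier r₂.vertices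

/-- `h` is a bounded harmonic function on the interior of `r` that tends to `0` at the open
horizontal sides along vertical segments, and to `1` at the open vertical sides along horizontal
segments. Harmonicity is with respect to the angular coordinates `θ`, `φ`, that is, for the lift
of `h` to the universal cover `ℂ = {θ + i φ}` of the torus. -/
structure IsHarmonicHeight (r : Rect) (h : Torus → ℝ) : Prop where
  harmonic : InnerProductSpace.HarmonicOnNhd
    (fun z : ℂ => h ((z.re : Real.Angle), (z.im : Real.Angle)))
    {z : ℂ | ((z.re : Real.Angle), (z.im : Real.Angle)) ∈ r.inner}
  bounded : ∃ C : ℝ, ∀ v ∈ r.inner, |h v| ≤ C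
  bottom : ∀ θ ∈ Set.cIoo r.θ₁ r.θ₂,
    Tendsto (fun φ => h (θ, φ)) (𝓝[Set.cIoo r.φ₁ r.φ₂] r.φ₁) (𝓝 0)
  top : ∀ θ ∈ Set.cIoo r.θ₁ r.θ₂,
    Tendsto (fun φ => h (θ, φ)) (𝓝[Set.cIoo r.φ₁ r.φ₂] r.φ₂) (𝓝 0)
  left : ∀ φ ∈ Set.cIoo r.φ₁ r.φ₂,
    Tendsto (fun θ => h (θ, φ)) (𝓝[Set.cIoo r.θ₁ r.θ₂] r.θ₁) (𝓝 1)
  right : ∀ φ ∈ Set.cIoo r.φ₁ r.φ₂,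
    Tendsto (fun θ => h (θ, φ)) (𝓝[Set.cIoo r.θ₁ r.θ₂] r.θ₂) (𝓝 1)

open Classical in
/-- The function `h_r`: the bounded harmonic function on the interior of `r` with boundary values
`0` on the horizontal and `1` on the vertical sides. Such a function exists and is unique on the
interior of `r`; its values elsewhere are never used. -/
noncomputable def height (r : Rect) : Torus → ℝ :=
  if hex : ∃ h : Torus → ℝ, r.IsHarmonicHeight h then hex.choose else 0

/-- The modified height `(2/π) arctan ((tan (π h_r / 2)) ^ (1 / (2 + κ)))`. -/
noncomputable def modHeight (r : Rect) (κ : ℝ) (v : Torus) : ℝ :=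
  2 / Real.pi * Real.arctan (Real.tan (Real.pi * r.height v / 2) ^ (1 / (2 + κ)))

end Rect

/-- A point of the torus is a free vertex of a collection of rectangles if it is a vertex of
exactly one of them. -/
def IsFreeVertex (P : Finset Rect) (v : Torus) : Prop := ∃! r : Rect, r ∈ P ∧ v ∈ r.vertices

/-- A rectangular diagram of a surface. -/
structure Diagram where
  rects : Finset Rect
  compatible : ∀ r₁ ∈ rects, ∀ r₂ ∈ rects, r₁ ≠ r₂ → r₁.Compatible r₂
  meridian : ∀ θ : Real.Angle, {v : Torus | IsFreeVertex rects v ∧ v.1 = θ}.encard ≤ 2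
  longitude : ∀ φ : Real.Angle, {v : Torus | IsFreeVertex rects v ∧ v.2 = φ}.encard ≤ 2

/-! ### The surface of a diagram in the three-sphere -/

/-- Euclidean four-space; the three-sphere is its unit sphere. -/
abbrev E4 : Type := EuclideanSpace ℝ (Fin 4)

/-- The Euclidean plane. -/
abbrev E2 : Type := EuclideanSpace ℝ (Fin 2)

/-- The parametrization `(θ, φ, τ)`, `0 ≤ τ ≤ 1`, of the unit three-sphere, which presents it as
the join of two circles. -/
noncomputable def join (x : Torus × ℝ) : E4 :=
  !₂[Real.cos (Real.pi * x.2 / 2) * x.1.2.cos, Real.cos (Real.pi * x.2 / 2) * x.1.2.sin,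
     Real.sin (Real.pi * x.2 / 2) * x.1.1.cos, Real.sin (Real.pi * x.2 / 2) * x.1.1.sin]

/-- The (perturbed) tile of a rectangle: the image in the three-sphere of the closure of the graph
of the modified height function over the interior of the rectangle. -/
noncomputable def tile (κ : ℝ) (r : Rect) : Set E4 :=
  join '' closure {x : Torus × ℝ | x.1 ∈ r.inner ∧ x.2 = r.modHeight κ x.1}

/-- The (perturbed) surface of a diagram: the union of the (perturbed) tiles. -/
noncomputable def Diagram.surface (D : Diagram) (κ : ℝ) : Set E4 := ⋃ r ∈ D.rects, tile κ r

/-! ### Surfaces with corners -/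

/-- The planar sector of angle `β` in `ℝ² × {0} ⊆ ℝ⁴`; it is the whole plane if `β = 2π`. -/
def flatSector (β : ℝ) : Set E4 :=
  {y | ∃ ρ : ℝ, 0 ≤ ρ ∧ ∃ a ∈ Set.Icc 0 β, y = !₂[ρ * Real.cos a, ρ * Real.sin a, 0, 0]}

/-- Near `p`, the set `F` is taken by a local `C¹` diffeomorphism of `ℝ⁴` to the flat sector of
angle `β`, with `p` going to its apex. -/
def IsSectorNear (F : Set E4) (p : E4) (β : ℝ) : Prop :=
  ∃ Φ : OpenPartialHomeomorph E4 E4, p ∈ Φ.source ∧ Φ p = 0 ∧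
    ContDiffOn ℝ 1 Φ Φ.source ∧ ContDiffOn ℝ 1 Φ.symm Φ.target ∧
    ∀ x ∈ Φ.source, x ∈ F ↔ Φ x ∈ flatSector β

/-- A (compact) surface with corners in the three-sphere, of class `C¹`: locally it is a plane
(`β = 2π`), a half-plane (`β = π`), or a sector of another angle between `0` and `2π` (at a corner
of the boundary). -/
structure IsSurfaceWithCorners (F : Set E4) : Prop where
  subset_sphere : F ⊆ Metric.sphere 0 1
  compact : IsCompact F
  sector : ∀ p ∈ F, ∃ β ∈ Set.Ioc 0 (2 * Real.pi), IsSectorNear F p β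

/-- `p` is a singularity (a corner) of the boundary curve of `F`. -/
def IsBoundaryCorner (F : Set E4) (p : E4) : Prop :=
  p ∈ F ∧ ∃ β ∈ Set.Ioo 0 (2 * Real.pi), β ≠ Real.pi ∧ IsSectorNear F p β

/-- The tangent plane to a surface with corners at one of its points. -/
def tangentPlane (F : Set E4) (p : E4) : Submodule ℝ E4 := Submodule.span ℝ (tangentConeAt ℝ F p)

/-! ### The standard contact structure -/

/-- The positive unit normal of the standard contact structure at a point `q` of the three-sphere.
The inner product with it is the form `q₀ dq₁ - q₁ dq₀ + q₂ dq₃ - q₃ dq₂`, which in the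
coordinates `(θ, φ, τ)` is `α₊ = cos² (π τ / 2) dφ + sin² (π τ / 2) dθ`. -/
def contactNormal (q : E4) : E4 := !₂[-q 1, q 0, -q 3, q 2]

/-- The contact plane `ξ₊(q)`: tangent vectors of the three-sphere at `q` on which `α₊` is zero. -/
noncomputable def contactPlane (q : E4) : Submodule ℝ E4 := (Submodule.span ℝ {q, contactNormal q})ᗮ

/-- The oriented volume of a triple of tangent vectors of the three-sphere at `q`, for the
standard orientation (outward normal first), for which `α₊ ∧ dα₊` is positive. -/
def volAt (q u v w : E4) : ℝ := (Matrix.of fun i j : Fin 4 => (![q, u, v, w] i) j).det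

/-- `n` is a unit normal to `F` in the three-sphere at `q`. -/
def IsUnitNormal (F : Set E4) (q n : E4) : Prop :=
  ‖n‖ = 1 ∧ inner ℝ q n = 0 ∧ ∀ v ∈ tangentPlane F q, inner ℝ v n = 0

/-! ### The characteristic foliation -/

/-- The field of subspaces `T_q F ∩ ξ₊(q)` defining the characteristic foliation. -/
noncomputable def charLine (F : Set E4) (q : E4) : Submodule ℝ E4 := tangentPlane F q ⊓ contactPlane q

/-- The singularities of the characteristic foliation: the points of tangency with `ξ₊`. -/
def singularSet (F : Set E4) : Set E4 := {q ∈ F | tangentPlane F q = contactPlane q}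

/-- The map `x`, restricted to `F ∩ U`, is a `C¹` local coordinate system on `F` centered at `p`. -/
structure IsLocalCoord (F : Set E4) (p : E4) (U : Set E4) (x : E4 → E2) : Prop where
  isOpen : IsOpen U
  mem : p ∈ U
  contDiffOn : ContDiffOn ℝ 1 x U
  center : x p = 0
  injOn : Set.InjOn x (F ∩ U)
  immersion : ∀ q ∈ F ∩ U, ∀ v ∈ tangentPlane F q, fderiv ℝ x q v = 0 → v = 0

/-- A node: a singularity such that, in suitable `C¹` local coordinates on `F` centered at it, the
characteristic foliation is the foliation by straight rays emanating from the origin. -/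
def IsNode (F : Set E4) (p : E4) : Prop :=
  p ∈ singularSet F ∧ ∃ (U : Set E4) (x : E4 → E2), IsLocalCoord F p U x ∧
    ∀ q ∈ F ∩ U, q ≠ p →
      (charLine F q).map (fderiv ℝ x q).toLinearMap = Submodule.span ℝ {x q}

/-- A (simple) saddle: a singularity near which, in suitable `C¹` local coordinates on `F`, the
characteristic foliation is directed by a `C¹` vector field `X` whose only zero is at the
singularity, the linear part of `X` there having negative determinant. -/
def IsSaddle (F : Set E4) (p : E4) : Prop :=
  p ∈ singularSet F ∧ ∃ (U : Set E4) (x : E4 → E2) (X : E2 → E2), IsLocalCoord F p U x ∧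
    ContDiffAt ℝ 1 X 0 ∧ X 0 = 0 ∧ LinearMap.det (fderiv ℝ X 0).toLinearMap < 0 ∧
    ∀ q ∈ F ∩ U, q ≠ p →
      (charLine F q).map (fderiv ℝ x q).toLinearMap = Submodule.span ℝ {X (x q)}

/-- `γ` is, on the open set `I` of parameters, a regularly parametrized `C¹` curve in the regular
part of `F` that is tangent to the characteristic foliation. -/
structure IsLeafCurve (F : Set E4) (I : Set ℝ) (γ : ℝ → E4) : Prop where
  contDiffOn : ContDiffOn ℝ 1 γ I
  mem : ∀ t ∈ I, γ t ∈ F \ singularSet F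
  regular : ∀ t ∈ I, deriv γ t ≠ 0
  tangent : ∀ t ∈ I, deriv γ t ∈ charLine F (γ t)

/-- The parameters in `(0, 1)` describe a regular leaf of the characteristic foliation that is an
arc going from the singularity `p` to the singularity `q`. -/
structure IsLeafArc (F : Set E4) (γ : ℝ → E4) (p q : E4) : Prop where
  isLeafCurve : IsLeafCurve F (Set.Ioo 0 1) γ
  source_mem : p ∈ singularSet F
  target_mem : q ∈ singularSet F
  tendsto_source : Tendsto γ (𝓝[>] 0) (𝓝 p)
  tendsto_target : Tendsto γ (𝓝[<] 1) (𝓝 q)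

/-- The characteristic foliation has a closed regular leaf. -/
def HasClosedLeaf (F : Set E4) : Prop :=
  ∃ γ : ℝ → E4, IsLeafCurve F Set.univ γ ∧ Function.Periodic γ 1

/-- A leaf arc `γ` that ends at `p`, followed by a leaf arc `δ` that starts at `p`, is a cooriented
path: for one of the two local orientations (choices of a unit normal field `N`) of `F` near `p`,
both arcs run near `p` in the direction that this orientation and the coorientation of the
foliation inherited from `ξ₊` define together. -/
def IsCoorientedTurn (F : Set E4) (p : E4) (γ δ : ℝ → E4) : Prop :=
  ∃ U ∈ 𝓝 p, ∃ N : E4 → E4, ContinuousOn N (F ∩ U) ∧ (∀ q ∈ F ∩ U, IsUnitNormal F q (N q)) ∧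
    (∀ᶠ t in 𝓝[<] (1 : ℝ), 0 < volAt (γ t) (N (γ t)) (contactNormal (γ t)) (deriv γ t)) ∧
    (∀ᶠ t in 𝓝[>] (0 : ℝ), 0 < volAt (δ t) (N (δ t)) (contactNormal (δ t)) (deriv δ t))

/-- The characteristic foliation has a cooriented saddle connection cycle: a cyclic sequence of
leaf arcs joining saddles whose coorientations agree at the saddles passed. -/
def HasCoorientedSaddleCycle (F : Set E4) : Prop :=
  ∃ (n : ℕ) (p : ℕ → E4) (γ : ℕ → ℝ → E4), 0 < n ∧ p n = p 0 ∧ γ n = γ 0 ∧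
    (∀ i < n, IsSaddle F (p i)) ∧
    (∀ i < n, IsLeafArc F (γ i) (p i) (p (i + 1))) ∧
    ∀ i < n, IsCoorientedTurn F (p (i + 1)) (γ i) (γ (i + 1))

/-- The characteristic foliation of `F` is nice. -/
structure IsNice (F : Set E4) : Prop where
  finite : (singularSet F).Finite
  node_or_saddle : ∀ p ∈ singularSet F, IsNode F p ∨ IsSaddle F p
  corner : ∀ p, IsBoundaryCorner F p → IsNode F p

/-- The characteristic foliation of `F` is very nice. -/
structure IsVeryNice (F : Set E4) : Prop where
  nice : IsNice F
  no_closed_leaf : ¬ HasClosedLeaf F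
  no_cycle : ¬ HasCoorientedSaddleCycle F

/-- The leaf arc `γ` is a `k`-arc: the contact plane rotates about `γ` relative to the tangent
plane of `F` by the angle `k π` in total (counted by the right-hand rule). Here `ν` is a continuous
unit normal of `F` along `γ`, and `ϑ` is a continuous angle from `ν` to the normal of the contact
plane, measured in the plane normal to `γ` in the three-sphere. -/
def IsTwistArc (F : Set E4) (γ : ℝ → E4) (k : ℤ) : Prop :=
  (∃ p q : E4, IsLeafArc F γ p q) ∧
  ∃ (ν : ℝ → E4) (ϑ : ℝ → ℝ) (a b : ℝ),
    ContinuousOn ν (Set.Ioo 0 1) ∧ ContinuousOn ϑ (Set.Ioo 0 1) ∧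
    (∀ t ∈ Set.Ioo (0 : ℝ) 1, IsUnitNormal F (γ t) (ν t) ∧
      inner ℝ (ν t) (contactNormal (γ t)) = Real.cos (ϑ t) ∧
      volAt (γ t) (deriv γ t) (ν t) (contactNormal (γ t)) = ‖deriv γ t‖ * Real.sin (ϑ t)) ∧
    Tendsto ϑ (𝓝[>] 0) (𝓝 a) ∧ Tendsto ϑ (𝓝[<] 1) (𝓝 b) ∧ b - a = k * Real.pi

end RectSurface

noncomputable section

namespace RectSurface

open Filter Topology Real Set intervalIntegral
open Function (Periodic)
/-! ### Coordinates on rectangles and on four-space -/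

/-- The representative of an angle in `[0, 2π)`. -/
def arcCoord (α : Angle) : ℝ := toIcoMod two_pi_pos 0 α.toReal

/-- The representative of the left side of `r`. -/
def Rect.s (r : Rect) : ℝ := arcCoord r.θ₁

/-- The representative of the bottom side of `r`. -/
def Rect.t (r : Rect) : ℝ := arcCoord r.φ₁

/-- The width of `r`. -/
def Rect.a (r : Rect) : ℝ := arcCoord (r.θ₂ - r.θ₁)

/-- The height of `r`. -/
def Rect.b (r : Rect) : ℝ := arcCoord (r.φ₂ - r.φ₁)

/-- An identification of four-space with `ℂ × ℂ` that is compatible with the metric and with the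
contact structure. -/
structure Split where
  e : E4 ≃L[ℝ] ℂ × ℂ
  inner_eq : ∀ u v, inner ℝ u v = inner ℝ (e u).1 (e v).1 + inner ℝ (e u).2 (e v).2
  normal : ∀ q, e (contactNormal q) = (Complex.I * (e q).1, Complex.I * (e q).2)

/-- The first complex coordinate. -/
def Split.z (S : Split) : E4 →L[ℝ] ℂ := (ContinuousLinearMap.fst ℝ ℂ ℂ).comp (S.e : E4 →L[ℝ] ℂ × ℂ)

/-- The second complex coordinate. -/
def Split.w (S : Split) : E4 →L[ℝ] ℂ := (ContinuousLinearMap.snd ℝ ℂ ℂ).comp (S.e : E4 →L[ℝ] ℂ × ℂ)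

/-- The ratio of the second coordinate to the modulus of the first one. -/
def Split.u (S : Split) (p : E4) : ℂ := ‖S.z p‖⁻¹ • S.w p

variable {a b c s t u x y μ β β' K κ L m k M δ ε e x₀ y₀ x₁ y₁ b' c' : ℝ} {r r₁ r₂ : Rect} {p q v : E4} {α γ θ : Angle} {z w₀ z₀ : ℂ} {f f' g g' : ℝ → ℝ} {F : Set E4}

/-! ### Arches: solutions of the equation `f'² = 1 + β f² - m f⁴` -/

/-- A solution of `f'² = 1 + β f² - m f⁴` that vanishes at `0` with slope `1`, and is
antiperiodic with antiperiod `L`, the first positive zero. -/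
structure Arch (L β m : ℝ) where
  fn : ℝ → ℝ
  der : ℝ → ℝ
  len_pos : 0 < L
  m_pos : 0 < m
  hasDerivAt : ∀ x, HasDerivAt fn (der x) x
  hasDerivAt_der : ∀ x, HasDerivAt der (β * fn x - 2 * m * fn x ^ 3) x
  der_sq : ∀ x, der x ^ 2 = 1 + β * fn x ^ 2 - m * fn x ^ 4
  zero : fn 0 = 0
  der_zero : der 0 = 1
  odd : ∀ x, fn (-x) = -fn x
  add_len : ∀ x, fn (x + L) = -fn x
  pos : ∀ x ∈ Ioo 0 L, 0 < fn x

namespace Arch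

variable (f : Arch L β m)

lemma differentiable : Differentiable ℝ f.fn := fun x => (f.hasDerivAt x).differentiableAt

lemma continuous : Continuous f.fn := f.differentiable.continuous

lemma continuous_der : Continuous f.der := Differentiable.continuous fun x => (f.hasDerivAt_der x).differentiableAt

lemma fn_len : f.fn L = 0 := by simpa [f.zero] using f.add_len 0

lemma der_add_len (x : ℝ) : f.der (x + L) = -f.der x := by
  have h1 : HasDerivAt (fun y => f.fn (y + L)) (f.der (x + L)) x := (f.hasDerivAt (x + L)).comp_add_const x L
  have h2 : HasDerivAt (fun y => f.fn (y + L)) (-f.der x) x := by simpa only [f.add_len] using (f.hasDerivAt x).fun_neg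
  exact h1.unique h2

lemma der_len : f.der L = -1 := by simpa [f.der_zero] using f.der_add_len 0

lemma len_sub (x : ℝ) : f.fn (L - x) = f.fn x := by rw [sub_eq_neg_add, f.add_len, f.odd, neg_neg]

lemma nonneg (hx : x ∈ Icc 0 L) : 0 ≤ f.fn x := by
  rcases eq_or_lt_of_le hx.1 with h | h
  · rw [← h, f.zero]
  rcases eq_or_lt_of_le hx.2 with h' | h'
  · rw [h', f.fn_len]
  exact (f.pos x ⟨h, h'⟩).le

lemma eq_zero_iff (hx : x ∈ Icc 0 L) : f.fn x = 0 ↔ x = 0 ∨ x = L := by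
  constructor
  · intro h; by_contra! hc; exact (f.pos x ⟨lt_of_le_of_ne hx.1 (Ne.symm hc.1), lt_of_le_of_ne hx.2 hc.2⟩).ne' h
  · rintro (h | h)
    · rw [h, f.zero]
    · rw [h, f.fn_len]

lemma contDiff : ContDiff ℝ 2 f.fn := by
  have hd : deriv f.fn = f.der := funext fun x => (f.hasDerivAt x).deriv
  have hd' : deriv f.der = fun x => β * f.fn x - 2 * m * f.fn x ^ 3 := funext fun x => (f.hasDerivAt_der x).deriv
  have h1 : ContDiff ℝ 1 f.der := by
    rw [contDiff_one_iff_deriv]; refine ⟨fun x => (f.hasDerivAt_der x).differentiableAt, ?_⟩; rw [hd']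
    have := f.continuous; fun_prop
  rw [show (2 : WithTop ℕ∞) = 1 + 1 from rfl, contDiff_succ_iff_deriv]; exact ⟨f.differentiable, by simp, by rwa [hd]⟩

/-- The logarithmic derivative of an arch is strictly decreasing. -/
lemma strictAntiOn_logDeriv : StrictAntiOn (fun x => f.der x / f.fn x) (Ioo 0 L) := by
  have hder : ∀ x ∈ Ioo 0 L, HasDerivAt (fun x => f.der x / f.fn x)
      (((β * f.fn x - 2 * m * f.fn x ^ 3) * f.fn x - f.der x * f.der x) / f.fn x ^ 2) x :=
    fun x hx => (f.hasDerivAt_der x).div (f.hasDerivAt x) (f.pos x hx).ne'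
  refine strictAntiOn_of_deriv_neg (convex_Ioo 0 L) (fun x hx => (hder x hx).continuousAt.continuousWithinAt) fun x hx => ?_
  rw [interior_Ioo] at hx; rw [(hder x hx).deriv]; have := f.pos x hx; have h2 := f.der_sq x
  refine div_neg_of_neg_of_pos ?_ (by positivity); have : 0 ≤ m * f.fn x ^ 4 := by have := f.m_pos; positivity
  nlinarith

/-- An arch has a local inverse near `0`. -/
lemma exists_inverse : ∃ A : ℝ → ℝ, ContDiffAt ℝ 1 A 0 ∧ A 0 = 0 ∧
    (∀ᶠ v in 𝓝 0, f.fn (A v) = v) ∧ (∀ᶠ x in 𝓝 0, A (f.fn x) = x) ∧ ∀ᶠ v in 𝓝 0, HasDerivAt A (f.der (A v))⁻¹ v := by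
  have h1 : ContDiffAt ℝ 1 f.fn 0 := (f.contDiff.of_le (by norm_num)).contDiffAt; have h2 : HasStrictDerivAt f.fn 1 0 := by
    have := h1.hasStrictDerivAt (by norm_num); rwa [(f.hasDerivAt 0).deriv, f.der_zero] at this
  have h3 : HasFDerivAt f.fn ((ContinuousLinearEquiv.unitsEquivAut ℝ (Units.mk0 1 one_ne_zero) : ℝ ≃L[ℝ] ℝ) : ℝ →L[ℝ] ℝ) 0 := by
    refine h2.hasDerivAt.hasFDerivAt.congr_fderiv ?_; ext; simp
  set e := h1.toOpenPartialHomeomorph f.fn h3 (by norm_num) with he; have he' : (e : ℝ → ℝ) = f.fn := rfl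
  have h0 : (0 : ℝ) ∈ e.source := h1.mem_toOpenPartialHomeomorph_source h3 (by norm_num)
  have h0t : (0 : ℝ) ∈ e.target := by have := e.map_source h0; rwa [he', f.zero] at this
  have hA0 : e.symm 0 = 0 := by have := e.left_inv h0; rwa [he', f.zero] at this
  have hA : ContDiffAt ℝ 1 e.symm 0 := by have := h1.to_localInverse h3 (by norm_num); rw [f.zero] at this; exact this
  refine ⟨e.symm, hA, hA0, ?_, ?_, ?_⟩
  · filter_upwards [e.open_target.mem_nhds h0t] with v hv using e.right_inv hv
  · filter_upwards [e.open_source.mem_nhds h0] with v hv using e.left_inv hv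
  · have hne : ∀ᶠ v in 𝓝 (0 : ℝ), f.der (e.symm v) ≠ 0 := by
      have : ContinuousAt (fun v => f.der (e.symm v)) 0 := f.continuous_der.continuousAt.comp hA.continuousAt
      refine this.eventually_ne ?_; rw [hA0, f.der_zero]; norm_num
    filter_upwards [hne, e.open_target.mem_nhds h0t] with v hv hvt
    exact (f.hasDerivAt _).of_local_left_inverse (e.symm.continuousAt hvt) hv
      (by filter_upwards [e.open_target.mem_nhds hvt] with w hw using e.right_inv hw)

end Arch

/-! #### Construction of arches -/

/-- The integrand of the elliptic integral inverse to the amplitude function. -/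
def ellipticIntegrand (p v : ℝ) : ℝ := (√(1 + p ^ 2 * sin v ^ 2))⁻¹

lemma ellipticIntegrand_pos (p v : ℝ) : 0 < ellipticIntegrand p v := by unfold ellipticIntegrand; positivity

lemma continuous_ellipticIntegrand : Continuous fun x : ℝ × ℝ => ellipticIntegrand x.1 x.2 := by
  unfold ellipticIntegrand; refine Continuous.inv₀ (by fun_prop) fun x => by positivity

lemma continuous_ellipticIntegrand_right (p : ℝ) : Continuous (ellipticIntegrand p) :=
  continuous_ellipticIntegrand.comp (Continuous.prodMk_right p)

/-- The complete elliptic integral over `[0, π]`. -/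
def ellipticPeriod (p : ℝ) : ℝ := ∫ v in (0 : ℝ)..π, ellipticIntegrand p v

lemma ellipticPeriod_pos (p : ℝ) : 0 < ellipticPeriod p := intervalIntegral_pos_of_pos
    ((continuous_ellipticIntegrand_right p).intervalIntegrable _ _)
    (ellipticIntegrand_pos p) pi_pos

lemma continuous_ellipticPeriod : Continuous ellipticPeriod := continuous_parametric_intervalIntegral_of_continuous'
    (f := ellipticIntegrand) continuous_ellipticIntegrand 0 π

/-- The amplitude function. -/
lemma exists_amplitude (p : ℝ) (hμ : 0 < μ) : ∃ am : ℝ → ℝ, StrictMono am ∧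
    am 0 = 0 ∧ (∀ x, am (-x) = -am x) ∧ (∀ x, am (x + ellipticPeriod p / μ) = am x + π) ∧
    ∀ x, HasDerivAt am (μ * √(1 + p ^ 2 * sin (am x) ^ 2)) x := by
  set X : ℝ → ℝ := fun u => (∫ v in (0 : ℝ)..u, ellipticIntegrand p v) / μ with hX
  have hcont := continuous_ellipticIntegrand_right p
  have hint : ∀ c d, IntervalIntegrable (ellipticIntegrand p) MeasureTheory.volume c d := fun c d => hcont.intervalIntegrable c d
  have hder : ∀ u, HasDerivAt X (ellipticIntegrand p u / μ) u := fun u =>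
    (hcont.integral_hasStrictDerivAt 0 u).hasDerivAt.div_const μ
  have hmono : StrictMono X := strictMono_of_deriv_pos fun u => by
    rw [(hder u).deriv]; exact div_pos (ellipticIntegrand_pos p u) hμ
  have hXodd : ∀ u, X (-u) = -X u := by
    intro u; have : ∫ v in (0 : ℝ)..(-u), ellipticIntegrand p v = -∫ v in (0 : ℝ)..u, ellipticIntegrand p v := by
      have h := integral_comp_neg (a := 0) (b := u) (ellipticIntegrand p)
      have h' : (fun x => ellipticIntegrand p (-x)) = ellipticIntegrand p := by funext x; simp [ellipticIntegrand]
      rw [h'] at h; rw [h, neg_zero, integral_symm]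
    grind
  have hper : ∀ u, X (u + π) = X u + ellipticPeriod p / μ := by
    intro u; have hP : Periodic (ellipticIntegrand p) π := by intro x; simp [ellipticIntegrand]
    have h1 := hP.intervalIntegral_add_eq u 0; rw [zero_add] at h1
    have h2 := integral_add_adjacent_intervals (hint 0 u) (hint u (u + π)); simp [hX, ellipticPeriod, ← h2, h1, add_div]
  have hlow : ∀ u, 0 ≤ u → (√(1 + p ^ 2))⁻¹ / μ * u ≤ X u := by
    intro u hu; have h := integral_mono_on hu (intervalIntegrable_const) (hint 0 u)
      (fun v _ => show (√(1 + p ^ 2))⁻¹ ≤ ellipticIntegrand p v by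
        unfold ellipticIntegrand; gcongr; nlinarith [sin_sq_le_one v, sq_nonneg p])
    rw [integral_const, sub_zero, smul_eq_mul] at h; simp [hX]; rw [div_mul_eq_mul_div]
    refine div_le_div_of_nonneg_right ?_ hμ.le; linarith
  have hc : 0 < (√(1 + p ^ 2))⁻¹ / μ := by positivity
  have htop : Tendsto X atTop atTop := by
    refine tendsto_atTop_mono' _ ?_ ((tendsto_id).const_mul_atTop hc)
    filter_upwards [eventually_ge_atTop 0] with u hu using hlow u hu
  have hbot : Tendsto X atBot atBot := by
    have : X = fun u => -X (-u) := by simp_all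
    rw [this]; exact tendsto_neg_atTop_atBot.comp (htop.comp tendsto_neg_atBot_atTop)
  have hsurj : Function.Surjective X := (continuous_iff_continuousAt.2 fun u => (hder u).continuousAt).surjective htop hbot
  set e := hmono.orderIsoOfSurjective X hsurj with he; have heX : ∀ u, e u = X u := fun u => rfl
  have hXam : ∀ x, X (e.symm x) = x := fun x => by rw [← heX, e.apply_symm_apply]
  have hamX : ∀ u, e.symm (X u) = u := fun u => by rw [← heX, e.symm_apply_apply]
  refine ⟨e.symm, e.symm.strictMono, ?_, ?_, ?_, ?_⟩
  · grind
  · intro x; apply hmono.injective; rw [hXam, hXodd, hXam]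
  · intro x; apply hmono.injective; rw [hXam, hper, hXam]
  · intro x; have h := (hder (e.symm x)).of_local_left_inverse e.symm.continuous.continuousAt
      (div_pos (ellipticIntegrand_pos p _) hμ).ne' (.of_forall hXam)
    refine h.congr_deriv ?_; rw [ellipticIntegrand, inv_div, div_inv_eq_mul]

lemma exists_arch (p : ℝ) (hp : 0 < p) (hμ : 0 < μ) :
    Nonempty (Arch (ellipticPeriod p / μ) (μ ^ 2 * (p ^ 2 - 1)) (μ ^ 4 * p ^ 2)) := by
  obtain ⟨am, hmono, h0, hodd, hadd, hder⟩ := exists_amplitude p hμ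
  have hR : ∀ u : ℝ, HasDerivAt (fun u => cos u * √(1 + p ^ 2 * sin u ^ 2))
      (sin u * (p ^ 2 - 1 - 2 * p ^ 2 * sin u ^ 2) / √(1 + p ^ 2 * sin u ^ 2)) u := by
    intro u; have hpos : 0 < 1 + p ^ 2 * sin u ^ 2 := by positivity
    have h1 : HasDerivAt (fun u => 1 + p ^ 2 * sin u ^ 2) (p ^ 2 * (2 * sin u * cos u)) u := by
      have := (((hasDerivAt_sin u).pow 2).const_mul (p ^ 2)).const_add 1; simp_all
    have := (hasDerivAt_cos u).mul (h1.sqrt hpos.ne'); refine this.congr_deriv ?_; have hs := sq_sqrt hpos.le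
    have hs0 : 0 < √(1 + p ^ 2 * sin u ^ 2) := sqrt_pos.2 hpos; have hc := cos_sq' u
    rw [eq_div_iff hs0.ne', add_mul, mul_assoc, ← sq, hs]; field_simp; rw [hc]; ring
  refine ⟨{ fn := fun x => sin (am x) / μ
            der := fun x => cos (am x) * √(1 + p ^ 2 * sin (am x) ^ 2)
            len_pos := div_pos (ellipticPeriod_pos p) hμ
            m_pos := by positivity
            hasDerivAt := fun x => ?_
            hasDerivAt_der := fun x => ?_
            der_sq := fun x => ?_
            zero := by simp [h0]
            der_zero := by simp [h0]
            odd := fun x => by simp [hodd, neg_div]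
            add_len := fun x => by simp [hadd, neg_div]
            pos := fun x hx => ?_ }⟩
  · refine (((hder x).sin).div_const μ).congr_deriv ?_; field_simp
  · refine ((hR (am x)).comp x (hder x)).congr_deriv ?_; field_simp
  · rw [mul_pow, sq_sqrt (by positivity), cos_sq']; field_simp; ring
  · refine div_pos (sin_pos_of_pos_of_lt_pi ?_ ?_) hμ
    · rw [← h0]; exact hmono hx.1
    · have := hadd 0; rw [zero_add, h0, zero_add] at this; rw [← this]; exact hmono hx.2

lemma ellipticPeriod_le (p : ℝ) : ellipticPeriod p ≤ π := by
  have h := integral_mono_on pi_pos.le ((continuous_ellipticIntegrand_right p).intervalIntegrable 0 π)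
    (intervalIntegrable_const (c := (1 : ℝ)) (μ := MeasureTheory.volume)) (fun v _ => by
      unfold ellipticIntegrand; refine inv_le_one_of_one_le₀ ?_; rw [one_le_sqrt]
      nlinarith [mul_nonneg (sq_nonneg p) (sq_nonneg (sin v))])
  simpa [ellipticPeriod] using h

/-- A lower bound for the elliptic period, of logarithmic order. -/
lemma le_mul_ellipticPeriod {p : ℝ} (hp : 0 < p) : log (1 + π * p) ≤ p * ellipticPeriod p := by
  have h : ∫ v in (0 : ℝ)..π, (p * (1 + p * v)⁻¹) ≤ ∫ v in (0 : ℝ)..π, p * ellipticIntegrand p v := by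
    refine integral_mono_on pi_pos.le ?_ ?_ fun v hv => ?_
    · refine ContinuousOn.intervalIntegrable fun v hv => ?_; rw [uIcc_of_le pi_pos.le] at hv
      have : 1 + p * v ≠ 0 := by have := mul_nonneg hp.le hv.1; positivity
      fun_prop
    · exact (continuous_const.mul (continuous_ellipticIntegrand_right p)).intervalIntegrable _ _
    · have hv0 := mul_nonneg hp.le hv.1
      unfold ellipticIntegrand
      gcongr; rw [sqrt_le_left (by positivity)]; have hs : sin v ^ 2 ≤ v ^ 2 := sq_le_sq.2 (by
        rw [abs_of_nonneg (sin_nonneg_of_mem_Icc hv), abs_of_nonneg hv.1]; exact sin_le hv.1)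
      nlinarith [mul_le_mul_of_nonneg_left hs (sq_nonneg p)]
  rw [integral_const_mul p (ellipticIntegrand p)] at h; refine le_trans (le_of_eq ?_) h
  have hd : ∀ v ∈ uIcc 0 π, HasDerivAt (fun v => log (1 + p * v)) (p * (1 + p * v)⁻¹) v := by
    intro v hv; rw [uIcc_of_le pi_pos.le] at hv; have h0 : 1 + p * v ≠ 0 := by have := mul_nonneg hp.le hv.1; positivity
    have := (((hasDerivAt_id v).const_mul p).const_add 1).log h0; grind
  rw [integral_eq_sub_of_hasDerivAt hd]
  · simp [mul_comm]
  · refine ContinuousOn.intervalIntegrable fun v hv => ?_; rw [uIcc_of_le pi_pos.le] at hv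
    have : 1 + p * v ≠ 0 := by have := mul_nonneg hp.le hv.1; positivity
    fun_prop

/-- A pair of arches over the sides of a rectangle of size `a × b`. -/
structure Profile (a b : ℝ) where
  β : ℝ
  m : ℝ
  C : Arch a β m
  B : Arch b (-β) m

/-- The profile of the transposed rectangle. -/
def Profile.swap (P : Profile a b) : Profile b a where
  β := -P.β
  m := P.m
  C := P.B
  B := { P.C with
    hasDerivAt_der := by simpa using P.C.hasDerivAt_der
    der_sq := by simpa using P.C.der_sq }

lemma exists_profile (ha : 0 < a) (hb : 0 < b) : Nonempty (Profile a b) := by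
  -- the ratio of the two periods takes all positive values
  obtain ⟨p, hp, hpe⟩ : ∃ p : ℝ, 0 < p ∧ p * ellipticPeriod p * b = a * ellipticPeriod p⁻¹ := by
    set F : ℝ → ℝ := fun p => p * ellipticPeriod p * b - a * ellipticPeriod p⁻¹ with hF; have hFc : ContinuousOn F (Ioi 0) := by
      intro p hp; have hp' : p ≠ 0 := ne_of_gt hp; have h1 : ContinuousAt (fun p : ℝ => ellipticPeriod p⁻¹) p :=
        continuous_ellipticPeriod.continuousAt.comp (continuousAt_inv₀ hp')
      have h2 : ContinuousAt ellipticPeriod p := continuous_ellipticPeriod.continuousAt; fun_prop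
    have hbig : ∃ p > 0, 0 ≤ F p := by
      have ht : Tendsto (fun p : ℝ => log (1 + π * p)) atTop atTop := tendsto_log_atTop.comp
          (tendsto_atTop_add_const_left _ _ (tendsto_id.const_mul_atTop pi_pos))
      obtain ⟨p, hp0, hp⟩ := ((eventually_gt_atTop 0).and (ht.eventually_ge_atTop (a * π / b))).exists
      refine ⟨p, hp0, ?_⟩; have h1 := le_mul_ellipticPeriod hp0; have h2 := ellipticPeriod_le p⁻¹
      have h3 : a * π ≤ p * ellipticPeriod p * b := by rw [← div_le_iff₀ hb]; exact hp.trans h1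
      have h4 : a * ellipticPeriod p⁻¹ ≤ a * π := by gcongr
      simp only [hF]; linarith
    have hsmall : ∃ p > 0, F p ≤ 0 := by
      have ht : Tendsto (fun p : ℝ => log (1 + π * p)) atTop atTop := tendsto_log_atTop.comp
          (tendsto_atTop_add_const_left _ _ (tendsto_id.const_mul_atTop pi_pos))
      obtain ⟨p, hp0, hp⟩ := ((eventually_gt_atTop 0).and (ht.eventually_ge_atTop (b * π / a))).exists
      refine ⟨p⁻¹, inv_pos.2 hp0, ?_⟩; have h1 := le_mul_ellipticPeriod hp0; have h2 := ellipticPeriod_le p⁻¹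
      have h3 : b * π ≤ p * ellipticPeriod p * a := by rw [← div_le_iff₀ ha]; exact hp.trans h1
      have h4 : b * ellipticPeriod p⁻¹ ≤ b * π := by gcongr
      simp only [hF, inv_inv]; have h5 : p⁻¹ * ellipticPeriod p⁻¹ * b - a * ellipticPeriod p =
        p⁻¹ * (b * ellipticPeriod p⁻¹ - p * ellipticPeriod p * a) := by field_simp
      rw [h5]; exact mul_nonpos_of_nonneg_of_nonpos (inv_pos.2 hp0).le (by linarith)
    obtain ⟨p1, hp1, h1⟩ := hbig; obtain ⟨p2, hp2, h2⟩ := hsmall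
    obtain ⟨p, hp, h⟩ := (convex_Ioi (0 : ℝ)).isPreconnected.intermediate_value₂ hp2 hp1 hFc
      (continuousOn_const (c := (0 : ℝ))) h2 h1
    grind
  have hμ : 0 < ellipticPeriod p / a := div_pos (ellipticPeriod_pos p) ha; obtain ⟨C⟩ := exists_arch p hp hμ
  obtain ⟨B⟩ := exists_arch p⁻¹ (inv_pos.2 hp) (mul_pos hμ hp)
  have h1 : ellipticPeriod p / (ellipticPeriod p / a) = a := by grind
  have h2 : ellipticPeriod p⁻¹ / (ellipticPeriod p / a * p) = b := by grind
  have h3 : (ellipticPeriod p / a * p) ^ 2 * (p⁻¹ ^ 2 - 1) = -((ellipticPeriod p / a) ^ 2 * (p ^ 2 - 1)) := by field_simp; ring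
  have h4 : (ellipticPeriod p / a * p) ^ 4 * p⁻¹ ^ 2 = (ellipticPeriod p / a) ^ 4 * p ^ 2 := by field_simp
  rw [h1] at C; rw [h2, h3, h4] at B; exact ⟨⟨_, _, C, B⟩⟩

open Complex (I reCLM imCLM)
open Function (comp_def)
open Angle (coe_add coe_sub angle_eq_iff_two_pi_dvd_sub induction_on)
/-! ### Arcs of the circle -/

lemma arcCoord_coe (x : ℝ) : arcCoord (x : Angle) = toIcoMod two_pi_pos 0 x := by
  rw [arcCoord, Angle.toReal_coe, toIcoMod_toIocMod]

lemma arcCoord_mem (α : Angle) : arcCoord α ∈ Ico 0 (2 * π) := by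
  have := toIcoMod_mem_Ico two_pi_pos 0 α.toReal; rwa [zero_add] at this

lemma coe_arcCoord (α : Angle) : (arcCoord α : Angle) = α := by rw [arcCoord, Angle.coe_toIcoMod, Angle.coe_toReal]

lemma arcCoord_coe_of_mem (hx : x ∈ Ico 0 (2 * π)) : arcCoord (x : Angle) = x := by
  rw [arcCoord_coe, toIcoMod_eq_self]; simpa using hx

lemma arcCoord_inj {β : Angle} : arcCoord α = arcCoord β ↔ α = β :=
  ⟨fun h => by rw [← coe_arcCoord α, h, coe_arcCoord], fun h => by rw [h]⟩

lemma arcCoord_zero : arcCoord 0 = 0 := arcCoord_coe_of_mem (x := 0) ⟨le_rfl, two_pi_pos⟩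

lemma arcCoord_eq_zero : arcCoord α = 0 ↔ α = 0 := by rw [← arcCoord_zero, arcCoord_inj]

lemma arcCoord_pos (h : α ≠ 0) : 0 < arcCoord α := lt_of_le_of_ne (arcCoord_mem α).1 fun h' => h (arcCoord_eq_zero.1 h'.symm)

lemma btw_iff_le {β : Angle} (h : γ ≠ α) : btw α β γ ↔ arcCoord (β - α) ≤ arcCoord (γ - α) := by
  induction α using induction_on with | _ x
  induction β using induction_on with | _ y
  induction γ using induction_on with | _ z
  have hp : Fact (0 < 2 * π) := ⟨two_pi_pos⟩; have h1 : btw (x : Angle) y z ↔ toIcoMod two_pi_pos 0 (y - x) ≤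
      toIocMod two_pi_pos 0 (z - x) := QuotientAddGroup.btw_coe_iff'
  rw [h1, ← coe_sub, ← coe_sub, arcCoord_coe, arcCoord_coe]
  have h2 : toIcoMod two_pi_pos 0 (z - x) = toIocMod two_pi_pos 0 (z - x) := by
    rw [← AddCommGroup.not_modEq_iff_toIcoMod_eq_toIocMod]; intro hm
    obtain ⟨k, hk⟩ := (AddCommGroup.modEq_iff_eq_add_zsmul).1 hm; apply h; rw [angle_eq_iff_two_pi_dvd_sub]; grind
  rw [h2]

lemma mem_cIcc_iff {β : Angle} (h : α ≠ γ) : β ∈ cIcc α γ ↔ arcCoord (β - α) ≤ arcCoord (γ - α) := btw_iff_le h.symm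

lemma mem_cIoo_iff {β : Angle} (h : α ≠ γ) : β ∈ cIoo α γ ↔ 0 < arcCoord (β - α) ∧ arcCoord (β - α) < arcCoord (γ - α) := by
  rw [mem_cIoo, sbtw_iff_not_btw]; by_cases hβ : β = α
  · subst hβ; simp [btw_rfl_right, arcCoord_zero]
  · rw [btw_cyclic, btw_iff_le hβ, not_le]; exact (and_iff_right (arcCoord_pos (sub_ne_zero.2 hβ))).symm

lemma coe_ne_coe_add (ha : a ∈ Ioo 0 (2 * π)) : (s : Angle) ≠ ((s + a : ℝ) : Angle) := by
  intro h; have h0 : ((a : ℝ) : Angle) = 0 := by simp_all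
  have := arcCoord_eq_zero.2 h0; rw [arcCoord_coe_of_mem ⟨ha.1.le, ha.2⟩] at this; exact ha.1.ne' this

lemma mem_cIcc_coe (ha : a ∈ Ioo 0 (2 * π)) {β : Angle} : β ∈ cIcc (s : Angle) ↑(s + a) ↔ ∃ x ∈ Icc 0 a, β = ↑(s + x) := by
  rw [mem_cIcc_iff (coe_ne_coe_add ha), coe_add, add_sub_cancel_left, arcCoord_coe_of_mem ⟨ha.1.le, ha.2⟩]; constructor
  · intro h; exact ⟨_, ⟨(arcCoord_mem _).1, h⟩, by rw [coe_add, coe_arcCoord]; abel⟩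
  · rintro ⟨x, hx, rfl⟩; rw [coe_add, add_sub_cancel_left, arcCoord_coe_of_mem ⟨hx.1, hx.2.trans_lt ha.2⟩]; exact hx.2

lemma mem_cIoo_coe (ha : a ∈ Ioo 0 (2 * π)) {β : Angle} : β ∈ cIoo (s : Angle) ↑(s + a) ↔ ∃ x ∈ Ioo 0 a, β = ↑(s + x) := by
  rw [mem_cIoo_iff (coe_ne_coe_add ha), coe_add, add_sub_cancel_left, arcCoord_coe_of_mem ⟨ha.1.le, ha.2⟩]; constructor
  · intro h; exact ⟨_, h, by rw [coe_add, coe_arcCoord]; abel⟩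
  · rintro ⟨x, hx, rfl⟩; rw [coe_add, add_sub_cancel_left, arcCoord_coe_of_mem ⟨hx.1.le, hx.2.trans ha.2⟩]; exact hx

lemma continuousAt_arcCoord (h : α ≠ 0) : ContinuousAt arcCoord α := by
  have hp : Fact (0 < 2 * π) := ⟨two_pi_pos⟩; have heq : arcCoord = fun β : Angle => (AddCircle.equivIco (2 * π) 0 β : ℝ) := by
    funext β
    induction β using induction_on with | _ x
    rw [arcCoord_coe]; rfl
  rw [heq]; exact continuous_subtype_val.continuousAt.comp (AddCircle.continuousAt_equivIco (2 * π) 0 (x := α) h)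

lemma tendsto_arcCoord_zero (hb : b ∈ Ioo 0 (2 * π)) : Tendsto arcCoord (𝓝[{α | arcCoord α < b}] 0) (𝓝 0) := by
  set d := (2 * π - b) / 2 with hd; have hd0 : 0 < d := by simp_all
  have hd1 : d < 2 * π := by grind
  have hdne : (d : Angle) ≠ 0 := by rw [Ne, ← arcCoord_eq_zero, arcCoord_coe_of_mem ⟨hd0.le, hd1⟩]; exact hd0.ne'
  have h1 : Tendsto (fun α : Angle => arcCoord (α + d) - d) (𝓝 0) (𝓝 0) := by
    have h2 : ContinuousAt (fun α : Angle => arcCoord (α + d) - d) 0 := by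
      refine ContinuousAt.sub ?_ continuousAt_const; refine ContinuousAt.comp (g := arcCoord) ?_ (by fun_prop)
      rw [zero_add]; exact continuousAt_arcCoord hdne
    have h3 := h2.tendsto; rwa [zero_add, arcCoord_coe_of_mem ⟨hd0.le, hd1⟩, sub_self] at h3
  refine (h1.mono_left nhdsWithin_le_nhds).congr' ?_; filter_upwards [self_mem_nhdsWithin] with α hα
  have h2 := arcCoord_mem α; have h3 : arcCoord (α + d) = arcCoord α + d := by
    rw [← arcCoord_coe_of_mem (x := arcCoord α + d) ⟨by grind, by simp [hd]; linarith⟩, coe_add, coe_arcCoord]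
  rw [h3]; ring

namespace Rect

variable (r : Rect)

lemma a_mem : r.a ∈ Ioo 0 (2 * π) := ⟨arcCoord_pos (sub_ne_zero.2 r.hθ.symm), (arcCoord_mem _).2⟩

lemma b_mem : r.b ∈ Ioo 0 (2 * π) := ⟨arcCoord_pos (sub_ne_zero.2 r.hφ.symm), (arcCoord_mem _).2⟩

lemma coe_s : (r.s : Angle) = r.θ₁ := coe_arcCoord _

lemma coe_t : (r.t : Angle) = r.φ₁ := coe_arcCoord _

lemma coe_s_add_a : ↑(r.s + r.a) = r.θ₂ := by rw [coe_add, coe_s, a, coe_arcCoord]; abel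

lemma coe_t_add_b : ↑(r.t + r.b) = r.φ₂ := by rw [coe_add, coe_t, b, coe_arcCoord]; abel

lemma mem_cIcc_θ {β : Angle} : β ∈ cIcc r.θ₁ r.θ₂ ↔ ∃ x ∈ Icc 0 r.a, β = ↑(r.s + x) := by
  rw [← coe_s, ← coe_s_add_a, mem_cIcc_coe r.a_mem]

lemma mem_cIoo_θ {β : Angle} : β ∈ cIoo r.θ₁ r.θ₂ ↔ ∃ x ∈ Ioo 0 r.a, β = ↑(r.s + x) := by
  rw [← coe_s, ← coe_s_add_a, mem_cIoo_coe r.a_mem]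

lemma mem_cIcc_φ {β : Angle} : β ∈ cIcc r.φ₁ r.φ₂ ↔ ∃ x ∈ Icc 0 r.b, β = ↑(r.t + x) := by
  rw [← coe_t, ← coe_t_add_b, mem_cIcc_coe r.b_mem]

lemma mem_cIoo_φ {β : Angle} : β ∈ cIoo r.φ₁ r.φ₂ ↔ ∃ x ∈ Ioo 0 r.b, β = ↑(r.t + x) := by
  rw [← coe_t, ← coe_t_add_b, mem_cIoo_coe r.b_mem]

lemma mem_inner {v : Torus} : v ∈ r.inner ↔ ∃ x ∈ Ioo 0 r.a, ∃ y ∈ Ioo 0 r.b, v = (↑(r.s + x), ↑(r.t + y)) := by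
  rw [inner, mem_prod, mem_cIoo_θ, mem_cIoo_φ]; grind

end Rect

/-! ### Harmonic functions on rectangles -/

/-- The Laplacian of a function on the complex plane in terms of its first partial derivatives. -/
lemma laplacian_eq_of_hasFDerivAt {f p q : ℂ → ℝ} {p' q' : ℝ} (hf : ContDiffAt ℝ 2 f z)
    (h : ∀ᶠ w in 𝓝 z, HasFDerivAt f (p w • reCLM + q w • imCLM) w)
    (hp : HasDerivAt (fun t : ℝ => p (z + t)) p' 0)
    (hq : HasDerivAt (fun t : ℝ => q (z + t * I)) q' 0) :
    Laplacian.laplacian f z = p' + q' := by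
  have hfd : DifferentiableAt ℝ (fderiv ℝ f) z := (hf.fderiv_right (m := 1) (by norm_num)).differentiableAt (by norm_num)
  rw [InnerProductSpace.laplacian_eq_iteratedFDeriv_complexPlane]
  simp [iteratedFDeriv_two_apply, Matrix.cons_val_zero, Matrix.cons_val_one]
  have hline : ∀ (c : ℂ), Tendsto (fun t : ℝ => z + t * c) (𝓝 0) (𝓝 z) := fun c => by
    have : Continuous fun t : ℝ => z + t * c := by fun_prop
    simpa using this.tendsto 0
  have key : ∀ c : ℂ, HasDerivAt (fun t : ℝ => fderiv ℝ f (z + t * c) c) (fderiv ℝ (fderiv ℝ f) z c c) 0 := by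
    intro c; have h1 : HasDerivAt (fun t : ℝ => z + t * c) c 0 := by
      simpa using ((Complex.ofRealCLM.hasDerivAt (x := (0 : ℝ))).mul_const c).const_add z
    have h2 : HasFDerivAt (fderiv ℝ f) (fderiv ℝ (fderiv ℝ f) z) (z + (0 : ℝ) * c) := by simpa using hfd.hasFDerivAt
    have h3 := h2.comp_hasDerivAt (0 : ℝ) h1; exact (ContinuousLinearMap.apply ℝ ℝ c).hasFDerivAt.comp_hasDerivAt (0 : ℝ) h3
  congr 1
  · have h1 := key 1; simp [mul_one] at h1; refine h1.unique (hp.congr_of_eventuallyEq ?_)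
    have := (hline 1).eventually h; simp [mul_one] at this; filter_upwards [this] with t ht; rw [ht.fderiv]; simp
  · refine (key I).unique (hq.congr_of_eventuallyEq ?_); filter_upwards [(hline I).eventually h] with t ht; rw [ht.fderiv]; simp

/-- The product solution of the Laplace equation associated with a profile. -/
lemma Profile.harmonicAt (P : Profile a b) (s t : ℝ) (hx : z.re - s ∈ Ioo 0 a) (hy : z.im - t ∈ Ioo 0 b) :
    InnerProductSpace.HarmonicAt (fun z : ℂ => 2 / π * arctan (P.B.fn (z.im - t) / P.C.fn (z.re - s))) z := by
  set U : Set ℂ := {z | z.re - s ∈ Ioo 0 a ∧ z.im - t ∈ Ioo 0 b} with hU; have hUo : IsOpen U := by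
    have h1 : IsOpen {z : ℂ | z.re - s ∈ Ioo 0 a} := isOpen_Ioo.preimage (by fun_prop : Continuous fun z : ℂ => z.re - s)
    have h2 : IsOpen {z : ℂ | z.im - t ∈ Ioo 0 b} := isOpen_Ioo.preimage (by fun_prop : Continuous fun z : ℂ => z.im - t)
    exact h1.inter h2
  have hC : ∀ z ∈ U, HasFDerivAt (fun z : ℂ => P.C.fn (z.re - s)) (P.C.der (z.re - s) • reCLM) z :=
    fun z _ => (P.C.hasDerivAt (z.re - s)).comp_hasFDerivAt z (Complex.reCLM.hasFDerivAt.sub_const s)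
  have hB : ∀ z ∈ U, HasFDerivAt (fun z : ℂ => P.B.fn (z.im - t)) (P.B.der (z.im - t) • imCLM) z :=
    fun z _ => (P.B.hasDerivAt (z.im - t)).comp_hasFDerivAt z (Complex.imCLM.hasFDerivAt.sub_const t)
  set D : ℂ → ℝ := fun z => P.C.fn (z.re - s) ^ 2 + P.B.fn (z.im - t) ^ 2 with hD
  set p : ℂ → ℝ := fun z => -(P.B.fn (z.im - t) * P.C.der (z.re - s)) / D z with hp
  set q : ℂ → ℝ := fun z => P.B.der (z.im - t) * P.C.fn (z.re - s) / D z with hq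
  have hDpos : ∀ z ∈ U, 0 < D z := fun z hz => by have := P.C.pos _ hz.1; simp [hD]; positivity
  have hfd : ∀ z ∈ U, HasFDerivAt (fun z : ℂ => arctan (P.B.fn (z.im - t) / P.C.fn (z.re - s)))
      (p z • reCLM + q z • imCLM) z := by
    intro z hz; have hc := (P.C.pos _ hz.1).ne'; have h0 : HasFDerivAt (fun z : ℂ => P.B.fn (z.im - t) / P.C.fn (z.re - s)) _ z :=
      (((hB z hz).mul ((hasDerivAt_inv hc).comp_hasFDerivAt z (hC z hz))).congr_of_eventuallyEq
        (.of_forall fun w => div_eq_mul_inv _ _))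
    have h1 := (hasDerivAt_arctan (P.B.fn (z.im - t) / P.C.fn (z.re - s))).comp_hasFDerivAt z h0
    refine h1.congr_fderiv ?_; have hd := (hDpos z hz).ne'; simp [hD] at hd; ext <;> simp [hp, hq, hD] <;> field_simp
  have hdiff : ∀ z ∈ U, ContDiffAt ℝ 2 (fun z : ℂ => arctan (P.B.fn (z.im - t) / P.C.fn (z.re - s))) z := by
    intro z hz; have h1 : ContDiff ℝ 2 fun z : ℂ => P.B.fn (z.im - t) :=
      P.B.contDiff.comp (Complex.imCLM.contDiff.sub contDiff_const)
    have h2 : ContDiff ℝ 2 fun z : ℂ => P.C.fn (z.re - s) := P.C.contDiff.comp (Complex.reCLM.contDiff.sub contDiff_const)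
    exact contDiff_arctan.contDiffAt.comp z (h1.contDiffAt.div h2.contDiffAt (P.C.pos _ hz.1).ne')
  have hlap : ∀ z ∈ U, Laplacian.laplacian (fun z : ℂ => arctan (P.B.fn (z.im - t) / P.C.fn (z.re - s))) z = 0 := by
    intro z hz; have hd := (hDpos z hz).ne'; have hx' : HasDerivAt (fun u : ℝ => (z + u).re - s) 1 0 := by
      simpa using ((hasDerivAt_id (0 : ℝ)).const_add z.re).sub_const s
    have hy' : HasDerivAt (fun u : ℝ => (z + u * I).im - t) 1 0 := by
      simpa using ((hasDerivAt_id (0 : ℝ)).const_add z.im).sub_const t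
    have e1 : (z + ((0 : ℝ) : ℂ)).re - s = z.re - s := by simp
    have e2 : (z + ((0 : ℝ) : ℂ) * I).im - t = z.im - t := by simp
    have hC1 := (P.C.hasDerivAt ((z + ((0 : ℝ) : ℂ)).re - s)).comp (0 : ℝ) hx'
    have hC2 := (P.C.hasDerivAt_der ((z + ((0 : ℝ) : ℂ)).re - s)).comp (0 : ℝ) hx'
    have hB1 := (P.B.hasDerivAt ((z + ((0 : ℝ) : ℂ) * I).im - t)).comp (0 : ℝ) hy'
    have hB2 := (P.B.hasDerivAt_der ((z + ((0 : ℝ) : ℂ) * I).im - t)).comp (0 : ℝ) hy'; simp [e1, comp_def] at hC1 hC2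
    simp [e2, comp_def] at hB1 hB2; have hp' := ((hC2.const_mul (P.B.fn (z.im - t))).neg.fun_div
      ((hC1.pow 2).add_const (P.B.fn (z.im - t) ^ 2)) (by simpa [hD] using hd)).congr_of_eventuallyEq
      (f₁ := fun u : ℝ => p (z + u)) (.of_forall fun u => by simp [hp, hD])
    have hq' := ((hB2.mul_const (P.C.fn (z.re - s))).fun_div
      ((hB1.pow 2).const_add (P.C.fn (z.re - s) ^ 2)) (by simpa [hD] using hd)).congr_of_eventuallyEq
      (f₁ := fun u : ℝ => q (z + u * I)) (.of_forall fun u => by simp [hq, hD])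
    rw [laplacian_eq_of_hasFDerivAt (hdiff z hz) (by filter_upwards [hUo.mem_nhds hz] with w hw using hfd w hw) hp' hq']
    simp [hD] at hd; have hCs := P.C.der_sq (z.re - s); have hBs := P.B.der_sq (z.im - t); simp; grind
  refine InnerProductSpace.HarmonicAt.const_smul (c := 2 / π) (f := fun z : ℂ =>
    arctan (P.B.fn (z.im - t) / P.C.fn (z.re - s))) ⟨hdiff z ⟨hx, hy⟩, ?_⟩
  filter_upwards [hUo.mem_nhds ⟨hx, hy⟩] with w hw using hlap w hw

open MeasureTheory
open scoped Complex
open InnerProductSpace (HarmonicOnNhd)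
/-! ### Uniqueness of bounded harmonic functions with given normal limits -/

/-- The open rectangle `(x₀, x₁) × (y₀, y₁)` in the complex plane. -/
def openRect (x₀ x₁ y₀ y₁ : ℝ) : Set ℂ := Ioo x₀ x₁ ×ℂ Ioo y₀ y₁

lemma isOpen_openRect (x₀ x₁ y₀ y₁ : ℝ) : IsOpen (openRect x₀ x₁ y₀ y₁) := isOpen_Ioo.reProdIm isOpen_Ioo

lemma hasFDerivAt_green_field {u φ ψ : ℂ → ℝ} {φ' ψ' : ℂ →L[ℝ] ℝ} (hu : ContDiffAt ℝ 2 u z) (v : ℂ)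
    (hφ : HasFDerivAt φ φ' z) (hψ : HasFDerivAt ψ ψ' z) (hv : φ' v = ψ z) :
    ∃ L : ℂ →L[ℝ] ℝ, HasFDerivAt (fun z => 2 * u z * fderiv ℝ u z v * φ z - u z ^ 2 * ψ z) L z ∧
      L v = 2 * (fderiv ℝ u z v) ^ 2 * φ z + 2 * u z * fderiv ℝ (fderiv ℝ u) z v v * φ z - u z ^ 2 * ψ' v := by
  have h0 := (hu.differentiableAt (by norm_num)).hasFDerivAt
  have h1 := (((hu.fderiv_right (m := 1) (by norm_num)).differentiableAt (by norm_num)).hasFDerivAt).clm_apply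
    (hasFDerivAt_const v z)
  refine ⟨_, (((h0.const_mul 2).mul h1).mul hφ).sub ((h0.pow 2).mul hψ), ?_⟩; simp [hv]; ring

/-- Green's inequality for the square of a harmonic function and the test function
`(x - p) (p' - x) (y - q) (q' - y)`. -/
lemma green_le {u : ℂ → ℝ} {p p' q q' : ℝ} (hp : p ≤ p') (hq : q ≤ q') (hu : HarmonicOnNhd u (Icc p p' ×ℂ Icc q q')) :
    ∫ z in Icc (p, q) (p', q'), 2 * u ⟨z.1, z.2⟩ ^ 2 * ((z.1 - p) * (p' - z.1) + (z.2 - q) * (q' - z.2)) ≤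
      (q' - q) * (∫ x in p..p', u ⟨x, q'⟩ ^ 2 * ((x - p) * (p' - x))) +
      (q' - q) * (∫ x in p..p', u ⟨x, q⟩ ^ 2 * ((x - p) * (p' - x))) +
      (p' - p) * (∫ y in q..q', u ⟨p', y⟩ ^ 2 * ((y - q) * (q' - y))) +
      (p' - p) * (∫ y in q..q', u ⟨p, y⟩ ^ 2 * ((y - q) * (q' - y))) := by
  set e := Complex.equivRealProdCLM.symm; have he : ∀ w, e w = ⟨w.1, w.2⟩ := fun w => rfl
  have hK : ∀ w ∈ Icc (p, q) (p', q'), e w ∈ Icc p p' ×ℂ Icc q q' := fun w hw =>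
    ⟨⟨hw.1.1, hw.2.1⟩, ⟨hw.1.2, hw.2.2⟩⟩
  have hC := fun w hw => (hu (e w) (hK w hw)).1
  have re (z : ℂ) : HasFDerivAt Complex.re Complex.reCLM z := Complex.reCLM.hasFDerivAt
  have im (z : ℂ) : HasFDerivAt Complex.im Complex.imCLM z := Complex.imCLM.hasFDerivAt
  have hA (z : ℂ) := ((re z).sub_const p).mul ((re z).const_sub p')
  have hB (z : ℂ) := ((im z).sub_const q).mul ((im z).const_sub q')
  choose! F hF hF1 using fun w hw => hasFDerivAt_green_field (hC w hw) 1 ((hA _).mul (hB _))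
    ((((re _).const_mul 2).const_sub (p + p')).mul (hB _)) (by simp; ring)
  choose! G hG hG1 using fun w hw => hasFDerivAt_green_field (hC w hw) Complex.I ((hA _).mul (hB _))
    ((hA _).mul (((im _).const_mul 2).const_sub (q + q'))) (by simp; ring)
  have hf := fun w hw => (hF w hw).comp w e.hasFDerivAt; have hg := fun w hw => (hG w hw).comp w e.hasFDerivAt
  have hI : ∀ w : ℝ × ℝ, w ∈ Ioo p p' ×ˢ Ioo q q' → w ∈ Icc (p, q) (p', q') := fun w hw =>
    ⟨⟨hw.1.1.le, hw.2.1.le⟩, ⟨hw.1.2.le, hw.2.2.le⟩⟩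
  have e1 : e (1, 0) = 1 := rfl; have e2 : e (0, 1) = Complex.I := rfl
  have c0 : ContinuousOn (u ∘ e) (Icc (p, q) (p', q')) := fun w hw =>
    ((hC w hw).continuousAt.comp e.continuous.continuousAt).continuousWithinAt
  have c1 (v : ℂ) : ContinuousOn (fun w => fderiv ℝ u (e w) v) (Icc (p, q) (p', q')) := fun w hw =>
    ((((hC w hw).fderiv_right (m := 1) (by norm_num)).continuousAt.clm_apply continuousAt_const).comp
      e.continuous.continuousAt).continuousWithinAt
  have c3 : ContinuousOn (fun w => 2 * u (e w) ^ 2 * ((w.1 - p) * (p' - w.1) + (w.2 - q) * (q' - w.2)))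
      (Icc (p, q) (p', q')) := (continuousOn_const.mul (c0.pow 2)).mul (by fun_prop)
  have key : EqOn (fun w => 2 * ((fderiv ℝ u (e w) 1) ^ 2 + (fderiv ℝ u (e w) Complex.I) ^ 2) *
        ((w.1 - p) * (p' - w.1) * ((w.2 - q) * (q' - w.2))) +
        2 * u (e w) ^ 2 * ((w.1 - p) * (p' - w.1) + (w.2 - q) * (q' - w.2)))
      (fun w => ((F w).comp (e : ℝ × ℝ →L[ℝ] ℂ)) (1, 0) + ((G w).comp (e : ℝ × ℝ →L[ℝ] ℂ)) (0, 1))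
      (Icc (p, q) (p', q')) := fun w hw => by
    have h := (hu (e w) (hK w hw)).2.self_of_nhds; rw [InnerProductSpace.laplacian_eq_iteratedFDeriv_complexPlane] at h
    simp [iteratedFDeriv_two_apply, Matrix.cons_val_zero, Matrix.cons_val_one, Pi.zero_apply] at h
    simp [ContinuousLinearMap.comp_apply, ContinuousLinearEquiv.coe_coe, e1, e2, hF1 w hw, hG1 w hw]; simp [he] at h ⊢
    linear_combination (-2 * u ⟨w.1, w.2⟩ * ((w.1 - p) * (p' - w.1) * ((w.2 - q) * (q' - w.2)))) * h
  have ci := ((continuousOn_const (c := (2 : ℝ)).mul (((c1 1).pow 2).add ((c1 Complex.I).pow 2))).mul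
    (g := fun w => (w.1 - p) * (p' - w.1) * ((w.2 - q) * (q' - w.2))) (by fun_prop)).add c3 |>.integrableOn_compact
      (μ := volume) isCompact_Icc
  have h := integral_divergence_prod_Icc_of_hasFDerivAt_of_le _ _ _ _ (p, q) (p', q') ⟨hp, hq⟩
    (fun w hw => (hf w hw).continuousAt.continuousWithinAt)
    (fun w hw => (hg w hw).continuousAt.continuousWithinAt)
    (fun w hw => hf w (hI w hw)) (fun w hw => hg w (hI w hw)) (ci.congr_fun key measurableSet_Icc)
  rw [← setIntegral_congr_fun measurableSet_Icc key] at h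
  refine (setIntegral_mono_on (c3.integrableOn_compact isCompact_Icc) ci measurableSet_Icc fun w hw => ?_).trans
    (h.le.trans_eq ?_)
  · have := mul_nonneg (mul_nonneg (sub_nonneg.2 hw.1.1) (sub_nonneg.2 hw.2.1))
      (mul_nonneg (sub_nonneg.2 hw.1.2) (sub_nonneg.2 hw.2.2))
    simp [Pi.add_apply, Pi.mul_apply, Pi.pow_apply] at this ⊢
    linarith [mul_nonneg (by positivity : 0 ≤ 2 * ((fderiv ℝ u (e w) 1) ^ 2 + (fderiv ℝ u (e w) Complex.I) ^ 2)) this]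
  · simp [Function.comp_def, he, Pi.mul_apply, sub_self, mul_zero, zero_mul, zero_sub, sub_eq_add_neg (_ + _),
      ← intervalIntegral.integral_neg, ← intervalIntegral.integral_const_mul, sub_eq_add_neg (∫ x in p..p', _)]
    congr 1
    · congr 1
      · congr 1 <;> exact intervalIntegral.integral_congr fun x _ => by ring
      · exact intervalIntegral.integral_congr fun x _ => by ring
    · exact intervalIntegral.integral_congr fun x _ => by ring

lemma tendsto_side_integral {g : ℝ → ℝ → ℝ} (hδ : 0 < δ)
    (hc : ∀ ε ∈ Ioo 0 δ, ContinuousOn (g ε) (Ioo a b)) (hM : ∀ ε ∈ Ioo 0 δ, ∀ y ∈ Ioo a b, |g ε y| ≤ M)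
    (hl : ∀ y ∈ Ioo a b, Tendsto (fun ε => g ε y) (𝓝[>] 0) (𝓝 0)) (hab : a < b) (c : ℝ) :
    Tendsto (fun ε => (c - ε - ε) * ∫ y in (a + ε)..(b - ε), g ε y * ((y - (a + ε)) * (b - ε - y))) (𝓝[>] 0) (𝓝 0) := by
  have hev : ∀ᶠ ε in 𝓝[>] (0 : ℝ), ε ∈ Ioo 0 (min δ ((b - a) / 2)) := Ioo_mem_nhdsGT (by positivity)
  have hw : ∀ ε > 0, ∀ y ∈ Ioo a b, y ∈ Ioc (a + ε) (b - ε) →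
      |(y - (a + ε)) * (b - ε - y)| ≤ (b - a) * (b - a) := fun ε hε y hy hy' => by
    rw [abs_mul]; exact mul_le_mul (abs_le.2 (by grind)) (abs_le.2 (by grind)) (abs_nonneg _) (by linarith)
  have h := MeasureTheory.tendsto_integral_filter_of_dominated_convergence (μ := volume.restrict (Ioo a b))
    (F := fun ε => (Ioc (a + ε) (b - ε)).indicator fun y => g ε y * ((y - (a + ε)) * (b - ε - y)))
    (f := fun _ => (0 : ℝ)) (l := 𝓝[>] (0 : ℝ)) (fun _ => M * ((b - a) * (b - a))) ?_ ?_ ?_ ?_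
  · have hcont : Tendsto (fun ε : ℝ => c - ε - ε) (𝓝[>] 0) (𝓝 (c - 0 - 0)) :=
      (Continuous.tendsto (by fun_prop) 0).mono_left nhdsWithin_le_nhds
    have := hcont.mul h; rw [integral_zero, mul_zero] at this; refine this.congr' ?_; filter_upwards [hev] with ε hε
    have h2 := hε.2.trans_le (min_le_right _ _)
    rw [setIntegral_indicator measurableSet_Ioc, intervalIntegral.integral_of_le (by linarith),
      inter_eq_right.2 (show Ioc _ _ ⊆ Ioo a b from fun y hy =>
        (by grind))]
  · filter_upwards [hev] with ε hε; exact (((hc ε ⟨hε.1, hε.2.trans_le (min_le_left _ _)⟩).mul (by fun_prop)).aestronglyMeasurable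
      measurableSet_Ioo).indicator measurableSet_Ioc
  · filter_upwards [hev] with ε hε; filter_upwards [ae_restrict_mem measurableSet_Ioo] with y hy
    have hg := hM ε ⟨hε.1, hε.2.trans_le (min_le_left _ _)⟩ y hy; have hM0 := (abs_nonneg _).trans hg
    by_cases h : y ∈ Ioc (a + ε) (b - ε)
    · rw [indicator_of_mem h, norm_eq_abs, abs_mul]; exact mul_le_mul hg (hw ε hε.1 y hy h) (abs_nonneg _) hM0
    · rw [indicator_of_notMem h, norm_zero]; positivity
  · exact integrable_const _
  · filter_upwards [ae_restrict_mem measurableSet_Ioo] with y hy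
    refine squeeze_zero_norm' (a := fun ε => |g ε y| * ((b - a) * (b - a))) ?_ (by simpa using (hl y hy).abs.mul_const _)
    filter_upwards [hev] with ε hε; by_cases h : y ∈ Ioc (a + ε) (b - ε)
    · rw [indicator_of_mem h, norm_eq_abs, abs_mul]; exact mul_le_mul_of_nonneg_left (hw ε hε.1 y hy h) (abs_nonneg _)
    · rw [indicator_of_notMem h, norm_zero]; positivity

/-- A bounded harmonic function on a rectangle with vanishing normal limits on the open sides is zero. -/
lemma harmonic_eq_zero_of_normal_limits {u : ℂ → ℝ} (hx : x₀ < x₁) (hy : y₀ < y₁) (hu : HarmonicOnNhd u (openRect x₀ x₁ y₀ y₁))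
    (hbd : ∃ M, ∀ z ∈ openRect x₀ x₁ y₀ y₁, |u z| ≤ M)
    (hb : ∀ x ∈ Ioo x₀ x₁, Tendsto (fun y : ℝ => u ⟨x, y⟩) (𝓝[>] y₀) (𝓝 0))
    (ht : ∀ x ∈ Ioo x₀ x₁, Tendsto (fun y : ℝ => u ⟨x, y⟩) (𝓝[<] y₁) (𝓝 0))
    (hl : ∀ y ∈ Ioo y₀ y₁, Tendsto (fun x : ℝ => u ⟨x, y⟩) (𝓝[>] x₀) (𝓝 0))
    (hr : ∀ y ∈ Ioo y₀ y₁, Tendsto (fun x : ℝ => u ⟨x, y⟩) (𝓝[<] x₁) (𝓝 0)) :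
    ∀ z ∈ openRect x₀ x₁ y₀ y₁, u z = 0 := by
  intro z₀ hz₀; obtain ⟨M, hM⟩ := hbd; have hM2 : ∀ z ∈ openRect x₀ x₁ y₀ y₁, |u z ^ 2| ≤ M ^ 2 := fun z hz => by
    rw [abs_pow]; exact pow_le_pow_left₀ (abs_nonneg _) (hM z hz) 2
  have hcont : ContinuousOn u (openRect x₀ x₁ y₀ y₁) := hu.continuousOn
  have cx : ∀ y ∈ Ioo y₀ y₁, ContinuousOn (fun x : ℝ => u ⟨x, y⟩ ^ 2) (Ioo x₀ x₁) := fun y hy =>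
    (hcont.comp (f := fun x : ℝ => (⟨x, y⟩ : ℂ)) (by simp [Complex.mk_eq_add_mul_I]; fun_prop) fun x hx => ⟨hx, hy⟩).pow 2
  have cy : ∀ x ∈ Ioo x₀ x₁, ContinuousOn (fun y : ℝ => u ⟨x, y⟩ ^ 2) (Ioo y₀ y₁) := fun x hx =>
    (hcont.comp (f := fun y : ℝ => (⟨x, y⟩ : ℂ)) (by simp [Complex.mk_eq_add_mul_I]; fun_prop) fun y hy => ⟨hx, hy⟩).pow 2
  have sq0 : ∀ {f : ℝ → ℝ} {l : Filter ℝ}, Tendsto f l (𝓝 0) → Tendsto (fun t => f t ^ 2) l (𝓝 0) :=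
    fun h => by simpa using h.pow 2
  have shr : ∀ a : ℝ, Tendsto (fun ε : ℝ => a + ε) (𝓝[>] 0) (𝓝[>] a) := fun a => by
    refine tendsto_nhdsWithin_iff.2 ⟨?_, by filter_upwards [self_mem_nhdsWithin] with ε hε using by simpa using hε⟩
    simpa using (Continuous.tendsto (f := fun ε : ℝ => a + ε) (by fun_prop) 0).mono_left nhdsWithin_le_nhds
  have shl : ∀ a : ℝ, Tendsto (fun ε : ℝ => a - ε) (𝓝[>] 0) (𝓝[<] a) := fun a => by
    refine tendsto_nhdsWithin_iff.2 ⟨?_, by filter_upwards [self_mem_nhdsWithin] with ε hε using by simpa using hε⟩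
    simpa using (Continuous.tendsto (f := fun ε : ℝ => a - ε) (by fun_prop) 0).mono_left nhdsWithin_le_nhds
  have t1 := tendsto_side_integral (g := fun ε x => u ⟨x, y₁ - ε⟩ ^ 2) (sub_pos.2 hy) (fun ε hε => cx _ (by grind))
    (fun ε hε x hx => hM2 _ ⟨hx, by grind⟩)
    (fun x hx => sq0 ((ht x hx).comp (shl y₁))) hx (y₁ - y₀)
  have t2 := tendsto_side_integral (g := fun ε x => u ⟨x, y₀ + ε⟩ ^ 2) (sub_pos.2 hy) (fun ε hε => cx _ (by grind))
    (fun ε hε x hx => hM2 _ ⟨hx, by grind⟩)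
    (fun x hx => sq0 ((hb x hx).comp (shr y₀))) hx (y₁ - y₀)
  have t3 := tendsto_side_integral (g := fun ε y => u ⟨x₁ - ε, y⟩ ^ 2) (sub_pos.2 hx) (fun ε hε => cy _ (by grind))
    (fun ε hε y hy => hM2 _ ⟨by grind, hy⟩)
    (fun y hy => sq0 ((hr y hy).comp (shl x₁))) hy (x₁ - x₀)
  have t4 := tendsto_side_integral (g := fun ε y => u ⟨x₀ + ε, y⟩ ^ 2) (sub_pos.2 hx) (fun ε hε => cy _ (by grind))
    (fun ε hε y hy => hM2 _ ⟨by grind, hy⟩)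
    (fun y hy => sq0 ((hl y hy).comp (shr x₀))) hy (x₁ - x₀)
  obtain ⟨η, hη, hzx, hzx', hzy, hzy'⟩ : ∃ η > 0, x₀ + η < z₀.re ∧ z₀.re < x₁ - η ∧ y₀ + η < z₀.im ∧ z₀.im < y₁ - η := by
    have n (a) := (shr a).mono_right (nhdsWithin_le_nhds (s := Ioi a))
    have n' (a) := (shl a).mono_right (nhdsWithin_le_nhds (s := Iio a))
    exact ((eventually_mem_nhdsWithin (a := (0 : ℝ)) (s := Ioi 0)).and <| ((n x₀).eventually_lt_const hz₀.1.1).and <|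
      ((n' x₁).eventually_const_lt hz₀.1.2).and <| ((n y₀).eventually_lt_const hz₀.2.1).and <|
      (n' y₁).eventually_const_lt hz₀.2.2).exists
  set f : ℝ → ℝ × ℝ → ℝ := fun ε z => 2 * u ⟨z.1, z.2⟩ ^ 2 *
    ((z.1 - (x₀ + ε)) * (x₁ - ε - z.1) + (z.2 - (y₀ + ε)) * (y₁ - ε - z.2)) with hf
  set R : ℝ → Set (ℝ × ℝ) := fun ε => Icc (x₀ + ε, y₀ + ε) (x₁ - ε, y₁ - ε) with hR
  have hRm : ∀ {ε δ}, 0 < ε → ε ≤ δ → R δ ⊆ R ε := fun h h' w hw =>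
    ⟨⟨by linarith [hw.1.1], by linarith [hw.1.2]⟩, ⟨by linarith [hw.2.1], by linarith [hw.2.2]⟩⟩
  have fm : ∀ {ε δ w}, 0 < ε → ε ≤ δ → w ∈ R δ → 0 ≤ f δ w ∧ f δ w ≤ f ε w := fun {ε δ w} h h' hw => by
    have h1 := sub_nonneg.2 hw.1.1; have h2 := sub_nonneg.2 hw.1.2
    have h3 := sub_nonneg.2 hw.2.1; have h4 := sub_nonneg.2 hw.2.2; simp only at h1 h2 h3 h4
    have h5 : 0 ≤ w.1 - (x₀ + ε) := by linarith
    have h6 : 0 ≤ w.2 - (y₀ + ε) := by linarith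
    refine ⟨by positivity, ?_⟩; simp [hf]; gcongr
  have cf (δ) : ∀ {ε}, 0 < ε → ContinuousOn (f δ) (R ε) := fun h =>
    (continuousOn_const.mul ((hcont.comp (Complex.equivRealProdCLM.symm.continuous.continuousOn) fun w hw =>
      ⟨⟨(lt_add_of_pos_right _ h).trans_le hw.1.1, hw.2.1.trans_lt (sub_lt_self _ h)⟩,
        ⟨(lt_add_of_pos_right _ h).trans_le hw.1.2, hw.2.2.trans_lt (sub_lt_self _ h)⟩⟩).pow 2)).mul
        (by fun_prop)
  have hi (δ) : ∀ {ε}, 0 < ε → IntegrableOn (f δ) (R ε) volume := fun h =>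
    (cf δ h).integrableOn_compact isCompact_Icc
  have h0 : ∫ w in R η, f η w ≤ 0 := by
    refine ge_of_tendsto (by simpa using ((t1.add t2).add t3).add t4) ?_; filter_upwards [Ioo_mem_nhdsGT hη] with ε hε
    have := green_le (u := u) (p := x₀ + ε) (p' := x₁ - ε) (q := y₀ + ε) (q' := y₁ - ε) (by grind)
      (by linarith [hε.2]) (hu.mono fun z hz => ⟨⟨by linarith [hz.1.1, hε.1], by linarith [hz.1.2, hε.1]⟩,
        ⟨by linarith [hz.2.1, hε.1], by linarith [hz.2.2, hε.1]⟩⟩)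
    rw [show x₁ - ε - (x₀ + ε) = x₁ - x₀ - ε - ε by ring, show y₁ - ε - (y₀ + ε) = y₁ - y₀ - ε - ε by ring] at this
    exact ((setIntegral_mono_on (hi η hη) ((hi ε hε.1).mono_set (hRm hε.1 hε.2.le)) measurableSet_Icc fun w hw =>
      (fm hε.1 hε.2.le hw).2).trans (setIntegral_mono_set (hi ε hε.1) (by
        filter_upwards [ae_restrict_mem measurableSet_Icc] with w hw using (fm hε.1 le_rfl hw).1)
        (hRm hε.1 hε.2.le).eventuallyLE)).trans this
  have hnn : 0 ≤ᵐ[volume.restrict (R η)] f η := by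
    filter_upwards [ae_restrict_mem measurableSet_Icc] with w hw using (fm hη le_rfl hw).1
  have h1 := (setIntegral_eq_zero_iff_of_nonneg_ae hnn (hi η hη)).1 (h0.antisymm (integral_nonneg_of_ae hnn))
  have hsub : Ioo (x₀ + η) (x₁ - η) ×ˢ Ioo (y₀ + η) (y₁ - η) ⊆ R η := fun w hw =>
    ⟨⟨hw.1.1.le, hw.2.1.le⟩, ⟨hw.1.2.le, hw.2.2.le⟩⟩
  have h2 := Measure.eqOn_open_of_ae_eq (ae_restrict_of_ae_restrict_of_subset hsub h1)
    (isOpen_Ioo.prod isOpen_Ioo) ((cf η hη).mono hsub) continuousOn_const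
    (show (z₀.re, z₀.im) ∈ _ from ⟨⟨hzx, hzx'⟩, ⟨hzy, hzy'⟩⟩)
  have p1 := mul_pos (sub_pos.2 hzx) (sub_pos.2 hzx'); have p2 := mul_pos (sub_pos.2 hzy) (sub_pos.2 hzy')
  simpa [hf, (add_pos p1 p2).ne'] using h2

/-- A function that is continuous on a closed rectangle, harmonic inside and positive on the boundary
is positive. -/
lemma harmonic_pos_of_boundary_pos {u : ℂ → ℝ} (hu : HarmonicOnNhd u (openRect x₀ x₁ y₀ y₁))
    (hc : ContinuousOn u (Icc x₀ x₁ ×ℂ Icc y₀ y₁))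
    (hpos : ∀ z ∈ Icc x₀ x₁ ×ℂ Icc y₀ y₁, z ∉ openRect x₀ x₁ y₀ y₁ → 0 < u z) :
    ∀ z ∈ Icc x₀ x₁ ×ℂ Icc y₀ y₁, 0 < u z := by
  set K : Set ℂ := Icc x₀ x₁ ×ℂ Icc y₀ y₁ with hK; have hKc : IsCompact K := isCompact_Icc.reProdIm isCompact_Icc
  intro z hz; by_contra! hneg; obtain ⟨z₁, hz₁, hmin⟩ := hKc.exists_isMinOn ⟨z, hz⟩ hc
  have hm : u z₁ ≤ 0 := (hmin hz).trans hneg; set S : Set ℂ := {w ∈ K | u w = u z₁} with hS; have hSc : IsCompact S := by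
    have : S = K ∩ u ⁻¹' {u z₁} := rfl; rw [this]
    exact hKc.of_isClosed_subset (hc.preimage_isClosed_of_isClosed hKc.isClosed isClosed_singleton) inter_subset_left
  obtain ⟨z₂, hz₂, hz₂min⟩ := hSc.exists_isMinOn ⟨z₁, hz₁, rfl⟩ Complex.continuous_re.continuousOn
  have hz₂in : z₂ ∈ openRect x₀ x₁ y₀ y₁ := by grind
  obtain ⟨R, hR, hball⟩ := Metric.isOpen_iff.1 (isOpen_openRect x₀ x₁ y₀ y₁) z₂ hz₂in
  obtain ⟨F, hF, hFe⟩ := InnerProductSpace.HarmonicOnNhd.exists_analyticOnNhd_ball_re_eq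
    (f := u) (z := z₂) (R := R) (hu.mono hball)
  have hsub : openRect x₀ x₁ y₀ y₁ ⊆ K := fun w hw =>
    ⟨Ioo_subset_Icc_self hw.1, Ioo_subset_Icc_self hw.2⟩
  have hnb := Metric.ball_mem_nhds z₂ hR
  have hconst := Complex.eventually_eq_of_isLocalMax_norm (f := fun w => cexp (-F w)) (c := z₂)
    (by filter_upwards [hnb] with w hw using ((hF w hw).differentiableAt).neg.cexp)
    (by
      filter_upwards [hnb] with w hw
      simp only [Function.comp, Complex.norm_exp, Complex.neg_re]; have e1 : (F w).re = u w := hFe hw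
      have e2 : (F z₂).re = u z₂ := hFe (Metric.mem_ball_self hR); rw [exp_le_exp, neg_le_neg_iff, e1, e2, hz₂.2]
      exact hmin (hsub (hball hw)))
  have hevu : ∀ᶠ w in 𝓝 z₂, w ∈ S := by
    filter_upwards [hconst, hnb] with w hw hwb; refine ⟨hsub (hball hwb), ?_⟩; have := congrArg norm hw
    simp only [Complex.norm_exp, Complex.neg_re, exp_eq_exp, neg_inj] at this; have e1 : (F w).re = u w := hFe hwb
    have e2 : (F z₂).re = u z₂ := hFe (Metric.mem_ball_self hR); grind
  have hseq : Tendsto (fun t : ℝ => z₂ - t) (𝓝[>] 0) (𝓝 z₂) := by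
    have : Continuous fun t : ℝ => z₂ - t := by fun_prop
    simpa using (this.tendsto 0).mono_left nhdsWithin_le_nhds
  obtain ⟨t, ht1, ht2⟩ := ((hseq.eventually hevu).and self_mem_nhdsWithin).exists; have h1 := hz₂min ht1; simp at h1; linarith

open Angle (continuous_coe)
/-! ### The height function of a rectangle -/

namespace Profile
variable (P : Profile a b)

/-- The harmonic function on `(0, a) × (0, b)` determined by a profile. -/
def hgt (x y : ℝ) : ℝ := 2 / π * arctan (P.B.fn y / P.C.fn x)

lemma abs_hgt_le (x y : ℝ) : |P.hgt x y| ≤ 1 := by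
  have h1 := arctan_lt_pi_div_two (P.B.fn y / P.C.fn x); have h2 := neg_pi_div_two_lt_arctan (P.B.fn y / P.C.fn x)
  have e1 : 2 / π * (π / 2) = 1 := by field_simp
  have h3 := mul_le_mul_of_nonneg_left h1.le (by positivity : 0 ≤ 2 / π)
  have h4 := mul_le_mul_of_nonneg_left h2.le (by positivity : 0 ≤ 2 / π); rw [e1] at h3; rw [mul_neg, e1] at h4
  exact abs_le.2 ⟨h4, h3⟩

lemma tendsto_hgt_y {ι : Type*} {l : Filter ι} {f : ι → ℝ}
    (hf : Tendsto f l (𝓝 y₀)) (hy₀ : P.B.fn y₀ = 0) : Tendsto (fun i => P.hgt x (f i)) l (𝓝 0) := by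
  have h : Continuous fun y => P.hgt x y := by have := P.B.continuous; unfold hgt; fun_prop
  have := (h.tendsto y₀).comp hf; simpa [hgt, hy₀, comp_def] using this

lemma tendsto_hgt_x {ι : Type*} {l : Filter ι} {f : ι → ℝ} (hy : y ∈ Ioo 0 b)
    (hf : Tendsto f l (𝓝 x₀)) (hx₀ : P.C.fn x₀ = 0) (hm : ∀ᶠ i in l, f i ∈ Ioo 0 a) :
    Tendsto (fun i => P.hgt (f i) y) l (𝓝 1) := by
  have h1 : Tendsto (fun i => P.C.fn (f i)) l (𝓝[>] 0) := by
    refine tendsto_nhdsWithin_iff.2 ⟨?_, ?_⟩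
    · simpa [hx₀, comp_def] using (P.C.continuous.tendsto x₀).comp hf
    · filter_upwards [hm] with i hi using P.C.pos _ hi
  have h2 : Tendsto (fun i => P.B.fn y / P.C.fn (f i)) l atTop := by
    simp [div_eq_mul_inv]; exact (tendsto_inv_nhdsGT_zero.comp h1).const_mul_atTop (P.B.pos _ hy)
  have h3 := ((tendsto_arctan_atTop.comp h2).mono_right nhdsWithin_le_nhds).const_mul (2 / π)
  have e1 : 2 / π * (π / 2) = 1 := by simp
  rw [e1] at h3; exact h3

end Profile

namespace Rect
variable (r : Rect)

lemma θ₂_sub_ne : r.θ₂ - r.θ₁ ≠ 0 := sub_ne_zero.2 r.hθ.symm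
lemma φ₂_sub_ne : r.φ₂ - r.φ₁ ≠ 0 := sub_ne_zero.2 r.hφ.symm

lemma tendsto_arcCoord_left : Tendsto (fun θ => arcCoord (θ - r.θ₁)) (𝓝[cIoo r.θ₁ r.θ₂] r.θ₁) (𝓝 0) := by
  refine (tendsto_arcCoord_zero r.a_mem).comp (tendsto_nhdsWithin_iff.2 ⟨?_, ?_⟩)
  · have : Continuous fun θ : Angle => θ - r.θ₁ := by fun_prop
    simpa using (this.tendsto r.θ₁).mono_left nhdsWithin_le_nhds
  · filter_upwards [self_mem_nhdsWithin] with θ hθ using ((mem_cIoo_iff r.hθ).1 hθ).2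

lemma tendsto_arcCoord_bottom : Tendsto (fun φ => arcCoord (φ - r.φ₁)) (𝓝[cIoo r.φ₁ r.φ₂] r.φ₁) (𝓝 0) := by
  refine (tendsto_arcCoord_zero r.b_mem).comp (tendsto_nhdsWithin_iff.2 ⟨?_, ?_⟩)
  · have : Continuous fun θ : Angle => θ - r.φ₁ := by fun_prop
    simpa using (this.tendsto r.φ₁).mono_left nhdsWithin_le_nhds
  · filter_upwards [self_mem_nhdsWithin] with θ hθ using ((mem_cIoo_iff r.hφ).1 hθ).2

lemma tendsto_arcCoord_right : Tendsto (fun θ => arcCoord (θ - r.θ₁)) (𝓝[cIoo r.θ₁ r.θ₂] r.θ₂) (𝓝 r.a) := by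
  have : Continuous fun θ : Angle => θ - r.θ₁ := by fun_prop
  exact ((continuousAt_arcCoord r.θ₂_sub_ne).tendsto.comp (this.tendsto r.θ₂)).mono_left nhdsWithin_le_nhds

lemma tendsto_arcCoord_top : Tendsto (fun φ => arcCoord (φ - r.φ₁)) (𝓝[cIoo r.φ₁ r.φ₂] r.φ₂) (𝓝 r.b) := by
  have : Continuous fun θ : Angle => θ - r.φ₁ := by fun_prop
  exact ((continuousAt_arcCoord r.φ₂_sub_ne).tendsto.comp (this.tendsto r.φ₂)).mono_left nhdsWithin_le_nhds

lemma arcCoord_θ_mem (h : θ ∈ cIoo r.θ₁ r.θ₂) : arcCoord (θ - r.θ₁) ∈ Ioo 0 r.a := (mem_cIoo_iff r.hθ).1 h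

lemma arcCoord_φ_mem {φ : Angle} (h : φ ∈ cIoo r.φ₁ r.φ₂) : arcCoord (φ - r.φ₁) ∈ Ioo 0 r.b := (mem_cIoo_iff r.hφ).1 h

lemma arcCoord_sub_θ (hx : x ∈ Ioo 0 r.a) : arcCoord (↑(r.s + x) - r.θ₁) = x := by
  rw [coe_add, coe_s, add_sub_cancel_left]; exact arcCoord_coe_of_mem ⟨hx.1.le, hx.2.trans r.a_mem.2⟩

lemma arcCoord_sub_φ (hy : y ∈ Ioo 0 r.b) : arcCoord (↑(r.t + y) - r.φ₁) = y := by
  rw [coe_add, coe_t, add_sub_cancel_left]; exact arcCoord_coe_of_mem ⟨hy.1.le, hy.2.trans r.b_mem.2⟩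

lemma harmonicAt_hgt (P : Profile r.a r.b) (hz : ((z.re : Angle), (z.im : Angle)) ∈ r.inner) :
    InnerProductSpace.HarmonicAt (fun z : ℂ => P.hgt (arcCoord ((z.re : Angle) - r.θ₁))
      (arcCoord ((z.im : Angle) - r.φ₁))) z := by
  obtain ⟨x, hx, y, hy, hv⟩ := r.mem_inner.1 hz; obtain ⟨n, hn⟩ := angle_eq_iff_two_pi_dvd_sub.1 (congrArg Prod.fst hv)
  obtain ⟨k, hk⟩ := angle_eq_iff_two_pi_dvd_sub.1 (congrArg Prod.snd hv)
  obtain ⟨s, hs⟩ : ∃ s, s = r.s + 2 * π * n := ⟨_, rfl⟩; obtain ⟨t, ht⟩ : ∃ t, t = r.t + 2 * π * k := ⟨_, rfl⟩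
  have hxz : z.re - s = x := by rw [hs]; linarith
  have hyz : z.im - t = y := by rw [ht]; linarith
  have hH := P.harmonicAt s t (z := z) (by rwa [hxz]) (by rwa [hyz])
  refine (InnerProductSpace.harmonicAt_congr_nhds ?_).2 hH; have e1 : ∀ᶠ w : ℂ in 𝓝 z, w.re - s ∈ Ioo 0 r.a := by
    have : ContinuousAt (fun w : ℂ => w.re - s) z := by fun_prop
    exact this.eventually_mem (isOpen_Ioo.mem_nhds (by rwa [hxz]))
  have e2 : ∀ᶠ w : ℂ in 𝓝 z, w.im - t ∈ Ioo 0 r.b := by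
    have : ContinuousAt (fun w : ℂ => w.im - t) z := by fun_prop
    exact this.eventually_mem (isOpen_Ioo.mem_nhds (by rwa [hyz]))
  filter_upwards [e1, e2] with w h1 h2; have a1 : ((w.re : ℝ) : Angle) = ((r.s + (w.re - s) : ℝ) : Angle) :=
    angle_eq_iff_two_pi_dvd_sub.2 ⟨n, by rw [hs]; ring⟩
  have a2 : ((w.im : ℝ) : Angle) = ((r.t + (w.im - t) : ℝ) : Angle) := angle_eq_iff_two_pi_dvd_sub.2 ⟨k, by rw [ht]; ring⟩
  rw [a1, a2, r.arcCoord_sub_θ h1, r.arcCoord_sub_φ h2, Profile.hgt]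

lemma isHarmonicHeight (P : Profile r.a r.b) :
    r.IsHarmonicHeight fun v => P.hgt (arcCoord (v.1 - r.θ₁)) (arcCoord (v.2 - r.φ₁)) := by
  have h1 : ∀ᶠ θ in 𝓝[cIoo r.θ₁ r.θ₂] r.θ₁, arcCoord (θ - r.θ₁) ∈ Ioo 0 r.a :=
    eventually_nhdsWithin_of_forall fun θ hθ => r.arcCoord_θ_mem hθ
  have h2 : ∀ᶠ θ in 𝓝[cIoo r.θ₁ r.θ₂] r.θ₂, arcCoord (θ - r.θ₁) ∈ Ioo 0 r.a :=
    eventually_nhdsWithin_of_forall fun θ hθ => r.arcCoord_θ_mem hθ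
  refine ⟨?_, ?_, ?_, ?_, ?_, ?_⟩
  · intro z hz; have := r.harmonicAt_hgt P hz; exact this
  · exact ⟨1, fun v _ => P.abs_hgt_le _ _⟩
  · intro θ _; exact P.tendsto_hgt_y (x := arcCoord (θ - r.θ₁)) r.tendsto_arcCoord_bottom P.B.zero
  · intro θ _; exact P.tendsto_hgt_y (x := arcCoord (θ - r.θ₁)) r.tendsto_arcCoord_top P.B.fn_len
  · intro φ hφ; exact P.tendsto_hgt_x (y := arcCoord (φ - r.φ₁)) (r.arcCoord_φ_mem hφ) r.tendsto_arcCoord_left P.C.zero h1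
  · intro φ hφ; exact P.tendsto_hgt_x (y := arcCoord (φ - r.φ₁)) (r.arcCoord_φ_mem hφ) r.tendsto_arcCoord_right P.C.fn_len h2

lemma isHarmonicHeight_height : r.IsHarmonicHeight r.height := by
  obtain ⟨P⟩ := exists_profile r.a_mem.1 r.b_mem.1
  have hex : ∃ h : Torus → ℝ, r.IsHarmonicHeight h := ⟨_, r.isHarmonicHeight P⟩; rw [height, dif_pos hex]; exact hex.choose_spec

lemma tendsto_coe_nhdsGT (ha : a ∈ Ioo 0 (2 * π)) {β : Angle} (hα : (s : Angle) = α) (hβ : ↑(s + a) = β) :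
    Tendsto (fun x : ℝ => (x : Angle)) (𝓝[>] s) (𝓝[cIoo α β] α) := by
  subst hα hβ; refine tendsto_nhdsWithin_iff.2 ⟨(continuous_coe.tendsto s).mono_left nhdsWithin_le_nhds, ?_⟩
  filter_upwards [Ioo_mem_nhdsGT (show s < s + a by grind)] with x hx
  exact (mem_cIoo_coe ha).2 ⟨x - s, (by grind), by rw [add_sub_cancel]⟩

lemma tendsto_coe_nhdsLT (ha : a ∈ Ioo 0 (2 * π)) {β : Angle} (hα : (s : Angle) = α) (hβ : ↑(s + a) = β) :
    Tendsto (fun x : ℝ => (x : Angle)) (𝓝[<] (s + a)) (𝓝[cIoo α β] β) := by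
  subst hα hβ; refine tendsto_nhdsWithin_iff.2 ⟨(continuous_coe.tendsto _).mono_left nhdsWithin_le_nhds, ?_⟩
  filter_upwards [Ioo_mem_nhdsLT (show s < s + a by grind)] with x hx
  exact (mem_cIoo_coe ha).2 ⟨x - s, (by grind), by rw [add_sub_cancel]⟩

/-- A harmonic height is determined in the interior of the rectangle. -/
lemma IsHarmonicHeight.eq {r : Rect} {h h' : Torus → ℝ} (H : r.IsHarmonicHeight h) (H' : r.IsHarmonicHeight h') (hx : x ∈ Ioo 0 r.a) (hy : y ∈ Ioo 0 r.b) :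
    h (↑(r.s + x), ↑(r.t + y)) = h' (↑(r.s + x), ↑(r.t + y)) := by
  set u : ℂ → ℝ := fun z => h ((z.re : Angle), (z.im : Angle)) - h' ((z.re : Angle), (z.im : Angle)) with hu
  have hθ : ∀ x ∈ Ioo r.s (r.s + r.a), (x : Angle) ∈ cIoo r.θ₁ r.θ₂ := fun x hx =>
    r.mem_cIoo_θ.2 ⟨x - r.s, (by grind), by rw [add_sub_cancel]⟩
  have hφ : ∀ x ∈ Ioo r.t (r.t + r.b), (x : Angle) ∈ cIoo r.φ₁ r.φ₂ := fun x hx =>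
    r.mem_cIoo_φ.2 ⟨x - r.t, (by grind), by rw [add_sub_cancel]⟩
  have hsub : openRect r.s (r.s + r.a) r.t (r.t + r.b) ⊆
      {z : ℂ | ((z.re : Angle), (z.im : Angle)) ∈ r.inner} := fun z hz => ⟨hθ _ hz.1, hφ _ hz.2⟩
  obtain ⟨M, hM⟩ := H.bounded; obtain ⟨M', hM'⟩ := H'.bounded
  have h0 := harmonic_eq_zero_of_normal_limits (u := u) (by grind) (by grind) ((H.harmonic.mono hsub).sub (H'.harmonic.mono hsub))
    ⟨M + M', fun z hz => (abs_sub _ _).trans (add_le_add (hM _ (hsub hz)) (hM' _ (hsub hz)))⟩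
    (fun x hx => by
      simpa [comp_def] using ((H.bottom _ (hθ x hx)).sub (H'.bottom _ (hθ x hx))).comp
        (tendsto_coe_nhdsGT r.b_mem r.coe_t r.coe_t_add_b))
    (fun x hx => by
      simpa [comp_def] using ((H.top _ (hθ x hx)).sub (H'.top _ (hθ x hx))).comp
        (tendsto_coe_nhdsLT r.b_mem r.coe_t r.coe_t_add_b))
    (fun x hx => by
      simpa [comp_def] using ((H.left _ (hφ x hx)).sub (H'.left _ (hφ x hx))).comp
        (tendsto_coe_nhdsGT r.a_mem r.coe_s r.coe_s_add_a))
    (fun x hx => by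
      simpa [comp_def] using ((H.right _ (hφ x hx)).sub (H'.right _ (hφ x hx))).comp
        (tendsto_coe_nhdsLT r.a_mem r.coe_s r.coe_s_add_a))
    ⟨r.s + x, r.t + y⟩ ⟨⟨by simp [hx.1], by simp [hx.2]⟩, ⟨by simp [hy.1], by simp [hy.2]⟩⟩
  exact sub_eq_zero.1 h0

lemma tan_height (P : Profile r.a r.b) (hx : x ∈ Ioo 0 r.a) (hy : y ∈ Ioo 0 r.b) :
    tan (π * r.height (↑(r.s + x), ↑(r.t + y)) / 2) = P.B.fn y / P.C.fn x := by
  rw [r.isHarmonicHeight_height.eq (r.isHarmonicHeight P) hx hy]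
  simp only [r.arcCoord_sub_θ hx, r.arcCoord_sub_φ hy, Profile.hgt]
  rw [show π * (2 / π * arctan (P.B.fn y / P.C.fn x)) / 2 = arctan (P.B.fn y / P.C.fn x) by field_simp [pi_ne_zero], tan_arctan]

end Rect

lemma arctan_add_arctan_div {p q : ℝ} (hp : 0 < p) (hq : 0 < q) : 1 - 2 / π * arctan (q / p) = 2 / π * arctan (p / q) := by
  rw [← inv_div p q, arctan_inv_of_pos (div_pos hp hq)]; field_simp; ring

/-- Comparison of the profiles of two crossing rectangles: the first is `[0, a₁] × [e, e + b₁]`, the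
second is `[d, d + a₂] × [0, b₂]`. -/
lemma Profile.cross_lt {a₁ b₁ a₂ b₂ d : ℝ} (P₁ : Profile a₁ b₁) (P₂ : Profile a₂ b₂)
    (hd : 0 < d) (hd' : d + a₂ < a₁) (he : 0 < e) (he' : e + b₁ < b₂)
    (hx : x ∈ Icc 0 a₂) (hy : y ∈ Icc 0 b₁) :
    P₁.B.fn y * P₂.C.fn x < P₂.B.fn (y + e) * P₁.C.fn (x + d) := by
  have pC : ∀ x ∈ Icc 0 a₂, 0 < P₁.C.fn (x + d) := fun x hx =>
    P₁.C.pos _ (by grind)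
  have pB : ∀ y ∈ Icc 0 b₁, 0 < P₂.B.fn (y + e) := fun y hy =>
    P₂.B.pos _ (by grind)
  have key : ∀ x ∈ Icc 0 a₂, ∀ y ∈ Icc 0 b₁, (0 < 1 - 2 / π * arctan (P₂.C.fn x / P₂.B.fn (y + e)) -
        2 / π * arctan (P₁.B.fn y / P₁.C.fn (x + d)) ↔
      P₁.B.fn y * P₂.C.fn x < P₂.B.fn (y + e) * P₁.C.fn (x + d)) := by
    intro x hx y hy; have hB := pB y hy; have hC := pC x hx; rcases (P₂.C.nonneg hx).eq_or_lt with h0 | h0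
    · rw [← h0, mul_zero]; refine iff_of_true ?_ (by positivity)
      have h1 := arctan_lt_pi_div_two (P₁.B.fn y / P₁.C.fn (x + d)); have e2 : 2 / π * (π / 2) = 1 := by field_simp
      have := mul_lt_mul_of_pos_left h1 (by positivity : 0 < 2 / π); simp [zero_div, arctan_zero, mul_zero, sub_zero]; linarith
    · rw [arctan_add_arctan_div hB h0, ← mul_sub, mul_pos_iff_of_pos_left (by positivity), sub_pos,
        arctan_strictMono.lt_iff_lt, div_lt_div_iff₀ hC h0]
  have c1 := P₁.C.continuous; have c2 := P₁.B.continuous; have c3 := P₂.C.continuous; have c4 := P₂.B.continuous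
  refine (key x hx y hy).1 (harmonic_pos_of_boundary_pos (x₀ := 0) (x₁ := a₂) (y₀ := 0) (y₁ := b₁)
    (u := fun z => 1 - 2 / π * arctan (P₂.C.fn z.re / P₂.B.fn (z.im + e)) -
        2 / π * arctan (P₁.B.fn z.im / P₁.C.fn (z.re + d))) ?_ ?_ ?_ ⟨x, y⟩ ⟨hx, hy⟩)
  · intro z hz; have h1 := P₁.harmonicAt (-d) 0 (z := z) ⟨by linarith [hz.1.1], by linarith [hz.1.2]⟩
      ⟨by linarith [hz.2.1], by linarith [hz.2.2]⟩
    have h2 := P₂.harmonicAt 0 (-e) (z := z) ⟨by linarith [hz.1.1], by linarith [hz.1.2]⟩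
      ⟨by linarith [hz.2.1], by linarith [hz.2.2]⟩
    refine (InnerProductSpace.harmonicAt_congr_nhds ?_).2 (h2.sub h1)
    filter_upwards [(isOpen_openRect 0 a₂ 0 b₁).mem_nhds hz] with w hw; have i1 := pB w.im ⟨hw.2.1.le, hw.2.2.le⟩
    have i2 := P₂.C.pos _ hw.1; simp [Pi.sub_apply, sub_neg_eq_add, sub_zero]; rw [arctan_add_arctan_div i1 i2]
  · intro z hz; have h1 : P₁.C.fn (z.re + d) ≠ 0 := (pC _ hz.1).ne'; have h2 : P₂.B.fn (z.im + e) ≠ 0 := (pB _ hz.2).ne'; fun_prop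
  · rintro ⟨x, y⟩ ⟨hx, hy⟩ hb; change x ∈ Icc 0 a₂ at hx; change y ∈ Icc 0 b₁ at hy; refine (key x hx y hy).2 ?_
    have hB := pB y hy; have hC := pC x hx; have hor : P₁.B.fn y = 0 ∨ P₂.C.fn x = 0 := by
      rw [P₁.B.eq_zero_iff hy, P₂.C.eq_zero_iff hx]; by_contra! hcon
      exact hb ⟨⟨lt_of_le_of_ne hx.1 hcon.2.1.symm, lt_of_le_of_ne hx.2 hcon.2.2⟩,
        ⟨lt_of_le_of_ne hy.1 hcon.1.1.symm, lt_of_le_of_ne hy.2 hcon.1.2⟩⟩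
    rcases hor with h | h <;> rw [h] <;> simp [hB, hC]

open Complex (norm_real norm_exp_ofReal_mul_I mk_eq_add_mul_I exp_mul_I re_ofReal_mul im_ofReal_mul ofReal_cos ofReal_sin cos_ofReal_re sin_ofReal_re)
/-! ### Splittings of four-space into two complex lines -/

namespace Split

/-- The standard identification. -/
def std : Split where
  e := LinearEquiv.toContinuousLinearEquiv
    { toFun := fun q => (⟨q 0, q 1⟩, ⟨q 2, q 3⟩)
      map_add' := fun u v => by ext <;> apply Complex.ext <;> simp
      map_smul' := fun c u => by ext <;> apply Complex.ext <;> simp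
      invFun := fun p => !₂[p.1.re, p.1.im, p.2.re, p.2.im]
      left_inv := fun q => by ext i; fin_cases i <;> simp
      right_inv := fun p => by ext <;> simp }
  inner_eq u v := by simp [PiLp.inner_apply, Fin.sum_univ_four, Complex.inner]; ring
  normal q := by ext <;> apply Complex.ext <;> simp [contactNormal]

/-- The identification with exchanged complex lines. -/
def swap (S : Split) : Split where
  e := S.e.trans (ContinuousLinearEquiv.prodComm ℝ ℂ ℂ)
  inner_eq u v := by simp [S.inner_eq u v, add_comm]
  normal q := by simp [S.normal q]

variable (S : Split)

lemma std_z (q : E4) : std.z q = ⟨q 0, q 1⟩ := rfl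
lemma std_w (q : E4) : std.w q = ⟨q 2, q 3⟩ := rfl

lemma inner_eq' (u v : E4) : inner ℝ u v = inner ℝ (S.z u) (S.z v) + inner ℝ (S.w u) (S.w v) := S.inner_eq u v
lemma z_normal (q : E4) : S.z (contactNormal q) = I * S.z q := congrArg Prod.fst (S.normal q)
lemma w_normal (q : E4) : S.w (contactNormal q) = I * S.w q := congrArg Prod.snd (S.normal q)

/-- The point with given complex coordinates. -/
def ofPair : ℂ × ℂ →L[ℝ] E4 := (S.e.symm : ℂ × ℂ →L[ℝ] E4)

@[simp] lemma z_ofPair (p : ℂ × ℂ) : S.z (S.ofPair p) = p.1 := by simp [z, ofPair]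
@[simp] lemma w_ofPair (p : ℂ × ℂ) : S.w (S.ofPair p) = p.2 := by simp [w, ofPair]
lemma ofPair_zw (q : E4) : S.ofPair (S.z q, S.w q) = q := by have : (S.z q, S.w q) = S.e q := rfl; rw [this]; simp [ofPair]

lemma ext {u : E4} (h1 : S.z u = S.z v) (h2 : S.w u = S.w v) : u = v := by rw [← S.ofPair_zw u, ← S.ofPair_zw v, h1, h2]

lemma norm_sq (q : E4) : ‖q‖ ^ 2 = ‖S.z q‖ ^ 2 + ‖S.w q‖ ^ 2 := by
  rw [← real_inner_self_eq_norm_sq, S.inner_eq', real_inner_self_eq_norm_sq, real_inner_self_eq_norm_sq]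

/-- The tile of a profile in the coordinates of a splitting. -/
def tile (K s t : ℝ) (P : Profile a b) : Set E4 := {q | ‖S.z q‖ ^ 2 + ‖S.w q‖ ^ 2 = 1 ∧ ∃ x ∈ Icc 0 a, ∃ y ∈ Icc 0 b,
    S.z q = ‖S.z q‖ * cexp ((t + y : ℝ) * I) ∧
    S.w q = ‖S.w q‖ * cexp ((s + x : ℝ) * I) ∧
    ‖S.z q‖ ^ K * P.B.fn y = ‖S.w q‖ ^ K * P.C.fn x}

lemma tile_swap (K s t : ℝ) (P : Profile a b) : S.swap.tile K t s P.swap = S.tile K s t P := by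
  ext q; constructor
  · rintro ⟨h, x, hx, y, hy, h1, h2, h3⟩; exact ⟨by rw [← h, add_comm]; rfl, y, hy, x, hx, h2, h1, h3.symm⟩
  · rintro ⟨h, x, hx, y, hy, h1, h2, h3⟩; exact ⟨by rw [← h, add_comm]; rfl, y, hy, x, hx, h2, h1, h3.symm⟩

lemma isCompact_tile (hK : 0 < K) (s t : ℝ) (P : Profile a b) : IsCompact (S.tile K s t P) := by
  set D : Set (ℝ × ℝ × ℝ × ℝ) := (Icc 0 a ×ˢ Icc 0 b ×ˢ Icc 0 1 ×ˢ Icc 0 1) ∩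
    {p | p.2.2.1 ^ 2 + p.2.2.2 ^ 2 = 1 ∧ p.2.2.1 ^ K * P.B.fn p.2.1 = p.2.2.2 ^ K * P.C.fn p.1} with hD
  have c1 := P.C.continuous; have c2 := P.B.continuous; have r1 : Continuous fun p : ℝ × ℝ × ℝ × ℝ => p.2.2.1 ^ K :=
    (by fun_prop : Continuous fun p : ℝ × ℝ × ℝ × ℝ => p.2.2.1).rpow_const fun _ => .inr hK.le
  have r2 : Continuous fun p : ℝ × ℝ × ℝ × ℝ => p.2.2.2 ^ K :=
    (by fun_prop : Continuous fun p : ℝ × ℝ × ℝ × ℝ => p.2.2.2).rpow_const fun _ => .inr hK.le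
  have hDc : IsCompact D := by
    refine (isCompact_Icc.prod (isCompact_Icc.prod (isCompact_Icc.prod isCompact_Icc))).inter_right ?_
    exact (isClosed_eq (by fun_prop) continuous_const).inter (isClosed_eq (by fun_prop) (by fun_prop))
  have himg : S.tile K s t P = (fun p : ℝ × ℝ × ℝ × ℝ =>
      S.ofPair ((p.2.2.1 : ℂ) * cexp ((t + p.2.1 : ℝ) * I), (p.2.2.2 : ℂ) * cexp ((s + p.1 : ℝ) * I))) '' D := by
    ext q; constructor
    · rintro ⟨h, x, hx, y, hy, h1, h2, h3⟩
      refine ⟨(x, y, ‖S.z q‖, ‖S.w q‖), ⟨⟨hx, hy, ⟨norm_nonneg _, ?_⟩, ⟨norm_nonneg _, ?_⟩⟩, h, h3⟩,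
        S.ext (by simp only [z_ofPair]; exact h1.symm) (by simp only [w_ofPair]; exact h2.symm)⟩
      · show ‖S.z q‖ ≤ 1; nlinarith [sq_nonneg ‖S.w q‖, norm_nonneg (S.z q)]
      · show ‖S.w q‖ ≤ 1; nlinarith [sq_nonneg ‖S.z q‖, norm_nonneg (S.w q)]
    · rintro ⟨⟨x, y, c, d⟩, ⟨⟨hx, hy, hc, hd⟩, h1, h2⟩, rfl⟩; have n1 : ‖(c : ℂ) * cexp ((t + y : ℝ) * I)‖ = c := by
        rw [norm_mul, norm_exp_ofReal_mul_I, mul_one, norm_real, norm_of_nonneg hc.1]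
      have n2 : ‖(d : ℂ) * cexp ((s + x : ℝ) * I)‖ = d := by
        rw [norm_mul, norm_exp_ofReal_mul_I, mul_one, norm_real, norm_of_nonneg hd.1]
      refine ⟨?_, x, hx, y, hy, ?_, ?_, ?_⟩
      · simp only [z_ofPair, w_ofPair]; rw [n1, n2]; exact h1
      · simp only [z_ofPair]; rw [n1]
      · simp only [w_ofPair]; rw [n2]
      · simp only [z_ofPair, w_ofPair]; rw [n1, n2]; exact h2
  rw [himg]; refine hDc.image ?_; fun_prop

end Split

lemma std_z_join (x y τ : ℝ) : Split.std.z (join (((x : Angle), (y : Angle)), τ)) =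
    (cos (π * τ / 2) : ℂ) * cexp ((y : ℝ) * I) := by
  rw [Split.std_z, exp_mul_I]; rw [← ofReal_cos, ← ofReal_sin]
  apply Complex.ext
  · rw [re_ofReal_mul]; simp [join, cos_ofReal_re, sin_ofReal_re]
  · rw [im_ofReal_mul]; simp [join, cos_ofReal_re, sin_ofReal_re]

lemma std_w_join (x y τ : ℝ) : Split.std.w (join (((x : Angle), (y : Angle)), τ)) =
    (sin (π * τ / 2) : ℂ) * cexp ((x : ℝ) * I) := by
  rw [Split.std_w, exp_mul_I]; rw [← ofReal_cos, ← ofReal_sin]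
  apply Complex.ext
  · rw [re_ofReal_mul]; simp [join, cos_ofReal_re, sin_ofReal_re]
  · rw [im_ofReal_mul]; simp [join, cos_ofReal_re, sin_ofReal_re]

lemma continuous_join : Continuous join := by
  have h : join = fun x : Torus × ℝ => Split.std.ofPair (⟨cos (π * x.2 / 2) * x.1.2.cos, cos (π * x.2 / 2) * x.1.2.sin⟩,
      ⟨sin (π * x.2 / 2) * x.1.1.cos, sin (π * x.2 / 2) * x.1.1.sin⟩) := by
    funext x
    exact Split.std.ext (by rw [Split.z_ofPair]; rfl) (by rw [Split.w_ofPair]; rfl)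
  rw [h]; have c1 := Angle.continuous_cos; have c2 := Angle.continuous_sin; simp [mk_eq_add_mul_I]; fun_prop

lemma arctan_rpow_eq (hK : 0 < K) (hu : u ∈ Ioo 0 (π / 2)) (hM : M = tan u ^ K) : arctan (M ^ (1 / K)) = u := by
  have h := tan_pos_of_pos_of_lt_pi_div_two hu.1 hu.2
  rw [hM, ← rpow_mul h.le, mul_one_div_cancel hK.ne', rpow_one, arctan_tan (by grind) hu.2]

lemma cos_mul_eq_sin_mul_of_arctan {B C : ℝ} (hK : 0 < K) (hB : 0 < B) (hC : 0 < C)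
    (hu : u = arctan ((B / C) ^ (1 / K))) : cos u ^ K * B = sin u ^ K * C := by
  have h0 : 0 < (B / C) ^ (1 / K) := by positivity
  have hcos : 0 < cos u := by rw [hu]; exact cos_arctan_pos _
  have hs : sin u = (B / C) ^ (1 / K) * cos u := by rw [← tan_mul_cos hcos.ne', hu, tan_arctan]
  rw [hs, mul_rpow h0.le hcos.le, ← rpow_mul (by positivity), one_div_mul_cancel hK.ne', rpow_one]; field_simp

namespace Rect
variable (r : Rect)

lemma modHeight_eq (κ : ℝ) (P : Profile r.a r.b) (hx : x ∈ Ioo 0 r.a) (hy : y ∈ Ioo 0 r.b) :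
    r.modHeight κ (((r.s + x : ℝ) : Angle), ((r.t + y : ℝ) : Angle)) =
      2 / π * arctan ((P.B.fn y / P.C.fn x) ^ (1 / (2 + κ))) := by rw [modHeight, r.tan_height P hx hy]

/-- The graph of the modified height function. -/
def graph (κ : ℝ) : Set (Torus × ℝ) := {x : Torus × ℝ | x.1 ∈ r.inner ∧ x.2 = r.modHeight κ x.1}

lemma mem_graph (P : Profile r.a r.b) (hx : x ∈ Ioo 0 r.a) (hy : y ∈ Ioo 0 r.b) :
    ((((r.s + x : ℝ) : Angle), ((r.t + y : ℝ) : Angle)), 2 / π * arctan ((P.B.fn y / P.C.fn x) ^ (1 / (2 + κ)))) ∈ r.graph κ :=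
  ⟨r.mem_inner.2 ⟨x, hx, y, hy, rfl⟩, (r.modHeight_eq κ P hx hy).symm⟩

lemma mem_closure_graph {ι : Type*} {l : Filter ι} [l.NeBot] (P : Profile r.a r.b)
    {f g : ι → ℝ} (hf : ∀ᶠ i in l, f i ∈ Ioo 0 r.a) (hg : ∀ᶠ i in l, g i ∈ Ioo 0 r.b)
    (hfx : Tendsto f l (𝓝 x)) (hgy : Tendsto g l (𝓝 y))
    (hu : Tendsto (fun i => arctan ((P.B.fn (g i) / P.C.fn (f i)) ^ (1 / (2 + κ)))) l (𝓝 u)) :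
    ((((r.s + x : ℝ) : Angle), ((r.t + y : ℝ) : Angle)), 2 / π * u) ∈ closure (r.graph κ) := by
  have t1 : Tendsto (fun i => ((r.s + f i : ℝ) : Angle)) l (𝓝 ((r.s + x : ℝ) : Angle)) :=
    (continuous_coe.tendsto _).comp (hfx.const_add _)
  have t2 : Tendsto (fun i => ((r.t + g i : ℝ) : Angle)) l (𝓝 ((r.t + y : ℝ) : Angle)) :=
    (continuous_coe.tendsto _).comp (hgy.const_add _)
  refine mem_closure_of_tendsto ((t1.prodMk_nhds t2).prodMk_nhds (hu.const_mul (2 / π))) ?_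
  filter_upwards [hf, hg] with i h1 h2 using r.mem_graph P h1 h2

lemma mem_closure_graph_corner (hκ : 0 ≤ κ) (P : Profile r.a r.b)
    (hx : x = 0 ∨ x = r.a) (hy : y = 0 ∨ y = r.b) (hu : u ∈ Ioo 0 (π / 2)) :
    ((((r.s + x : ℝ) : Angle), ((r.t + y : ℝ) : Angle)), 2 / π * u) ∈ closure (r.graph κ) := by
  obtain ⟨A, hA, hA0, hBA, -, -⟩ := P.B.exists_inverse; have ha := P.C.len_pos; have hb := P.B.len_pos
  set M := tan u ^ (2 + κ) with hM; have hM0 : 0 < M := rpow_pos_of_pos (tan_pos_of_pos_of_lt_pi_div_two hu.1 hu.2) _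
  have hid : Tendsto (fun δ : ℝ => δ) (𝓝[>] 0) (𝓝 0) := nhdsWithin_le_nhds
  have hC0 : Tendsto (fun δ => M * P.C.fn δ) (𝓝[>] 0) (𝓝 0) := by
    have h := (P.C.continuous.tendsto 0).const_mul M; rw [P.C.zero, mul_zero] at h; exact h.mono_left nhdsWithin_le_nhds
  have hAt : Tendsto (fun δ => A (M * P.C.fn δ)) (𝓝[>] 0) (𝓝 0) := by
    have h := hA.continuousAt.tendsto; rw [hA0] at h; exact h.comp hC0
  have hδ : ∀ᶠ δ : ℝ in 𝓝[>] 0, δ ∈ Ioo 0 r.a := Ioo_mem_nhdsGT ha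
  have hAb : ∀ᶠ δ : ℝ in 𝓝[>] 0, A (M * P.C.fn δ) ∈ Ioo (-r.b) r.b := hAt.eventually_mem (Ioo_mem_nhds (by linarith) hb)
  have hBe : ∀ᶠ δ : ℝ in 𝓝[>] 0, P.B.fn (A (M * P.C.fn δ)) = M * P.C.fn δ := hC0.eventually hBA
  have hApos : ∀ᶠ δ : ℝ in 𝓝[>] 0, A (M * P.C.fn δ) ∈ Ioo 0 r.b := by
    filter_upwards [hδ, hAb, hBe] with δ h1 h2 h3; refine ⟨?_, h2.2⟩; by_contra! hneg
    have h4 : 0 < P.B.fn (A (M * P.C.fn δ)) := by rw [h3]; exact mul_pos hM0 (P.C.pos _ h1)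
    have h5 := P.B.nonneg (x := -A (M * P.C.fn δ)) (by grind); rw [P.B.odd] at h5; linarith
  set f : ℝ → ℝ := fun δ => if x = 0 then δ else r.a - δ with hf
  set g : ℝ → ℝ := fun δ => if y = 0 then A (M * P.C.fn δ) else r.b - A (M * P.C.fn δ) with hg
  have hfC : ∀ δ, P.C.fn (f δ) = P.C.fn δ := fun δ => by
    simp [hf]; split_ifs
    · rfl
    · exact P.C.len_sub δ
  have hgB : ∀ δ, P.B.fn (g δ) = P.B.fn (A (M * P.C.fn δ)) := fun δ => by
    simp [hg]; split_ifs
    · rfl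
    · exact P.B.len_sub _
  refine r.mem_closure_graph (l := 𝓝[>] (0 : ℝ)) P (f := f) (g := g) ?_ ?_ ?_ ?_ ?_
  · filter_upwards [hδ] with δ h; grind
  · grind
  · simp [hf]; split_ifs with h
    · rw [h]; exact hid
    · rw [hx.resolve_left h]; simpa using hid.const_sub r.a
  · simp [hg]; split_ifs with h
    · rw [h]; exact hAt
    · rw [hy.resolve_left h]; simpa using hAt.const_sub r.b
  · refine tendsto_const_nhds.congr' ?_; filter_upwards [hδ, hBe] with δ h1 h2
    rw [hfC, hgB, h2, mul_div_cancel_right₀ _ (P.C.pos _ h1).ne']; exact (arctan_rpow_eq (by linarith) hu hM).symm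

lemma mem_closure_graph_of_eq (hκ : 0 ≤ κ) (P : Profile r.a r.b)
    (hx : x ∈ Icc 0 r.a) (hy : y ∈ Icc 0 r.b) (hu : u ∈ Icc 0 (π / 2))
    (h : cos u ^ (2 + κ) * P.B.fn y = sin u ^ (2 + κ) * P.C.fn x) :
    ((((r.s + x : ℝ) : Angle), ((r.t + y : ℝ) : Angle)), 2 / π * u) ∈ closure (r.graph κ) := by
  have hpi := pi_pos; have hK : 0 < 2 + κ := by linarith
  have ha := P.C.len_pos; have hb := P.B.len_pos; have hcos : 0 ≤ cos u := cos_nonneg_of_mem_Icc ⟨by grind, hu.2⟩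
  have hsin : 0 ≤ sin u := sin_nonneg_of_nonneg_of_le_pi hu.1 (by grind); rcases (P.C.nonneg hx).eq_or_lt with hC | hC
  · have hx' := (P.C.eq_zero_iff hx).1 hC.symm; rcases (P.B.nonneg hy).eq_or_lt with hB | hB
    · have hy' := (P.B.eq_zero_iff hy).1 hB.symm
      have hsub : ∀ u ∈ Ioo 0 (π / 2), ((((r.s + x : ℝ) : Angle), ((r.t + y : ℝ) : Angle)),
          2 / π * u) ∈ closure (r.graph κ) := fun u hu => r.mem_closure_graph_corner hκ P hx' hy' hu
      have hu' : u ∈ closure (Ioo 0 (π / 2)) := by rwa [closure_Ioo (by linarith : (0 : ℝ) ≠ π / 2)]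
      have hc : Continuous fun u : ℝ => ((((r.s + x : ℝ) : Angle), ((r.t + y : ℝ) : Angle)), 2 / π * u) := by fun_prop
      have := map_mem_closure hc hu' hsub; rwa [closure_closure] at this
    · have hy' : y ∈ Ioo 0 r.b := by
        refine ⟨lt_of_le_of_ne hy.1 ?_, lt_of_le_of_ne hy.2 ?_⟩ <;> rintro rfl
        · exact hB.ne' P.B.zero
        · exact hB.ne' P.B.fn_len
      rw [← hC, mul_zero] at h; have h0 : cos u = 0 := (rpow_eq_zero hcos hK.ne').1 ((mul_eq_zero.1 h).resolve_right hB.ne')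
      have hu2 : u = π / 2 := by by_contra hne; exact (cos_pos_of_mem_Ioo ⟨by grind, lt_of_le_of_ne hu.2 hne⟩).ne' h0
      have : (𝓝[Ioo 0 r.a] x).NeBot := by rw [← mem_closure_iff_nhdsWithin_neBot, closure_Ioo ha.ne]; exact hx
      have hm : ∀ᶠ x' in 𝓝[Ioo 0 r.a] x, x' ∈ Ioo 0 r.a := self_mem_nhdsWithin
      refine r.mem_closure_graph (l := 𝓝[Ioo 0 r.a] x) P (f := id) (g := fun _ => y) hm
        (.of_forall fun _ => hy') nhdsWithin_le_nhds tendsto_const_nhds ?_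
      have h1 : Tendsto P.C.fn (𝓝[Ioo 0 r.a] x) (𝓝[>] 0) := by
        refine tendsto_nhdsWithin_iff.2 ⟨?_, ?_⟩
        · rw [hC]; exact (P.C.continuous.tendsto x).mono_left nhdsWithin_le_nhds
        · filter_upwards [hm] with i hi using P.C.pos _ hi
      have h2 : Tendsto (fun i => P.B.fn y / P.C.fn i) (𝓝[Ioo 0 r.a] x) atTop := by
        simp [div_eq_mul_inv]; exact (tendsto_inv_nhdsGT_zero.comp h1).const_mul_atTop hB
      rw [hu2]; exact (tendsto_arctan_atTop.mono_right nhdsWithin_le_nhds).comp ((tendsto_rpow_atTop (by positivity)).comp h2)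
  · have hx' : x ∈ Ioo 0 r.a := by
      refine ⟨lt_of_le_of_ne hx.1 ?_, lt_of_le_of_ne hx.2 ?_⟩ <;> rintro rfl
      · exact hC.ne' P.C.zero
      · exact hC.ne' P.C.fn_len
    rcases (P.B.nonneg hy).eq_or_lt with hB | hB
    · rw [← hB, mul_zero] at h; have h0 : sin u = 0 := (rpow_eq_zero hsin hK.ne').1 ((mul_eq_zero.1 h.symm).resolve_right hC.ne')
      have hu2 : u = 0 := by by_contra hne; exact (sin_pos_of_pos_of_lt_pi (lt_of_le_of_ne hu.1 (Ne.symm hne)) (by grind)).ne' h0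
      have : (𝓝[Ioo 0 r.b] y).NeBot := by rw [← mem_closure_iff_nhdsWithin_neBot, closure_Ioo hb.ne]; exact hy
      have hm : ∀ᶠ x' in 𝓝[Ioo 0 r.b] y, x' ∈ Ioo 0 r.b := self_mem_nhdsWithin
      refine r.mem_closure_graph (l := 𝓝[Ioo 0 r.b] y) P (f := fun _ => x) (g := id)
        (.of_forall fun _ => hx') hm tendsto_const_nhds nhdsWithin_le_nhds ?_
      have c2 := P.B.continuous; have hc : Continuous fun y => arctan ((P.B.fn y / P.C.fn x) ^ (1 / (2 + κ))) :=
        continuous_arctan.comp ((by fun_prop : Continuous fun y => P.B.fn y / P.C.fn x).rpow_const fun _ => .inr (by positivity))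
      have h3 := (hc.tendsto y).mono_left (nhdsWithin_le_nhds (s := Ioo 0 r.b))
      rw [← hB, zero_div, zero_rpow (by positivity), arctan_zero] at h3; rw [hu2]; exact h3
    · have hy' : y ∈ Ioo 0 r.b := by
        refine ⟨lt_of_le_of_ne hy.1 ?_, lt_of_le_of_ne hy.2 ?_⟩ <;> rintro rfl
        · exact hB.ne' P.B.zero
        · exact hB.ne' P.B.fn_len
      have hu' : u ∈ Ioo 0 (π / 2) := by
        refine ⟨lt_of_le_of_ne hu.1 ?_, lt_of_le_of_ne hu.2 ?_⟩ <;> rintro rfl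
        · simp [zero_rpow hK.ne'] at h; exact hB.ne' h
        · simp [zero_rpow hK.ne'] at h; exact hC.ne h
      have hc0 : 0 < cos u := cos_pos_of_mem_Ioo ⟨by grind, hu'.2⟩; have hM : P.B.fn y / P.C.fn x = tan u ^ (2 + κ) := by
        rw [tan_eq_sin_div_cos, div_rpow hsin hcos, div_eq_div_iff hC.ne' (by positivity)]; linarith
      have := subset_closure (r.mem_graph (κ := κ) P hx' hy'); rwa [arctan_rpow_eq hK hu' hM] at this

/-- The description of a tile by a profile of the rectangle. -/
lemma tile_eq (hκ : 0 ≤ κ) (P : Profile r.a r.b) : tile κ r = Split.std.tile (2 + κ) r.s r.t P := by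
  have hK : 0 < 2 + κ := by linarith
  refine Set.Subset.antisymm ?_ ?_
  · rw [tile, image_subset_iff]
    refine closure_minimal ?_ ((Split.std.isCompact_tile hK r.s r.t P).isClosed.preimage continuous_join)
    rintro ⟨v, τ⟩ ⟨hv, hτ⟩; obtain ⟨x, hx, y, hy, rfl⟩ := r.mem_inner.1 hv; simp only at hτ; rw [r.modHeight_eq κ P hx hy] at hτ
    obtain ⟨u, hu⟩ : ∃ u, u = arctan ((P.B.fn y / P.C.fn x) ^ (1 / (2 + κ))) := ⟨_, rfl⟩
    have hτu : π * τ / 2 = u := by rw [hτ, hu]; field_simp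
    have hq : 0 < (P.B.fn y / P.C.fn x) ^ (1 / (2 + κ)) := rpow_pos_of_pos (div_pos (P.B.pos y hy) (P.C.pos x hx)) _
    have hu0 : 0 < u := by simp_all
    have hu1 : u < π / 2 := by rw [hu]; exact arctan_lt_pi_div_two _
    have hcos : 0 < cos u := cos_pos_of_mem_Ioo ⟨by linarith, hu1⟩; have hsin : 0 < sin u := by simp_all
    have hz := std_z_join (r.s + x) (r.t + y) τ; have hw := std_w_join (r.s + x) (r.t + y) τ; rw [hτu] at hz hw
    have nz : ‖Split.std.z (join ((((r.s + x : ℝ) : Angle), ((r.t + y : ℝ) : Angle)), τ))‖ = cos u := by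
      rw [hz, norm_mul, norm_exp_ofReal_mul_I, mul_one, norm_real, norm_of_nonneg hcos.le]
    have nw : ‖Split.std.w (join ((((r.s + x : ℝ) : Angle), ((r.t + y : ℝ) : Angle)), τ))‖ = sin u := by
      rw [hw, norm_mul, norm_exp_ofReal_mul_I, mul_one, norm_real, norm_of_nonneg hsin.le]
    refine ⟨?_, x, Ioo_subset_Icc_self hx, y, Ioo_subset_Icc_self hy, ?_, ?_, ?_⟩
    · simp_all
    · rw [nz, hz]
    · rw [nw, hw]
    · rw [nz, nw]; exact cos_mul_eq_sin_mul_of_arctan hK (P.B.pos y hy) (P.C.pos x hx) hu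
  · rintro q ⟨h, x, hx, y, hy, h1, h2, h3⟩; set u := arccos ‖Split.std.z q‖ with hu
    have hz1 : ‖Split.std.z q‖ ≤ 1 := by nlinarith [sq_nonneg ‖Split.std.w q‖, norm_nonneg (Split.std.z q)]
    have hcos : cos u = ‖Split.std.z q‖ := cos_arccos (by linarith [norm_nonneg (Split.std.z q)]) hz1
    have hsin : sin u = ‖Split.std.w q‖ := by rw [hu, sin_arccos, ← h, add_sub_cancel_left, sqrt_sq (norm_nonneg _)]
    have hm := r.mem_closure_graph_of_eq hκ P hx hy (u := u)
      ⟨arccos_nonneg _, arccos_le_pi_div_two.2 (norm_nonneg _)⟩ (by rw [hcos, hsin]; exact h3)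
    refine ⟨_, hm, Split.std.ext ?_ ?_⟩
    · rw [std_z_join, h1, show π * (2 / π * u) / 2 = u by field_simp, hcos]
    · rw [std_w_join, h2, show π * (2 / π * u) / 2 = u by field_simp, hsin]

end Rect

open Complex (arg)
open Split (std)
open Angle (coe_two_pi cos_coe sin_coe)
/-! ### Compatible rectangles -/

lemma eq_norm_mul_exp_iff {u : ℂ} (hu : u ≠ 0) (x : ℝ) : u = ‖u‖ * cexp (x * I) ↔ (arg u : Angle) = x := by
  constructor
  · intro h; rw [h, exp_mul_I]; have := Complex.arg_mul_cos_add_sin_mul_I_coe_angle (norm_pos_iff.2 hu) (x : Angle)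
    rwa [cos_coe, sin_coe, ofReal_cos, ofReal_sin] at this
  · intro h
    conv_lhs => rw [← Complex.norm_mul_exp_arg_mul_I u]
    congr 1; rw [exp_mul_I, exp_mul_I, ← ofReal_cos, ← ofReal_sin, ← ofReal_cos,
      ← ofReal_sin, ← cos_coe, ← sin_coe, h, cos_coe, sin_coe]

lemma coe_eq_coe_of_mem (hx : x ∈ Ico 0 (2 * π)) (hy : y ∈ Ico 0 (2 * π)) (h : (x : Angle) = y) : x = y := by
  rw [← arcCoord_coe_of_mem hx, h, arcCoord_coe_of_mem hy]

/-- If the ends of an arc are not on a second arc, which meets the first one, the second arc is in the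
interior of the first. -/
lemma exists_shift_of_ends_not_mem {β δ μ : Angle} (hαβ : α ≠ β) (hγδ : γ ≠ δ)
    (h1 : μ ∈ cIcc α β) (h2 : μ ∈ cIcc γ δ) (hα : α ∉ cIcc γ δ) (hβ : β ∉ cIcc γ δ) :
    ∃ d : ℝ, 0 < d ∧ d + arcCoord (δ - γ) < arcCoord (β - α) ∧ γ = α + d := by
  obtain ⟨d, hd⟩ : ∃ d, d = arcCoord (γ - α) := ⟨_, rfl⟩; obtain ⟨l, hl⟩ : ∃ l, l = arcCoord (β - α) := ⟨_, rfl⟩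
  obtain ⟨m, hm⟩ : ∃ m, m = arcCoord (δ - γ) := ⟨_, rfl⟩; have dI := arcCoord_mem (γ - α)
  have lI := arcCoord_mem (β - α); have mI := arcCoord_mem (δ - γ); rw [mem_cIcc_iff hαβ, ← hl] at h1
  rw [mem_cIcc_iff hγδ, ← hm] at h2 hα hβ; rw [← hd] at dI; rw [← hl] at lI; rw [← hm] at mI
  have hγα : (γ - α) = (d : Angle) := by rw [hd, coe_arcCoord]
  have hβα : (β - α) = (l : Angle) := by rw [hl, coe_arcCoord]
  have hd0 : 0 < d := by
    rcases dI.1.eq_or_lt with h | h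
    · rw [← h, Angle.coe_zero, sub_eq_zero] at hγα; grind
    · exact h
  have hα' : arcCoord (α - γ) = 2 * π - d := by
    rw [← arcCoord_coe_of_mem (x := 2 * π - d) (by grind), coe_sub, coe_two_pi, ← hγα]; congr 1; abel
  rw [hα', not_le] at hα; have hμ := arcCoord_mem (μ - γ); obtain ⟨u, hu⟩ : ∃ u, u = arcCoord (μ - γ) := ⟨_, rfl⟩
  rw [← hu] at hμ h2; have hμα : arcCoord (μ - α) = d + u := by
    rw [← arcCoord_coe_of_mem (x := d + u) (by grind), coe_add, ← hγα, hu, coe_arcCoord]; congr 1; abel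
  rw [hμα] at h1; have hβ' : arcCoord (β - γ) = l - d := by
    rw [← arcCoord_coe_of_mem (x := l - d) (by grind), coe_sub, ← hγα, ← hβα]; congr 1; abel
  grind

namespace Rect

lemma left_mem (r : Rect) : r.θ₁ ∈ cIcc r.θ₁ r.θ₂ := r.mem_cIcc_θ.2 ⟨0, ⟨le_rfl, r.a_mem.1.le⟩, by rw [add_zero, coe_s]⟩
lemma right_mem (r : Rect) : r.θ₂ ∈ cIcc r.θ₁ r.θ₂ := r.mem_cIcc_θ.2 ⟨r.a, ⟨r.a_mem.1.le, le_rfl⟩, by rw [coe_s_add_a]⟩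
lemma bottom_mem (r : Rect) : r.φ₁ ∈ cIcc r.φ₁ r.φ₂ := r.mem_cIcc_φ.2 ⟨0, ⟨le_rfl, r.b_mem.1.le⟩, by rw [add_zero, coe_t]⟩
lemma top_mem (r : Rect) : r.φ₂ ∈ cIcc r.φ₁ r.φ₂ := r.mem_cIcc_φ.2 ⟨r.b, ⟨r.b_mem.1.le, le_rfl⟩, by rw [coe_t_add_b]⟩

lemma mem_vertices {v : Torus} : v ∈ r.vertices ↔ (v.1 = r.θ₁ ∨ v.1 = r.θ₂) ∧ (v.2 = r.φ₁ ∨ v.2 = r.φ₂) := by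
  simp [vertices, mem_prod]

lemma vertices_subset (r : Rect) : r.vertices ⊆ r.carrier := by
  intro v hv; obtain ⟨h1, h2⟩ := mem_vertices.1 hv; constructor
  · rcases h1 with h | h <;> rw [h]
    · exact r.left_mem
    · exact r.right_mem
  · rcases h2 with h | h <;> rw [h]
    · exact r.bottom_mem
    · exact r.top_mem

/-- The first rectangle crosses the second one horizontally. -/
def Cross (r₁ r₂ : Rect) : Prop :=
  ∃ d e : ℝ, 0 < d ∧ d + r₂.a < r₁.a ∧ 0 < e ∧ e + r₁.b < r₂.b ∧ r₂.θ₁ = r₁.θ₁ + d ∧ r₁.φ₁ = r₂.φ₁ + e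

lemma cross_of_disjoint_vertices {v : Torus} (hv₁ : v ∈ r₁.carrier) (hv₂ : v ∈ r₂.carrier)
    (h₁ : ∀ v ∈ r₁.vertices, v ∉ r₂.carrier) (h₂ : ∀ v ∈ r₂.vertices, v ∉ r₁.carrier) :
    Cross r₁ r₂ ∨ Cross r₂ r₁ := by
  have key : ∀ {r₁ r₂ : Rect}, v ∈ r₁.carrier → v ∈ r₂.carrier →
      (∀ v ∈ r₁.vertices, v ∉ r₂.carrier) → (∀ v ∈ r₂.vertices, v ∉ r₁.carrier) →
      (r₁.θ₁ ∈ cIcc r₂.θ₁ r₂.θ₂ ∨ r₁.θ₂ ∈ cIcc r₂.θ₁ r₂.θ₂) → Cross r₂ r₁ := by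
    intro r₁ r₂ hv₁ hv₂ h₁ h₂ hor; obtain ⟨θ, hθ, hθm⟩ : ∃ θ, (θ = r₁.θ₁ ∨ θ = r₁.θ₂) ∧ θ ∈ cIcc r₂.θ₁ r₂.θ₂ := by simp_all
    obtain ⟨e, he, he', hee⟩ := exists_shift_of_ends_not_mem r₁.hφ r₂.hφ hv₁.2 hv₂.2
      (fun h => h₁ (θ, r₁.φ₁) (mem_vertices.2 ⟨hθ, .inl rfl⟩) ⟨hθm, h⟩)
      (fun h => h₁ (θ, r₁.φ₂) (mem_vertices.2 ⟨hθ, .inr rfl⟩) ⟨hθm, h⟩)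
    have hφm : r₂.φ₁ ∈ cIcc r₁.φ₁ r₁.φ₂ := by
      have hb := r₂.b_mem; refine r₁.mem_cIcc_φ.2 ⟨e, ⟨he.le, ?_⟩, ?_⟩
      · change e + r₂.b < r₁.b at he'; grind
      · rw [hee, coe_add, coe_t]
    obtain ⟨d, hd, hd', hde⟩ := exists_shift_of_ends_not_mem r₂.hθ r₁.hθ hv₂.1 hv₁.1
      (fun h => h₂ (r₂.θ₁, r₂.φ₁) (mem_vertices.2 ⟨.inl rfl, .inl rfl⟩) ⟨h, hφm⟩)
      (fun h => h₂ (r₂.θ₂, r₂.φ₁) (mem_vertices.2 ⟨.inr rfl, .inl rfl⟩) ⟨h, hφm⟩)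
    exact ⟨d, e, hd, hd', he, he', hde, hee⟩
  by_cases hor : r₁.θ₁ ∈ cIcc r₂.θ₁ r₂.θ₂ ∨ r₁.θ₂ ∈ cIcc r₂.θ₁ r₂.θ₂
  · grind
  · push Not at hor
    obtain ⟨d, hd, hd', hde⟩ := exists_shift_of_ends_not_mem r₁.hθ r₂.hθ hv₁.1 hv₂.1 hor.1 hor.2
    refine .inl (key hv₂ hv₁ h₂ h₁ (.inl (r₁.mem_cIcc_θ.2 ⟨d, ⟨hd.le, ?_⟩, ?_⟩)))
    · change d + r₂.a < r₁.a at hd'; linarith [r₂.a_mem.1]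
    · rw [hde, coe_add, coe_s]

end Rect

namespace Diagram
variable (D : Diagram)

lemma vertex_or_cross (h₁ : r₁ ∈ D.rects) (h₂ : r₂ ∈ D.rects) (hne : r₁ ≠ r₂) {v : Torus}
    (hv₁ : v ∈ r₁.carrier) (hv₂ : v ∈ r₂.carrier) :
    (v ∈ r₁.vertices ∧ v ∈ r₂.vertices) ∨ r₁.Cross r₂ ∨ r₂.Cross r₁ := by
  have cr : ∀ r₁ r₂ : Rect, v ∈ r₁.carrier → v ∈ r₂.carrier → (∃ r₃ : Rect, r₁.carrier ∩ r₂.carrier = r₃.carrier ∧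
    Disjoint r₃.carrier r₁.vertices ∧ Disjoint r₃.carrier r₂.vertices) → r₁.Cross r₂ ∨ r₂.Cross r₁ := by
    rintro r₁ r₂ hv₁ hv₂ ⟨r₃, he, hd1, hd2⟩
    refine Rect.cross_of_disjoint_vertices hv₁ hv₂ (fun v hv hv' => ?_) (fun v hv hv' => ?_)
    · exact disjoint_right.1 hd1 hv (he ▸ ⟨r₁.vertices_subset hv, hv'⟩)
    · exact disjoint_right.1 hd2 hv (he ▸ ⟨hv', r₂.vertices_subset hv⟩)
  rcases D.compatible r₁ h₁ r₂ h₂ hne with h | h | h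
  · exact absurd (h ▸ ⟨hv₁, hv₂⟩ : v ∈ (∅ : Set Torus)) (notMem_empty v)
  · rcases D.compatible r₂ h₂ r₁ h₁ hne.symm with h' | h' | h'
    · grind
    · grind
    grind
  grind

end Diagram

namespace Rect

/-- Rectangles that cross have no longitude of a side in common. -/
lemma Cross.ends_ne (h : r₁.Cross r₂) {φ : Angle} (h₁ : φ = r₁.φ₁ ∨ φ = r₁.φ₂) (h₂ : φ = r₂.φ₁ ∨ φ = r₂.φ₂) : False := by
  obtain ⟨d, e, -, -, he, he', -, hee⟩ := h; have hb := r₁.b_mem; have hb₂ := r₂.b_mem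
  obtain ⟨x, hx, hφ⟩ : ∃ x ∈ Ioo 0 r₂.b, φ = r₂.φ₁ + x := by
    rcases h₁ with h | h
    · grind
    · refine ⟨e + r₁.b, ⟨by grind, he'⟩, ?_⟩; rw [h, ← r₁.coe_t_add_b, coe_add, coe_t, hee, coe_add, add_assoc]
  have hx2 : x ∈ Ico 0 (2 * π) := by grind
  rcases h₂ with h | h
  · rw [hφ] at h; have h' : (x : Angle) = ↑(0) := by simpa using h
    have := coe_eq_coe_of_mem hx2 ⟨le_rfl, two_pi_pos⟩ h'; exact hx.1.ne' this
  · rw [hφ, ← r₂.coe_t_add_b, coe_add, coe_t] at h; have := coe_eq_coe_of_mem hx2 ⟨hb₂.1.le, hb₂.2⟩ (add_left_cancel h)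
    exact hx.2.ne this

/-- Rectangles that cross have no meridian of a side in common. -/
lemma Cross.ends_ne' (h : r₁.Cross r₂) (h₁ : θ = r₁.θ₁ ∨ θ = r₁.θ₂) (h₂ : θ = r₂.θ₁ ∨ θ = r₂.θ₂) : False := by
  obtain ⟨d, e, hd, hd', -, -, hde, -⟩ := h; have hb := r₂.a_mem; have hb₂ := r₁.a_mem
  obtain ⟨x, hx, hφ⟩ : ∃ x ∈ Ioo 0 r₁.a, θ = r₁.θ₁ + x := by
    rcases h₂ with h | h
    · grind
    · refine ⟨d + r₂.a, ⟨by grind, hd'⟩, ?_⟩; rw [h, ← r₂.coe_s_add_a, coe_add, coe_s, hde, coe_add, add_assoc]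
  have hx2 : x ∈ Ico 0 (2 * π) := by grind
  rcases h₁ with h | h
  · rw [hφ] at h; have h' : (x : Angle) = ↑(0) := by simpa using h
    have := coe_eq_coe_of_mem hx2 ⟨le_rfl, two_pi_pos⟩ h'; exact hx.1.ne' this
  · rw [hφ, ← r₁.coe_s_add_a, coe_add, coe_s] at h; have := coe_eq_coe_of_mem hx2 ⟨hb₂.1.le, hb₂.2⟩ (add_left_cancel h)
    exact hx.2.ne this

/-- Two different angles at most are avoided by a point of a non-degenerate arc next to its end. -/
lemma exists_mem_arc_ne {a' : ℝ} (ha : 0 < a) (ha' : 0 < a') (α β : Angle) :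
    ∃ x : ℝ, 0 < x ∧ x < a ∧ x < a' ∧ ((s + x : ℝ) : Angle) ≠ α ∧ ((s + x : ℝ) : Angle) ≠ β := by
  obtain ⟨m, hm⟩ : ∃ m, m = min (min a a') 1 := ⟨_, rfl⟩; have hma : m ≤ a := by simp_all
  have hma' : m ≤ a' := by grind
  have inj : ∀ x y : ℝ, x ∈ Ioo 0 m → y ∈ Ioo 0 m → ((s + x : ℝ) : Angle) = ((s + y : ℝ) : Angle) → x = y := by
    intro x y hx hy h; rw [coe_add, coe_add] at h; have hp3 := pi_gt_three
    exact coe_eq_coe_of_mem ⟨hx.1.le, by grind⟩ ⟨hy.1.le, by grind⟩ (add_left_cancel h)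
  by_contra! hcon; have h1 := fun x (hx : x ∈ Ioo 0 m) => hcon x hx.1 (hx.2.trans_le hma) (hx.2.trans_le hma')
  have m1 : m / 2 ∈ Ioo 0 m := by grind
  have m2 : m / 3 ∈ Ioo 0 m := by grind
  have m3 : m / 4 ∈ Ioo 0 m := by grind
  grind

/-- Arcs with a common initial point or a common terminal point meet in a point different from their ends. -/
lemma exists_common_mem {β α' β' : Angle} (h : α ≠ β) (h' : α' ≠ β') (hc : α = α' ∨ β = β') :
    ∃ θ ∈ cIcc α β, θ ∈ cIcc α' β' ∧ θ ≠ α ∧ θ ≠ β := by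
  have l1 : arcCoord (β - α) ∈ Ioo 0 (2 * π) := ⟨arcCoord_pos (sub_ne_zero.2 h.symm), (arcCoord_mem _).2⟩
  have l2 : arcCoord (β' - α') ∈ Ioo 0 (2 * π) := ⟨arcCoord_pos (sub_ne_zero.2 h'.symm), (arcCoord_mem _).2⟩
  have ea : ↑(arcCoord α) = α := coe_arcCoord _; have ea' : ↑(arcCoord α') = α' := coe_arcCoord _
  have eb : ↑(arcCoord α + arcCoord (β - α)) = β := by rw [coe_add, coe_arcCoord, coe_arcCoord]; abel
  have eb' : ↑(arcCoord α' + arcCoord (β' - α')) = β' := by rw [coe_add, coe_arcCoord, coe_arcCoord]; abel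
  have m1 : ∀ θ, θ ∈ cIcc α β ↔ ∃ x ∈ Icc 0 (arcCoord (β - α)), θ = ↑(arcCoord α + x) := by
    intro θ
    conv_lhs => rw [← ea, ← eb]
    exact mem_cIcc_coe l1
  have m2 : ∀ θ, θ ∈ cIcc α' β' ↔ ∃ x ∈ Icc 0 (arcCoord (β' - α')), θ = ↑(arcCoord α' + x) := by
    intro θ
    conv_lhs => rw [← ea', ← eb']
    exact mem_cIcc_coe l2
  rcases hc with hc | hc
  · obtain ⟨x, hx0, hx1, hx2, hxα, hxβ⟩ := exists_mem_arc_ne (s := arcCoord α) l1.1 l2.1 α β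
    exact ⟨_, (m1 _).2 ⟨x, ⟨hx0.le, hx1.le⟩, rfl⟩, (m2 _).2 ⟨x, ⟨hx0.le, hx2.le⟩, by rw [hc]⟩, hxα, hxβ⟩
  · obtain ⟨x, hx0, hx1, hx2, hxα, hxβ⟩ := exists_mem_arc_ne (s := arcCoord (-β)) l1.1 l2.1 (-α) (-β)
    have e : ↑(arcCoord (-β) + x) = -(β - x) := by rw [coe_add, coe_arcCoord]; abel
    rw [e] at hxα hxβ; refine ⟨β - x, (m1 _).2 ⟨arcCoord (β - α) - x, (by grind), ?_⟩,
      (m2 _).2 ⟨arcCoord (β' - α') - x, (by grind), ?_⟩, fun h => hxα (by rw [h]), fun h => hxβ (by rw [h])⟩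
    · rw [← add_sub_assoc, coe_sub, eb]
    · rw [← add_sub_assoc, coe_sub, eb', hc]

end Rect

namespace Diagram
variable (D : Diagram)

/-- Two rectangles with a common vertex are in opposite quadrants at it. -/
lemma opposite (h₁ : r₁ ∈ D.rects) (h₂ : r₂ ∈ D.rects) (hne : r₁ ≠ r₂) {v : Torus}
    (hv₁ : v ∈ r₁.vertices) (hv₂ : v ∈ r₂.vertices) :
    (v.1 = r₁.θ₁ ↔ v.1 = r₂.θ₂) ∧ (v.2 = r₁.φ₁ ↔ v.2 = r₂.φ₂) := by
  have hnc : ¬ (r₁.Cross r₂ ∨ r₂.Cross r₁) := by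
    rintro (h | h)
    · exact h.ends_ne (Rect.mem_vertices.1 hv₁).2 (Rect.mem_vertices.1 hv₂).2
    · exact h.ends_ne (Rect.mem_vertices.1 hv₂).2 (Rect.mem_vertices.1 hv₁).2
  have hall : ∀ w ∈ r₁.carrier, w ∈ r₂.carrier → w ∈ r₁.vertices := fun w hw hw' =>
    ((D.vertex_or_cross h₁ h₂ hne hw hw').resolve_right hnc).1
  have hc₁ := r₁.vertices_subset hv₁; have hc₂ := r₂.vertices_subset hv₂
  have nθ : ¬ (r₁.θ₁ = r₂.θ₁ ∨ r₁.θ₂ = r₂.θ₂) := fun hc => by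
    obtain ⟨θ, m1, m2, n1, n2⟩ := Rect.exists_common_mem r₁.hθ r₂.hθ hc
    rcases (Rect.mem_vertices.1 (hall (θ, v.2) ⟨m1, hc₁.2⟩ ⟨m2, hc₂.2⟩)).1 with h | h
    · exact n1 h
    · exact n2 h
  have nφ : ¬ (r₁.φ₁ = r₂.φ₁ ∨ r₁.φ₂ = r₂.φ₂) := fun hc => by
    obtain ⟨θ, m1, m2, n1, n2⟩ := Rect.exists_common_mem r₁.hφ r₂.hφ hc
    rcases (Rect.mem_vertices.1 (hall (v.1, θ) ⟨hc₁.1, m1⟩ ⟨hc₂.1, m2⟩)).2 with h | h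
    · exact n1 h
    · exact n2 h
  push Not at nθ nφ
  have a1 := (Rect.mem_vertices.1 hv₁); have a2 := (Rect.mem_vertices.1 hv₂); grind

end Diagram

namespace Split
variable (S : Split)

lemma mem_tile_iff (P : Profile a b) (hz : S.z q ≠ 0) (hw : S.w q ≠ 0) :
    q ∈ S.tile K s t P ↔ ‖S.z q‖ ^ 2 + ‖S.w q‖ ^ 2 = 1 ∧ ∃ x ∈ Icc 0 a, ∃ y ∈ Icc 0 b,
      (arg (S.z q) : Angle) = (t + y : ℝ) ∧ (arg (S.w q) : Angle) = (s + x : ℝ) ∧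
      ‖S.z q‖ ^ K * P.B.fn y = ‖S.w q‖ ^ K * P.C.fn x := by simp only [← eq_norm_mul_exp_iff hz, ← eq_norm_mul_exp_iff hw]; rfl

end Split

/-- The angular coordinates of a point that is not on the two core circles. -/
def proj (q : E4) : Torus := (arg (std.w q), arg (std.z q))

lemma proj_mem_carrier (hκ : 0 ≤ κ) (hz : std.z q ≠ 0) (hw : std.w q ≠ 0) (hq : q ∈ tile κ r) : proj q ∈ r.carrier := by
  obtain ⟨P⟩ := exists_profile r.a_mem.1 r.b_mem.1; rw [r.tile_eq hκ P, std.mem_tile_iff P hz hw] at hq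
  obtain ⟨-, x, hx, y, hy, h1, h2, -⟩ := hq; exact ⟨r.mem_cIcc_θ.2 ⟨x, hx, h2⟩, r.mem_cIcc_φ.2 ⟨y, hy, h1⟩⟩

lemma not_cross_of_mem_tile (hκ : 0 ≤ κ) (hz : std.z q ≠ 0)
    (hw : std.w q ≠ 0) (h₁ : q ∈ tile κ r₁) (h₂ : q ∈ tile κ r₂) : ¬ r₁.Cross r₂ := by
  rintro ⟨d, e, hd, hd', he, he', hde, hee⟩; obtain ⟨P₁⟩ := exists_profile r₁.a_mem.1 r₁.b_mem.1
  obtain ⟨P₂⟩ := exists_profile r₂.a_mem.1 r₂.b_mem.1; rw [r₁.tile_eq hκ P₁, std.mem_tile_iff P₁ hz hw] at h₁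
  rw [r₂.tile_eq hκ P₂, std.mem_tile_iff P₂ hz hw] at h₂; obtain ⟨-, x₁, hx₁, y₁, hy₁, a1, b1, e1⟩ := h₁
  obtain ⟨-, x₂, hx₂, y₂, hy₂, a2, b2, e2⟩ := h₂
  have i1 := r₁.a_mem; have i2 := r₂.b_mem; have i3 := r₂.a_mem; have i4 := r₁.b_mem; have ey : y₂ = y₁ + e := by
    refine coe_eq_coe_of_mem ⟨hy₂.1, by grind⟩ (by grind) ?_; rw [a1] at a2
    rw [coe_add, coe_add, Rect.coe_t, Rect.coe_t, hee, add_assoc] at a2; rw [coe_add, add_comm, ← add_left_cancel a2]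
  have ex : x₁ = x₂ + d := by
    refine coe_eq_coe_of_mem ⟨hx₁.1, by grind⟩ (by grind) ?_; rw [b1] at b2
    rw [coe_add, coe_add, Rect.coe_s, Rect.coe_s, hde, add_assoc] at b2; rw [coe_add, add_comm, add_left_cancel b2]
  have hlt := P₁.cross_lt P₂ hd hd' he he' hx₂ hy₁; rw [ey] at e2; rw [ex] at e1
  have p1 : 0 < ‖std.z q‖ ^ (2 + κ) := by positivity
  have p2 : 0 < ‖std.w q‖ ^ (2 + κ) := by positivity
  have := mul_lt_mul_of_pos_left hlt (mul_pos p1 p2); refine this.ne ?_; grind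

/-- A point that is not on the core circles belongs to two tiles only if it lies over a common vertex. -/
lemma Diagram.proj_mem_vertices (D : Diagram) (hκ : 0 ≤ κ) (m₁ : r₁ ∈ D.rects)
    (m₂ : r₂ ∈ D.rects) (hne : r₁ ≠ r₂) (hz : std.z q ≠ 0) (hw : std.w q ≠ 0)
    (h₁ : q ∈ tile κ r₁) (h₂ : q ∈ tile κ r₂) : proj q ∈ r₁.vertices ∧ proj q ∈ r₂.vertices := by
  refine (D.vertex_or_cross m₁ m₂ hne (proj_mem_carrier hκ hz hw h₁) (proj_mem_carrier hκ hz hw h₂)).resolve_right ?_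
  rintro (h | h)
  · exact not_cross_of_mem_tile hκ hz hw h₁ h₂ h
  · exact not_cross_of_mem_tile hκ hz hw h₂ h₁ h

/-! ### Charts of surfaces with corners -/

/-- The planar sector of angle `β`. -/
def InSector (β x y : ℝ) : Prop := ∃ ρ : ℝ, 0 ≤ ρ ∧ ∃ a ∈ Icc 0 β, x = ρ * cos a ∧ y = ρ * sin a

lemma mem_flatSector_iff {y : E4} : y ∈ flatSector β ↔ InSector β (y 0) (y 1) ∧ y 2 = 0 ∧ y 3 = 0 := by
  constructor
  · rintro ⟨ρ, hρ, a, ha, rfl⟩; exact ⟨⟨ρ, hρ, a, ha, by simp, by simp⟩, by simp, by simp⟩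
  · rintro ⟨⟨ρ, hρ, a, ha, h1, h2⟩, h3, h4⟩; refine ⟨ρ, hρ, a, ha, ?_⟩
    ext i
    fin_cases i <;> simp [h1, h2, h3, h4]

lemma inSector_two_pi (x y : ℝ) : InSector (2 * π) x y := by
  set u : ℂ := ⟨x, y⟩ with hu; have hm : toIcoMod two_pi_pos 0 u.arg ∈ Ico 0 (0 + 2 * π) := toIcoMod_mem_Ico _ _ _
  have he : ↑(toIcoMod two_pi_pos 0 u.arg) = (u.arg : Angle) :=
    (angle_eq_iff_two_pi_dvd_sub.2 ⟨-toIcoDiv two_pi_pos 0 u.arg, by rw [toIcoMod]; push_cast; simp; ring⟩)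
  refine ⟨‖u‖, norm_nonneg _, _, ⟨hm.1, by grind⟩, ?_, ?_⟩
  · rw [← cos_coe, he, cos_coe, Complex.norm_mul_cos_arg]
  · rw [← sin_coe, he, sin_coe, Complex.norm_mul_sin_arg]

lemma inSector_pi_iff : InSector π x y ↔ 0 ≤ y := by
  constructor
  · rintro ⟨ρ, hρ, a, ha, -, rfl⟩; exact mul_nonneg hρ (sin_nonneg_of_mem_Icc ha)
  · intro hy; refine ⟨‖(⟨x, y⟩ : ℂ)‖, norm_nonneg _, arg ⟨x, y⟩, ⟨Complex.arg_nonneg_iff.2 hy, Complex.arg_le_pi _⟩, ?_, ?_⟩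
    · simp
    simp

lemma InSector.smul (hc : 0 ≤ c) (h : InSector β x y) : InSector β (c * x) (c * y) := by
  obtain ⟨ρ, hρ, a, ha, rfl, rfl⟩ := h; exact ⟨c * ρ, mul_nonneg hc hρ, a, ha, by ring, by ring⟩

/-- The map to four-space with given coordinates. -/
def coordMap (f : Fin 4 → E4 → ℝ) (q : E4) : E4 := WithLp.toLp 2 fun i => f i q

lemma exists_coord_equiv {l : Fin 4 → E4 →L[ℝ] ℝ} (inj : ∀ v, (∀ i, l i v = 0) → v = 0) :
    ∃ e : E4 ≃L[ℝ] E4, ∀ v i, e v i = l i v := by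
  set L : E4 →ₗ[ℝ] E4 :=
    { toFun := fun v => WithLp.toLp 2 fun i => l i v
      map_add' := fun u v => by ext i; simp
      map_smul' := fun c v => by ext i; simp } with hL
  have hinj : Function.Injective L := by
    rw [injective_iff_map_eq_zero]; intro v hv; exact inj v fun i => congrFun (congrArg WithLp.ofLp hv) i
  exact ⟨(LinearEquiv.ofInjectiveEndo L hinj).toContinuousLinearEquiv, fun v i => rfl⟩

lemma tangentCone_flatSector {y : E4} (hy : y ∈ flatSector β) : y ∈ tangentConeAt ℝ (flatSector β) 0 := by
  have h0 : Tendsto (fun n : ℕ => ((n : ℝ) + 1)⁻¹) atTop (𝓝 0) := tendsto_inv_atTop_zero.comp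
    (tendsto_atTop_add_const_right _ _ tendsto_natCast_atTop_atTop)
  refine mem_tangentConeAt_of_seq (α := ℕ) atTop (fun n => (n : ℝ) + 1) (fun n => ((n : ℝ) + 1)⁻¹ • y) ?_ ?_ ?_
  · simpa using h0.smul_const y
  · refine .of_forall fun n => ?_; obtain ⟨h1, h2, h3⟩ := mem_flatSector_iff.1 hy; rw [zero_add]
    refine mem_flatSector_iff.2 ⟨?_, by simp [h2], by simp [h3]⟩; simpa using h1.smul (c := ((n : ℝ) + 1)⁻¹) (by positivity)
  · refine tendsto_const_nhds.congr fun n => ?_; rw [smul_smul, mul_inv_cancel₀ (by positivity), one_smul]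

lemma mem_span_flatSector (hβ : 0 < β) {y : E4} (h2 : y 2 = 0) (h3 : y 3 = 0) : y ∈ Submodule.span ℝ (flatSector β) := by
  set b := min β (π / 2) with hb; have hb0 : 0 < b := by rw [hb]; positivity
  have hs : 0 < sin b := sin_pos_of_pos_of_lt_pi hb0 (by simp_all)
  have m1 : (!₂[1, 0, 0, 0] : E4) ∈ flatSector β := ⟨1, zero_le_one, 0, ⟨le_rfl, hβ.le⟩, by simp⟩
  have m2 : (!₂[cos b, sin b, 0, 0] : E4) ∈ flatSector β := ⟨1, zero_le_one, b, ⟨hb0.le, min_le_left _ _⟩, by simp⟩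
  have : y = (y 0 - y 1 / sin b * cos b) • (!₂[1, 0, 0, 0] : E4) + (y 1 / sin b) • (!₂[cos b, sin b, 0, 0] : E4) := by
    ext i
    fin_cases i <;> simp [h2, h3, hs.ne']
  rw [this]; exact Submodule.add_mem _ (Submodule.smul_mem _ _ (Submodule.subset_span m1))
    (Submodule.smul_mem _ _ (Submodule.subset_span m2))

/-- A set that is a sector in `C¹` coordinates is a surface with corners there, and its tangent plane
is given by the differentials of the transverse coordinates. -/
lemma sector_of_coords (hβ : 0 < β) {f : Fin 4 → E4 → ℝ}
    {l : Fin 4 → E4 →L[ℝ] ℝ} (hf : ∀ i, ContDiffAt ℝ 1 (f i) p) (hl : ∀ i, HasFDerivAt (f i) (l i) p)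
    (h0 : ∀ i, f i p = 0) (inj : ∀ v, (∀ i, l i v = 0) → v = 0)
    (hF : ∀ᶠ q in 𝓝 p, q ∈ F ↔ InSector β (f 0 q) (f 1 q) ∧ f 2 q = 0 ∧ f 3 q = 0) :
    IsSectorNear F p β ∧ ∀ v, v ∈ tangentPlane F p ↔ l 2 v = 0 ∧ l 3 v = 0 := by
  obtain ⟨e, he⟩ := exists_coord_equiv inj; have hc : ContDiffAt ℝ 1 (coordMap f) p := by fun_prop
  have hd : HasFDerivAt (coordMap f) (e : E4 →L[ℝ] E4) p := by
    refine (hasFDerivWithinAt_univ.symm.trans (hasFDerivWithinAt_euclidean)).2 fun i => ?_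
    refine ((hl i).congr_fderiv ?_).hasFDerivWithinAt; ext v; simp [← he v i]
  have hp0 : coordMap f p = 0 := by ext i; exact h0 i
  set Φ := hc.toOpenPartialHomeomorph (coordMap f) hd one_ne_zero with hΦ
  have hΦc : (Φ : E4 → E4) = coordMap f := hc.toOpenPartialHomeomorph_coe hd one_ne_zero
  have hps : p ∈ Φ.source := hc.mem_toOpenPartialHomeomorph_source hd one_ne_zero
  have hsymm : ContDiffAt ℝ 1 Φ.symm (coordMap f p) := hc.to_localInverse hd one_ne_zero
  have hsd : HasFDerivAt Φ.symm (e.symm : E4 →L[ℝ] E4) 0 := by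
    have h1 : Φ.symm 0 = p := by rw [← hp0, ← hΦc]; exact Φ.left_inv hps
    have h0t : (0 : E4) ∈ Φ.target := by rw [← hp0, ← hΦc]; exact Φ.map_source hps
    exact Φ.hasFDerivAt_symm h0t (by rw [h1, hΦc]; exact hd)
  set A : Set E4 := {q | ContDiffAt ℝ 1 (coordMap f) q ∧ (q ∈ F ↔ coordMap f q ∈ flatSector β) ∧
    ContDiffAt ℝ 1 Φ.symm (coordMap f q)} with hA
  have hF' : ∀ᶠ q in 𝓝 p, q ∈ F ↔ coordMap f q ∈ flatSector β := by
    filter_upwards [hF] with q hq; rw [hq, mem_flatSector_iff]; rfl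
  have hAn : A ∈ 𝓝 p := by
    filter_upwards [hc.eventually (by simp), hF', hc.continuousAt.eventually (hsymm.eventually (by simp))]
      with q h1 h2 h3 using ⟨h1, h2, h3⟩
  constructor
  · refine ⟨Φ.restr A, ?_, ?_, ?_, ?_, ?_⟩
    · rw [Φ.restr_source]; exact ⟨hps, mem_interior_iff_mem_nhds.2 hAn⟩
    · simp [OpenPartialHomeomorph.restr_apply, hΦc, hp0]
    · intro q hq; rw [Φ.restr_source] at hq; have := (interior_subset hq.2 : q ∈ A).1
      have e : (Φ.restr A : E4 → E4) = coordMap f := hΦc; rw [e]; exact this.contDiffWithinAt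
    · intro y hy; have hs := (Φ.restr A).map_target hy; rw [Φ.restr_source] at hs
      have h1 := (interior_subset hs.2 : _ ∈ A).2.2; have h2 : coordMap f ((Φ.restr A).symm y) = y := by
        have := (Φ.restr A).right_inv hy; rwa [OpenPartialHomeomorph.restr_apply, hΦc] at this
      rw [h2] at h1; exact h1.contDiffWithinAt
    · intro q hq; rw [Φ.restr_source] at hq; have := (interior_subset hq.2 : q ∈ A).2.1
      rw [OpenPartialHomeomorph.restr_apply, hΦc]; exact this
  · intro v; constructor
    · intro hv; have hz : ∀ i, (∀ᶠ q in 𝓝 p, q ∈ F → f i q = 0) → ∀ v ∈ tangentConeAt ℝ F p, l i v = 0 := fun i hi v hv => by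
        rw [← tangentConeAt_inter_nhds hi] at hv
        have h1 := tangentConeAt_mono (t := {0}) (by rintro _ ⟨q, hq, rfl⟩; exact hq.2 hq.1)
          ((hl i).hasFDerivWithinAt.mapsTo_tangent_cone hv)
        rw [h0] at h1; exact tangentConeAt_subset_zero (fun h => h.ne (by rw [nhdsWithin, inf_assoc, inf_principal]; simp)) h1
      have : Submodule.span ℝ (tangentConeAt ℝ F p) ≤ LinearMap.ker (l 2).toLinearMap ⊓ LinearMap.ker (l 3).toLinearMap :=
        Submodule.span_le.2 fun v hv => ⟨hz 2 (hF.mono fun q hq h => (hq.1 h).2.1) v hv,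
          hz 3 (hF.mono fun q hq h => (hq.1 h).2.2) v hv⟩
      exact ⟨(this hv).1, (this hv).2⟩
    · rintro ⟨h2, h3⟩; have hw : e v ∈ Submodule.span ℝ (flatSector β) := mem_span_flatSector hβ (by rw [he, h2]) (by rw [he, h3])
      have hmaps : ∀ y ∈ flatSector β, e.symm y ∈ tangentConeAt ℝ F p := by
        intro y hy; have h1 := tangentCone_flatSector hy; set V : Set E4 := {y | y ∈ Φ.target ∧ Φ.symm y ∈ A} with hV
        have h1p : Φ.symm 0 = p := by rw [← hp0, ← hΦc]; exact Φ.left_inv hps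
        have h0t : (0 : E4) ∈ Φ.target := by rw [← hp0, ← hΦc]; exact Φ.map_source hps
        have hVn : V ∈ 𝓝 (0 : E4) := by
          have c1 := hsd.continuousAt.tendsto; rw [h1p] at c1
          filter_upwards [Φ.open_target.mem_nhds h0t, c1 hAn] with y h1 h2 using ⟨h1, h2⟩
        rw [← tangentConeAt_inter_nhds hVn] at h1
        have h2 := (hsd.hasFDerivWithinAt (s := flatSector β ∩ V)).mapsTo_tangent_cone h1; rw [h1p] at h2
        refine tangentConeAt_mono ?_ h2; rintro _ ⟨y, ⟨hy1, hy2, hy3⟩, rfl⟩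
        have e1 : coordMap f (Φ.symm y) = y := by rw [← hΦc]; exact Φ.right_inv hy2
        exact hy3.2.1.2 (by rw [e1]; exact hy1)
      have : Submodule.span ℝ (flatSector β) ≤ (Submodule.span ℝ (tangentConeAt ℝ F p)).comap
          (e.symm : E4 →L[ℝ] E4).toLinearMap :=
        Submodule.span_le.2 fun y hy => Submodule.subset_span (hmaps y hy)
      have h4 := this hw; simpa [tangentPlane] using h4

/-! ### Boundary corners -/

lemma isClosed_flatSector : IsClosed (flatSector β) := by
  refine isClosed_of_closure_subset fun y hy => ?_; obtain ⟨x, hx, hxy⟩ := mem_closure_iff_seq_limit.1 hy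
  choose ρ hρ a ha he using hx; have hn : ∀ n, ‖x n‖ = ρ n := fun n => by
    rw [he, EuclideanSpace.norm_eq, sqrt_eq_iff_eq_sq (by positivity) (hρ n)]; simp [Fin.sum_univ_four, mul_pow, ← mul_add]
  obtain ⟨b, hb, φ, hφ, ht⟩ := isCompact_Icc.tendsto_subseq ha
  have hc : Continuous fun p : ℝ × ℝ => (!₂[p.1 * cos p.2, p.1 * sin p.2, 0, 0] : E4) :=
    (PiLp.continuous_toLp 2 _).comp (continuous_pi fun i => by fun_prop)
  have h1 := hxy.comp hφ.tendsto_atTop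
  refine ⟨‖y‖, norm_nonneg y, b, hb, tendsto_nhds_unique h1 (((hc.tendsto _).comp (h1.norm.prodMk_nhds ht)).congr fun n => ?_)⟩
  simp_all

lemma flatSector_smul (hc : 0 ≤ c) {y : E4} (hy : y ∈ flatSector β) : c • y ∈ flatSector β := by
  obtain ⟨h1, h2, h3⟩ := mem_flatSector_iff.1 hy
  exact mem_flatSector_iff.2 ⟨by simpa using h1.smul hc, by simp [h2], by simp [h3]⟩

lemma sector_linear_maps {T : E4 → E4} {L : E4 →L[ℝ] E4} (hT : HasFDerivAt T L 0) (hT0 : T 0 = 0)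
    (h : ∀ᶠ y in 𝓝 (0 : E4), y ∈ flatSector β → T y ∈ flatSector β') {y : E4} (hy : y ∈ flatSector β) :
    L y ∈ flatSector β' := by
  have hε : Tendsto (fun n : ℕ => ((n : ℝ) + 1)⁻¹) atTop (𝓝 0) := tendsto_inv_atTop_zero.comp
    (tendsto_atTop_add_const_right _ _ tendsto_natCast_atTop_atTop)
  have hεy : Tendsto (fun n : ℕ => ((n : ℝ) + 1)⁻¹ • y) atTop (𝓝 0) := by simpa using hε.smul_const y
  have h3 := hT.hasFDerivWithinAt (s := univ).lim (c := fun n : ℕ => (n : ℝ) + 1) hεy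
    (.of_forall fun _ => mem_univ _) (v := y) (by
      refine tendsto_const_nhds.congr fun n => ?_; rw [smul_smul, mul_inv_cancel₀ (by positivity), one_smul])
  refine isClosed_flatSector.mem_of_tendsto h3 ?_; filter_upwards [hεy.eventually h] with n hn
  rw [hT0, sub_zero, zero_add]; exact flatSector_smul (by positivity) (hn (flatSector_smul (by positivity) hy))

lemma inSector_cos_sin (hβ : β < 2 * π) (ha : a ∈ Ico 0 (2 * π)) : InSector β (cos a) (sin a) ↔ a ≤ β := by
  constructor
  · rintro ⟨ρ, hρ, a', ha', h1, h2⟩; have h3 : ρ ^ 2 = 1 := by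
      have := cos_sq_add_sin_sq a; rw [h1, h2, mul_pow, mul_pow, ← mul_add, cos_sq_add_sin_sq, mul_one] at this; exact this
    have h4 : ρ = 1 := by nlinarith
    rw [h4, one_mul] at h1 h2; have := coe_eq_coe_of_mem ha ⟨ha'.1, ha'.2.trans_lt hβ⟩ (Angle.cos_sin_inj h1 h2)
    rw [this]; exact ha'.2
  · intro h; exact ⟨1, zero_le_one, a, ⟨ha.1, h⟩, by simp, by simp⟩

/-- The unit vector of the plane of sectors in a given direction. -/
def sectorDir (a : ℝ) : E4 := !₂[cos a, sin a, 0, 0]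

lemma sectorDir_mem (hβ : β < 2 * π) (ha : a ∈ Ico 0 (2 * π)) : sectorDir a ∈ flatSector β ↔ a ≤ β := by
  rw [mem_flatSector_iff, ← inSector_cos_sin hβ ha]; simp [sectorDir]

lemma linear_sector_ne (hβ : β = π ∨ β = 2 * π) (hβ' : β' ∈ Ioo 0 (2 * π))
    (hne : β' ≠ π) {L M : E4 →L[ℝ] E4} (hL : ∀ y ∈ flatSector β, L y ∈ flatSector β')
    (hM : ∀ y ∈ flatSector β', M y ∈ flatSector β) (hML : ∀ y, M (L y) = y) (hLM : ∀ y, L (M y) = y) : False := by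
  obtain ⟨h0, h2⟩ := hβ'; have hpi := pi_pos
  have mem : ∀ {y : E4}, y ∈ flatSector β ↔ (β = π → 0 ≤ y 1) ∧ y 2 = 0 ∧ y 3 = 0 := fun {y} => by
    rw [mem_flatSector_iff]; rcases hβ with rfl | rfl
    · rw [inSector_pi_iff]; simp
    · simp [inSector_two_pi, hpi.ne']
  rcases lt_or_gt_of_ne hne with hlt | hgt
  · have pos : ∀ y ∈ flatSector β', y ≠ 0 → 0 < y 0 * cos (β' / 2) + y 1 * sin (β' / 2) := by
      rintro _ ⟨ρ, hρ, a, ha, rfl⟩ h; have hρ0 : 0 < ρ := hρ.lt_of_ne fun h' => h (by rw [← h']; ext i; fin_cases i <;> simp)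
      have : 0 < ρ * cos (a - β' / 2) := mul_pos hρ0 (cos_pos_of_mem_Ioo (by grind)); rw [cos_sub] at this; simp; linarith
    have hd : L (sectorDir 0) ≠ 0 := fun h => by
      have := congrArg (fun v : E4 => v 0) (hML (sectorDir 0)); rw [h, map_zero] at this; simp [sectorDir] at this
    have h1 := pos _ (hL _ (mem.2 (by simp [sectorDir]))) hd
    have h2 := pos (L (-sectorDir 0)) (hL _ (mem.2 (by simp [sectorDir]))) (by rwa [map_neg, neg_ne_zero]); simp at h2; linarith
  · have m : ∀ a, 0 ≤ a → a ≤ β' → M (sectorDir a) ∈ flatSector β := fun a h h' =>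
      hM _ ((sectorDir_mem h2 ⟨h, h'.trans_lt h2⟩).2 h')
    have h3 : M (sectorDir 0) + M (sectorDir β') ∈ flatSector β := by
      have h4 := mem.1 (m 0 le_rfl h0.le); have h5 := mem.1 (m β' h0.le le_rfl)
      exact mem.2 ⟨fun h => add_nonneg (h4.1 h) (h5.1 h), by simp [h4, h5], by simp [h4, h5]⟩
    have h4 := hL _ h3; have hc : cos (β' / 2) < 0 := cos_neg_of_pi_div_two_lt_of_lt (by linarith) (by linarith)
    have e : sectorDir 0 + sectorDir β' = (-(2 * cos (β' / 2))) • sectorDir (β' / 2 + π) := by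
      have e1 : cos β' = 2 * cos (β' / 2) ^ 2 - 1 := by rw [← cos_two_mul]; ring_nf
      have e2 : sin β' = 2 * sin (β' / 2) * cos (β' / 2) := by rw [← sin_two_mul]; ring_nf
      ext i
      fin_cases i <;> simp [sectorDir, e1, e2] <;> ring
    rw [map_add, hLM, hLM, e] at h4; have h5 := flatSector_smul (inv_nonneg.2 (by linarith : 0 ≤ -(2 * cos (β' / 2)))) h4
    rw [smul_smul, inv_mul_cancel₀ (by linarith), one_smul, sectorDir_mem h2 (by grind)] at h5; linarith

lemma fderiv_symm_fderiv (Φ : OpenPartialHomeomorph E4 E4) (hp : p ∈ Φ.source) (h1 : DifferentiableAt ℝ Φ p)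
    (h2 : DifferentiableAt ℝ Φ.symm (Φ p)) (v : E4) : fderiv ℝ Φ.symm (Φ p) (fderiv ℝ Φ p v) = v :=
  DFunLike.congr_fun ((h2.hasFDerivAt.comp p h1.hasFDerivAt).unique
    ((hasFDerivAt_id p).congr_of_eventuallyEq (Φ.eventually_left_inverse hp))) v

lemma not_isBoundaryCorner (hβ : β = π ∨ β = 2 * π)
    (h : IsSectorNear F p β) : ¬ IsBoundaryCorner F p := by
  rintro ⟨-, β', hβ', hne, Ψ, hpΨ, hΨ0, hΨ1, hΨ2, hΨF⟩; obtain ⟨Φ, hpΦ, hΦ0, hΦ1, hΦ2, hΦF⟩ := h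
  have inv : ∀ {Φ : OpenPartialHomeomorph E4 E4}, p ∈ Φ.source → Φ p = 0 → 0 ∈ Φ.target ∧ Φ.symm 0 = p :=
    fun {Φ} h h0 => ⟨h0 ▸ Φ.map_source h, h0 ▸ Φ.left_inv h⟩
  have diff : ∀ {Φ Ψ : OpenPartialHomeomorph E4 E4}, p ∈ Φ.source → Φ p = 0 → ContDiffOn ℝ 1 Φ.symm Φ.target →
      p ∈ Ψ.source → ContDiffOn ℝ 1 Ψ Ψ.source → DifferentiableAt ℝ (Ψ ∘ Φ.symm) 0 := fun {Φ Ψ} h h0 h1 h' h2 =>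
    DifferentiableAt.comp 0 (by rw [(inv h h0).2]; exact (h2.contDiffAt (Ψ.open_source.mem_nhds h')).differentiableAt one_ne_zero)
      ((h1.contDiffAt (Φ.open_target.mem_nhds (inv h h0).1)).differentiableAt one_ne_zero)
  set T := Φ.symm.trans Ψ with hT; have h0 : (0 : E4) ∈ T.source := by simp_all
  have T0 : T 0 = 0 := by simp_all
  have T0' : T.symm 0 = 0 := by simp_all
  have d : DifferentiableAt ℝ T 0 := by simp_all
  have d' : DifferentiableAt ℝ T.symm 0 := by simp_all
  have h0' : (0 : E4) ∈ T.target := by simp_all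
  have hTF : ∀ y ∈ T.source, (y ∈ flatSector β ↔ T y ∈ flatSector β') := fun y hy => by
    rw [hT, OpenPartialHomeomorph.trans_source] at hy
    rw [← Φ.right_inv hy.1, ← hΦF _ (Φ.map_target hy.1), hΨF _ hy.2, Φ.right_inv hy.1]; rfl
  refine linear_sector_ne hβ hβ' hne
    (fun y hy => sector_linear_maps d.hasFDerivAt T0 ?_ hy) (fun y hy => sector_linear_maps d'.hasFDerivAt T0' ?_ hy)
    (fun v => ?_) (fun v => ?_)
  · filter_upwards [T.open_source.mem_nhds h0] with y hy using (hTF y hy).1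
  · filter_upwards [T.open_target.mem_nhds h0'] with y hy h; simp_all
  · simpa only [T0] using fderiv_symm_fderiv T h0 d (by rwa [T0]) v
  · simpa only [T0', T.symm_symm] using fderiv_symm_fderiv T.symm h0' d' (by rwa [T0', T.symm_symm]) v

open Complex (slitPlane normSq_eq_norm_sq slitPlane_ne_zero log_re)
/-! ### Angular coordinates on four-space -/

namespace Split
variable (S : Split)

/-- The angle of the second complex coordinate relative to `w₀`. -/
def X (w₀ : ℂ) (q : E4) : ℝ := (Complex.log (S.w q / w₀)).im
/-- The angle of the first complex coordinate relative to `z₀`. -/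
def Y (z₀ : ℂ) (q : E4) : ℝ := (Complex.log (S.z q / z₀)).im
/-- The logarithm of the ratio of the two radii. -/
def lam (q : E4) : ℝ := log ‖S.w q‖ - log ‖S.z q‖

/-- The angular form of the second coordinate. -/
def dθ (q : E4) : E4 →L[ℝ] ℝ := Complex.imCLM.comp ((S.w q)⁻¹ • S.w)
/-- The angular form of the first coordinate. -/
def dφ (q : E4) : E4 →L[ℝ] ℝ := Complex.imCLM.comp ((S.z q)⁻¹ • S.z)
/-- The differential of `lam`. -/
def dlam (q : E4) : E4 →L[ℝ] ℝ := Complex.reCLM.comp ((S.w q)⁻¹ • S.w) - Complex.reCLM.comp ((S.z q)⁻¹ • S.z)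

lemma dθ_apply (q v : E4) : S.dθ q v = ((S.w q)⁻¹ * S.w v).im := rfl
lemma dφ_apply (q v : E4) : S.dφ q v = ((S.z q)⁻¹ * S.z v).im := rfl
lemma dlam_apply (q v : E4) : S.dlam q v = ((S.w q)⁻¹ * S.w v).re - ((S.z q)⁻¹ * S.z v).re := rfl

variable {S}

lemma ne_zero_of_slit {u u₀ : ℂ} (h : u / u₀ ∈ slitPlane) : u ≠ 0 ∧ u₀ ≠ 0 := by have := slitPlane_ne_zero h; simp_all

lemma hasFDerivAt_log (h : S.w q / w₀ ∈ slitPlane) : HasFDerivAt (fun q => Complex.log (S.w q / w₀)) ((S.w q)⁻¹ • S.w) q := by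
  obtain ⟨h1, h2⟩ := ne_zero_of_slit h; have h3 : HasFDerivAt (fun q => S.w q / w₀) (w₀⁻¹ • S.w) q := by
    refine ((S.w.hasFDerivAt (x := q)).const_mul w₀⁻¹).congr_of_eventuallyEq ?_; exact .of_forall fun p => div_eq_inv_mul _ _
  have h4 := ((Complex.hasDerivAt_log h).hasFDerivAt.restrictScalars ℝ).comp q h3; refine h4.congr_fderiv ?_; ext v
  simp; field_simp

lemma contDiffAt_log (h : S.w q / w₀ ∈ slitPlane) (n : WithTop ℕ∞) : ContDiffAt ℝ n (fun q => Complex.log (S.w q / w₀)) q := by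
  have h1 : ContDiffAt ℝ n (fun q => S.w q / w₀) q := by fun_prop
  exact ((Complex.contDiffAt_log h).restrict_scalars ℝ).comp q h1

lemma hasFDerivAt_X (h : S.w q / w₀ ∈ slitPlane) : HasFDerivAt (S.X w₀) (S.dθ q) q :=
  Complex.imCLM.hasFDerivAt.comp q (hasFDerivAt_log h)

lemma contDiffAt_X (h : S.w q / w₀ ∈ slitPlane) {n : WithTop ℕ∞} : ContDiffAt ℝ n (S.X w₀) q :=
  Complex.imCLM.contDiff.contDiffAt.comp q (contDiffAt_log h n)

lemma hasFDerivAt_Y (h : S.z q / z₀ ∈ slitPlane) : HasFDerivAt (S.Y z₀) (S.dφ q) q := S.swap.hasFDerivAt_X h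

lemma contDiffAt_Y (h : S.z q / z₀ ∈ slitPlane) {n : WithTop ℕ∞} : ContDiffAt ℝ n (S.Y z₀) q := S.swap.contDiffAt_X h

lemma logNorm_eventuallyEq (h : S.w q ≠ 0) : (fun p => log ‖S.w p‖) =ᶠ[𝓝 q]
    fun p => (Complex.log (S.w p / S.w q)).re + log ‖S.w q‖ := by
  have hc : ContinuousAt (fun p => S.w p) q := by fun_prop
  filter_upwards [hc.eventually_ne h] with p hp
  rw [log_re, norm_div, log_div (norm_ne_zero_iff.2 hp) (norm_ne_zero_iff.2 h)]; ring

lemma self_div_mem {u : ℂ} (h : u ≠ 0) : u / u ∈ slitPlane := by simp_all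

lemma hasFDerivAt_logNorm (h : S.w q ≠ 0) : HasFDerivAt (fun p => log ‖S.w p‖) (Complex.reCLM.comp ((S.w q)⁻¹ • S.w)) q :=
  ((Complex.reCLM.hasFDerivAt.comp q (hasFDerivAt_log (self_div_mem h))).add_const _).congr_of_eventuallyEq
    (logNorm_eventuallyEq h)

lemma contDiffAt_logNorm (h : S.w q ≠ 0) {n : WithTop ℕ∞} : ContDiffAt ℝ n (fun p => log ‖S.w p‖) q :=
  ((Complex.reCLM.contDiff.contDiffAt.comp q (contDiffAt_log (self_div_mem h) n)).add
    contDiffAt_const).congr_of_eventuallyEq (logNorm_eventuallyEq h)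

lemma hasFDerivAt_lam (hz : S.z q ≠ 0) (hw : S.w q ≠ 0) : HasFDerivAt S.lam (S.dlam q) q :=
  (hasFDerivAt_logNorm hw).sub (S.swap.hasFDerivAt_logNorm hz)

lemma contDiffAt_lam (hz : S.z q ≠ 0) (hw : S.w q ≠ 0) {n : WithTop ℕ∞} : ContDiffAt ℝ n S.lam q :=
  (contDiffAt_logNorm hw).sub (S.swap.contDiffAt_logNorm hz)

lemma exp_lam (hz : S.z q ≠ 0) (hw : S.w q ≠ 0) : exp (K * S.lam q) = ‖S.w q‖ ^ K / ‖S.z q‖ ^ K := by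
  rw [rpow_def_of_pos (norm_pos_iff.2 hw), rpow_def_of_pos (norm_pos_iff.2 hz), ← exp_sub, lam]; congr 1; ring

lemma inner_eq_re (hz : S.z q ≠ 0) (hw : S.w q ≠ 0) (v : E4) : inner ℝ q v =
    ‖S.z q‖ ^ 2 * ((S.z q)⁻¹ * S.z v).re + ‖S.w q‖ ^ 2 * ((S.w q)⁻¹ * S.w v).re := by
  have key : ∀ u c : ℂ, u ≠ 0 → inner ℝ u c = ‖u‖ ^ 2 * (u⁻¹ * c).re := by
    intro u c hu; rw [Complex.inner, ← normSq_eq_norm_sq, Complex.inv_def, mul_comm ((starRingEnd ℂ) u) _]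
    simp; have : Complex.normSq u ≠ 0 := by simpa using hu
    field_simp
  rw [S.inner_eq', key _ _ hz, key _ _ hw]

lemma eq_zero_of_forms (hz : S.z q ≠ 0) (hw : S.w q ≠ 0) (h1 : S.dθ q v = 0)
    (h2 : S.dφ q v = 0) (h3 : S.dlam q v = 0) (h4 : inner ℝ q v = 0) : v = 0 := by
  rw [inner_eq_re hz hw] at h4; rw [dlam_apply] at h3; rw [dθ_apply] at h1; rw [dφ_apply] at h2
  have h5 : ((S.z q)⁻¹ * S.z v).re = 0 := by
    have e : ((S.w q)⁻¹ * S.w v).re = ((S.z q)⁻¹ * S.z v).re := by linarith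
    rw [e, ← add_mul] at h4; exact (mul_eq_zero.1 h4).resolve_left (by positivity)
  have h6 : ((S.w q)⁻¹ * S.w v).re = 0 := by linarith
  have k1 : (S.z q)⁻¹ * S.z v = 0 := Complex.ext h5 h2; have k2 : (S.w q)⁻¹ * S.w v = 0 := Complex.ext h6 h1; refine S.ext ?_ ?_
  · rw [map_zero]; exact (mul_eq_zero.1 k1).resolve_left (inv_ne_zero hz)
  · rw [map_zero]; exact (mul_eq_zero.1 k2).resolve_left (inv_ne_zero hw)

end Split

lemma hasFDerivAt_normSq_sub_one (q : E4) : HasFDerivAt (fun p : E4 => ‖p‖ ^ 2 - 1) (2 • innerSL ℝ q) q :=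
  ((hasStrictFDerivAt_norm_sq q).hasFDerivAt).sub_const 1

lemma contDiff_normSq_sub_one : ContDiff ℝ 1 (fun p : E4 => ‖p‖ ^ 2 - 1) := (contDiff_norm_sq ℝ).sub contDiff_const

/-- The equation of a surface with separated variables in the coordinates `X`, `Y`, `lam`. -/
def sepFn (S : Split) (K : ℝ) (w₀ z₀ : ℂ) (c b : ℝ → ℝ) (q : E4) : ℝ := exp (K * S.lam q) * c (S.X w₀ q) - b (S.Y z₀ q)

/-- The differential of `sepFn`. -/
def sepForm (S : Split) (K : ℝ) (q : E4) (c c' b' : ℝ) : E4 →L[ℝ] ℝ :=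
  (exp (K * S.lam q) * c') • S.dθ q - b' • S.dφ q + (K * exp (K * S.lam q) * c) • S.dlam q

section Sep
variable {S : Split} {c b : ℝ → ℝ}

lemma hasFDerivAt_sepFn (hw : S.w q / w₀ ∈ slitPlane) (hz : S.z q / z₀ ∈ slitPlane)
    (hc : HasDerivAt c c' (S.X w₀ q)) (hb : HasDerivAt b b' (S.Y z₀ q)) :
    HasFDerivAt (sepFn S K w₀ z₀ c b) (sepForm S K q (c (S.X w₀ q)) c' b') q := by
  have hw0 := (Split.ne_zero_of_slit hw).1; have hz0 := (Split.ne_zero_of_slit hz).1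
  have h1 : HasFDerivAt (fun p => exp (K * S.lam p)) (exp (K * S.lam q) • (K • S.dlam q)) q :=
    ((S.hasFDerivAt_lam hz0 hw0).const_mul K).exp
  have h2 := (h1.mul (hc.comp_hasFDerivAt q (Split.hasFDerivAt_X hw))).sub (hb.comp_hasFDerivAt q (Split.hasFDerivAt_Y hz))
  refine h2.congr_fderiv ?_; ext v; simp [sepForm]; ring

lemma contDiffAt_sepFn (hw : S.w q / w₀ ∈ slitPlane) (hz : S.z q / z₀ ∈ slitPlane)
    (hc : ContDiffAt ℝ 1 c (S.X w₀ q)) (hb : ContDiffAt ℝ 1 b (S.Y z₀ q)) :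
    ContDiffAt ℝ 1 (sepFn S K w₀ z₀ c b) q := by
  have hw0 := (Split.ne_zero_of_slit hw).1; have hz0 := (Split.ne_zero_of_slit hz).1
  have h1 : ContDiffAt ℝ 1 (fun p => exp (K * S.lam p)) q := (contDiffAt_const.mul (S.contDiffAt_lam hz0 hw0)).exp
  exact (h1.mul (hc.comp q (Split.contDiffAt_X hw))).sub (hb.comp q (Split.contDiffAt_Y hz))

/-- A surface given by an equation with separated variables, possibly cut off along `X = 0`. -/
lemma sector_of_sepFn (hK : 0 < K) (hq : ‖q‖ ^ 2 = 1) (hqF : q ∈ F) (hw : S.w q / w₀ ∈ slitPlane) (hz : S.z q / z₀ ∈ slitPlane)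
    (hc : HasDerivAt c c' (S.X w₀ q)) (hb : HasDerivAt b b' (S.Y z₀ q))
    (hc1 : ContDiffAt ℝ 1 c (S.X w₀ q)) (hb1 : ContDiffAt ℝ 1 b (S.Y z₀ q))
    (h : ((∀ᶠ p in 𝓝 q, p ∈ F ↔ ‖p‖ ^ 2 = 1 ∧ sepFn S K w₀ z₀ c b p = 0) ∧ (c (S.X w₀ q) ≠ 0 ∨ b' ≠ 0)) ∨
      ∃ σ : ℝ, (σ = 1 ∨ σ = -1) ∧ S.X w₀ q = 0 ∧ b' ≠ 0 ∧
      (∀ᶠ p in 𝓝 q, p ∈ F ↔ ‖p‖ ^ 2 = 1 ∧ 0 ≤ σ * S.X w₀ p ∧ sepFn S K w₀ z₀ c b p = 0)) :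
    (∃ β, (β = π ∨ β = 2 * π) ∧ IsSectorNear F q β) ∧
    ∀ v, v ∈ tangentPlane F q ↔ inner ℝ q v = 0 ∧ sepForm S K q (c (S.X w₀ q)) c' b' v = 0 := by
  have hw0 := (Split.ne_zero_of_slit hw).1; have hz0 := (Split.ne_zero_of_slit hz).1
  have hpi := pi_pos; have dS := hasFDerivAt_sepFn (K := K) hw hz hc hb
  have cS := contDiffAt_sepFn (K := K) hw hz hc1 hb1; have dN := hasFDerivAt_normSq_sub_one q
  have cN : ContDiffAt ℝ 1 (fun p : E4 => ‖p‖ ^ 2 - 1) q := contDiff_normSq_sub_one.contDiffAt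
  have dX := Split.hasFDerivAt_X hw; have cX : ContDiffAt ℝ 1 (S.X w₀) q := Split.contDiffAt_X hw
  have dL := S.hasFDerivAt_lam hz0 hw0; have cL : ContDiffAt ℝ 1 S.lam q := S.contDiffAt_lam hz0 hw0
  have dY := Split.hasFDerivAt_Y hz; have cY : ContDiffAt ℝ 1 (S.Y z₀) q := Split.contDiffAt_Y hz
  have tp : ∀ {v : E4}, (sepForm S K q (c (S.X w₀ q)) c' b' v = 0 ∧ (2 • innerSL ℝ q) v = 0) ↔
      inner ℝ q v = 0 ∧ sepForm S K q (c (S.X w₀ q)) c' b' v = 0 := by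
    intro v; rw [and_comm]
    simp
  have hE := exp_pos (K * S.lam q); have hsep : ∀ {v : E4}, sepForm S K q (c (S.X w₀ q)) c' b' v =
      exp (K * S.lam q) * c' * S.dθ q v - b' * S.dφ q v + K * exp (K * S.lam q) * c (S.X w₀ q) * S.dlam q v := by
    intro v; simp [sepForm]
  have fin4 : ∀ {P : Fin 4 → Prop}, P 0 → P 1 → P 2 → P 3 → ∀ i, P i := by intro P h0 h1 h2 h3 i; fin_cases i <;> assumption
  rcases h with ⟨hF, hnd⟩ | ⟨σ, hσ, hX0, hb0, hF⟩
  · have hS0 : sepFn S K w₀ z₀ c b q = 0 := (hF.self_of_nhds.1 hqF).2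
    have hF' : ∀ g₀ g₁ : E4 → ℝ, ∀ᶠ p in 𝓝 q, p ∈ F ↔ InSector (2 * π) (g₀ p) (g₁ p) ∧
        sepFn S K w₀ z₀ c b p = 0 ∧ ‖p‖ ^ 2 - 1 = 0 := by
      intro g₀ g₁; filter_upwards [hF] with p hp; rw [hp, sub_eq_zero]
      exact ⟨fun h => ⟨inSector_two_pi _ _, h.2, h.1⟩, fun h => ⟨h.2.2, h.2.1⟩⟩
    by_cases hc0 : c (S.X w₀ q) = 0
    · have hb0 : b' ≠ 0 := hnd.resolve_left (fun h => h hc0)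
      obtain ⟨h1, h2⟩ := sector_of_coords (F := F) (p := q) (β := 2 * π) (by positivity)
        (f := ![fun p => S.lam p - S.lam q, fun p => S.X w₀ p - S.X w₀ q, sepFn S K w₀ z₀ c b, fun p => ‖p‖ ^ 2 - 1])
        (l := ![S.dlam q, S.dθ q, sepForm S K q (c (S.X w₀ q)) c' b', 2 • innerSL ℝ q])
        (fin4 (cL.sub contDiffAt_const) (cX.sub contDiffAt_const) cS cN)
        (fin4 (dL.sub_const _) (dX.sub_const _) dS dN)
        (fin4 (sub_self _) (sub_self _) hS0 (by simp [hq]))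
        (fun v hv => by
          have v0 : S.dlam q v = 0 := hv 0; have v1 : S.dθ q v = 0 := hv 1
          have v2 : sepForm S K q (c (S.X w₀ q)) c' b' v = 0 := hv 2; have v3 : (2 • innerSL ℝ q) v = 0 := hv 3
          rw [hsep, v0, v1] at v2; simp only [mul_zero, zero_sub, add_zero, neg_eq_zero] at v2
          exact Split.eq_zero_of_forms hz0 hw0 v1 ((mul_eq_zero.1 v2).resolve_left hb0) v0 (by simpa using v3))
        (hF' _ _)
      exact ⟨⟨_, .inr rfl, h1⟩, fun v => (h2 v).trans tp⟩
    · obtain ⟨h1, h2⟩ := sector_of_coords (F := F) (p := q) (β := 2 * π) (by positivity)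
        (f := ![fun p => S.X w₀ p - S.X w₀ q, fun p => S.Y z₀ p - S.Y z₀ q, sepFn S K w₀ z₀ c b, fun p => ‖p‖ ^ 2 - 1])
        (l := ![S.dθ q, S.dφ q, sepForm S K q (c (S.X w₀ q)) c' b', 2 • innerSL ℝ q])
        (fin4 (cX.sub contDiffAt_const) (cY.sub contDiffAt_const) cS cN)
        (fin4 (dX.sub_const _) (dY.sub_const _) dS dN)
        (fin4 (sub_self _) (sub_self _) hS0 (by simp [hq]))
        (fun v hv => by
          have v0 : S.dθ q v = 0 := hv 0; have v1 : S.dφ q v = 0 := hv 1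
          have v2 : sepForm S K q (c (S.X w₀ q)) c' b' v = 0 := hv 2; have v3 : (2 • innerSL ℝ q) v = 0 := hv 3
          rw [hsep, v0, v1] at v2; simp only [mul_zero, sub_zero, zero_add] at v2; exact Split.eq_zero_of_forms hz0 hw0 v0 v1
            ((mul_eq_zero.1 v2).resolve_left (mul_ne_zero (by positivity) hc0)) (by simpa using v3))
        (hF' _ _)
      exact ⟨⟨_, .inr rfl, h1⟩, fun v => (h2 v).trans tp⟩
  · have hS0 : sepFn S K w₀ z₀ c b q = 0 := (hF.self_of_nhds.1 hqF).2.2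
    have hσ0 : σ ≠ 0 := by rcases hσ with h | h <;> rw [h] <;> norm_num
    obtain ⟨h1, h2⟩ := sector_of_coords (F := F) (p := q) (β := π) hpi
      (f := ![fun p => S.lam p - S.lam q, fun p => σ * S.X w₀ p, sepFn S K w₀ z₀ c b, fun p => ‖p‖ ^ 2 - 1])
      (l := ![S.dlam q, σ • S.dθ q, sepForm S K q (c (S.X w₀ q)) c' b', 2 • innerSL ℝ q])
      (fin4 (cL.sub contDiffAt_const) (contDiffAt_const.mul cX) cS cN)
      (fin4 (dL.sub_const _) (dX.const_mul _) dS dN)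
      (fin4 (sub_self _) (by simp [hX0]) hS0 (by simp [hq]))
      (fun v hv => by
        have v0 : S.dlam q v = 0 := hv 0; have v1 : (σ • S.dθ q) v = 0 := hv 1
        have v2 : sepForm S K q (c (S.X w₀ q)) c' b' v = 0 := hv 2; have v3 : (2 • innerSL ℝ q) v = 0 := hv 3
        have v1' : S.dθ q v = 0 := by simpa [hσ0] using v1
        rw [hsep, v0, v1'] at v2; simp only [mul_zero, zero_sub, add_zero, neg_eq_zero] at v2
        exact Split.eq_zero_of_forms hz0 hw0 v1' ((mul_eq_zero.1 v2).resolve_left hb0) v0 (by simpa using v3))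
      (by
        filter_upwards [hF] with p hp
        simp only [Matrix.cons_val_zero, Matrix.cons_val_one, Matrix.cons_val]; rw [hp, sub_eq_zero, inSector_pi_iff]
        exact ⟨fun h => ⟨h.2.1, h.2.2, h.1⟩, fun h => ⟨h.2.2, h.1, h.2.1⟩⟩)
    exact ⟨⟨_, .inl rfl, h1⟩, fun v => (h2 v).trans tp⟩

end Sep

open Complex (arg_div_coe_angle log_im)
open Split (self_div_mem exp_lam)
/-! ### Gluing of functions of one variable -/

/-- The function that is `f` on the right and `g` on the left of the origin. -/
def glue (f g : ℝ → ℝ) (x : ℝ) : ℝ := if 0 ≤ x then f x else g x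

lemma glue_of_nonneg (h : 0 ≤ x) : glue f g x = f x := if_pos h

lemma glue_of_nonpos (h0 : f 0 = g 0) (h : x ≤ 0) : glue f g x = g x := by
  rcases h.eq_or_lt with rfl | h
  · rw [glue_of_nonneg le_rfl, h0]
  · exact if_neg (not_le.2 h)

lemma continuous_glue (hf : Continuous f) (hg : Continuous g) (h0 : f 0 = g 0) : Continuous (glue f g) :=
  hf.if_le hg continuous_const continuous_id fun x hx => by simp_all

lemma hasDerivAt_glue (hf : ∀ x, HasDerivAt f (f' x) x) (hg : ∀ x, HasDerivAt g (g' x) x)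
    (h0 : f 0 = g 0) (h1 : f' 0 = g' 0) (x : ℝ) : HasDerivAt (glue f g) (glue f' g' x) x := by
  rcases lt_trichotomy x 0 with h | rfl | h
  · rw [glue_of_nonpos h1 h.le]; refine (hg x).congr_of_eventuallyEq ?_
    filter_upwards [Iio_mem_nhds h] with y hy using glue_of_nonpos h0 (le_of_lt hy)
  · rw [glue_of_nonneg le_rfl]; have r1 : HasDerivWithinAt (glue f g) (f' 0) (Ici 0) 0 :=
      (hf 0).hasDerivWithinAt.congr (fun y hy => glue_of_nonneg hy) (glue_of_nonneg le_rfl)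
    have r2 : HasDerivWithinAt (glue f g) (f' 0) (Iic 0) 0 := by
      rw [h1]; exact (hg 0).hasDerivWithinAt.congr (fun y hy => glue_of_nonpos h0 hy) (glue_of_nonpos h0 le_rfl)
    have := r2.union r1; simp_all
  · rw [glue_of_nonneg h.le]; refine (hf x).congr_of_eventuallyEq ?_
    filter_upwards [Ioi_mem_nhds h] with y hy using glue_of_nonneg (le_of_lt hy)

/-- A `C²` function with derivative one at its zero at the origin. -/
structure Germ where
  fn : ℝ → ℝ
  der : ℝ → ℝ
  der2 : ℝ → ℝ
  hasDerivAt : ∀ x, HasDerivAt fn (der x) x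
  hasDerivAt_der : ∀ x, HasDerivAt der (der2 x) x
  continuous_der2 : Continuous der2
  zero : fn 0 = 0
  der_zero : der 0 = 1

namespace Germ

lemma contDiff_der (c : Germ) : ContDiff ℝ 1 c.der := by
  rw [show (1 : WithTop ℕ∞) = 0 + 1 from rfl, contDiff_succ_iff_deriv]
  refine ⟨fun x => (c.hasDerivAt_der x).differentiableAt, by simp, ?_⟩
  rw [contDiff_zero, funext fun x => (c.hasDerivAt_der x).deriv]; exact c.continuous_der2

lemma contDiff (c : Germ) : ContDiff ℝ 2 c.fn := by
  rw [show (2 : WithTop ℕ∞) = 1 + 1 from rfl, contDiff_succ_iff_deriv]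
  refine ⟨fun x => (c.hasDerivAt x).differentiableAt, by simp, ?_⟩; rw [funext fun x => (c.hasDerivAt x).deriv]
  exact c.contDiff_der

end Germ

/-- The germ glued from two arches. -/
def glueArch {L' m' : ℝ} (f : Arch L β m) (g : Arch L' β' m') : Germ where
  fn := glue f.fn g.fn
  der := glue f.der g.der
  der2 := glue (fun x => β * f.fn x - 2 * m * f.fn x ^ 3) (fun x => β' * g.fn x - 2 * m' * g.fn x ^ 3)
  hasDerivAt := hasDerivAt_glue f.hasDerivAt g.hasDerivAt (by rw [f.zero, g.zero]) (by rw [f.der_zero, g.der_zero])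
  hasDerivAt_der := hasDerivAt_glue f.hasDerivAt_der g.hasDerivAt_der (by rw [f.der_zero, g.der_zero])
    (by rw [f.zero, g.zero]; ring)
  continuous_der2 := continuous_glue (by have := f.continuous; fun_prop) (by have := g.continuous; fun_prop)
    (by rw [f.zero, g.zero]; ring)
  zero := by rw [glue_of_nonneg le_rfl, f.zero]
  der_zero := by rw [glue_of_nonneg le_rfl, f.der_zero]

lemma Arch.fn_pos_iff (f : Arch L β m) (hx : x ∈ Ioo (-L) L) : 0 ≤ f.fn x ↔ 0 ≤ x := by
  constructor
  · intro h; by_contra! hneg; have := f.pos (-x) (by grind); rw [f.odd] at this; linarith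
  · intro h; exact f.nonneg ⟨h, hx.2.le⟩

/-- A profile of a rectangle. -/
def Rect.P (r : Rect) : Profile r.a r.b := Classical.choice (exists_profile r.a_mem.1 r.b_mem.1)

/-! ### The surface away from the core circles -/

lemma arc_shift {α : ℝ} (hx₀ : x₀ ∈ Icc 0 a) (hx : x ∈ Icc 0 a) (hα : (α : Angle) = (s + x₀ : ℝ)) (hu : |u| < 2 * π - a) :
    ((α + u : ℝ) : Angle) = (s + x : ℝ) ↔ x = x₀ + u := by
  have h3 := abs_lt.1 hu; rw [coe_add, hα, ← coe_add]; constructor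
  · intro he; obtain ⟨n, hn⟩ := angle_eq_iff_two_pi_dvd_sub.1 he; have h4 : (n : ℝ) < 1 := by
      by_contra! hge; nlinarith [hx.1, hx.2, hx₀.1, hx₀.2, pi_pos]
    have h5 : (-1 : ℝ) < n := by by_contra! hge; nlinarith [hx.1, hx.2, hx₀.1, hx₀.2, pi_pos]
    have h6 : n = 0 := by
      have h7 : n < 1 := by exact_mod_cast h4
      have h8 : -1 < n := by exact_mod_cast h5
      omega
    rw [h6] at hn; simp at hn; linarith
  grind

namespace Split
variable {S : Split}

lemma arg_eq_add_X (h : S.w p / w₀ ∈ slitPlane) : (arg (S.w p) : Angle) = arg w₀ + (S.X w₀ p : ℝ) := by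
  obtain ⟨h1, h2⟩ := ne_zero_of_slit h; rw [X, log_im, arg_div_coe_angle h1 h2]; abel

lemma X_self (h : S.w q ≠ 0) : S.X (S.w q) q = 0 := by rw [X, div_self h, Complex.log_one]; rfl

lemma continuousAt_w_div : ContinuousAt (fun p => S.w p / w₀) q := by fun_prop

lemma eventually_slit (h : S.w q / w₀ ∈ slitPlane) : ∀ᶠ p in 𝓝 q, S.w p / w₀ ∈ slitPlane :=
  continuousAt_w_div.eventually_mem (Complex.isOpen_slitPlane.mem_nhds h)

lemma eventually_abs_X_lt (h : S.w q / w₀ ∈ slitPlane) (h0 : S.X w₀ q = 0) (hδ : 0 < δ) : ∀ᶠ p in 𝓝 q, |S.X w₀ p| < δ := by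
  have h1 : ContinuousAt (S.X w₀) q := (hasFDerivAt_X h).continuousAt; have h2 := h1.abs
  refine h2.eventually_lt_const ?_; simp_all

/-- Near a point, the angular coordinate in an arc is a translate of the coordinate `X`. -/
lemma angle_eq_iff (h : S.w q ≠ 0) (ha : a < 2 * π) (hx₀ : x₀ ∈ Icc 0 a) (h0 : (arg (S.w q) : Angle) = (s + x₀ : ℝ)) :
    ∀ᶠ p in 𝓝 q, ∀ x ∈ Icc 0 a, ((arg (S.w p) : Angle) = (s + x : ℝ) ↔ x = x₀ + S.X (S.w q) p) := by
  filter_upwards [eventually_slit (self_div_mem h),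
    eventually_abs_X_lt (self_div_mem h) (X_self h) (sub_pos.2 ha)] with p h1 h2 x hx
  rw [arg_eq_add_X h1, ← coe_add]; exact arc_shift hx₀ hx h0 h2

end Split

section Tile

/-- The equation of a tile near a point. -/
lemma tile_local (hκ : 0 ≤ κ) (hz : std.z q ≠ 0) (hw : std.w q ≠ 0) (hx₀ : x₀ ∈ Icc 0 r.a) (hy₀ : y₀ ∈ Icc 0 r.b)
    (h1 : (arg (std.w q) : Angle) = (r.s + x₀ : ℝ))
    (h2 : (arg (std.z q) : Angle) = (r.t + y₀ : ℝ)) :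
    ∀ᶠ p in 𝓝 q, p ∈ tile κ r ↔ ‖p‖ ^ 2 = 1 ∧ x₀ + std.X (std.w q) p ∈ Icc 0 r.a ∧ y₀ + std.Y (std.z q) p ∈ Icc 0 r.b ∧
      sepFn std (2 + κ) (std.w q) (std.z q) (fun u => r.P.C.fn (x₀ + u)) (fun u => r.P.B.fn (y₀ + u)) p = 0 := by
  filter_upwards [Split.angle_eq_iff hw r.a_mem.2 hx₀ h1, Split.angle_eq_iff (S := std.swap) hz r.b_mem.2 hy₀ h2,
    std.w.continuous.continuousAt.eventually_ne hw,
    std.z.continuous.continuousAt.eventually_ne hz] with p a1 a2 hw' hz'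
  rw [r.tile_eq hκ r.P, std.mem_tile_iff r.P hz' hw', std.norm_sq]
  have eqv : ∀ B C : ℝ, (‖std.z p‖ ^ (2 + κ) * B = ‖std.w p‖ ^ (2 + κ) * C ↔ exp ((2 + κ) * std.lam p) * C - B = 0) := by
    intro B C; rw [exp_lam hz' hw']; constructor
    · intro h; field_simp; linarith
    · intro h; field_simp at h; linarith
  constructor
  · rintro ⟨hN, x, hx, y, hy, e2, e1, e3⟩; have ex := (a1 x hx).1 e1; have ey := (a2 y hy).1 e2
    have ey : y = y₀ + std.Y (std.z q) p := ey; rw [ex, ey] at e3; exact ⟨hN, ex ▸ hx, ey ▸ hy, (eqv _ _).1 e3⟩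
  · rintro ⟨hN, hx, hy, e3⟩; exact ⟨hN, _, hx, _, hy, (a2 _ hy).2 rfl, (a1 _ hx).2 rfl, (eqv _ _).2 e3⟩

/-- The sign of the corner of a rectangle at one of its ends. -/
def CornerSign (x₀ a ε : ℝ) : Prop := x₀ = 0 ∧ ε = 1 ∨ x₀ = a ∧ ε = -1

lemma CornerSign.abs (h : CornerSign x₀ a ε) : ε = 1 ∨ ε = -1 := h.imp And.right And.right

lemma CornerSign.fn_add (h : CornerSign x₀ a ε) (f : Arch a β m) (u : ℝ) : f.fn (x₀ + u) = ε * f.fn u := by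
  rcases h with ⟨rfl, rfl⟩ | ⟨rfl, rfl⟩
  · rw [zero_add, one_mul]
  · rw [add_comm, f.add_len]; ring

lemma CornerSign.der_add (h : CornerSign x₀ a ε) (f : Arch a β m) (u : ℝ) : f.der (x₀ + u) = ε * f.der u := by
  rcases h with ⟨rfl, rfl⟩ | ⟨rfl, rfl⟩
  · rw [zero_add, one_mul]
  · rw [add_comm, f.der_add_len]; ring

lemma CornerSign.mem_Icc_iff (h : CornerSign x₀ a ε) (hu : |u| < a) : x₀ + u ∈ Icc 0 a ↔ 0 ≤ ε * u := by
  have := abs_lt.1 hu; rcases h with ⟨rfl, rfl⟩ | ⟨rfl, rfl⟩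
  · grind
  grind

lemma Arch.sign_mul (f : Arch L β m) (hx : |x| < L) (hε : ε = 1 ∨ ε = -1) : 0 ≤ ε * f.fn x ↔ 0 ≤ ε * x := by
  have h := abs_lt.1 hx; rcases hε with rfl | rfl
  · rw [one_mul, one_mul]; exact f.fn_pos_iff h
  · rw [neg_one_mul, neg_one_mul, ← f.odd]; exact f.fn_pos_iff (by grind)

/-- The equation of a tile near a point over a vertex. -/
lemma tile_local_corner (hκ : 0 ≤ κ) (hz : std.z q ≠ 0) (hw : std.w q ≠ 0) {εx εy : ℝ}
    (hεx : CornerSign x₀ r.a εx) (hεy : CornerSign y₀ r.b εy)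
    (h1 : (arg (std.w q) : Angle) = (r.s + x₀ : ℝ))
    (h2 : (arg (std.z q) : Angle) = (r.t + y₀ : ℝ)) :
    ∀ᶠ p in 𝓝 q, (p ∈ tile κ r ↔ ‖p‖ ^ 2 = 1 ∧ 0 ≤ εx * std.X (std.w q) p ∧ 0 ≤ εy * std.Y (std.z q) p ∧
      sepFn std (2 + κ) (std.w q) (std.z q) r.P.C.fn (fun u => εx * εy * r.P.B.fn u) p = 0) ∧
      (p ∈ tile κ r ↔ ‖p‖ ^ 2 = 1 ∧ 0 ≤ εx * std.X (std.w q) p ∧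
      sepFn std (2 + κ) (std.w q) (std.z q) r.P.C.fn (fun u => εx * εy * r.P.B.fn u) p = 0) := by
  have ha := r.a_mem.1; have hb := r.b_mem.1
  have hx₀ : x₀ ∈ Icc 0 r.a := by rcases hεx with ⟨rfl, -⟩ | ⟨rfl, -⟩ <;> constructor <;> linarith
  have hy₀ : y₀ ∈ Icc 0 r.b := by rcases hεy with ⟨rfl, -⟩ | ⟨rfl, -⟩ <;> constructor <;> linarith
  filter_upwards [tile_local hκ hz hw hx₀ hy₀ h1 h2, Split.eventually_abs_X_lt (self_div_mem hw) (Split.X_self hw) ha,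
    Split.eventually_abs_X_lt (S := std.swap) (self_div_mem hz) (Split.X_self (S := std.swap) hz) hb]
    with p hp hX hY
  change |std.Y (std.z q) p| < r.b at hY; set X := std.X (std.w q) p with hXd; set Y := std.Y (std.z q) p with hYd
  have hs : sepFn std (2 + κ) (std.w q) (std.z q) (fun u => r.P.C.fn (x₀ + u))
      (fun u => r.P.B.fn (y₀ + u)) p = 0 ↔ sepFn std (2 + κ) (std.w q) (std.z q) r.P.C.fn
      (fun u => εx * εy * r.P.B.fn u) p = 0 := by
    simp [sepFn, hεx.fn_add, hεy.fn_add]; rcases hεx.abs with h | h <;> rw [h]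
    · simp
    grind
  rw [hs, hεx.mem_Icc_iff hX, hεy.mem_Icc_iff hY] at hp
  refine ⟨hp, hp.trans ⟨fun h => ⟨h.1, h.2.1, h.2.2.2⟩, fun h => ⟨h.1, h.2.1, ?_, h.2.2⟩⟩⟩; have h3 := h.2.2
  simp [sepFn, ← hXd, ← hYd] at h3; rw [← r.P.B.sign_mul hY hεy.abs]; have h4 := (r.P.C.sign_mul hX hεx.abs).2 h.2.1
  have h5 : εy * r.P.B.fn Y = exp ((2 + κ) * std.lam p) * (εx * r.P.C.fn X) := by
    rcases hεx.abs with h | h <;> rw [h] at h3 ⊢ <;> linarith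
  rw [h5]; positivity

end Tile

namespace Diagram
variable (D : Diagram)

lemma isCompact_tile (hκ : 0 ≤ κ) (r : Rect) : IsCompact (tile κ r) := by
  rw [r.tile_eq hκ r.P]; exact std.isCompact_tile (by linarith) _ _ _

/-- Near a point, the surface is the union of the tiles that contain the point. -/
lemma surface_local (hκ : 0 ≤ κ) (q : E4) : ∀ᶠ p in 𝓝 q, p ∈ D.surface κ ↔ ∃ r ∈ D.rects, q ∈ tile κ r ∧ p ∈ tile κ r := by
  have h : ∀ r ∈ D.rects, ∀ᶠ p in 𝓝 q, p ∈ tile κ r → q ∈ tile κ r := by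
    intro r _; by_cases hq : q ∈ tile κ r
    · simp_all
    · filter_upwards [(isCompact_tile hκ r).isClosed.isOpen_compl.mem_nhds hq] with p hp hp'; exact absurd hp' hp
  filter_upwards [(Finset.eventually_all _).2 h] with p hp; simp [surface, mem_iUnion, exists_prop]
  exact ⟨fun ⟨r, hr, h⟩ => ⟨r, hr, hp r hr h, h⟩, fun ⟨r, hr, _, h⟩ => ⟨r, hr, h⟩⟩

end Diagram

open Classical in
/-- The sign of the corner of a rectangle at a meridian of its vertical sides: `1` on the left, `-1` on the right. -/
def Rect.sgnθ (r : Rect) (θ : Angle) : ℝ := if θ = r.θ₁ then 1 else -1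

open Classical in
/-- The sign of the corner of a rectangle at a longitude of its horizontal sides: `1` at the bottom, `-1` on top. -/
def Rect.sgnφ (r : Rect) (φ : Angle) : ℝ := if φ = r.φ₁ then 1 else -1

/-- The product of the signs of the corner of a rectangle at a vertex: it is `1` at the lower left and the
upper right, and `-1` at the other vertices. -/
def Rect.slope (r : Rect) (v : Torus) : ℝ := r.sgnθ v.1 * r.sgnφ v.2

lemma Rect.cornerSign_θ (hx : x ∈ Icc 0 r.a) (h : α = (r.s + x : ℝ))
    (hv : α = r.θ₁ ∨ α = r.θ₂) : CornerSign x r.a (r.sgnθ α) := by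
  unfold sgnθ; have ha := r.a_mem; have hx' : x ∈ Ico 0 (2 * π) := by grind
  by_cases h1 : α = r.θ₁
  · rw [if_pos h1]; refine .inl ⟨coe_eq_coe_of_mem hx' ⟨le_rfl, two_pi_pos⟩ ?_, rfl⟩; rw [h, coe_add, coe_s] at h1; simpa using h1
  · rw [if_neg h1]; refine .inr ⟨coe_eq_coe_of_mem hx' ⟨ha.1.le, ha.2⟩ ?_, rfl⟩; have h2 := hv.resolve_left h1
    rw [h, ← r.coe_s_add_a, coe_add, coe_add] at h2; exact add_left_cancel h2

lemma Rect.cornerSign_φ (hx : x ∈ Icc 0 r.b) (h : α = (r.t + x : ℝ))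
    (hv : α = r.φ₁ ∨ α = r.φ₂) : CornerSign x r.b (r.sgnφ α) := by
  unfold sgnφ; have ha := r.b_mem; have hx' : x ∈ Ico 0 (2 * π) := by grind
  by_cases h1 : α = r.φ₁
  · rw [if_pos h1]; refine .inl ⟨coe_eq_coe_of_mem hx' ⟨le_rfl, two_pi_pos⟩ ?_, rfl⟩; rw [h, coe_add, coe_t] at h1; simpa using h1
  · rw [if_neg h1]; refine .inr ⟨coe_eq_coe_of_mem hx' ⟨ha.1.le, ha.2⟩ ?_, rfl⟩; have h2 := hv.resolve_left h1
    rw [h, ← r.coe_t_add_b, coe_add, coe_add] at h2; exact add_left_cancel h2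

open Split (X_self hasFDerivAt_X hasFDerivAt_Y eventually_slit)
/-! ### The surface over a vertex -/

/-- The equation of a surface near a point over a vertex with the sign `ε`, which may be on the boundary. -/
def VertexModel (F : Set E4) (K ε : ℝ) (q : E4) (c b : Germ) : Prop := (∀ᶠ p in 𝓝 q, p ∈ F ↔ ‖p‖ ^ 2 = 1 ∧
    sepFn std K (std.w q) (std.z q) c.fn (fun u => ε * b.fn u) p = 0) ∨
  ∃ σ : ℝ, (σ = 1 ∨ σ = -1) ∧ ∀ᶠ p in 𝓝 q, p ∈ F ↔ ‖p‖ ^ 2 = 1 ∧ 0 ≤ σ * std.X (std.w q) p ∧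
    sepFn std K (std.w q) (std.z q) c.fn (fun u => ε * b.fn u) p = 0

lemma VertexModel.eventually_tangent {c b : Germ} (h : VertexModel F K ε q c b)
    (hK : 0 < K) (hε : ε = 1 ∨ ε = -1) (hz : std.z q ≠ 0) (hw : std.w q ≠ 0) :
    ∀ᶠ p in 𝓝 q, p ∈ F → (∃ β, (β = π ∨ β = 2 * π) ∧ IsSectorNear F p β) ∧ ∀ v, v ∈ tangentPlane F p ↔ inner ℝ p v = 0 ∧
        sepForm std K p (c.fn (std.X (std.w q) p)) (c.der (std.X (std.w q) p)) (ε * b.der (std.Y (std.z q) p)) v = 0 := by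
  have hε0 : ε ≠ 0 := by grind
  have hY : ContinuousAt (fun p => b.der (std.Y (std.z q) p)) q := b.contDiff_der.continuous.continuousAt.comp
      (hasFDerivAt_Y (self_div_mem hz)).continuousAt
  have hY0 : b.der (std.Y (std.z q) q) ≠ 0 := by
    rw [show std.Y (std.z q) q = 0 from X_self (S := std.swap) hz, b.der_zero]; norm_num
  have c1 : ∀ x, ContDiffAt ℝ 1 c.fn x := fun x => (c.contDiff.of_le one_le_two).contDiffAt
  have b1 : ∀ x, ContDiffAt ℝ 1 (fun u => ε * b.fn u) x := fun x =>
    contDiffAt_const.mul (b.contDiff.of_le one_le_two).contDiffAt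
  rcases h with h | ⟨σ, hσ, h⟩
  · filter_upwards [eventually_slit (self_div_mem hw), eventually_slit (S := std.swap) (self_div_mem hz), hY.eventually_ne hY0,
      eventually_eventually_nhds.2 h] with p p1 p2 p3 p4 hpF
    exact sector_of_sepFn hK (p4.self_of_nhds.1 hpF).1 hpF p1 p2 (c.hasDerivAt _) ((b.hasDerivAt _).const_mul ε)
      (c1 _) (b1 _) (.inl ⟨p4, .inr (mul_ne_zero hε0 p3)⟩)
  · filter_upwards [eventually_slit (self_div_mem hw), eventually_slit (S := std.swap) (self_div_mem hz), hY.eventually_ne hY0,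
      eventually_eventually_nhds.2 h] with p p1 p2 p3 p4 hpF
    have hp := p4.self_of_nhds.1 hpF; have hσ0 : σ ≠ 0 := by grind
    refine sector_of_sepFn hK hp.1 hpF p1 p2 (c.hasDerivAt _) ((b.hasDerivAt _).const_mul ε) (c1 _) (b1 _) ?_
    rcases hp.2.1.eq_or_lt with h0 | h0
    · exact .inr ⟨σ, hσ, (mul_eq_zero.1 h0.symm).resolve_left hσ0, mul_ne_zero hε0 p3, p4⟩
    · refine .inl ⟨?_, .inr (mul_ne_zero hε0 p3)⟩
      have hX : ContinuousAt (fun p => σ * std.X (std.w q) p) p := (hasFDerivAt_X p1).continuousAt.const_mul σ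
      filter_upwards [p4, hX.eventually_const_lt h0] with u hu hu'; rw [hu]
      exact ⟨fun h => ⟨h.1, h.2.2⟩, fun h => ⟨h.1, hu'.le, h.2⟩⟩

lemma eventually_glueArch_sign {L' m' : ℝ} (f : Arch L β m) (g : Arch L' β' m') :
    ∀ᶠ x in 𝓝 (0 : ℝ), (0 ≤ (glueArch f g).fn x ↔ 0 ≤ x) ∧ ((glueArch f g).fn x ≤ 0 ↔ x ≤ 0) := by
  have hf := f.len_pos; have hg := g.len_pos
  filter_upwards [Ioo_mem_nhds (neg_lt_zero.2 hf) hf, Ioo_mem_nhds (neg_lt_zero.2 hg) hg] with x h1 h2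
  change (0 ≤ glue f.fn g.fn x ↔ _) ∧ (glue f.fn g.fn x ≤ 0 ↔ _); rcases lt_trichotomy x 0 with h | rfl | h
  · rw [glue_of_nonpos (by rw [f.zero, g.zero]) h.le]; have := g.pos (-x) (by grind); rw [g.odd] at this; grind
  · rw [glue_of_nonneg le_rfl, f.zero]; simp
  · rw [glue_of_nonneg h.le]; have := f.pos x ⟨h, h1.2⟩; grind

lemma Rect.sgnθ_abs (r : Rect) (α : Angle) : r.sgnθ α = 1 ∨ r.sgnθ α = -1 := by unfold sgnθ; split_ifs <;> simp

lemma Rect.sgnφ_abs (r : Rect) (α : Angle) : r.sgnφ α = 1 ∨ r.sgnφ α = -1 := by unfold sgnφ; split_ifs <;> simp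

lemma Rect.slope_abs (r : Rect) (v : Torus) : r.slope v = 1 ∨ r.slope v = -1 := by
  unfold slope; rcases r.sgnθ_abs v.1 with h | h <;> rcases r.sgnφ_abs v.2 with h' | h' <;> rw [h, h'] <;> simp

/-- The coordinates of a point of a tile. -/
lemma exists_coords (hκ : 0 ≤ κ) (hz : std.z q ≠ 0) (hw : std.w q ≠ 0)
    (hq : q ∈ tile κ r) : ∃ x ∈ Icc 0 r.a, ∃ y ∈ Icc 0 r.b, (proj q).1 = (r.s + x : ℝ) ∧
      (proj q).2 = (r.t + y : ℝ) ∧ r.P.B.fn y = exp ((2 + κ) * std.lam q) * r.P.C.fn x := by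
  rw [r.tile_eq hκ r.P, std.mem_tile_iff r.P hz hw] at hq; obtain ⟨-, x, hx, y, hy, e2, e1, e3⟩ := hq
  refine ⟨x, hx, y, hy, e1, e2, ?_⟩; rw [exp_lam hz hw]; field_simp; linarith

section Vertex

lemma tile_local_vertex (hκ : 0 ≤ κ) (hz : std.z q ≠ 0) (hw : std.w q ≠ 0) (hq : q ∈ tile κ r) (hv : proj q ∈ r.vertices) :
    ∀ᶠ p in 𝓝 q, (p ∈ tile κ r ↔ ‖p‖ ^ 2 = 1 ∧ 0 ≤ r.sgnθ (proj q).1 * std.X (std.w q) p ∧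
      0 ≤ r.sgnφ (proj q).2 * std.Y (std.z q) p ∧
      sepFn std (2 + κ) (std.w q) (std.z q) r.P.C.fn (fun u => r.slope (proj q) * r.P.B.fn u) p = 0) ∧
      (p ∈ tile κ r ↔ ‖p‖ ^ 2 = 1 ∧ 0 ≤ r.sgnθ (proj q).1 * std.X (std.w q) p ∧
      sepFn std (2 + κ) (std.w q) (std.z q) r.P.C.fn (fun u => r.slope (proj q) * r.P.B.fn u) p = 0) := by
  obtain ⟨x, hx, y, hy, e1, e2, -⟩ := exists_coords hκ hz hw hq; obtain ⟨v1, v2⟩ := Rect.mem_vertices.1 hv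
  exact tile_local_corner hκ hz hw (Rect.cornerSign_θ hx e1 v1) (Rect.cornerSign_φ hy e2 v2) e1 e2

lemma Diagram.opposite_sgn (D : Diagram) (h₁ : r₁ ∈ D.rects) (h₂ : r₂ ∈ D.rects) (hne : r₁ ≠ r₂)
    {v : Torus} (hv₁ : v ∈ r₁.vertices) (hv₂ : v ∈ r₂.vertices) :
    r₂.sgnθ v.1 = -r₁.sgnθ v.1 ∧ r₂.sgnφ v.2 = -r₁.sgnφ v.2 := by
  obtain ⟨a1, a2⟩ := D.opposite h₁ h₂ hne hv₁ hv₂; have b2 := Rect.mem_vertices.1 hv₂; have n1 := r₂.hθ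
  have n2 := r₂.hφ; unfold Rect.sgnθ Rect.sgnφ; grind

/-- The model of the union of two tiles at a common vertex, the first of which is on the right. -/
lemma vertexModel_of_pair (hκ : 0 ≤ κ) {R L : Rect} (hz : std.z q ≠ 0) (hw : std.w q ≠ 0)
    (hR : q ∈ tile κ R) (hL : q ∈ tile κ L) (vR : proj q ∈ R.vertices) (vL : proj q ∈ L.vertices)
    (hF : ∀ᶠ p in 𝓝 q, p ∈ F ↔ p ∈ tile κ R ∨ p ∈ tile κ L)
    (hop : L.sgnθ (proj q).1 = -R.sgnθ (proj q).1 ∧ L.sgnφ (proj q).2 = -R.sgnφ (proj q).2)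
    (h1 : R.sgnθ (proj q).1 = 1) : ∃ c b, VertexModel F (2 + κ) (R.slope (proj q)) q c b := by
  have hLs : L.slope (proj q) = R.slope (proj q) := by unfold Rect.slope; rw [hop.1, hop.2]; ring
  have hRs : R.sgnφ (proj q).2 = R.slope (proj q) := by unfold Rect.slope; rw [h1, one_mul]
  have hε := R.slope_abs (proj q); have eR := tile_local_vertex hκ hz hw hR vR
  have eL := tile_local_vertex hκ hz hw hL vL; rw [hop.1, hop.2, hLs] at eL; rw [h1, hRs] at eR eL
  generalize R.slope (proj q) = ε at *
  have cX : Tendsto (std.X (std.w q)) (𝓝 q) (𝓝 0) := by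
    have := (hasFDerivAt_X (self_div_mem hw)).continuousAt.tendsto; rwa [X_self hw] at this
  have cY : Tendsto (std.Y (std.z q)) (𝓝 q) (𝓝 0) := by
    have := (hasFDerivAt_Y (self_div_mem hz)).continuousAt.tendsto
    rwa [show std.Y (std.z q) q = 0 from X_self (S := std.swap) hz] at this
  obtain ⟨b, hb1, hb2, hbs⟩ : ∃ b : Germ, (∀ u, 0 ≤ ε * u → b.fn u = R.P.B.fn u) ∧ (∀ u, 0 ≤ -ε * u → b.fn u = L.P.B.fn u) ∧
      ∀ᶠ x in 𝓝 (0 : ℝ), (0 ≤ b.fn x ↔ 0 ≤ x) ∧ (b.fn x ≤ 0 ↔ x ≤ 0) := by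
    have e0 : R.P.B.fn 0 = L.P.B.fn 0 := by rw [R.P.B.zero, L.P.B.zero]
    rcases hε with rfl | rfl
    · exact ⟨glueArch R.P.B L.P.B, fun u hu => glue_of_nonneg (by linarith),
        fun u hu => glue_of_nonpos e0 (by linarith), eventually_glueArch_sign _ _⟩
    · exact ⟨glueArch L.P.B R.P.B, fun u hu => glue_of_nonpos e0.symm (by linarith),
        fun u hu => glue_of_nonneg (by linarith), eventually_glueArch_sign _ _⟩
  have e0 : R.P.C.fn 0 = L.P.C.fn 0 := by rw [R.P.C.zero, L.P.C.zero]
  refine ⟨glueArch R.P.C L.P.C, b, .inl ?_⟩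
  filter_upwards [hF, eR, eL, cX.eventually (eventually_glueArch_sign R.P.C L.P.C), cY.eventually hbs] with p hp pR pL sX sY
  rw [hp, pR.1, pL.1]; simp [sepFn]
  generalize std.X (std.w q) p = X at *
  generalize std.Y (std.z q) p = Y at *
  have hE := exp_pos ((2 + κ) * std.lam p)
  generalize exp ((2 + κ) * std.lam p) = E at *
  have cR : 0 ≤ X → (glueArch R.P.C L.P.C).fn X = R.P.C.fn X := fun h => glue_of_nonneg h
  have cL : X ≤ 0 → (glueArch R.P.C L.P.C).fn X = L.P.C.fn X := fun h => glue_of_nonpos e0 h; constructor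
  · grind
  · rintro ⟨hN, h⟩; have hεb : ε * b.fn Y = E * (glueArch R.P.C L.P.C).fn X := by linarith
    rcases le_total 0 X with hX | hX
    · have hY : 0 ≤ ε * Y := by
        have : 0 ≤ ε * b.fn Y := by rw [hεb]; exact mul_nonneg hE.le (sX.1.2 hX)
        rcases hε with rfl | rfl
        · grind
        grind
      grind
    · have hY : 0 ≤ -ε * Y := by
        have : ε * b.fn Y ≤ 0 := by rw [hεb]; exact mul_nonpos_of_nonneg_of_nonpos hE.le (sX.2.2 hX)
        rcases hε with rfl | rfl
        · grind
        grind
      grind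

/-- The model of the surface at a point over a vertex. -/
lemma Diagram.exists_vertexModel (D : Diagram) (hκ : 0 ≤ κ) (hr : r ∈ D.rects) (hz : std.z q ≠ 0)
    (hw : std.w q ≠ 0) (hq : q ∈ tile κ r) (hv : proj q ∈ r.vertices) :
    ∃ c b, VertexModel (D.surface κ) (2 + κ) (r.slope (proj q)) q c b := by
  by_cases hex : ∃ r' ∈ D.rects, r' ≠ r ∧ q ∈ tile κ r'
  · obtain ⟨r', hr', hne, hq'⟩ := hex; have hv' := (D.proj_mem_vertices hκ hr' hr hne hz hw hq' hq).1
    have hop := D.opposite_sgn hr hr' hne.symm hv hv'; have honly : ∀ r'' ∈ D.rects, q ∈ tile κ r'' → r'' = r ∨ r'' = r' := by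
      intro r'' hr'' hq''; by_contra! hn; have hv'' := (D.proj_mem_vertices hκ hr'' hr hn.1 hz hw hq'' hq).1
      have o1 := (D.opposite_sgn hr hr'' hn.1.symm hv hv'').1; have o2 := (D.opposite_sgn hr' hr'' hn.2.symm hv' hv'').1
      rcases r.sgnθ_abs (proj q).1 with h | h <;> rw [hop.1, h] at o2 <;> rw [h] at o1 <;> linarith
    have hF : ∀ᶠ p in 𝓝 q, p ∈ D.surface κ ↔ p ∈ tile κ r ∨ p ∈ tile κ r' := by
      filter_upwards [D.surface_local hκ q] with p hp; rw [hp]; constructor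
      · rintro ⟨r'', h1, h2, h3⟩; rcases honly r'' h1 h2 with rfl | rfl
        · exact .inl h3
        · exact .inr h3
      · rintro (h | h)
        · exact ⟨r, hr, hq, h⟩
        · exact ⟨r', hr', hq', h⟩
    rcases r.sgnθ_abs (proj q).1 with h | h
    · exact vertexModel_of_pair hκ hz hw hq hq' hv hv' hF hop h
    · have hop' : r.sgnθ (proj q).1 = -r'.sgnθ (proj q).1 ∧ r.sgnφ (proj q).2 = -r'.sgnφ (proj q).2 := by rw [hop.1, hop.2]; simp
      have hs : r.slope (proj q) = r'.slope (proj q) := by unfold Rect.slope; rw [hop.1, hop.2]; ring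
      rw [hs]; exact vertexModel_of_pair hκ hz hw hq' hq hv' hv (hF.mono fun p hp => hp.trans or_comm) hop'
        (by rw [hop.1, h]; norm_num)
  · push Not at hex
    refine ⟨glueArch r.P.C r.P.C, glueArch r.P.B r.P.B, .inr ⟨_, r.sgnθ_abs (proj q).1, ?_⟩⟩
    have hg : ∀ f : ℝ → ℝ, glue f f = f := fun f => by funext x; unfold glue; simp
    filter_upwards [D.surface_local hκ q, tile_local_vertex hκ hz hw hq hv] with p hp hp'
    change _ ↔ _ ∧ _ ∧ sepFn _ _ _ _ (glue _ _) (fun u => _ * glue _ _ u) p = 0; rw [hg, hg, hp, ← hp'.2]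
    exact ⟨fun ⟨r'', h1, h2, h3⟩ => by
      by_cases h : r'' = r
      · rwa [h] at h3
      grind, fun h => ⟨r, hr, hq, h⟩⟩

end Vertex

/-! ### Tangent planes away from the core circles -/

lemma mem_vertices_iff {v : Torus} (hx : x ∈ Icc 0 r.a) (hy : y ∈ Icc 0 r.b)
    (h1 : v.1 = (r.s + x : ℝ)) (h2 : v.2 = (r.t + y : ℝ)) : v ∈ r.vertices ↔ (x = 0 ∨ x = r.a) ∧ (y = 0 ∨ y = r.b) := by
  constructor
  · intro hv; obtain ⟨v1, v2⟩ := Rect.mem_vertices.1 hv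
    exact ⟨(Rect.cornerSign_θ hx h1 v1).imp And.left And.left, (Rect.cornerSign_φ hy h2 v2).imp And.left And.left⟩
  · rintro ⟨a1, a2⟩; refine Rect.mem_vertices.2 ⟨a1.imp (fun h => ?_) (fun h => ?_), a2.imp (fun h => ?_) (fun h => ?_)⟩
    · rw [h1, h, add_zero, r.coe_s]
    · rw [h1, h, r.coe_s_add_a]
    · rw [h2, h, add_zero, r.coe_t]
    · rw [h2, h, r.coe_t_add_b]

namespace Diagram
variable (D : Diagram)

/-- The surface near a point that is not on the core circles, and its tangent plane. -/
lemma sector_tangent (hκ : 0 ≤ κ) (hr : r ∈ D.rects) (hz : std.z q ≠ 0) (hw : std.w q ≠ 0)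
    (hq : q ∈ tile κ r) (hx : x ∈ Icc 0 r.a) (hy : y ∈ Icc 0 r.b)
    (h1 : (proj q).1 = (r.s + x : ℝ)) (h2 : (proj q).2 = (r.t + y : ℝ)) :
    (∃ β, (β = π ∨ β = 2 * π) ∧ IsSectorNear (D.surface κ) q β) ∧
    ∀ v, v ∈ tangentPlane (D.surface κ) q ↔ inner ℝ q v = 0 ∧
      sepForm std (2 + κ) q (r.P.C.fn x) (r.P.C.der x) (r.P.B.der y) v = 0 := by
  have hqF : q ∈ D.surface κ := mem_biUnion hr hq; have hX0 : std.X (std.w q) q = 0 := X_self hw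
  have hY0 : std.Y (std.z q) q = 0 := X_self (S := std.swap) hz; by_cases hv : proj q ∈ r.vertices
  · obtain ⟨c, b, hm⟩ := D.exists_vertexModel hκ hr hz hw hq hv
    obtain ⟨k1, k2⟩ := (hm.eventually_tangent (by linarith) (r.slope_abs _) hz hw).self_of_nhds hqF
    refine ⟨k1, fun v => (k2 v).trans ?_⟩; obtain ⟨v1, v2⟩ := Rect.mem_vertices.1 hv
    have s1 := Rect.cornerSign_θ hx h1 v1; have s2 := Rect.cornerSign_φ hy h2 v2; have c1 := s1.fn_add r.P.C 0
    have c2 := s1.der_add r.P.C 0; have c3 := s2.der_add r.P.B 0; rw [add_zero] at c1 c2 c3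
    rw [c1, c2, c3, hX0, hY0, c.zero, c.der_zero, b.der_zero, r.P.C.zero, r.P.C.der_zero, r.P.B.der_zero]
    refine and_congr Iff.rfl ?_; simp [sepForm, Rect.slope]; rcases s1.abs with e | e <;> rw [e]
    · simp
    · simp [FunLike.coe_sub, FunLike.coe_add, FunLike.coe_smul, Pi.sub_apply, Pi.add_apply, Pi.smul_apply, smul_eq_mul]; grind
  · obtain ⟨x', hx', y', hy', e1, e2, e3⟩ := exists_coords hκ hz hw hq; have ha := r.a_mem; have hb := r.b_mem
    have ex : x' = x := by
      rw [e1, coe_add, coe_add] at h1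
      exact coe_eq_coe_of_mem ⟨hx'.1, hx'.2.trans_lt ha.2⟩ ⟨hx.1, hx.2.trans_lt ha.2⟩ (add_left_cancel h1)
    have ey : y' = y := by
      rw [e2, coe_add, coe_add] at h2
      exact coe_eq_coe_of_mem ⟨hy'.1, hy'.2.trans_lt hb.2⟩ ⟨hy.1, hy.2.trans_lt hb.2⟩ (add_left_cancel h2)
    subst ex ey; have hE := exp_pos ((2 + κ) * std.lam q); rw [mem_vertices_iff hx hy h1 h2] at hv
    have hC0 := r.P.C.eq_zero_iff hx; have hB0 := r.P.B.eq_zero_iff hy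
    have hCB : r.P.C.fn x' = 0 ↔ r.P.B.fn y' = 0 := by rw [e3]; simp [hE.ne']
    have hCne : r.P.C.fn x' ≠ 0 := by grind
    have hxI : x' ∈ Ioo 0 r.a := by grind
    have hyI : y' ∈ Ioo 0 r.b := by grind
    have cX := (hasFDerivAt_X (S := std) (self_div_mem hw)).continuousAt
    have cY := (hasFDerivAt_Y (S := std) (self_div_mem hz)).continuousAt; have hF : ∀ᶠ p in 𝓝 q, p ∈ D.surface κ ↔ ‖p‖ ^ 2 = 1 ∧
        sepFn std (2 + κ) (std.w q) (std.z q) (fun u => r.P.C.fn (x' + u)) (fun u => r.P.B.fn (y' + u)) p = 0 := by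
      have hXm := (cX.const_add x').eventually_mem
        (Ioo_mem_nhds (by rw [hX0, add_zero]; exact hxI.1) (by rw [hX0, add_zero]; exact hxI.2))
      have hYm := (cY.const_add y').eventually_mem
        (Ioo_mem_nhds (by rw [hY0, add_zero]; exact hyI.1) (by rw [hY0, add_zero]; exact hyI.2))
      filter_upwards [D.surface_local hκ q, tile_local hκ hz hw hx hy h1 h2, hXm, hYm] with p hp hp' m1 m2
      have e : p ∈ D.surface κ ↔ p ∈ tile κ r := by
        rw [hp]; constructor
        · rintro ⟨r', a1, a2, a3⟩; by_cases h : r' = r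
          · rwa [h] at a3
          · exact absurd ((mem_vertices_iff hx hy h1 h2).1 (D.proj_mem_vertices hκ a1 hr h hz hw a2 hq).2) hv
        · exact fun h => ⟨r, hr, hq, h⟩
      rw [e, hp']; exact ⟨fun h => ⟨h.1, h.2.2.2⟩, fun h => ⟨h.1, Ioo_subset_Icc_self m1, Ioo_subset_Icc_self m2, h.2⟩⟩
    have dC : HasDerivAt (fun u => r.P.C.fn (x' + u)) (r.P.C.der x') (std.X (std.w q) q) := by
      rw [hX0]; have := r.P.C.hasDerivAt (x' + 0); rw [add_zero] at this
      simpa using HasDerivAt.comp_const_add x' 0 (by simpa using this)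
    have dB : HasDerivAt (fun u => r.P.B.fn (y' + u)) (r.P.B.der y') (std.Y (std.z q) q) := by
      rw [hY0]; have := r.P.B.hasDerivAt (y' + 0); rw [add_zero] at this
      simpa using HasDerivAt.comp_const_add y' 0 (by simpa using this)
    have sc : ∀ {L β m : ℝ} (f : Arch L β m) (s u : ℝ), ContDiffAt ℝ 1 (fun u => f.fn (s + u)) u := fun f s u =>
      ((f.contDiff.of_le one_le_two).comp (contDiff_const.add contDiff_id)).contDiffAt
    have := sector_of_sepFn (by linarith) (hF.self_of_nhds.1 hqF).1 hqF (self_div_mem hw) (self_div_mem hz)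
      dC dB (sc _ _ _) (sc _ _ _) (.inl ⟨hF, .inl (by rw [hX0, add_zero]; exact hCne)⟩)
    simpa only [hX0, add_zero] using this

end Diagram

open Split (ne_zero_of_slit eq_zero_of_forms contDiffAt_X)
/-! ### The characteristic foliation away from the core circles -/

lemma mem_contactPlane : v ∈ contactPlane q ↔ inner ℝ q v = 0 ∧ inner ℝ (contactNormal q) v = 0 := by
  rw [contactPlane, Submodule.mem_orthogonal]; constructor
  · exact fun h => ⟨h _ (Submodule.subset_span (by simp)), h _ (Submodule.subset_span (by simp))⟩
  · rintro ⟨h1, h2⟩ u hu; obtain ⟨s, t, rfl⟩ := Submodule.mem_span_pair.1 hu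
    rw [inner_add_left, inner_smul_left, inner_smul_left, h1, h2]; simp

namespace Split
variable {S : Split}

lemma inner_contactNormal (hz : S.z q ≠ 0) (hw : S.w q ≠ 0) (v : E4) :
    inner ℝ (contactNormal q) v = ‖S.z q‖ ^ 2 * S.dφ q v + ‖S.w q‖ ^ 2 * S.dθ q v := by
  have key : ∀ u c : ℂ, u ≠ 0 → inner ℝ (I * u) c = ‖u‖ ^ 2 * (u⁻¹ * c).im := by
    intro u c hu; rw [Complex.inner, ← normSq_eq_norm_sq, Complex.inv_def]; have : Complex.normSq u ≠ 0 := by simpa using hu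
    simp; field_simp; ring
  rw [S.inner_eq', S.z_normal, S.w_normal, key _ _ hz, key _ _ hw, dφ_apply, dθ_apply]

/-- Tangent vectors of the sphere with given angular and radial components. -/
lemma exists_vec (hz : S.z q ≠ 0) (hw : S.w q ≠ 0) (hN : ‖q‖ ^ 2 = 1) (θ' φ' l : ℝ) :
    ∃ v : E4, inner ℝ q v = 0 ∧ S.dθ q v = θ' ∧ S.dφ q v = φ' ∧ S.dlam q v = l := by
  rw [S.norm_sq] at hN; have e1 : ∀ c : ℂ, (S.w q)⁻¹ * (S.w q * c) = c := by simp_all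
  have e2 : ∀ c : ℂ, (S.z q)⁻¹ * (S.z q * c) = c := by simp_all
  refine ⟨S.ofPair (S.z q * ⟨-(‖S.w q‖ ^ 2 * l), φ'⟩, S.w q * ⟨‖S.z q‖ ^ 2 * l, θ'⟩), ?_, ?_, ?_, ?_⟩
  · rw [inner_eq_re hz hw, z_ofPair, w_ofPair, e1, e2]; ring
  · rw [dθ_apply, w_ofPair, e1]
  · rw [dφ_apply, z_ofPair, e2]
  · rw [dlam_apply, z_ofPair, w_ofPair, e1, e2]; linear_combination l * hN

lemma eq_of_coords {p₁ p₂ : E4} (w1 : S.w p₁ / w₀ ∈ slitPlane) (w2 : S.w p₂ / w₀ ∈ slitPlane)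
    (z1 : S.z p₁ / z₀ ∈ slitPlane) (z2 : S.z p₂ / z₀ ∈ slitPlane) (n1 : ‖p₁‖ ^ 2 = 1) (n2 : ‖p₂‖ ^ 2 = 1)
    (hX : S.X w₀ p₁ = S.X w₀ p₂) (hY : S.Y z₀ p₁ = S.Y z₀ p₂) (hl : S.lam p₁ = S.lam p₂) : p₁ = p₂ := by
  obtain ⟨a1, a0⟩ := ne_zero_of_slit w1; obtain ⟨a2, -⟩ := ne_zero_of_slit w2
  obtain ⟨b1, b0⟩ := ne_zero_of_slit z1; obtain ⟨b2, -⟩ := ne_zero_of_slit z2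
  have A1 := norm_pos_iff.2 a1; have A2 := norm_pos_iff.2 a2; have B1 := norm_pos_iff.2 b1; have B2 := norm_pos_iff.2 b2
  rw [S.norm_sq] at n1 n2; unfold lam at hl; rw [← log_div A1.ne' B1.ne', ← log_div A2.ne' B2.ne'] at hl
  have hr := log_injOn_pos (div_pos A1 B1) (div_pos A2 B2) hl; rw [div_eq_div_iff B1.ne' B2.ne'] at hr
  have hzz : ‖S.z p₁‖ = ‖S.z p₂‖ := by
    have h2 : ‖S.z p₁‖ ^ 2 = ‖S.z p₂‖ ^ 2 := by
      have h3 : (‖S.w p₁‖ * ‖S.z p₂‖) ^ 2 = (‖S.w p₂‖ * ‖S.z p₁‖) ^ 2 := by rw [hr]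
      nlinarith
    exact (pow_left_inj₀ B1.le B2.le two_ne_zero).1 h2
  have hww : ‖S.w p₁‖ = ‖S.w p₂‖ := by rw [hzz] at hr; exact mul_right_cancel₀ B2.ne' hr
  have key : ∀ {u v u₀ : ℂ}, u₀ ≠ 0 → u / u₀ ∈ slitPlane → v / u₀ ∈ slitPlane → ‖u‖ = ‖v‖ →
      (Complex.log (u / u₀)).im = (Complex.log (v / u₀)).im → u = v := by
    intro u v u₀ h0 hu hv hn hi; have h1 : Complex.log (u / u₀) = Complex.log (v / u₀) := by
      refine Complex.ext ?_ hi; rw [log_re, log_re, norm_div, norm_div, hn]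
    have h2 := congrArg Complex.exp h1
    rw [Complex.exp_log (slitPlane_ne_zero hu), Complex.exp_log (slitPlane_ne_zero hv)] at h2; grind
  exact S.ext (key b0 z1 z2 hzz hY) (key a0 w1 w2 hww hX)

end Split

section CharLine
variable {S : Split}

lemma sepForm_apply (v : E4) : sepForm S K q c c' b' v =
    exp (K * S.lam q) * c' * S.dθ q v - b' * S.dφ q v + K * exp (K * S.lam q) * c * S.dlam q v := by simp [sepForm]

/-- Tangency of the plane field `sepForm = 0` with the contact structure. -/
lemma tangentPlane_eq_contactPlane_iff (hK : 0 < K) (hz : S.z q ≠ 0) (hw : S.w q ≠ 0) (hN : ‖q‖ ^ 2 = 1)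
    (hT : ∀ v, v ∈ tangentPlane F q ↔ inner ℝ q v = 0 ∧ sepForm S K q c c' b' v = 0) (hb : c = 0 → b' ≠ 0) :
    tangentPlane F q = contactPlane q ↔ c = 0 ∧ exp (K * S.lam q) * c' * ‖S.z q‖ ^ 2 + b' * ‖S.w q‖ ^ 2 = 0 := by
  constructor
  · intro h; have h' : ∀ v, inner ℝ q v = 0 → inner ℝ (contactNormal q) v = 0 → sepForm S K q c c' b' v = 0 := by
      intro v h1 h2; exact ((hT v).1 (h ▸ mem_contactPlane.2 ⟨h1, h2⟩)).2
    simp [Split.inner_contactNormal hz hw, sepForm_apply] at h'; obtain ⟨v, v0, v1, v2, v3⟩ := Split.exists_vec hz hw hN 0 0 1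
    obtain ⟨u, u0, u1, u2, u3⟩ := Split.exists_vec hz hw hN (‖S.z q‖ ^ 2) (-‖S.w q‖ ^ 2) 0
    have a := h' v v0 (by rw [v1, v2]; ring); have b := h' u u0 (by rw [u1, u2]; ring); rw [v1, v2, v3] at a
    rw [u1, u2, u3] at b; refine ⟨?_, by linarith⟩; have : K * exp (K * S.lam q) * c = 0 := by linarith
    exact (mul_eq_zero.1 this).resolve_left (by positivity)
  · rintro ⟨rfl, hA⟩; ext v; rw [hT, mem_contactPlane, Split.inner_contactNormal hz hw, sepForm_apply]
    refine and_congr Iff.rfl ?_; have hz2 : ‖S.z q‖ ^ 2 ≠ 0 := by simpa using hz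
    have e : ‖S.z q‖ ^ 2 * (exp (K * S.lam q) * c' * S.dθ q v - b' * S.dφ q v + K * exp (K * S.lam q) * 0 * S.dlam q v)
        = -b' * (‖S.z q‖ ^ 2 * S.dφ q v + ‖S.w q‖ ^ 2 * S.dθ q v) := by linear_combination S.dθ q v * hA
    constructor
    · intro h; rw [h, mul_zero] at e; exact (mul_eq_zero.1 e.symm).resolve_left (neg_ne_zero.2 (hb rfl))
    · intro h; rw [h, mul_zero (-b')] at e; exact (mul_eq_zero.1 e).resolve_left hz2

/-- The direction of the characteristic foliation. -/
lemma exists_charLine_eq_span (hK : 0 < K) (hz : S.z q ≠ 0) (hw : S.w q ≠ 0) (hN : ‖q‖ ^ 2 = 1)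
    (hT : ∀ v, v ∈ tangentPlane F q ↔ inner ℝ q v = 0 ∧ sepForm S K q c c' b' v = 0)
    (hne : ¬ (c = 0 ∧ exp (K * S.lam q) * c' * ‖S.z q‖ ^ 2 + b' * ‖S.w q‖ ^ 2 = 0)) :
    ∃ d : E4, inner ℝ q d = 0 ∧ S.dθ q d = K * exp (K * S.lam q) * c * ‖S.z q‖ ^ 2 ∧
      S.dφ q d = -(K * exp (K * S.lam q) * c * ‖S.w q‖ ^ 2) ∧
      S.dlam q d = -(exp (K * S.lam q) * c' * ‖S.z q‖ ^ 2 + b' * ‖S.w q‖ ^ 2) ∧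
      charLine F q = Submodule.span ℝ {d} := by
  obtain ⟨d, d0, d1, d2, d3⟩ := Split.exists_vec hz hw hN (K * exp (K * S.lam q) * c * ‖S.z q‖ ^ 2)
    (-(K * exp (K * S.lam q) * c * ‖S.w q‖ ^ 2))
    (-(exp (K * S.lam q) * c' * ‖S.z q‖ ^ 2 + b' * ‖S.w q‖ ^ 2))
  refine ⟨d, d0, d1, d2, d3, ?_⟩; obtain ⟨A, hA⟩ : ∃ A, A = exp (K * S.lam q) * c' * ‖S.z q‖ ^ 2 + b' * ‖S.w q‖ ^ 2 := ⟨_, rfl⟩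
  obtain ⟨C, hC⟩ : ∃ C, C = K * exp (K * S.lam q) * c := ⟨_, rfl⟩; have hne' : ¬ (C = 0 ∧ A = 0) := by
    rw [hC, hA]; rintro ⟨h1, h2⟩; exact hne ⟨(mul_eq_zero.1 h1).resolve_left (by positivity), h2⟩
  rw [← hC] at d1 d2; rw [← hA] at d3; have hz2 : ‖S.z q‖ ^ 2 ≠ 0 := by simpa using hz
  have hpos : C ^ 2 + A ^ 2 ≠ 0 := by
    intro h; have h1 : C = 0 := by nlinarith [sq_nonneg C, sq_nonneg A]
    grind
  ext v; rw [Submodule.mem_span_singleton, charLine, Submodule.mem_inf, hT, mem_contactPlane, Split.inner_contactNormal hz hw,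
    sepForm_apply, ← hC]
  constructor
  · rintro ⟨⟨v0, v1⟩, -, v2⟩; obtain ⟨m, hm⟩ : ∃ m, S.dθ q v = ‖S.z q‖ ^ 2 * m := ⟨S.dθ q v / ‖S.z q‖ ^ 2, by field_simp⟩
    have hφ : S.dφ q v = -‖S.w q‖ ^ 2 * m := by
      rw [hm] at v2; have : ‖S.z q‖ ^ 2 * (S.dφ q v + ‖S.w q‖ ^ 2 * m) = 0 := by linear_combination v2
      linarith [(mul_eq_zero.1 this).resolve_left hz2]
    have v1' : A * m + C * S.dlam q v = 0 := by rw [hm, hφ] at v1; rw [hA]; linear_combination v1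
    refine ⟨(C * m - A * S.dlam q v) / (C ^ 2 + A ^ 2), ?_⟩; have hm' : (C * m - A * S.dlam q v) / (C ^ 2 + A ^ 2) * C = m := by
      rw [div_mul_eq_mul_div, div_eq_iff hpos]; linear_combination -A * v1'
    have hl' : (C * m - A * S.dlam q v) / (C ^ 2 + A ^ 2) * -A = S.dlam q v := by
      rw [div_mul_eq_mul_div, div_eq_iff hpos]; linear_combination -C * v1'
    rw [← sub_eq_zero]; refine eq_zero_of_forms hz hw ?_ ?_ ?_ ?_
    · rw [map_sub, map_smul, smul_eq_mul, d1, ← mul_assoc, hm', hm]; ring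
    · rw [map_sub, map_smul, smul_eq_mul, d2, hφ, mul_neg, ← mul_assoc, hm']; ring
    · rw [map_sub, map_smul, smul_eq_mul, d3, hl']; ring
    · rw [inner_sub_right, inner_smul_right, d0, v0]; simp
  · rintro ⟨t, rfl⟩; simp only [map_smul, smul_eq_mul, inner_smul_right, d0, d1, d2, d3]
    refine ⟨⟨by ring, ?_⟩, by ring, by ring⟩; rw [hA]; ring

end CharLine

/-! ### Saddles -/

lemma Germ.exists_inverse (b : Germ) : ∃ g : ℝ → ℝ, ContDiffAt ℝ 1 g 0 ∧ g 0 = 0 ∧ ∀ᶠ y in 𝓝 (0 : ℝ), g (b.fn y) = y := by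
  have hd : HasFDerivAt b.fn ((ContinuousLinearEquiv.refl ℝ ℝ : ℝ ≃L[ℝ] ℝ) : ℝ →L[ℝ] ℝ) 0 := by
    have := (b.hasDerivAt 0).hasFDerivAt; rw [b.der_zero] at this; refine this.congr_fderiv ?_; ext; simp
  have hc : ContDiffAt ℝ 1 b.fn 0 := (b.contDiff.of_le one_le_two).contDiffAt
  have hs : HasStrictFDerivAt b.fn ((ContinuousLinearEquiv.refl ℝ ℝ : ℝ ≃L[ℝ] ℝ) : ℝ →L[ℝ] ℝ) 0 :=
    hc.hasStrictFDerivAt' hd one_ne_zero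
  have h1 := hc.to_localInverse hd one_ne_zero; have h2 := hs.eventually_left_inverse; rw [b.zero] at h1
  exact ⟨_, h1, by have := h2.self_of_nhds; rwa [b.zero] at this, h2⟩

lemma det_E2 (M : E2 →L[ℝ] E2) : LinearMap.det M.toLinearMap = M (EuclideanSpace.single 0 1) 0 * M (EuclideanSpace.single 1 1) 1 -
      M (EuclideanSpace.single 1 1) 0 * M (EuclideanSpace.single 0 1) 1 := by
  rw [← LinearMap.det_toMatrix (EuclideanSpace.basisFun (Fin 2) ℝ).toBasis, Matrix.det_fin_two]; simp [LinearMap.toMatrix_apply]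

lemma hasFDerivAt_pair {f g : E4 → ℝ} {f' g' : E4 →L[ℝ] ℝ} (hf : HasFDerivAt f f' p) (hg : HasFDerivAt g g' p) :
    DifferentiableAt ℝ (fun p => (!₂[f p, g p] : E2)) p ∧
    ∀ v, fderiv ℝ (fun p => (!₂[f p, g p] : E2)) p v = !₂[f' v, g' v] := by
  have h : DifferentiableAt ℝ (fun p => (!₂[f p, g p] : E2)) p := by
    rw [differentiableAt_euclidean]; intro i
    fin_cases i
    · exact hf.differentiableAt
    · exact hg.differentiableAt
  refine ⟨h, fun v => ?_⟩; have h2 := (hasFDerivWithinAt_euclidean (t := univ)).1 h.hasFDerivAt.hasFDerivWithinAt; ext i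
  fin_cases i
  · exact congrArg (fun l : E4 →L[ℝ] ℝ => l v) ((hasFDerivWithinAt_univ.1 (h2 0)).unique hf)
  · exact congrArg (fun l : E4 →L[ℝ] ℝ => l v) ((hasFDerivWithinAt_univ.1 (h2 1)).unique hg)

lemma isSaddle_of_vertexModel (hκ : 0 < κ) {c b : Germ} (hm : VertexModel F (2 + κ) (-1) q c b)
    (hz : std.z q ≠ 0) (hw : std.w q ≠ 0) (hqF : q ∈ F) (hl : std.lam q = 0) : IsSaddle F q := by
  set S := std with hS; have hX0 : S.X (S.w q) q = 0 := X_self hw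
  have hY0 : S.Y (S.z q) q = 0 := X_self (S := S.swap) hz; obtain ⟨g, gC, g0, gb⟩ := b.exists_inverse
  have tX : Tendsto (S.X (S.w q)) (𝓝 q) (𝓝 0) := by
    have := (hasFDerivAt_X (S := S) (self_div_mem hw)).continuousAt.tendsto; rwa [hX0] at this
  have tY : Tendsto (S.Y (S.z q)) (𝓝 q) (𝓝 0) := by
    have := (hasFDerivAt_Y (S := S) (self_div_mem hz)).continuousAt.tendsto; rwa [hY0] at this
  have hbd : ∀ᶠ y in 𝓝 (0 : ℝ), b.der y ≠ 0 := b.contDiff_der.continuous.continuousAt.eventually_ne (by rw [b.der_zero]; norm_num)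
  obtain ⟨gc, -, -, gcb⟩ := c.exists_inverse
  have hF : ∀ᶠ p in 𝓝 q, p ∈ F → ‖p‖ ^ 2 = 1 ∧ sepFn S (2 + κ) (S.w q) (S.z q) c.fn (fun u => -1 * b.fn u) p = 0 := by
    rcases hm with h | ⟨σ, -, h⟩
    · exact h.mono fun p hp hpF => hp.1 hpF
    · exact h.mono fun p hp hpF => ⟨(hp.1 hpF).1, (hp.1 hpF).2.2⟩
  have hall := (((hm.eventually_tangent (by linarith) (.inr rfl) hz hw).and hF).and
    ((eventually_slit (self_div_mem hw)).and (eventually_slit (S := S.swap) (self_div_mem hz)))).and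
    (((tY.eventually gb).and (tY.eventually hbd)).and (tX.eventually gcb))
  obtain ⟨U, hU, Uo, qU⟩ := mem_nhds_iff.1 hall; have gz : gc 0 = 0 := by have := gcb.self_of_nhds; rwa [c.zero] at this
  obtain ⟨hN, -⟩ := hF.self_of_nhds hqF; have hT0 := ((hU qU).1.1.1 hqF).2
  rw [hX0, hY0, c.zero, c.der_zero, b.der_zero] at hT0; have hzw : ‖S.z q‖ ^ 2 = ‖S.w q‖ ^ 2 := by
    have := exp_lam (K := 1) hz hw
    rw [hl, mul_zero, exp_zero, rpow_one, rpow_one, eq_comm, div_eq_one_iff_eq (norm_ne_zero_iff.2 hz)] at this; rw [this]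
  have nz : ∀ p ∈ U, S.z p ≠ 0 ∧ S.w p ≠ 0 := fun p hp =>
    ⟨(ne_zero_of_slit (hU hp).1.2.2).1, (ne_zero_of_slit (hU hp).1.2.1).1⟩
  have hpair := fun p hp => hasFDerivAt_pair (hasFDerivAt_X (hU hp).1.2.1) (S.hasFDerivAt_lam (nz p hp).1 (nz p hp).2)
  have hsep : ∀ p ∈ F ∩ U, b.fn (S.Y (S.z q) p) = -(exp ((2 + κ) * S.lam p) * c.fn (S.X (S.w q) p)) := by
    intro p hp; have := ((hU hp.2).1.1.2 hp.1).2; unfold sepFn at this; linarith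
  have hYeq : ∀ p ∈ F ∩ U, S.Y (S.z q) p = g (-(exp ((2 + κ) * S.lam p) * c.fn (S.X (S.w q) p))) := by
    intro p hp; rw [← hsep p hp]; exact (hU hp.2).2.1.1.symm
  set V : E2 → E2 := fun u => !₂[(2 + κ) * c.fn (u 0),
    -(c.der (u 0) - exp (-κ * u 1) * b.der (g (-(exp ((2 + κ) * u 1) * c.fn (u 0)))))] with hV
  have p1 : ContDiff ℝ 1 fun u : E2 => u 1 := by fun_prop
  have p0 : ContDiff ℝ 1 fun u : E2 => u 0 := by fun_prop
  have c1 : ContDiff ℝ 1 c.fn := c.contDiff.of_le one_le_two; have Vc : ContDiffAt ℝ 1 V 0 := by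
    rw [contDiffAt_euclidean]; intro i
    fin_cases i
    · exact (contDiff_const.mul (c1.comp p0)).contDiffAt
    · refine ((c.contDiff_der.comp p0).contDiffAt.sub ((contDiff_const.mul p1).exp.contDiffAt.mul
        (b.contDiff_der.contDiffAt.comp _ (ContDiffAt.comp _ ?_ ((contDiff_const.mul p1).exp.mul (c1.comp p0)).neg.contDiffAt)))).neg
      simpa [c.zero] using gC
  have V0 : V 0 = 0 := by
    ext i
    fin_cases i <;> simp [hV, c.zero, g0, c.der_zero, b.der_zero]
  refine ⟨⟨hqF, ?_⟩, U, fun p => !₂[S.X (S.w q) p, S.lam p], V, ⟨Uo, qU, ?_, ?_, ?_, ?_⟩, Vc, V0, ?_, ?_⟩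
  · rw [tangentPlane_eq_contactPlane_iff (by linarith) hz hw hN hT0 (fun _ => by norm_num), hl, mul_zero, exp_zero, hzw]
    exact ⟨rfl, by ring⟩
  · intro p hp; refine ContDiffAt.contDiffWithinAt (contDiffAt_euclidean.2 fun i => ?_)
    fin_cases i
    · exact contDiffAt_X (hU hp).1.2.1
    · exact S.contDiffAt_lam (nz p hp).1 (nz p hp).2
  · ext i
    fin_cases i
    · exact hX0
    · exact hl
  · intro p hp p' hp' h; have e0 : S.X (S.w q) p = S.X (S.w q) p' := congrArg (fun u : E2 => u 0) h
    have e1 : S.lam p = S.lam p' := congrArg (fun u : E2 => u 1) h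
    refine Split.eq_of_coords (hU hp.2).1.2.1 (hU hp'.2).1.2.1 (hU hp.2).1.2.2 (hU hp'.2).1.2.2 ((hU hp.2).1.1.2 hp.1).1
      ((hU hp'.2).1.1.2 hp'.1).1 e0 ?_ e1
    change S.Y (S.z q) p = S.Y (S.z q) p'; rw [hYeq p hp, hYeq p' hp', e0, e1]
  · intro p hp v hv h; rw [(hpair p hp.2).2] at h; have e0 : S.dθ p v = 0 := congrArg (fun u : E2 => u 0) h
    have e1 : S.dlam p v = 0 := congrArg (fun u : E2 => u 1) h; have hv' := (((hU hp.2).1.1.1 hp.1).2 v).1 hv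
    rw [sepForm_apply, e0, e1] at hv'; refine eq_zero_of_forms (nz p hp.2).1 (nz p hp.2).2 e0 ?_ e1 hv'.1
    have := hv'.2; simp only [mul_zero, zero_sub, add_zero, neg_mul, one_mul, neg_neg] at this
    exact (mul_eq_zero.1 this).resolve_left (hU hp.2).2.1.2
  · have hd := (Vc.differentiableAt one_ne_zero).hasFDerivAt
    have line : ∀ e : E2, HasDerivAt (fun t : ℝ => V (t • e)) (fderiv ℝ V 0 e) 0 := by
      intro e; have h1 : HasDerivAt (fun t : ℝ => t • e) e 0 := by simpa using (hasDerivAt_id (0 : ℝ)).smul_const e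
      exact HasFDerivAt.comp_hasDerivAt 0 (by rwa [zero_smul]) h1
    have comp : ∀ (e : E2) (i : Fin 2), HasDerivAt (fun t : ℝ => V (t • e) i) (fderiv ℝ V 0 e i) 0 := fun e i =>
      (EuclideanSpace.proj i : E2 →L[ℝ] ℝ).hasFDerivAt.comp_hasDerivAt (0 : ℝ) (line e)
    have d00 : fderiv ℝ V 0 (EuclideanSpace.single 0 1) 0 = 2 + κ := by
      refine (comp _ 0).unique ?_; have h2 := (c.hasDerivAt 0).const_mul (2 + κ); rw [c.der_zero, mul_one] at h2
      simpa [hV] using h2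
    have d10 : fderiv ℝ V 0 (EuclideanSpace.single 1 1) 0 = 0 := by
      refine (comp _ 0).unique ?_; simpa [hV, c.zero] using hasDerivAt_const (0 : ℝ) (0 : ℝ)
    have d11 : fderiv ℝ V 0 (EuclideanSpace.single 1 1) 1 = -κ := by
      refine (comp _ 1).unique ?_; have h2 : HasDerivAt (fun t : ℝ => -(1 - exp (-κ * t))) (-κ) 0 := by
        have := (((hasDerivAt_id (0 : ℝ)).const_mul (-κ)).exp.const_sub 1).neg
        simp only [id, mul_zero, exp_zero, one_mul, mul_one, neg_neg] at this; exact this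
      simpa [hV, c.zero, g0, c.der_zero, b.der_zero] using h2
    rw [det_E2, d00, d10, d11]; nlinarith
  · intro p hp hpq; obtain ⟨hz', hw'⟩ := nz p hp.2; have hN' := ((hU hp.2).1.1.2 hp.1).1
    have hz2 : 0 < ‖S.z p‖ ^ 2 := by positivity
    have hE2 : ‖S.w p‖ ^ 2 = exp ((2 + κ) * S.lam p) * ‖S.z p‖ ^ 2 * exp (-κ * S.lam p) := by
      have h2 := exp_lam (K := (2 : ℝ)) hz' hw'; rw [rpow_two, rpow_two, eq_div_iff hz2.ne'] at h2
      rw [← h2, mul_right_comm, ← exp_add]; congr 2; ring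
    obtain ⟨d, d0, d1, d2, d3, d4⟩ := exists_charLine_eq_span (by linarith) hz' hw' hN' ((hU hp.2).1.1.1 hp.1).2 (by
      rintro ⟨h1, h2⟩; have x0 : S.X (S.w q) p = 0 := by have := (hU hp.2).2.2; rwa [h1, gz, eq_comm] at this
      have y0 : S.Y (S.z q) p = 0 := by rw [hYeq p hp, h1, mul_zero, neg_zero, g0]
      rw [x0, y0, c.der_zero, b.der_zero, hE2] at h2
      have h3 : exp ((2 + κ) * S.lam p) * ‖S.z p‖ ^ 2 * (1 - exp (-κ * S.lam p)) = 0 := by linear_combination h2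
      have h4 := (mul_eq_zero.1 h3).resolve_left (by positivity)
      have h5 : -κ * S.lam p = 0 := exp_eq_one_iff _ |>.1 (by linarith)
      refine hpq (Split.eq_of_coords (hU hp.2).1.2.1 (self_div_mem hw) (hU hp.2).1.2.2 (self_div_mem hz)
        hN' hN (x0.trans hX0.symm) (y0.trans hY0.symm) (?_ : S.lam p = S.lam q))
      rw [hl]; exact (mul_eq_zero.1 h5).resolve_left (by linarith))
    rw [d4, Submodule.map_span, image_singleton]; change Submodule.span ℝ {fderiv ℝ _ p d} = _; rw [(hpair p hp.2).2, d1, d3]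
    have hu : IsUnit (exp ((2 + κ) * S.lam p) * ‖S.z p‖ ^ 2) := (by positivity : _ ≠ (0 : ℝ)).isUnit
    refine Eq.trans ?_ (Submodule.span_singleton_smul_eq hu _); congr 2; ext i
    fin_cases i
    · simp [hV]; ring
    · simp [hV]; rw [hE2, ← hYeq p hp]; simp; ring

/-! ### Arcs on the line of angles -/

/-- The angle `α` is in the arc of length `a` that starts at `s`. -/
def InArc (s a α : ℝ) : Prop := ∃ x ∈ Icc 0 a, (α : Angle) = (s + x : ℝ)

lemma inArc_add_iff {α : ℝ} (hx₀ : x₀ ∈ Icc 0 a) (hα : (α : Angle) = (s + x₀ : ℝ))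
    (hu : |u| < 2 * π - a) : InArc s a (α + u) ↔ x₀ + u ∈ Icc 0 a :=
  ⟨fun ⟨x, hx, h⟩ => (arc_shift hx₀ hx hα hu).1 h ▸ hx, fun h => ⟨_, h, (arc_shift hx₀ h hα hu).2 rfl⟩⟩

lemma isClosed_inArc (s a : ℝ) : IsClosed {α | InArc s a α} := by
  have h : {α | InArc s a α} = (fun α : ℝ => (α : Angle)) ⁻¹' ((fun x : ℝ => ((s + x : ℝ) : Angle)) '' Icc 0 a) := by
    ext α; exact ⟨fun ⟨x, hx, h⟩ => ⟨x, hx, h.symm⟩, fun ⟨x, hx, h⟩ => ⟨x, hx, h.symm⟩⟩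
  rw [h]; have hc : Continuous fun x : ℝ => ((s + x : ℝ) : Angle) := continuous_coe.comp (continuous_const.add continuous_id)
  exact (isCompact_Icc.image hc).isClosed.preimage continuous_coe

lemma arc_coord_unique (ha : a < 2 * π) (hx : x ∈ Icc 0 a) (hy : y ∈ Icc 0 a)
    (h : ((s + x : ℝ) : Angle) = (s + y : ℝ)) : x = y := by
  rw [coe_add, coe_add] at h; exact coe_eq_coe_of_mem ⟨hx.1, hx.2.trans_lt ha⟩ ⟨hy.1, hy.2.trans_lt ha⟩ (add_left_cancel h)

lemma eventually_abs_sub_lt (α : ℝ) (hδ : 0 < δ) : ∀ᶠ y in 𝓝 α, |y - α| < δ := Metric.eventually_nhds_iff.2 ⟨δ, hδ, fun _ h => h⟩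

/-! ### Periodic functions with prescribed arcs -/

/-- A `C²` function that vanishes at the ends of an interval together with its second derivative. -/
structure Wave where
  L : ℝ
  f : ℝ → ℝ
  f' : ℝ → ℝ
  f'' : ℝ → ℝ
  hasDerivAt : ∀ x, HasDerivAt f (f' x) x
  hasDerivAt' : ∀ x, HasDerivAt f' (f'' x) x
  cont : Continuous f''
  zero : f 0 = 0
  zero'' : f'' 0 = 0
  zero_len : f L = 0
  zero_len'' : f'' L = 0

lemma contDiff_two_of_hasDerivAt {f'' : ℝ → ℝ} (h : ∀ x, HasDerivAt f (f' x) x) (h' : ∀ x, HasDerivAt f' (f'' x) x)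
    (hc : Continuous f'') : ContDiff ℝ 2 f := by
  rw [show (2 : WithTop ℕ∞) = 1 + 1 from rfl, contDiff_succ_iff_deriv]; refine ⟨fun x => (h x).differentiableAt, by simp, ?_⟩
  rw [funext fun x => (h x).deriv, show (1 : WithTop ℕ∞) = 0 + 1 from rfl, contDiff_succ_iff_deriv]
  refine ⟨fun x => (h' x).differentiableAt, by simp, ?_⟩; rwa [contDiff_zero, funext fun x => (h' x).deriv]

/-- An arch with a sign. -/
def Wave.ofArch (f : Arch L β m) (ε : ℝ) : Wave where
  L := L
  f x := ε * f.fn x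
  f' x := ε * f.der x
  f'' x := ε * (β * f.fn x - 2 * m * f.fn x ^ 3)
  hasDerivAt x := (f.hasDerivAt x).const_mul ε
  hasDerivAt' x := (f.hasDerivAt_der x).const_mul ε
  cont := by have := f.continuous; fun_prop
  zero := by rw [f.zero, mul_zero]
  zero'' := by rw [f.zero]; ring
  zero_len := by rw [f.fn_len, mul_zero]
  zero_len'' := by rw [f.fn_len]; ring

/-- A function with arbitrary slopes at the ends of an interval. -/
lemma Wave.exists_of_slopes (hL : 0 < L) (d₀ d₁ : ℝ) : ∃ W : Wave, W.L = L ∧ W.f' 0 = d₀ ∧ W.f' W.L = d₁ := by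
  obtain ⟨A, hA⟩ : ∃ A, A = (d₀ - d₁) / 2 := ⟨_, rfl⟩; obtain ⟨B, hB⟩ : ∃ B, B = (d₀ + d₁) / 2 := ⟨_, rfl⟩
  obtain ⟨k, hk⟩ : ∃ k, k = π / L := ⟨_, rfl⟩; have hk0 : k ≠ 0 := by rw [hk]; positivity
  have hkL : k * L = π := by rw [hk]; field_simp
  have hlin : ∀ c x : ℝ, HasDerivAt (fun x => c * x) c x := fun c x => by simpa using (hasDerivAt_id x).const_mul c
  refine ⟨{ L := L
            f := fun x => A / k * sin (k * x) + B / (2 * k) * sin (2 * k * x)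
            f' := fun x => A * cos (k * x) + B * cos (2 * k * x)
            f'' := fun x => -(A * k) * sin (k * x) - B * (2 * k) * sin (2 * k * x)
            hasDerivAt := fun x => ?_
            hasDerivAt' := fun x => ?_
            cont := by fun_prop
            zero := by simp
            zero'' := by simp
            zero_len := by rw [mul_assoc, hkL]; simp
            zero_len'' := by rw [mul_assoc 2, hkL]; simp }, rfl, ?_, ?_⟩
  · convert! ((hlin k x).sin.const_mul (A / k)).add ((hlin (2 * k) x).sin.const_mul (B / (2 * k))) using 1
    field_simp
  · convert! ((hlin k x).cos.const_mul A).add ((hlin (2 * k) x).cos.const_mul B) using 1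
    ring
  · simp [hA, hB]; ring
  · simp [mul_assoc, hkL, cos_pi, cos_two_pi, hA, hB]; ring

/-- Functions on arcs that cover the circle and meet with equal slopes are restrictions of a periodic function. -/
lemma exists_periodic {ι : Type} [Fintype ι] (s : ι → ℝ) (W : ι → Wave) (hL : ∀ i, (W i).L ∈ Ioo 0 (2 * π))
    (cover : ∀ α : ℝ, (∃ i, ∃ x ∈ Ioo 0 (W i).L, (α : Angle) = (s i + x : ℝ) ∧ ∀ j, j ≠ i → ¬ InArc (s j) (W j).L α) ∨
      ∃ i j, i ≠ j ∧ (α : Angle) = (s i : ℝ) ∧ (α : Angle) = (s j + (W j).L : ℝ) ∧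
        (W i).f' 0 = (W j).f' (W j).L ∧ ∀ k, k ≠ i → k ≠ j → ¬ InArc (s k) (W k).L α) :
    ∃ C : ℝ → ℝ, ContDiff ℝ 2 C ∧ (∀ α β : ℝ, (α : Angle) = β → C α = C β) ∧
      ∀ i, ∀ x ∈ Icc 0 (W i).L, ∀ α : ℝ, (α : Angle) = (s i + x : ℝ) → C α = (W i).f x ∧ HasDerivAt C ((W i).f' x) α := by
  classical
  set T : ι → ℝ → ℝ := fun i α => if InArc (s i) (W i).L α then (W i).f (arcCoord ((α : Angle) - s i)) else 0 with hT
  have T1 : ∀ {i x} {α : ℝ}, x ∈ Icc 0 (W i).L → (α : Angle) = (s i + x : ℝ) → T i α = (W i).f x := by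
    intro i x α hx hα; have : arcCoord ((α : Angle) - s i) = x := by
      rw [hα, coe_add, add_sub_cancel_left, arcCoord_coe_of_mem ⟨hx.1, hx.2.trans_lt (hL i).2⟩]
    rw [hT]; simp only; rw [if_pos ⟨x, hx, hα⟩, this]
  have T0 : ∀ {i α}, ¬ InArc (s i) (W i).L α → T i α = 0 := fun h => if_neg h
  have Tz : ∀ {i α}, ¬ InArc (s i) (W i).L α → ∀ᶠ y in 𝓝 α, T i y = 0 := fun {i α} h =>
    ((isClosed_inArc _ _).isOpen_compl.eventually_mem h).mono fun y hy => T0 hy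
  have hpos : ∀ i, 0 < 2 * π - (W i).L := by grind
  have hall : ∀ (α : ℝ) (A : Finset ι), (∀ k, k ∉ A → ¬ InArc (s k) (W k).L α) → ∀ᶠ y in 𝓝 α, ∑ i, T i y = ∑ i ∈ A, T i y := by
    intro α A hA; have : ∀ᶠ y in 𝓝 α, ∀ k, k ∉ A → T k y = 0 := by
      rw [eventually_all]; intro k; by_cases hk : k ∈ A
      · exact .of_forall fun _ h => absurd hk h
      grind
    exact this.mono fun y hy => (Finset.sum_subset (Finset.subset_univ A) fun k _ hk => hy k hk).symm
  have key : ∀ α : ℝ, ∃ g g' g'' : ℝ → ℝ, (∀ x, HasDerivAt g (g' x) x) ∧ (∀ x, HasDerivAt g' (g'' x) x) ∧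
      Continuous g'' ∧ (∀ᶠ y in 𝓝 α, ∑ i, T i y = g (y - α)) ∧
      ∀ i, ∀ x ∈ Icc 0 (W i).L, (α : Angle) = (s i + x : ℝ) → g' 0 = (W i).f' x := by
    intro α; rcases cover α with ⟨i, x, hx, hα, hn⟩ | ⟨i, j, hij, hi, hj, hs, hn⟩
    · have hxI := Ioo_subset_Icc_self hx; refine ⟨fun u => (W i).f (x + u), fun u => (W i).f' (x + u), fun u => (W i).f'' (x + u),
        fun u => ((W i).hasDerivAt _).comp_const_add _ _, fun u => ((W i).hasDerivAt' _).comp_const_add _ _,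
        (W i).cont.comp (continuous_const.add continuous_id), ?_, ?_⟩
      · filter_upwards [hall α {i} fun k hk => hn k (by simpa using hk), eventually_abs_sub_lt α (hpos i),
          eventually_abs_sub_lt α hx.1, eventually_abs_sub_lt α (sub_pos.2 hx.2)] with y h1 h2 h3 h4
        rw [h1, Finset.sum_singleton]; have h4' := abs_lt.1 h4; have hm : x + (y - α) ∈ Icc 0 (W i).L := by grind
        refine T1 hm ?_; have := (arc_shift hxI hm hα h2).2 rfl; grind
      · intro k y hy hk; by_cases h : k = i
        · subst h; change (W k).f' (x + 0) = _; rw [add_zero, arc_coord_unique (hL k).2 hxI hy (hα.symm.trans hk)]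
        · exact absurd ⟨y, hy, hk⟩ (hn k h)
    · have m0 : ∀ k, (0 : ℝ) ∈ Icc 0 (W k).L := by grind
      have mL : ∀ k, (W k).L ∈ Icc 0 (W k).L := by grind
      have hi' : (α : Angle) = (s i + 0 : ℝ) := by rw [add_zero]; exact hi
      have e0 : (W i).f 0 = (W j).f ((W j).L + 0) := by rw [add_zero, (W i).zero, (W j).zero_len]
      have e1 : (W i).f' 0 = (W j).f' ((W j).L + 0) := by rw [add_zero, hs]
      have e2 : (W i).f'' 0 = (W j).f'' ((W j).L + 0) := by rw [add_zero, (W i).zero'', (W j).zero_len'']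
      refine ⟨glue (W i).f fun u => (W j).f ((W j).L + u), glue (W i).f' fun u => (W j).f' ((W j).L + u),
        glue (W i).f'' fun u => (W j).f'' ((W j).L + u),
        hasDerivAt_glue (W i).hasDerivAt (fun u => ((W j).hasDerivAt _).comp_const_add _ _) e0 e1,
        hasDerivAt_glue (W i).hasDerivAt' (fun u => ((W j).hasDerivAt' _).comp_const_add _ _) e1 e2,
        continuous_glue (W i).cont ((W j).cont.comp (continuous_const.add continuous_id)) e2, ?_, ?_⟩
      · filter_upwards [hall α {i, j} fun k hk => by grind,
          eventually_abs_sub_lt α (hpos i), eventually_abs_sub_lt α (hpos j), eventually_abs_sub_lt α (hL i).1,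
          eventually_abs_sub_lt α (hL j).1] with y h1 h2 h3 h4 h5
        rw [h1, Finset.sum_pair hij]; have k1 := inArc_add_iff (m0 i) hi' h2; have k2 := inArc_add_iff (mL j) hj h3
        rw [add_sub_cancel] at k1 k2; have s1 : 0 ≤ y - α → T i y = (W i).f (y - α) := fun h => by
          have hm : 0 + (y - α) ∈ Icc 0 (W i).L := by grind
          have := (arc_shift (m0 i) hm hi' h2).2 rfl; grind
        have s2 : y - α ≤ 0 → T j y = (W j).f ((W j).L + (y - α)) := fun h => by
          have hm : (W j).L + (y - α) ∈ Icc 0 (W j).L := by grind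
          have := (arc_shift (mL j) hm hj h3).2 rfl; grind
        rcases lt_trichotomy (y - α) 0 with h | h | h
        · rw [glue_of_nonpos e0 h.le, s2 h.le, T0 fun hc => by grind, zero_add]
        · rw [s1 h.ge, s2 h.le, h, glue_of_nonneg le_rfl, add_zero, (W j).zero_len, add_zero]
        · rw [glue_of_nonneg h.le, s1 h.le, T0 fun hc => by grind, add_zero]
      · intro k y hy hk; rw [glue_of_nonneg le_rfl]; by_cases h : k = i
        · subst h; rw [← arc_coord_unique (hL k).2 (m0 k) hy (hi'.symm.trans hk)]
        by_cases h' : k = j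
        · subst h'; rw [← arc_coord_unique (hL k).2 (mL k) hy (hj.symm.trans hk), hs]
        · exact absurd ⟨y, hy, hk⟩ (hn k h h')
  refine ⟨fun α => ∑ i, T i α, contDiff_iff_contDiffAt.2 fun α => ?_, fun α β h => ?_, fun i x hx α hα => ⟨?_, ?_⟩⟩
  · obtain ⟨g, g', g'', h, h', hc, he, -⟩ := key α
    exact ((contDiff_two_of_hasDerivAt h h' hc).comp (contDiff_id.sub contDiff_const)).contDiffAt.congr_of_eventuallyEq he
  · refine Finset.sum_congr rfl fun i _ => ?_; have e : InArc (s i) (W i).L α ↔ InArc (s i) (W i).L β := by simp [InArc, h]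
    grind
  · rw [← T1 hx hα]; obtain ⟨k, hk⟩ | ⟨k, l, hkl, h1, h2, -, hn⟩ := cover α
    · obtain ⟨y, -, -, hn⟩ := hk; have : i = k := by by_contra h; exact hn i h ⟨x, hx, hα⟩
      exact Finset.sum_eq_single i (fun j _ hj => T0 (hn j (this ▸ hj))) fun h => absurd (Finset.mem_univ _) h
    · have z1 : T k α = 0 := by rw [T1 (x := 0) ⟨le_rfl, (hL k).1.le⟩ (by rw [add_zero]; exact h1), (W k).zero]
      have z2 : T l α = 0 := by rw [T1 (x := (W l).L) ⟨(hL l).1.le, le_rfl⟩ h2, (W l).zero_len]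
      have hall0 : ∀ j, T j α = 0 := fun j => by
        by_cases a : j = k
        · rw [a, z1]
        grind
      rw [hall0 i]; exact Finset.sum_eq_zero fun j _ => hall0 j
  · obtain ⟨g, g', g'', h, -, -, he, hd⟩ := key α; rw [← hd i x hx hα]; have h0 := h (α - α); rw [sub_self] at h0
    have := HasDerivAt.comp_sub_const α α (f := g) (f' := g' 0) (by rwa [sub_self]); exact this.congr_of_eventuallyEq he

/-! ### The arcs around a point of a core circle -/

/-- Arcs with profiles and signs, which meet only in their ends, and have at most two free ends. -/
structure Fan (ι : Type) where
  s : ι → ℝ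
  a : ι → ℝ
  b : ι → ℝ
  ε : ι → ℝ
  P : ∀ i, Profile (a i) (b i)
  ha : ∀ i, a i ∈ Ioo 0 (2 * π)
  hε : ∀ i, ε i = 1 ∨ ε i = -1
  meet : ∀ i j, i ≠ j → ∀ α : ℝ, InArc (s i) (a i) α → InArc (s j) (a j) α → ε j = -ε i ∧
    (((α : Angle) = (s i : ℝ) ∧ (α : Angle) = (s j + a j : ℝ)) ∨
      ((α : Angle) = (s j : ℝ) ∧ (α : Angle) = (s i + a i : ℝ)))
  free : {α : Angle | ∃! i, α = (s i : ℝ) ∨ α = (s i + a i : ℝ)}.encard ≤ 2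

namespace Fan
variable {ι : Type} (A : Fan ι)

/-- The initial point of an arc. -/
def st (i : ι) : Angle := (A.s i : ℝ)
/-- The terminal point of an arc. -/
def en (i : ι) : Angle := (A.s i + A.a i : ℝ)
/-- An angle is in one of the arcs. -/
def Mem (α : ℝ) : Prop := ∃ i, InArc (A.s i) (A.a i) α

variable {A}

lemma inArc_st {i : ι} {α : ℝ} (h : (α : Angle) = A.st i) : InArc (A.s i) (A.a i) α :=
  ⟨0, ⟨le_rfl, (A.ha i).1.le⟩, by rw [add_zero]; exact h⟩

lemma inArc_en {i : ι} {α : ℝ} (h : (α : Angle) = A.en i) : InArc (A.s i) (A.a i) α := ⟨_, ⟨(A.ha i).1.le, le_rfl⟩, h⟩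

lemma st_ne_en (i : ι) : A.st i ≠ A.en i := fun h => by
  have := arc_coord_unique (s := A.s i) (A.ha i).2 ⟨le_rfl, (A.ha i).1.le⟩ ⟨(A.ha i).1.le, le_rfl⟩ (by rw [add_zero]; exact h)
  exact (A.ha i).1.ne this

lemma st_injective : Function.Injective A.st := fun i j h => by
  by_contra hij; obtain ⟨α, hα⟩ : ∃ α : ℝ, (α : Angle) = A.st i := ⟨_, rfl⟩
  rcases (A.meet i j hij α (inArc_st hα) (inArc_st (hα.trans h))).2 with ⟨-, h2⟩ | ⟨-, h2⟩
  · exact st_ne_en j (h.symm.trans (hα.symm.trans h2))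
  · exact st_ne_en i (hα.symm.trans h2)

lemma en_injective : Function.Injective A.en := fun i j h => by
  by_contra hij; obtain ⟨α, hα⟩ : ∃ α : ℝ, (α : Angle) = A.en i := ⟨_, rfl⟩
  rcases (A.meet i j hij α (inArc_en hα) (inArc_en (hα.trans h))).2 with ⟨h2, -⟩ | ⟨h2, -⟩
  · exact st_ne_en i (h2.symm.trans hα)
  · exact st_ne_en j (h2.symm.trans (hα.trans h))

/-- The position of a point of an arc. -/
lemma cases_of_inArc {i : ι} {α : ℝ} (h : InArc (A.s i) (A.a i) α) :
    (∃ x ∈ Ioo 0 (A.a i), (α : Angle) = (A.s i + x : ℝ) ∧ ∀ j, j ≠ i → ¬ InArc (A.s j) (A.a j) α) ∨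
      (α : Angle) = A.st i ∨ (α : Angle) = A.en i := by
  obtain ⟨x, hx, hα⟩ := h; rcases hx.1.eq_or_lt with h0 | h0
  · right; left; rw [hα, ← h0, add_zero]; rfl
  rcases hx.2.eq_or_lt with h1 | h1
  · right; right; rw [hα, h1]; rfl
  refine .inl ⟨x, ⟨h0, h1⟩, hα, fun j hj hjα => ?_⟩; rcases (A.meet i j hj.symm α ⟨x, hx, hα⟩ hjα).2 with ⟨h2, -⟩ | ⟨-, h2⟩
  · exact h0.ne' (arc_coord_unique (A.ha i).2 hx ⟨le_rfl, (A.ha i).1.le⟩ (hα.symm.trans (by rw [add_zero]; exact h2)))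
  · exact h1.ne (arc_coord_unique (A.ha i).2 hx ⟨(A.ha i).1.le, le_rfl⟩ (hα.symm.trans h2))

lemma junction {i j : ι} {α : ℝ} (h : A.st i = A.en j) (hα : (α : Angle) = A.st i) :
    i ≠ j ∧ A.ε j = -A.ε i ∧ ∀ k, k ≠ i → k ≠ j → ¬ InArc (A.s k) (A.a k) α := by
  have hij : i ≠ j := fun e => st_ne_en i (h.trans (by rw [e]))
  refine ⟨hij, (A.meet i j hij α (inArc_st hα) (inArc_en (hα.trans h))).1, fun k hki hkj hk => ?_⟩
  rcases (A.meet i k hki.symm α (inArc_st hα) hk).2 with ⟨-, h2⟩ | ⟨-, h2⟩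
  · exact hkj (en_injective (h2.symm.trans (hα.trans h)))
  · exact st_ne_en i (hα.symm.trans h2)

variable [Fintype ι]

lemma isClosed_mem : IsClosed {α | A.Mem α} := by
  have : {α | A.Mem α} = ⋃ i, {α | InArc (A.s i) (A.a i) α} := by ext; simp [Mem]
  rw [this]; exact isClosed_iUnion_of_finite fun i => isClosed_inArc _ _

lemma eventually_mem {i : ι} {α : ℝ} (hx : x ∈ Ioo 0 (A.a i)) (hα : (α : Angle) = (A.s i + x : ℝ)) : ∀ᶠ y in 𝓝 α, A.Mem y := by
  filter_upwards [eventually_abs_sub_lt α (sub_pos.2 (A.ha i).2), eventually_abs_sub_lt α hx.1,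
    eventually_abs_sub_lt α (sub_pos.2 hx.2)] with y h2 h3 h4
  have := (inArc_add_iff (Ioo_subset_Icc_self hx) hα h2).2 (by grind); rw [add_sub_cancel] at this; exact ⟨i, this⟩

lemma eventually_mem_of_junction {i j : ι} {α : ℝ} (h : A.st i = A.en j) (hα : (α : Angle) = A.st i) : ∀ᶠ y in 𝓝 α, A.Mem y := by
  have hi : (α : Angle) = (A.s i + 0 : ℝ) := by rw [add_zero]; exact hα
  filter_upwards [eventually_abs_sub_lt α (sub_pos.2 (A.ha i).2), eventually_abs_sub_lt α (A.ha i).1,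
    eventually_abs_sub_lt α (sub_pos.2 (A.ha j).2), eventually_abs_sub_lt α (A.ha j).1] with y h2 h3 h4 h5
  rcases le_total 0 (y - α) with h | h
  · have := (inArc_add_iff ⟨le_rfl, (A.ha i).1.le⟩ hi h2).2 (by grind); rw [add_sub_cancel] at this; exact ⟨i, this⟩
  · have := (inArc_add_iff ⟨(A.ha j).1.le, le_rfl⟩ (hα.trans ‹_› : _ = A.en j) h4).2 (by grind)
    rw [add_sub_cancel] at this; exact ⟨j, this⟩

/-- A connected set that contains a point of the arcs, but no free end in their closure, is in the arcs. -/
lemma subset_of_isPreconnected {u : Set ℝ} (hu : IsPreconnected u)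
    (h : ∀ α ∈ u, A.Mem α → ∀ᶠ y in 𝓝 α, A.Mem y) (hne : ∃ α ∈ u, A.Mem α) : ∀ α ∈ u, A.Mem α := by
  have hint : ∀ α ∈ u, A.Mem α → α ∈ interior {α | A.Mem α} := fun α h1 h2 => mem_interior_iff_mem_nhds.2 (h α h1 h2)
  obtain ⟨α₀, h1, h2⟩ := hne; have := hu.subset_of_closure_inter_subset isOpen_interior ⟨α₀, h1, hint _ h1 h2⟩
    fun α hα => hint α hα.2 (closure_minimal interior_subset isClosed_mem hα.1)
  exact fun α hα => (interior_subset (this hα) : α ∈ {α | A.Mem α})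

/-- The free ends of the arcs. -/
lemma free_ends [Nonempty ι] : (∀ i, ∃ j, A.st i = A.en j) ∧ (∀ j, ∃ i, A.st i = A.en j) ∨
    ∃ i₀ i₁, (∀ i, i ≠ i₀ → ∃ j, A.st i = A.en j) ∧ (∀ j, j ≠ i₁ → ∃ i, A.st i = A.en j) ∧
      (∀ j, A.st i₀ ≠ A.en j) ∧ ∀ i, A.st i ≠ A.en i₁ := by
  classical
  set S := Finset.univ.image A.st with hS; set E := Finset.univ.image A.en with hE; have hcard : (S \ E).card = (E \ S).card := by
    refine Finset.card_sdiff_comm ?_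
    rw [hS, hE, Finset.card_image_of_injective _ st_injective, Finset.card_image_of_injective _ en_injective]
  have hS' : ∀ i, A.st i ∈ S \ E ↔ ∀ j, A.st i ≠ A.en j := by grind
  have hE' : ∀ j, A.en j ∈ E \ S ↔ ∀ i, A.st i ≠ A.en j := by simp_all
  have hsub : ((S \ E ∪ E \ S : Finset Angle) : Set Angle) ⊆ {α | ∃! i, α = (A.s i : ℝ) ∨ α = (A.s i + A.a i : ℝ)} := by
    intro α hα; rcases Finset.mem_union.1 (Finset.mem_coe.1 hα) with h | h
    · obtain ⟨i, -, rfl⟩ := Finset.mem_image.1 (Finset.mem_sdiff.1 h).1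
      refine ⟨i, .inl rfl, fun k hk => hk.elim (fun hk => st_injective hk.symm) fun hk => absurd hk ((hS' i).1 h k)⟩
    · obtain ⟨i, -, rfl⟩ := Finset.mem_image.1 (Finset.mem_sdiff.1 h).1
      refine ⟨i, .inr rfl, fun k hk => hk.elim (fun hk => absurd hk.symm ((hE' i).1 h k)) fun hk => en_injective hk.symm⟩
  have h2 := (encard_le_encard hsub).trans A.free; rw [encard_coe_eq_coe_finsetCard, Finset.card_union_of_disjoint (by
    rw [Finset.disjoint_left]; simp_all), ← hcard] at h2
  have h3 : (S \ E).card + (S \ E).card ≤ 2 := by exact_mod_cast h2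
  rcases Nat.eq_zero_or_pos (S \ E).card with h0 | h0
  · have e1 := Finset.card_eq_zero.1 h0; have e2 := Finset.card_eq_zero.1 (hcard ▸ h0); refine .inl ⟨fun i => ?_, fun j => ?_⟩
    · by_contra! hc; grind
    · by_contra! hc; grind
  · have h1 : (S \ E).card = 1 := by omega
    obtain ⟨σ, hσ⟩ := Finset.card_eq_one.1 h1; obtain ⟨e, he⟩ := Finset.card_eq_one.1 (hcard ▸ h1)
    obtain ⟨i₀, -, h4⟩ := Finset.mem_image.1 (Finset.mem_sdiff.1 (hσ ▸ Finset.mem_singleton_self σ : σ ∈ S \ E)).1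
    obtain ⟨i₁, -, h5⟩ := Finset.mem_image.1 (Finset.mem_sdiff.1 (he ▸ Finset.mem_singleton_self e : e ∈ E \ S)).1
    refine .inr ⟨i₀, i₁, fun i hi => ?_, fun j hj => ?_, (hS' i₀).1 (by rw [hσ, h4]; simp), (hE' i₁).1 (by rw [he, h5]; simp)⟩
    · by_contra! hc; have := (hS' i).2 hc; rw [hσ, Finset.mem_singleton, ← h4] at this; exact hi (st_injective this)
    · by_contra! hc; have := (hE' j).2 hc; rw [he, Finset.mem_singleton, ← h5] at this; exact hj (en_injective this)

lemma mem_all_of_no_free_ends [Nonempty ι] (h1 : ∀ i, ∃ j, A.st i = A.en j) (h2 : ∀ j, ∃ i, A.st i = A.en j) (α : ℝ) :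
    A.Mem α := by
  refine subset_of_isPreconnected isPreconnected_univ (fun α _ hα => ?_) ?_ α trivial
  · obtain ⟨i, hi⟩ := hα; rcases cases_of_inArc hi with ⟨x, hx, h, -⟩ | h | h
    · exact eventually_mem hx h
    · obtain ⟨j, hj⟩ := h1 i; exact eventually_mem_of_junction hj h
    · obtain ⟨j, hj⟩ := h2 i; exact eventually_mem_of_junction hj (h.trans hj.symm)
  · obtain ⟨i⟩ := ‹Nonempty ι›; exact ⟨A.s i, trivial, i, inArc_st rfl⟩

/-- If there are free ends, the union of the arcs is an arc. -/
lemma exists_arc_of_free_ends {i₀ i₁ : ι} (h1 : ∀ i, i ≠ i₀ → ∃ j, A.st i = A.en j)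
    (h2 : ∀ j, j ≠ i₁ → ∃ i, A.st i = A.en j) (h3 : ∀ j, A.st i₀ ≠ A.en j) (h4 : ∀ i, A.st i ≠ A.en i₁) :
    ∃ l ∈ Ioo 0 (2 * π), A.en i₁ = ↑(A.s i₀ + l) ∧ ∀ x ∈ Ico 0 (2 * π), A.Mem (A.s i₀ + x) ↔ x ≤ l := by
  have hl : A.en i₁ = ↑(A.s i₀ + arcCoord (A.en i₁ - A.st i₀)) := by rw [coe_add, coe_arcCoord]; exact (add_sub_cancel _ _).symm
  have hl0 : arcCoord (A.en i₁ - A.st i₀) ∈ Ioo 0 (2 * π) := ⟨arcCoord_pos (sub_ne_zero.2 (h3 i₁).symm), (arcCoord_mem _).2⟩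
  generalize arcCoord (A.en i₁ - A.st i₀) = l at hl hl0
  obtain ⟨s, hs⟩ : ∃ s, s = A.s i₀ := ⟨_, rfl⟩; rw [← hs] at hl ⊢
  have hloc : ∀ x ∈ Ioo 0 (2 * π), x ≠ l → A.Mem (s + x) → ∀ᶠ y in 𝓝 (s + x), A.Mem y := by
    rintro x hx hxl ⟨i, hi⟩; rcases cases_of_inArc hi with ⟨y, hy, h, -⟩ | h | h
    · exact eventually_mem hy h
    · have : i ≠ i₀ := by
        rintro rfl; have h' : ((s + x : ℝ) : Angle) = (s + 0 : ℝ) := by rw [h, add_zero, hs]; rfl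
        exact hx.1.ne' (arc_coord_unique hx.2 ⟨hx.1.le, le_rfl⟩ ⟨le_rfl, hx.1.le⟩ h')
      obtain ⟨j, hj⟩ := h1 i this; exact eventually_mem_of_junction hj h
    · have : i ≠ i₁ := by
        rintro rfl; have h' := h.trans hl; rw [coe_add, coe_add] at h'
        exact hxl (coe_eq_coe_of_mem ⟨hx.1.le, hx.2⟩ ⟨hl0.1.le, hl0.2⟩ (add_left_cancel h'))
      obtain ⟨j, hj⟩ := h2 i this; exact eventually_mem_of_junction hj (h.trans hj.symm)
  have c1 : ∀ α ∈ Ioo s (s + l), A.Mem α := by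
    refine subset_of_isPreconnected isPreconnected_Ioo (fun α hα hm => ?_) ?_
    · have := hloc (α - s) (by grind) (by grind); grind
    · obtain ⟨x, hx0, hx⟩ : ∃ x, 0 < x ∧ x < min l (A.a i₀) := exists_between (lt_min hl0.1 (A.ha i₀).1)
      refine ⟨s + x, ⟨by linarith, by grind⟩, i₀, x, ⟨hx0.le, (hx.trans_le (min_le_right _ _)).le⟩, ?_⟩; rw [hs]
  have c2 : ∀ α ∈ Ioo (s + l) (s + 2 * π), ¬ A.Mem α := by
    intro α hα hm; have hall : ∀ α ∈ Ioo (s + l) (s + 2 * π), A.Mem α := by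
      refine subset_of_isPreconnected isPreconnected_Ioo (fun α hα hm => ?_) ⟨α, hα, hm⟩
      have := hloc (α - s) (by grind) (by grind); grind
    have hev : ∀ᶠ y in 𝓝 (s + l), ∀ j, j ≠ i₁ → ¬ InArc (A.s j) (A.a j) y := by
      rw [eventually_all]; intro j; by_cases hj : j = i₁
      · exact .of_forall fun _ h => absurd hj h
      · refine ((isClosed_inArc (A.s j) (A.a j)).isOpen_compl.eventually_mem ?_).mono fun y hy _ => hy; intro hc
        rcases (A.meet i₁ j (Ne.symm hj) _ (inArc_en hl.symm) hc).2 with ⟨h, -⟩ | ⟨h, -⟩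
        · exact h4 i₁ (h.symm.trans hl.symm)
        · exact h4 j (h.symm.trans hl.symm)
    have hev2 := (hev.and (eventually_abs_sub_lt (s + l) (sub_pos.2 (A.ha i₁).2))).filter_mono
      (nhdsWithin_le_nhds (s := Ioi (s + l)))
    obtain ⟨y, ⟨hy, hy'⟩, hy2⟩ := (hev2.and (Ioo_mem_nhdsGT (by grind : s + l < s + 2 * π))).exists
    obtain ⟨j, hj⟩ := hall y hy2; by_cases hji : j = i₁
    · subst hji; have := inArc_add_iff (x₀ := A.a j) ⟨(A.ha j).1.le, le_rfl⟩ hl.symm hy'; grind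
    · exact hy j hji hj
  refine ⟨l, hl0, hl, fun x hx => ⟨fun h => ?_, fun h => ?_⟩⟩
  · grind
  · rcases hx.1.eq_or_lt with h0 | h0
    · rw [← h0, add_zero]; exact ⟨i₀, inArc_st (by rw [hs]; rfl)⟩
    rcases h.eq_or_lt with h' | h'
    · rw [h']; exact ⟨i₁, inArc_en hl.symm⟩
    grind

/-- The arches of a fan with their signs are restrictions of a periodic function; the arcs cover the circle or an arc. -/
lemma exists_hat [Nonempty ι] (A : Fan ι) : ∃ C : ℝ → ℝ, ContDiff ℝ 2 C ∧ (∀ α β : ℝ, (α : Angle) = β → C α = C β) ∧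
    (∀ i, ∀ x ∈ Icc 0 (A.a i), ∀ α : ℝ, (α : Angle) = (A.s i + x : ℝ) →
      C α = A.ε i * (A.P i).C.fn x ∧ HasDerivAt C (A.ε i * (A.P i).C.der x) α) ∧
    ((∀ α, A.Mem α) ∨ ∃ s, ∃ l ∈ Ioo 0 (2 * π), ∀ α, A.Mem α ↔ InArc s l α) := by
  classical
  set W : ι → Wave := fun i => Wave.ofArch (A.P i).C (A.ε i) with hW
  have slopes : ∀ i j, A.ε j = -A.ε i → (W i).f' 0 = (W j).f' (W j).L := fun i j h => by
    change A.ε i * (A.P i).C.der 0 = A.ε j * (A.P j).C.der (A.a j); rw [(A.P i).C.der_zero, (A.P j).C.der_len, h]; ring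
  rcases A.free_ends with ⟨h1, h2⟩ | ⟨i₀, i₁, h1, h2, h3, h4⟩
  · have hall := mem_all_of_no_free_ends h1 h2; obtain ⟨C, hC, hper, hv⟩ := exists_periodic A.s W A.ha fun α => by
      obtain ⟨i, hi⟩ := hall α; rcases cases_of_inArc hi with h | h | h
      · exact .inl ⟨i, h⟩
      · obtain ⟨j, hj⟩ := h1 i; obtain ⟨hij, he, hk⟩ := junction hj h; exact .inr ⟨i, j, hij, h, h.trans hj, slopes i j he, hk⟩
      · obtain ⟨j, hj⟩ := h2 i; obtain ⟨hij, he, hk⟩ := junction hj (h.trans hj.symm)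
        exact .inr ⟨j, i, hij, h.trans hj.symm, h, slopes j i he, hk⟩
    exact ⟨C, hC, hper, hv, .inl hall⟩
  · obtain ⟨l, hl, he, hm⟩ := exists_arc_of_free_ends h1 h2 h3 h4
    obtain ⟨V, hVL, hV0, hV1⟩ := Wave.exists_of_slopes (sub_pos.2 hl.2) ((W i₁).f' (W i₁).L) ((W i₀).f' 0)
    have key : ∀ α : ℝ, ∃ x ∈ Ico 0 (2 * π), (α : Angle) = (A.s i₀ + x : ℝ) ∧ (A.Mem α ↔ x ≤ l) ∧
        (InArc (A.s i₀ + l) V.L α ↔ x = 0 ∨ l ≤ x) := fun α => by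
      have hx := arcCoord_mem ((α : Angle) - (A.s i₀ : ℝ))
      have hα : (α : Angle) = (A.s i₀ + arcCoord ((α : Angle) - (A.s i₀ : ℝ)) : ℝ) := by
        rw [coe_add, coe_arcCoord, add_sub_cancel]
      generalize arcCoord ((α : Angle) - (A.s i₀ : ℝ)) = x at hx hα
      refine ⟨x, hx, hα, ?_, ?_⟩
      · rw [← hm x hx]; simp [Mem, InArc, hα]
      · rw [hVL]; constructor
        · rintro ⟨y, hy, h⟩; by_contra! hc
          have h' : ((A.s i₀ + x : ℝ) : Angle) = (A.s i₀ + (l + y) : ℝ) := by rw [← hα, h, add_assoc]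
          rcases hy.2.eq_or_lt with h0 | h0
          · rw [h0, add_sub_cancel, coe_add, coe_add, coe_two_pi, add_left_cancel_iff] at h'
            exact hc.1 (coe_eq_coe_of_mem hx ⟨le_rfl, two_pi_pos⟩ h')
          · rw [coe_add, coe_add (A.s i₀), add_left_cancel_iff] at h'
            linarith [hy.1, coe_eq_coe_of_mem hx ⟨by linarith [hy.1, hl.1], by linarith⟩ h']
        · rintro (rfl | h)
          · refine ⟨_, ⟨(sub_pos.2 hl.2).le, le_rfl⟩, ?_⟩
            rw [hα, add_assoc, add_sub_cancel, add_zero, coe_add, coe_two_pi, add_zero]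
          · exact ⟨x - l, ⟨by linarith, by linarith [hx.2]⟩, by rw [hα]; congr 1; ring⟩
    obtain ⟨C, hC, hper, hv⟩ := exists_periodic (ι := Option ι) (fun o => o.elim (A.s i₀ + l) A.s) (fun o => o.elim V W)
      (fun o => by
        cases o
        · grind
        · exact A.ha _) fun α => by
      obtain ⟨x, hx, hα, hmem, hgap⟩ := key α; by_cases hA : A.Mem α
      · obtain ⟨i, hi⟩ := hA; have hxl := hmem.1 ⟨i, hi⟩; by_cases hg : InArc (A.s i₀ + l) V.L α
        · rcases hgap.1 hg with h | h
          · have hα0 : (α : Angle) = A.st i₀ := by rw [hα, h, add_zero]; rfl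
            refine .inr ⟨some i₀, none, by simp, hα0, ?_, hV1.symm, ?_⟩
            · change (α : Angle) = (A.s i₀ + l + V.L : ℝ)
              rw [hVL, hα0, add_assoc, add_sub_cancel, coe_add, coe_two_pi, add_zero]; rfl
            · rintro (_ | k) hk1 hk2 hk
              · exact hk2 rfl
              · have hk' : InArc (A.s k) (A.a k) α := hk
                rcases (A.meet i₀ k (fun h => hk1 (by rw [h])) α (inArc_st hα0) hk').2 with ⟨-, h⟩ | ⟨-, h⟩
                · exact h3 k (hα0.symm.trans h)
                · exact h3 i₀ (hα0.symm.trans h)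
          · have hα1 : (α : Angle) = A.en i₁ := by grind
            refine .inr ⟨none, some i₁, by simp, hα1.trans he, hα1, hV0, ?_⟩; rintro (_ | k) hk1 hk2 hk
            · exact hk1 rfl
            · have hk' : InArc (A.s k) (A.a k) α := hk
              rcases (A.meet i₁ k (fun h => hk2 (by rw [h])) α (inArc_en hα1) hk').2 with ⟨h, -⟩ | ⟨h, -⟩
              · exact h4 i₁ (h.symm.trans hα1)
              · exact h4 k (h.symm.trans hα1)
        · have hgk : ∀ {Q : Option ι → Prop}, (∀ k, Q (some k) → ¬ InArc (A.s k) (A.a k) α) →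
              ∀ o : Option ι, Q o → ¬ InArc (o.elim (A.s i₀ + l) A.s) (o.elim V W).L α := by
            intro Q hQ o ho; cases o
            · exact hg
            · exact hQ _ ho
          have n0 : (α : Angle) ≠ A.st i₀ := fun h => hg (hgap.2 (.inl (by
            refine arc_coord_unique hx.2 ⟨hx.1, le_rfl⟩ ⟨le_rfl, hx.1⟩ (hα.symm.trans ?_); rw [h, add_zero]; rfl)))
          have n1 : (α : Angle) ≠ A.en i₁ := fun h => hg (hgap.2 (.inr (by
            have := hα.symm.trans (h.trans he); rw [coe_add, coe_add, add_left_cancel_iff] at this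
            exact (coe_eq_coe_of_mem hx ⟨hl.1.le, hl.2⟩ this).ge)))
          obtain ⟨k, y, hy, h, hn⟩ | ⟨k, j, h, hj⟩ : (∃ k, ∃ x ∈ Ioo 0 (A.a k), (α : Angle) = (A.s k + x : ℝ) ∧
              ∀ j, j ≠ k → ¬ InArc (A.s j) (A.a j) α) ∨ ∃ k j, (α : Angle) = A.st k ∧ A.st k = A.en j := by
            rcases cases_of_inArc hi with h | h | h
            · exact .inl ⟨i, h⟩
            · obtain ⟨j, hj⟩ := h1 i fun e => n0 (by rw [h, e]); grind
            · obtain ⟨j, hj⟩ := h2 i fun e => n1 (by rw [h, e]); grind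
          · exact .inl ⟨some k, y, hy, h, hgk (Q := fun o => o ≠ some k) (fun k hQ => hn k fun h => hQ (by rw [h]))⟩
          · obtain ⟨hij, he', hk⟩ := junction hj h
            exact .inr ⟨some k, some j, by simpa using hij, h, h.trans hj, slopes k j he', fun o h1 h2 =>
              hgk (Q := fun o => o ≠ some k ∧ o ≠ some j) (fun k hQ => hk k (fun h => hQ.1 (by rw [h])) (fun h => hQ.2 (by rw [h])))
                o ⟨h1, h2⟩⟩
      · have hxl : l < x := by grind
        refine .inl ⟨none, x - l, ⟨by linarith, ?_⟩, ?_, ?_⟩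
        · grind
        · grind
        · rintro (_ | k) hk hc
          · exact hk rfl
          · exact hA ⟨k, hc⟩
    refine ⟨C, hC, hper, fun i => hv (some i), .inr ⟨A.s i₀, l, hl, fun α => ?_⟩⟩
    obtain ⟨x, hx, hα, hmem, -⟩ := key α; rw [hmem]; refine ⟨fun h => ⟨x, ⟨hx.1, h⟩, hα⟩, fun ⟨y, hy, h⟩ => ?_⟩
    have := hα.symm.trans h; rw [coe_add, coe_add, add_left_cancel_iff] at this
    rw [coe_eq_coe_of_mem hx ⟨hy.1, hy.2.trans_lt hl.2⟩ this]; exact hy.2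

end Fan

open Function (uncurry)
/-! ### Flows of scalar equations -/

/-- A scalar equation has a flow that is continuously differentiable in the initial value. -/
lemma exists_flow {G g : ℝ → ℝ → ℝ} {τ : ℝ} (hτ : 0 < τ) (hM : 0 ≤ M) (hL : 0 ≤ L)
    (cG : Continuous (uncurry G)) (cg : Continuous (uncurry g))
    (hd : ∀ t θ, HasDerivAt (G t) (g t θ) θ) (bG : ∀ t θ, |G t θ| ≤ M) (bg : ∀ t θ, |g t θ| ≤ L)
    (hper : ∀ t θ, G t (θ + 2 * π) = G t θ) :
    ∃ φ φ' : ℝ → ℝ → ℝ, Continuous (uncurry φ) ∧ Continuous (uncurry φ') ∧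
      (∀ a, ∀ t ∈ Ioo 0 τ, HasDerivAt (φ a) (G t (φ a t)) t) ∧ (∀ a t, HasDerivAt (fun a => φ a t) (φ' a t) a) ∧
      (∀ a t, φ (a + 2 * π) t = φ a t + 2 * π) ∧ (∀ a, ∀ t ∈ Icc 0 τ, |φ a t - a| ≤ M * t) ∧
      ∀ a, ∀ t ∈ Icc 0 τ, |φ' a t - 1| ≤ exp (L * t) - 1 := by
  have lip : ∀ t, LipschitzWith L.toNNReal (G t) := fun t =>
    lipschitzWith_of_nnnorm_deriv_le (fun θ => (hd t θ).differentiableAt) fun θ => by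
      rw [(hd t θ).deriv, ← NNReal.coe_le_coe, coe_nnnorm, coe_toNNReal _ hL]; exact bg t θ
  have hex : ∀ a : ℝ, ∃ f : ℝ → ℝ, f 0 = a ∧ ∀ t ∈ Icc 0 τ, HasDerivWithinAt f (G t (f t)) (Icc 0 τ) t := fun a =>
    IsPicardLindelof.exists_eq_forall_mem_Icc_hasDerivWithinAt (f := G) (t₀ := ⟨0, le_rfl, hτ.le⟩) (x₀ := a)
      (a := (M * τ).toNNReal) (r := 0) (L := M.toNNReal) (K := L.toNNReal)
      ⟨fun t _ => (lip t).lipschitzOnWith, fun x _ => (cG.comp (by fun_prop : Continuous fun t : ℝ => (t, x))).continuousOn,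
        fun t _ x _ => by simp_all, by rw [coe_toNNReal _ hM, coe_toNNReal _ (by positivity)]; simp [hτ.le]⟩ (by simp)
  choose f hf0 hf using hex; have hfc : ∀ a, ContinuousOn (f a) (Icc 0 τ) := fun a t ht => (hf a t ht).continuousWithinAt
  have right : ∀ {F : ℝ → ℝ} {F' t : ℝ}, t ∈ Ico 0 τ → HasDerivWithinAt F F' (Icc 0 τ) t →
      HasDerivWithinAt F F' (Ici t) t := fun ht h =>
    h.mono_of_mem_nhdsWithin (mem_of_superset (Icc_mem_nhdsGE ht.2) (Icc_subset_Icc_left ht.1))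
  have gron : ∀ a (F : ℝ → ℝ), (∀ t ∈ Icc 0 τ, HasDerivWithinAt F (G t (F t)) (Icc 0 τ) t) → ∀ t ∈ Icc 0 τ,
      |f a t - F t| ≤ |a - F 0| * exp (L * t) := fun a F hF t ht => by
    have := dist_le_of_trajectories_ODE (v := G) lip (hfc a) (fun t ht => right ht (hf a t (Ico_subset_Icc_self ht)))
      (fun t ht => (hF t ht).continuousWithinAt) (fun t ht => right ht (hF t (Ico_subset_Icc_self ht))) le_rfl t ht
    rwa [dist_eq, dist_eq, hf0, sub_zero, coe_toNNReal _ hL] at this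
  set cl : ℝ → ℝ := fun t => max 0 (min t τ) with hcl; have clc : Continuous cl := by fun_prop
  have clm : ∀ t, cl t ∈ Icc 0 τ := by grind
  have cle : ∀ t ∈ Icc 0 τ, cl t = t := by grind
  have moved : ∀ a, ∀ t ∈ Icc 0 τ, |f a t - a| ≤ M * t := fun a t ht => by
    have := norm_image_sub_le_of_norm_deriv_le_segment' (fun t ht => hf a t ht) (C := M)
      (fun t _ => by rw [norm_eq_abs]; exact bG _ _) t ht
    rwa [hf0, sub_zero, norm_eq_abs] at this
  have fc : Continuous (uncurry fun a t => f a (cl t)) := by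
    refine continuous_iff_continuousAt.2 fun ⟨a, t⟩ => ?_; have h1 : ContinuousAt (fun p : ℝ × ℝ => f a (cl p.2)) (a, t) := by
      refine ((hfc a).comp_continuous clc clm).continuousAt.comp (f := Prod.snd) continuousAt_snd
    have h2 : Tendsto (fun p : ℝ × ℝ => f p.1 (cl p.2) - f a (cl p.2)) (𝓝 (a, t)) (𝓝 0) := by
      refine squeeze_zero_norm (a := fun p => |p.1 - a| * exp (L * τ)) (fun p => ?_) ?_
      · refine (gron p.1 (f a) (hf a) _ (clm _)).trans ?_; rw [hf0]; have := (clm p.2).2; gcongr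
      · have : Continuous fun p : ℝ × ℝ => |p.1 - a| * exp (L * τ) := by fun_prop
        simpa using this.tendsto (a, t)
    have := h2.add h1; simpa [ContinuousAt, Function.uncurry_def] using this
  set Γ : ℝ × ℝ × ℝ → ℝ := fun p => ∫ σ in (0 : ℝ)..1, g p.1 (p.2.1 + σ * (p.2.2 - p.2.1)) with hΓ
  have cΓ : Continuous Γ := by fun_prop
  have Γeq : ∀ t x y, G t y - G t x = Γ (t, x, y) * (y - x) := fun t x y => by
    have h1 : ∀ σ ∈ uIcc (0 : ℝ) 1, HasDerivAt (fun σ => G t (x + σ * (y - x))) (g t (x + σ * (y - x)) * (y - x)) σ :=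
      fun σ _ => (hd t _).comp σ (((hasDerivAt_id σ).mul_const _).const_add x |>.congr_deriv (one_mul _))
    have := intervalIntegral.integral_eq_sub_of_hasDerivAt h1 (Continuous.intervalIntegrable
      ((cg.comp (by fun_prop : Continuous fun σ : ℝ => (t, x + σ * (y - x)))).mul continuous_const) _ _)
    rw [intervalIntegral.integral_mul_const] at this
    grind
  have Γd : ∀ t x, Γ (t, x, x) = g t x := fun t x => by simp [hΓ]
  set γ : ℝ × ℝ → ℝ → ℝ := fun q s => Γ (s, f q.1 (cl s), f q.2 (cl s)) with hγ
  have cγ : Continuous (uncurry γ) := cΓ.comp (continuous_snd.prodMk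
    ((fc.comp (by fun_prop : Continuous fun q : (ℝ × ℝ) × ℝ => (q.1.1, q.2))).prodMk
      (fc.comp (by fun_prop : Continuous fun q : (ℝ × ℝ) × ℝ => (q.1.2, q.2)))))
  set Q : (ℝ × ℝ) × ℝ → ℝ := fun q => exp (∫ s in (0 : ℝ)..cl q.2, γ q.1 s) with hQ; have cQ : Continuous Q := by fun_prop
  have diffeq : ∀ a b t, f b (cl t) - f a (cl t) = (b - a) * Q ((a, b), t) := fun a b t => by
    have cab : Continuous (γ (a, b)) := by fun_prop
    have dI : ∀ s, HasDerivAt (fun t => ∫ s in (0 : ℝ)..t, γ (a, b) s) (γ (a, b) s) s := fun s =>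
      intervalIntegral.integral_hasDerivAt_right (cab.intervalIntegrable _ _) cab.aestronglyMeasurable.stronglyMeasurableAtFilter
        cab.continuousAt
    have hE : ∀ s ∈ Icc 0 τ, HasDerivWithinAt (fun s => exp (-∫ s in (0 : ℝ)..s, γ (a, b) s) * (f b s - f a s)) 0
        (Icc 0 τ) s := fun s hs => by
      have := ((dI s).neg.exp.hasDerivWithinAt (s := Icc 0 τ)).mul ((hf b s hs).sub (hf a s hs))
      refine this.congr_deriv ?_; simp [Pi.sub_apply, Pi.neg_apply, Γeq, hγ, cle s hs]; ring
    have := constant_of_has_deriv_right_zero (fun s hs => (hE s hs).continuousWithinAt)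
      (fun s hs => right hs (hE s (Ico_subset_Icc_self hs))) (cl t) (clm t)
    simp [intervalIntegral.integral_same, neg_zero, exp_zero, one_mul, hf0] at this; rw [hQ]; simp only
    rw [← this, mul_right_comm, ← exp_add, neg_add_cancel, exp_zero, one_mul]
  refine ⟨fun a t => f a (cl t), fun a t => Q ((a, a), t), fc, cQ.comp (by fun_prop : Continuous fun p : ℝ × ℝ => ((p.1, p.1), p.2)),
    fun a t ht => ?_, fun a t => ?_, fun a t => ?_, fun a t ht => ?_, fun a t ht => ?_⟩
  · have h1 := (hf a t (Ioo_subset_Icc_self ht)).hasDerivAt (Icc_mem_nhds ht.1 ht.2); simp [cle t (Ioo_subset_Icc_self ht)]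
    exact h1.congr_of_eventuallyEq (by filter_upwards [Ioo_mem_nhds ht.1 ht.2] with s hs
                                       grind)
  · rw [hasDerivAt_iff_tendsto_slope]; have : Tendsto (fun b => Q ((a, b), t)) (𝓝[≠] a) (𝓝 (Q ((a, a), t))) :=
      (cQ.comp (by fun_prop : Continuous fun b : ℝ => ((a, b), t))).continuousAt.continuousWithinAt
    refine this.congr' ?_; filter_upwards [self_mem_nhdsWithin] with b hb
    rw [slope_def_field, diffeq, mul_div_cancel_left₀ _ (sub_ne_zero.2 hb)]
  · have := gron (a + 2 * π) (fun t => f a t + 2 * π) (fun t ht => by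
      simp only [hper]; exact (hf a t ht).add_const _) (cl t) (clm t)
    rw [hf0, sub_self, abs_zero, zero_mul] at this; exact sub_eq_zero.1 (abs_eq_zero.1 (le_antisymm this (abs_nonneg _)))
  · grind
  · simp [hQ, cle t ht, hγ, Γd]; have : |∫ s in (0 : ℝ)..t, g s (f a (cl s))| ≤ L * t := by
      have := intervalIntegral.norm_integral_le_of_norm_le_const (a := 0) (b := t) (C := L)
        (f := fun s => g s (f a (cl s))) (fun s _ => by rw [norm_eq_abs]; exact bg _ _)
      rwa [sub_zero, abs_of_nonneg ht.1, norm_eq_abs] at this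
    set I := ∫ s in (0 : ℝ)..t, g s (f a (cl s)); have h1 := exp_le_exp.2 ((le_abs_self I).trans this)
    have h2 := add_one_le_exp (L * t); have h3 := add_one_le_exp I
    grind

/-! ### Functions in polar coordinates -/

/-- A function of the polar coordinates that is small to the first order at the origin. -/
lemma contDiffAt_polar {E : Type*} [NormedAddCommGroup E] [NormedSpace ℝ E] {f fa fr : ℝ → ℝ → E} {ω : ℝ → ℝ}
    (hδ : 0 < δ) (per : ∀ α β r : ℝ, (α : Angle) = β → f α r = f β r ∧ fa α r = fa β r ∧ fr α r = fr β r)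
    (da : ∀ α, ∀ r ∈ Ioo 0 δ, HasDerivAt (fun α => f α r) (fa α r) α)
    (dr : ∀ α, ∀ r ∈ Ioo 0 δ, HasDerivAt (f α) (fr α r) r)
    (ca : ∀ α, ∀ r ∈ Ioo 0 δ, ContinuousAt (uncurry fa) (α, r))
    (cr : ∀ α, ∀ r ∈ Ioo 0 δ, ContinuousAt (uncurry fr) (α, r)) (h0 : f (arg 0) 0 = 0)
    (b0 : ∀ α, ∀ r ∈ Ioo 0 δ, ‖f α r‖ ≤ ω r * r) (ba : ∀ α, ∀ r ∈ Ioo 0 δ, ‖fa α r‖ ≤ ω r * r)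
    (br : ∀ α, ∀ r ∈ Ioo 0 δ, ‖fr α r‖ ≤ ω r) (hω : Tendsto ω (𝓝[>] 0) (𝓝 0)) :
    ContDiffAt ℝ 1 (fun u : ℂ => f (arg u) ‖u‖) 0 ∧ HasFDerivAt (fun u : ℂ => f (arg u) ‖u‖) (0 : ℂ →L[ℝ] E) 0 := by
  set G : ℂ → E := fun u => f (arg u) ‖u‖ with hG; set l : ℂ → ℂ →L[ℝ] ℂ := fun u => ContinuousLinearMap.mul ℝ ℂ u⁻¹ with hl
  set G' : ℂ → ℂ →L[ℝ] E := fun u => (Complex.imCLM.comp (l u)).smulRight (fa (arg u) ‖u‖) +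
    (‖u‖ • Complex.reCLM.comp (l u) : ℂ →L[ℝ] ℝ).smulRight (fr (arg u) ‖u‖) with hG'
  have G'0 : G' 0 = 0 := by ext v; simp [hG', hl]
  have tω : Tendsto (fun u : ℂ => ω ‖u‖) (𝓝[≠] 0) (𝓝 0) := hω.comp tendsto_norm_nhdsNE_zero
  have near : ∀ᶠ u : ℂ in 𝓝[≠] 0, ‖u‖ ∈ Ioo 0 δ := tendsto_norm_nhdsNE_zero (Ioo_mem_nhdsGT hδ)
  have polar : ∀ u₀ : ℂ, u₀ ≠ 0 → ∀ᶠ u in 𝓝 u₀, ‖u‖ = ‖u₀‖ * exp (Complex.log (u / u₀)).re ∧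
      (arg u : Angle) = (arg u₀ + (Complex.log (u / u₀)).im : ℝ) := by
    intro u₀ hu₀; filter_upwards [eventually_ne_nhds hu₀] with u hu; have hq : u / u₀ ≠ 0 := div_ne_zero hu hu₀; constructor
    · rw [log_re, exp_log (norm_pos_iff.2 hq), norm_div, mul_div_cancel₀ _ (norm_ne_zero_iff.2 hu₀)]
    · rw [log_im, coe_add, arg_div_coe_angle hu hu₀]; abel
  have dlog : ∀ u₀ : ℂ, u₀ ≠ 0 → HasFDerivAt (fun u : ℂ => Complex.log (u / u₀)) (l u₀) u₀ := by
    intro u₀ hu₀; have h1 : HasDerivAt (fun u : ℂ => Complex.log (u / u₀)) u₀⁻¹ u₀ := by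
      have := (Complex.hasDerivAt_log (z := u₀ / u₀) (by rw [div_self hu₀]; simp)).comp u₀ (h := fun u => u / u₀)
        ((hasDerivAt_id u₀).div_const u₀)
      simpa [div_self hu₀, comp_def] using this
    refine (h1.hasFDerivAt.restrictScalars ℝ).congr_fderiv ?_; ext v; simp [hl]; ring
  have hder : ∀ u₀ : ℂ, ‖u₀‖ ∈ Ioo 0 δ → HasFDerivAt G (G' u₀) u₀ := by
    intro u₀ hr; have hu₀ := norm_pos_iff.1 hr.1; have ev : ∀ᶠ p : ℝ × ℝ in 𝓝 (arg u₀, ‖u₀‖), p.2 ∈ Ioo 0 δ :=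
      continuousAt_snd.eventually_mem (Ioo_mem_nhds hr.1 hr.2)
    have h1 := (hasStrictFDerivAt_uncurry_coprod (𝕜 := ℝ) (u := (arg u₀, ‖u₀‖)) (f := f)
      (f₁ := fun α r => ContinuousLinearMap.toSpanSingleton ℝ (fa α r))
      (f₂ := fun α r => ContinuousLinearMap.toSpanSingleton ℝ (fr α r)) (ev.mono fun p hp => (da p.1 p.2 hp).hasFDerivAt)
      (ev.mono fun p hp => (dr p.1 p.2 hp).hasFDerivAt)
      ((ContinuousLinearMap.toSpanSingletonCLE (𝕜 := ℝ) (E := E)).continuous.continuousAt.comp (ca _ _ hr))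
      ((ContinuousLinearMap.toSpanSingletonCLE (𝕜 := ℝ) (E := E)).continuous.continuousAt.comp (cr _ _ hr))).hasFDerivAt
    have hL := dlog u₀ hu₀; have z0 : Complex.log (u₀ / u₀) = 0 := by simp
    have h2 : HasFDerivAt (fun u : ℂ => ((arg u₀ + (Complex.log (u / u₀)).im, ‖u₀‖ * exp (Complex.log (u / u₀)).re) : ℝ × ℝ))
        ((Complex.imCLM.comp (l u₀)).prod (‖u₀‖ • Complex.reCLM.comp (l u₀))) u₀ := by
      have i1 := (Complex.imCLM.hasFDerivAt.comp u₀ hL).const_add (arg u₀)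
      have i2 := ((Complex.reCLM.hasFDerivAt.comp u₀ hL).exp).const_mul ‖u₀‖; refine (i1.prodMk i2).congr_fderiv ?_
      ext v <;> simp [z0]
    have h3 := HasFDerivAt.comp u₀ (g := uncurry f) (by simp [z0]; exact h1) h2
    refine (h3.congr_of_eventuallyEq ?_).congr_fderiv ?_
    · filter_upwards [polar u₀ hu₀] with u hu; exact (per _ _ _ hu.2).1.trans (by rw [hu.1]; rfl)
    · ext v; change ((l u₀) v).im • fa u₀.arg ‖u₀‖ + (‖u₀‖ * ((l u₀) v).re) • fr u₀.arg ‖u₀‖ = _; simp [hG']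
  have hcont : ∀ u₀ : ℂ, ‖u₀‖ ∈ Ioo 0 δ → ContinuousAt G' u₀ := by
    intro u₀ hr; have hu₀ := norm_pos_iff.1 hr.1; have c1 : ContinuousAt l u₀ := by fun_prop
    have cL : ContinuousAt (fun u : ℂ => (arg u₀ + (Complex.log (u / u₀)).im, ‖u‖)) u₀ :=
      ((Complex.continuous_im.continuousAt.comp (dlog u₀ hu₀).continuousAt).const_add _).prodMk continuous_norm.continuousAt
    have e0 : (arg u₀ + (Complex.log (u₀ / u₀)).im, ‖u₀‖) = (arg u₀, ‖u₀‖) := by simp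
    have cf : ∀ k : ℝ → ℝ → E, ContinuousAt (uncurry k) (arg u₀, ‖u₀‖) →
        (∀ α β r : ℝ, (α : Angle) = β → k α r = k β r) → ContinuousAt (fun u => k (arg u) ‖u‖) u₀ := by
      intro k hk hp; refine (ContinuousAt.comp (g := uncurry k) (by rw [e0]; exact hk) cL).congr ?_
      filter_upwards [polar u₀ hu₀] with u hu using (hp _ _ _ hu.2).symm
    have c2 : ∀ {k : ℂ → ℂ →L[ℝ] ℝ} {m : ℂ → E}, ContinuousAt k u₀ → ContinuousAt m u₀ →
        ContinuousAt (fun u => (k u).smulRight (m u)) u₀ := fun hk hm =>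
      ((ContinuousLinearMap.smulRightL ℝ ℂ E).continuous.continuousAt.comp hk).clm_apply hm
    exact (c2 (continuousAt_const.clm_comp c1) (cf fa (ca _ _ hr) fun α β r h => (per α β r h).2.1)).add
      (c2 (continuous_norm.continuousAt.smul (continuousAt_const.clm_comp c1)) (cf fr (cr _ _ hr) fun α β r h => (per α β r h).2.2))
  have G0 : G 0 = 0 := by simp only [hG, norm_zero]; exact h0
  have hder0 : HasFDerivAt G (0 : ℂ →L[ℝ] E) 0 := by
    rw [hasFDerivAt_iff_isLittleO, Asymptotics.isLittleO_iff]; intro c hc; have : ∀ᶠ u : ℂ in 𝓝[≠] 0, ‖G u‖ ≤ c * ‖u‖ := by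
      filter_upwards [near, tω.eventually_lt_const hc] with u h1 h2; exact (b0 _ _ h1).trans (by have := h1.1; gcongr)
    rw [eventually_nhdsWithin_iff] at this; filter_upwards [this] with u hu; by_cases h : u = 0
    · simp [h]
    · simpa [G0] using hu h
  have hcont0 : ContinuousAt G' 0 := by
    rw [continuousAt_iff_punctured_nhds, G'0]
    refine squeeze_zero_norm' (a := fun u => 2 * ω ‖u‖) ?_ (by simpa using tω.const_mul 2)
    filter_upwards [near, self_mem_nhdsWithin] with u h1 h2; have hpos := h1.1
    refine ContinuousLinearMap.opNorm_le_bound _ ?_ fun v => ?_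
    · have := (norm_nonneg _).trans (br (arg u) _ h1); linarith
    have n1 : ‖u⁻¹ * v‖ = ‖u‖⁻¹ * ‖v‖ := by rw [norm_mul, norm_inv]
    have e : G' u v = (u⁻¹ * v).im • fa (arg u) ‖u‖ + (‖u‖ * (u⁻¹ * v).re) • fr (arg u) ‖u‖ := by simp [hG', hl]
    rw [e]; refine (norm_add_le _ _).trans ?_; rw [norm_smul, norm_smul, norm_mul, norm_norm]
    have i1 : ‖(u⁻¹ * v).im‖ ≤ ‖u‖⁻¹ * ‖v‖ := n1 ▸ Complex.abs_im_le_norm _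
    have i2 : ‖(u⁻¹ * v).re‖ ≤ ‖u‖⁻¹ * ‖v‖ := n1 ▸ Complex.abs_re_le_norm _
    calc _ ≤ ‖u‖⁻¹ * ‖v‖ * (ω ‖u‖ * ‖u‖) + ‖u‖ * (‖u‖⁻¹ * ‖v‖) * ω ‖u‖ := by
          gcongr
          · exact ba _ _ h1
          · exact br _ _ h1
      _ = _ := by field_simp; ring
  refine ⟨?_, hder0⟩; have hu : {u : ℂ | u = 0 ∨ ‖u‖ ∈ Ioo 0 δ} ∈ 𝓝 (0 : ℂ) := by
    filter_upwards [Metric.ball_mem_nhds (0 : ℂ) hδ] with u hu; by_cases h : u = 0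
    · exact .inl h
    · exact .inr ⟨norm_pos_iff.2 h, by simpa using hu⟩
  rw [contDiffAt_one_iff]; refine ⟨G', _, hu, fun u hu => ?_, fun u hu => ?_⟩
  · rcases hu with rfl | hu
    · exact hcont0.continuousWithinAt
    · exact (hcont u hu).continuousWithinAt
  · rcases hu with rfl | hu
    · rw [G'0]; exact hder0
    · exact hder u hu

/-! ### Sums over arcs -/

/-- The sum of functions of `r * C α` over the arcs that contain `α`. -/
def arcSum {ι : Type} [Fintype ι] (T : ι → Set ℝ) (C : ℝ → ℝ) (k : ι → ℝ → ℝ) (r α : ℝ) : ℝ :=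
  ∑ i, (T i).indicator (fun α => k i (r * C α)) α

section ArcSum
variable {ι : Type} [Fintype ι] {T : ι → Set ℝ} {C C' : ℝ → ℝ} {k k' : ι → ℝ → ℝ} {r α : ℝ}

lemma arcSum_eq_of_mem {i : ι} (h0 : ∀ i, k i 0 = 0) (hi : α ∈ T i) (hu : C α ≠ 0 → ∀ j, j ≠ i → α ∉ T j) :
    arcSum T C k r α = k i (r * C α) := by
  by_cases h : C α = 0
  · rw [h, mul_zero, h0]; refine Finset.sum_eq_zero fun j _ => ?_; simp_all
  · refine (Finset.sum_eq_single i (fun j _ hj => indicator_of_notMem (hu h j hj) _)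
      fun h => absurd (Finset.mem_univ _) h).trans (indicator_of_mem hi _)

lemma hasDerivAt_arcSum (hT : ∀ i, IsClosed (T i)) (hint : ∀ i, α ∈ T i → C α ≠ 0 → T i ∈ 𝓝 α) (hC : HasDerivAt C (C' α) α)
    (h0 : ∀ i, k i 0 = 0) (h0' : ∀ i, k' i 0 = 0) (hk : ∀ i, HasDerivAt (k i) (k' i (r * C α)) (r * C α)) :
    HasDerivAt (arcSum T C k r) (arcSum T C k' r α * (r * C' α)) α := by
  unfold arcSum; rw [Finset.sum_mul]; refine HasDerivAt.fun_sum fun i _ => ?_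
  have hf : HasDerivAt (fun α => k i (r * C α)) (k' i (r * C α) * (r * C' α)) α := (hk i).comp α (hC.const_mul r)
  by_cases hα : α ∈ T i
  · rw [indicator_of_mem hα]; by_cases hz : C α = 0
    · rw [hz, mul_zero, h0', zero_mul] at hf ⊢; rw [hasDerivAt_iff_isLittleO] at hf ⊢
      refine Asymptotics.IsLittleO.of_norm_left ((Asymptotics.IsBigO.of_bound 1 (.of_forall fun y => ?_)).trans_isLittleO hf)
      rw [indicator_of_mem hα]; simp [hz, mul_zero, h0, sub_zero, smul_zero, norm_norm, one_mul]; by_cases hy : y ∈ T i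
      · rw [indicator_of_mem hy]
      simp_all
    · exact hf.congr_of_eventuallyEq (by filter_upwards [hint i hα hz] with y hy using indicator_of_mem hy _)
  · rw [indicator_of_notMem hα, zero_mul]; refine (hasDerivAt_const α (0 : ℝ)).congr_of_eventuallyEq ?_
    filter_upwards [(hT i).isOpen_compl.mem_nhds hα] with y hy using indicator_of_notMem hy _

lemma hasDerivAt_arcSum_left (hk : ∀ i, HasDerivAt (k i) (k' i (r * C α)) (r * C α)) :
    HasDerivAt (fun r => arcSum T C k r α) (arcSum T C k' r α * C α) r := by
  unfold arcSum; rw [Finset.sum_mul]; refine HasDerivAt.fun_sum fun i _ => ?_; by_cases hα : α ∈ T i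
  · simp [indicator_of_mem hα]; exact (hk i).comp r (by simpa using (hasDerivAt_id r).mul_const (C α))
  · simp [indicator_of_notMem hα, zero_mul]; exact hasDerivAt_const _ _

lemma continuousAt_arcSum (hT : ∀ i, IsClosed (T i)) (hint : ∀ i, α ∈ T i → C α ≠ 0 → T i ∈ 𝓝 α) (hC : Continuous C)
    (h0 : ∀ i, k i 0 = 0) (hk : ∀ i, ContinuousAt (k i) (r * C α)) :
    ContinuousAt (uncurry (arcSum T C k)) (r, α) := by
  unfold arcSum; refine tendsto_finset_sum _ fun i _ => ?_; have hf : ContinuousAt (fun p : ℝ × ℝ => k i (p.1 * C p.2)) (r, α) :=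
    ContinuousAt.comp (f := fun p : ℝ × ℝ => p.1 * C p.2) (hk i) (by fun_prop)
  change ContinuousAt (fun p : ℝ × ℝ => (T i).indicator (fun α => k i (p.1 * C α)) p.2) (r, α); by_cases hα : α ∈ T i
  · by_cases hz : C α = 0
    · have e : (T i).indicator (fun y => k i (r * C y)) α = 0 := by simp_all
      have hf0 : Tendsto (fun p : ℝ × ℝ => ‖k i (p.1 * C p.2)‖) (𝓝 (r, α)) (𝓝 0) := by
        have := hf.norm; simpa [ContinuousAt, hz, h0] using this
      rw [ContinuousAt, e]; refine squeeze_zero_norm (fun p => ?_) hf0; by_cases hp : p.2 ∈ T i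
      · rw [indicator_of_mem hp]
      simp_all
    · refine hf.congr ?_; filter_upwards [continuousAt_snd.eventually_mem (hint i hα hz)] with p hp; simp_all
  · refine ContinuousAt.congr (f := fun _ : ℝ × ℝ => (0 : ℝ)) continuousAt_const ?_
    filter_upwards [continuousAt_snd.eventually_mem ((hT i).isOpen_compl.mem_nhds hα)] with p hp; simp_all

end ArcSum

/-! ### The chart of a fan -/

lemma periodic_eq {E : Type*} {f : ℝ → E} (hf : Periodic f (2 * π)) {α : ℝ} (h : (α : Angle) = β) : f α = f β := by
  rw [← hf.lift_coe α, ← hf.lift_coe β]; exact congrArg hf.lift h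

lemma exists_bound_of_periodic {f : ℝ → ℝ → ℝ} (hf : Continuous (uncurry f)) (per : ∀ t, Periodic (f t) (2 * π)) (τ : ℝ) :
    ∃ M, 0 ≤ M ∧ ∀ t ∈ Icc 0 τ, ∀ θ, |f t θ| ≤ M := by
  obtain ⟨M, hM⟩ := (isCompact_Icc.prod isCompact_Icc : IsCompact (Icc 0 τ ×ˢ Icc 0 (2 * π))).exists_bound_of_continuousOn
    hf.continuousOn
  refine ⟨|M|, abs_nonneg _, fun t ht θ => ?_⟩; obtain ⟨y, hy, e⟩ := (per t).exists_mem_Ico₀ two_pi_pos θ; rw [e]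
  exact (hM (t, y) ⟨ht, Ico_subset_Icc_self hy⟩).trans (le_abs_self M)

/-- The local inverse of an arch, as a perturbation of the identity. -/
lemma Arch.exists_chart (f : Arch L β m) (hc : 0 < c) : ∃ k k' k'' : ℝ → ℝ,
    k 0 = 0 ∧ k' 0 = 0 ∧ k'' 0 = 0 ∧ ∀ᶠ δ in 𝓝[>] (0 : ℝ), ∀ v, |v| < δ → HasDerivAt k (k' v) v ∧
      HasDerivAt k' (k'' v) v ∧ ContinuousAt k'' v ∧ |k' v| ≤ c ∧ (1 + k' v) * f.der (v + k v) = 1 ∧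
      ∀ y, |y| < δ → (f.fn y = v ↔ y = v + k v) := by
  obtain ⟨A, -, A0, h1, h2, h3⟩ := f.exists_inverse
  have tA : Tendsto A (𝓝 0) (𝓝 0) := by have := h3.self_of_nhds.continuousAt.tendsto; rwa [A0] at this
  have td : Tendsto (fun v => f.der (A v)) (𝓝 0) (𝓝 1) := by
    have := (f.continuous_der.tendsto 0).comp tA; rwa [f.der_zero] at this
  have tk : Tendsto (fun v => |(f.der (A v))⁻¹ - 1|) (𝓝 0) (𝓝 0) := by simpa using ((td.inv₀ one_ne_zero).sub_const 1).abs
  obtain ⟨δ₀, hδ₀, h⟩ := Metric.eventually_nhds_iff.1 (h1.and (h2.and (h3.and ((td.eventually_ne one_ne_zero).and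
    (tk.eventually_le_const hc)))))
  refine ⟨fun v => A v - v, fun v => (f.der (A v))⁻¹ - 1,
    fun v => -((β * f.fn (A v) - 2 * m * f.fn (A v) ^ 3) * (f.der (A v))⁻¹) / f.der (A v) ^ 2, by simp [A0],
    by simp [A0, f.der_zero], by simp [A0, f.zero], ?_⟩
  filter_upwards [Ioo_mem_nhdsGT hδ₀] with δ hδ v hv
  obtain ⟨e1, -, e3, e4, e5⟩ := h (y := v) (by rw [dist_eq, sub_zero]; exact hv.trans hδ.2)
  refine ⟨e3.sub (hasDerivAt_id v), (((f.hasDerivAt_der (A v)).comp v e3).inv e4).sub_const 1, ?_, e5, by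
    simp_all, fun y hy => ?_⟩
  · have c1 := f.continuous.continuousAt.comp e3.continuousAt; have c2 := f.continuous_der.continuousAt.comp e3.continuousAt
    exact (((c1.const_mul β).sub ((c1.pow 3).const_mul _)).mul (c2.inv₀ e4)).neg.div (c2.pow 2) (pow_ne_zero 2 e4)
  · rw [add_sub_cancel]; constructor
    · rintro rfl; exact ((h (y := y) (by rw [dist_eq, sub_zero]; exact hy.trans hδ.2)).2.1).symm
    · rintro rfl; exact e1

/-- The data of the chart of a fan of tiles: the common extension `C` of the arches of the arcs, and for each arc the local
inverse `v ↦ v + k v` of the transversal arch. -/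
structure Hat {ι : Type} [Fintype ι] (A : Fan ι) where
  (C C' C'' : ℝ → ℝ) (k k' k'' : ι → ℝ → ℝ) (δ : ℝ)
  hC : ∀ α, HasDerivAt C (C' α) α
  hC' : ∀ α, HasDerivAt C' (C'' α) α
  cont : Continuous C''
  per : Periodic C (2 * π)
  arc : ∀ i, ∀ x ∈ Icc 0 (A.a i), ∀ α : ℝ, (α : Angle) = (A.s i + x : ℝ) →
    C α = A.ε i * (A.P i).C.fn x ∧ C' α = A.ε i * (A.P i).C.der x
  zero : ∀ i, k i 0 = 0 ∧ k' i 0 = 0 ∧ k'' i 0 = 0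
  δ_pos : 0 < δ
  chart : ∀ i v, |v| < δ → HasDerivAt (k i) (k' i v) v ∧ HasDerivAt (k' i) (k'' i v) v ∧ ContinuousAt (k'' i) v ∧
    |k' i v| ≤ 1 / (2 * (Fintype.card ι + 1)) ∧ (1 + k' i v) * (A.P i).B.der (v + k i v) = 1 ∧
    ∀ y, |y| < δ → ((A.P i).B.fn y = v ↔ y = v + k i v)

namespace Hat
variable {ι : Type} [Fintype ι] {A : Fan ι}

lemma exists_of_fan [Nonempty ι] (A : Fan ι) : ∃ _ : Hat A, (∀ α, A.Mem α) ∨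
    ∃ s, ∃ l ∈ Ioo 0 (2 * π), ∀ α, A.Mem α ↔ InArc s l α := by
  obtain ⟨C, h2, per, h, hM⟩ := A.exists_hat; have h1 : ContDiff ℝ 1 (deriv C) := by fun_prop
  choose k k' k'' k0 k0' k0'' hk using fun i => (A.P i).B.exists_chart (c := 1 / (2 * (Fintype.card ι + 1))) (by positivity)
  obtain ⟨δ, hδ, hδ0⟩ := ((eventually_all.2 hk).and self_mem_nhdsWithin).exists
  exact ⟨⟨C, deriv C, deriv (deriv C), k, k', k'', δ, fun α => (h2.differentiable two_ne_zero α).hasDerivAt,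
    fun α => (h1.differentiable one_ne_zero α).hasDerivAt, h1.continuous_deriv le_rfl, fun α => per _ _ (by simp),
    fun i x hx α hα => ⟨(h i x hx α hα).1, (h i x hx α hα).2.deriv⟩, fun i => ⟨k0 i, k0' i, k0'' i⟩, hδ0, hδ⟩, hM⟩

variable (H : Hat A)

lemma cont_C : Continuous H.C := continuous_iff_continuousAt.2 fun α => (H.hC α).continuousAt

lemma cont_C' : Continuous H.C' := continuous_iff_continuousAt.2 fun α => (H.hC' α).continuousAt

lemma per' : Periodic H.C' (2 * π) := fun α =>
  ((H.hC (α + 2 * π)).comp_add_const α (2 * π)).unique ((H.hC α).congr_of_eventuallyEq (.of_forall H.per))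

lemma per'' : Periodic H.C'' (2 * π) := fun α =>
  ((H.hC' (α + 2 * π)).comp_add_const α (2 * π)).unique ((H.hC' α).congr_of_eventuallyEq (.of_forall H.per'))

/-- The arcs of a fan, lifted to the line. -/
def _root_.RectSurface.Fan.T (A : Fan ι) (i : ι) : Set ℝ := {α | InArc (A.s i) (A.a i) α}

lemma isClosed_T (i : ι) : IsClosed (A.T i) := isClosed_inArc _ _

lemma arc_interior {i : ι} {α : ℝ} (hα : α ∈ A.T i) (h : H.C α ≠ 0) : A.T i ∈ 𝓝 α ∧ ∀ j, j ≠ i → α ∉ A.T j := by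
  have ha := A.ha i; rcases Fan.cases_of_inArc hα with ⟨x, hx, e, hj⟩ | e | e
  · refine ⟨?_, hj⟩; filter_upwards [eventually_abs_sub_lt α (lt_min (sub_pos.2 ha.2) (lt_min hx.1 (sub_pos.2 hx.2)))] with y hy
    rw [lt_min_iff, lt_min_iff] at hy; have := (inArc_add_iff (s := A.s i) (Ioo_subset_Icc_self hx) e hy.1).2 ⟨by grind, by grind⟩
    rwa [add_sub_cancel] at this
  · exact absurd (by rw [(H.arc i 0 ⟨le_rfl, ha.1.le⟩ α (by rw [add_zero]; exact e)).1, Arch.zero, mul_zero]) h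
  · exact absurd (by rw [(H.arc i _ ⟨ha.1.le, le_rfl⟩ α e).1, Arch.fn_len, mul_zero]) h

lemma sum_eq {k : ι → ℝ → ℝ} (h0 : ∀ i, k i 0 = 0) {i : ι} {α : ℝ} (hα : α ∈ A.T i) (r : ℝ) :
    arcSum A.T H.C k r α = k i (r * H.C α) :=
  arcSum_eq_of_mem h0 hα fun h => (H.arc_interior hα h).2

lemma sum_periodic (k : ι → ℝ → ℝ) (r : ℝ) : Periodic (arcSum A.T H.C k r) (2 * π) := fun α => by
  refine Finset.sum_congr rfl fun i _ => ?_; have : α + 2 * π ∈ A.T i ↔ α ∈ A.T i := by simp [Fan.T, InArc]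
  by_cases h : α ∈ A.T i
  · rw [indicator_of_mem h, indicator_of_mem (this.2 h), H.per]
  simp_all

/-- The derivative of the inverse arches, over all arcs. -/
def D (r α : ℝ) : ℝ := 1 + arcSum A.T H.C H.k' r α

/-- The inverse arches, over all arcs. -/
def V (r α : ℝ) : ℝ := r * H.C α + arcSum A.T H.C H.k r α

variable {H} {r α : ℝ}

lemma hasDerivAt_V (h : |r * H.C α| < H.δ) : HasDerivAt (H.V r) (r * H.C' α * H.D r α) α := by
  have := (H.hC α).const_mul r |>.add (hasDerivAt_arcSum isClosed_T (fun i h1 h2 => (H.arc_interior h1 h2).1) (H.hC α)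
    (fun i => (H.zero i).1) (fun i => (H.zero i).2.1) fun i => (H.chart i _ h).1)
  exact this.congr_deriv (by rw [D]; ring)

lemma hasDerivAt_V_left (h : |r * H.C α| < H.δ) : HasDerivAt (fun r => H.V r α) (H.C α * H.D r α) r := by
  have := ((hasDerivAt_id r).mul_const (H.C α)).add (hasDerivAt_arcSum_left (T := A.T) fun i => (H.chart i _ h).1)
  exact this.congr_deriv (by rw [D]; ring)

lemma hasDerivAt_D (h : |r * H.C α| < H.δ) : HasDerivAt (H.D r) (arcSum A.T H.C H.k'' r α * (r * H.C' α)) α :=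
  (hasDerivAt_arcSum isClosed_T (fun i h1 h2 => (H.arc_interior h1 h2).1) (H.hC α)
    (fun i => (H.zero i).2.1) (fun i => (H.zero i).2.2) fun i => (H.chart i _ h).2.1).const_add 1

lemma continuousAt_sum {k : ι → ℝ → ℝ} (h0 : ∀ i, k i 0 = 0) (hk : ∀ i, ContinuousAt (k i) (r * H.C α)) :
    ContinuousAt (uncurry (arcSum A.T H.C k)) (r, α) :=
  continuousAt_arcSum isClosed_T (fun i h1 h2 => (H.arc_interior h1 h2).1) H.cont_C h0 hk

lemma continuousAt_D (h : |r * H.C α| < H.δ) : ContinuousAt (uncurry H.D) (r, α) :=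
  continuousAt_const.add (continuousAt_sum (fun i => (H.zero i).2.1) fun i => (H.chart i _ h).2.1.continuousAt)

lemma abs_D_sub_one (h : |r * H.C α| < H.δ) : |H.D r α - 1| ≤ 1 / 2 := by
  rw [D, add_sub_cancel_left, arcSum]
  refine (Finset.abs_sum_le_sum_abs _ _).trans ((Finset.sum_le_card_nsmul _ _ (1 / (2 * ((Fintype.card ι : ℝ) + 1))) fun i _ => ?_).trans ?_)
  · by_cases hi : α ∈ A.T i
    · rw [indicator_of_mem hi]; exact (H.chart i _ h).2.2.2.1
    · rw [indicator_of_notMem hi, abs_zero]; positivity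
  · rw [Finset.card_univ, nsmul_eq_mul, mul_one_div, div_le_div_iff₀ (by positivity) two_pos]; linarith

lemma V_eq {i : ι} (hα : α ∈ A.T i) (r : ℝ) : H.V r α = r * H.C α + H.k i (r * H.C α) := by
  rw [V, H.sum_eq (fun i => (H.zero i).1) hα]

/-- On an arc, `D` is the inverse of the derivative of the transversal arch. -/
lemma D_mul {i : ι} (hα : α ∈ A.T i) (h : |r * H.C α| < H.δ) : H.D r α * (A.P i).B.der (H.V r α) = 1 := by
  rw [V_eq hα, D, H.sum_eq (fun i => (H.zero i).2.1) hα]; exact (H.chart i _ h).2.2.2.2.1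

lemma V_periodic (r : ℝ) : Periodic (H.V r) (2 * π) := fun α => by rw [V, V, H.per, H.sum_periodic]

lemma D_periodic (r : ℝ) : Periodic (H.D r) (2 * π) := fun α => by rw [D, D, H.sum_periodic]

lemma exists_bounds (H : Hat A) : ∃ M > 0, ∀ α, |H.C α| ≤ M ∧ |H.C' α| ≤ M := by
  obtain ⟨M₁, h1, b1⟩ := exists_bound_of_periodic (f := fun _ => H.C) (H.cont_C.comp continuous_snd) (fun _ => H.per) 0
  obtain ⟨M₂, h2, b2⟩ := exists_bound_of_periodic (f := fun _ => H.C') (H.cont_C'.comp continuous_snd) (fun _ => H.per') 0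
  exact ⟨M₁ + M₂ + 1, by positivity, fun α => ⟨by linarith [b1 0 ⟨le_rfl, le_rfl⟩ α], by linarith [b2 0 ⟨le_rfl, le_rfl⟩ α]⟩⟩

/-- The function whose graph is the union of the tiles of a fan. -/
def ψ (H : Hat A) (K : ℝ) (u : ℂ) : ℝ := H.V (‖u‖ ^ K) (arg u)

lemma eventually_small (H : Hat A) (hK : 0 < K) : ∀ᶠ r in 𝓝 (0 : ℝ), ∀ α, |r ^ K * H.C α| < H.δ := by
  obtain ⟨M, hM, b⟩ := H.exists_bounds; have : Tendsto (fun r : ℝ => |r ^ K| * M) (𝓝 0) (𝓝 0) := by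
    have := ((continuousAt_rpow_const 0 K (.inr hK.le)).tendsto.abs).mul_const M
    rwa [zero_rpow hK.ne', abs_zero, zero_mul] at this
  filter_upwards [this.eventually_lt_const H.δ_pos] with r hr α; rw [abs_mul]
  exact (mul_le_mul_of_nonneg_left (b α).1 (abs_nonneg _)).trans_lt hr

lemma contDiffAt_ψ (H : Hat A) (hK : 1 < K) : ContDiffAt ℝ 1 (H.ψ K) 0 ∧ HasFDerivAt (H.ψ K) (0 : ℂ →L[ℝ] ℝ) 0 ∧ H.ψ K 0 = 0 := by
  obtain ⟨M, hM, b⟩ := H.exists_bounds; have hK0 : 0 < K := by linarith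
  obtain ⟨δ, hδ, h⟩ := Metric.eventually_nhds_iff.1 (H.eventually_small hK0)
  have sm : ∀ r ∈ Ioo 0 δ, ∀ α, |r ^ K * H.C α| < H.δ := fun r hr => h (by rw [dist_eq, sub_zero, abs_of_pos hr.1]; exact hr.2)
  have V0 : ∀ α, H.V 0 α = 0 := fun α => by
    rw [V, zero_mul, zero_add]; exact Finset.sum_eq_zero fun i _ => by
      by_cases hi : α ∈ A.T i
      · rw [indicator_of_mem hi, zero_mul, (H.zero i).1]
      simp_all
  have d2 : ∀ r ∈ Ioo 0 δ, ∀ α, |H.D (r ^ K) α| ≤ 2 := fun r hr α => by have := abs_le.1 (abs_D_sub_one (sm r hr α)); grind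
  have dr : ∀ α, ∀ r ∈ Ioo 0 δ, HasDerivAt (fun r => H.V (r ^ K) α) (H.C α * H.D (r ^ K) α * (K * r ^ (K - 1))) r :=
    fun α r hr => (hasDerivAt_V_left (sm r hr α)).comp r (h := fun r => r ^ K) (hasDerivAt_rpow_const (.inl hr.1.ne'))
  have bC : ∀ {c d : ℝ}, |c| ≤ M → |d| ≤ 2 → |c * d| ≤ M * 2 := fun h1 h2 => by
    rw [abs_mul]; exact mul_le_mul h1 h2 (abs_nonneg _) hM.le
  have pw : ∀ r ∈ Ioo 0 δ, r ^ K = r ^ (K - 1) * r := fun r hr => by rw [← rpow_add_one hr.1.ne', sub_add_cancel]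
  have cD : ∀ α, ∀ r ∈ Ioo 0 δ, ContinuousAt (fun p : ℝ × ℝ => H.D (p.2 ^ K) p.1) (α, r) := fun α r hr =>
    ContinuousAt.comp (g := uncurry H.D) (f := fun p : ℝ × ℝ => (p.2 ^ K, p.1)) (continuousAt_D (sm r hr α))
      ((continuousAt_snd.rpow_const (.inl hr.1.ne')).prodMk continuousAt_fst)
  have := contDiffAt_polar (f := fun α r => H.V (r ^ K) α) (fa := fun α r => r ^ K * H.C' α * H.D (r ^ K) α)
    (fr := fun α r => H.C α * H.D (r ^ K) α * (K * r ^ (K - 1))) (ω := fun r => 2 * M * K * r ^ (K - 1)) hδ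
    (fun α β r e => ⟨periodic_eq (V_periodic _) e, by
      rw [periodic_eq H.per' e, periodic_eq (H.D_periodic _) e], by rw [periodic_eq H.per e, periodic_eq (H.D_periodic _) e]⟩)
    (fun α r hr => hasDerivAt_V (sm r hr α)) dr
    (fun α r hr => ((continuousAt_snd.rpow_const (.inl hr.1.ne')).mul (H.cont_C'.continuousAt.comp continuousAt_fst)).mul (cD α r hr))
    (fun α r hr => ((H.cont_C.continuousAt.comp continuousAt_fst).mul (cD α r hr)).mul
      ((continuousAt_snd.rpow_const (.inl hr.1.ne')).const_mul K))
    (by simp [zero_rpow hK0.ne', V0]) (fun α r hr => ?_) (fun α r hr => ?_) (fun α r hr => ?_) ?_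
  · exact ⟨this.1, this.2, by rw [ψ, norm_zero, zero_rpow hK0.ne', V0]⟩
  · have hrK := rpow_pos_of_pos hr.1 K; have hs : ∀ s ∈ Icc 0 (r ^ K), |s * H.C α| < H.δ := fun s hs => by
      refine lt_of_le_of_lt ?_ (sm r hr α); rw [abs_mul, abs_mul, abs_of_nonneg hs.1, abs_of_pos hrK]
      exact mul_le_mul_of_nonneg_right hs.2 (abs_nonneg _)
    have := (convex_Icc 0 (r ^ K)).norm_image_sub_le_of_norm_hasDerivWithin_le (f := fun r => H.V r α)
      (f' := fun r => H.C α * H.D r α) (C := M * 2) (x := 0) (y := r ^ K)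
      (fun s h => (hasDerivAt_V_left (hs s h)).hasDerivWithinAt) (fun s h => bC (b α).1 (by
        have := abs_le.1 (abs_D_sub_one (hs s h)); exact abs_le.2 (by grind))) ⟨le_rfl, hrK.le⟩ ⟨hrK.le, le_rfl⟩
    rw [V0, sub_zero, sub_zero, norm_of_nonneg hrK.le] at this; have e := congrArg (2 * M * K * ·) (pw r hr)
    have h2 : 0 < M * r ^ K * (K - 1) := by positivity
    linarith
  · have hp := rpow_pos_of_pos hr.1 (K - 1); rw [mul_assoc, norm_eq_abs, abs_mul, abs_of_pos (rpow_pos_of_pos hr.1 K)]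
    have := mul_le_mul_of_nonneg_left (bC (b α).2 (d2 r hr α)) (mul_pos hp hr.1).le; rw [← pw r hr] at this
    have e := congrArg (2 * M * K * ·) (pw r hr)
    have h2 : 0 < M * r ^ K * (K - 1) := mul_pos (mul_pos hM (rpow_pos_of_pos hr.1 K)) (by linarith); linarith
  · have hp := rpow_pos_of_pos hr.1 (K - 1); rw [norm_eq_abs, abs_mul, abs_of_pos (mul_pos hK0 hp)]
    have := mul_le_mul_of_nonneg_right (bC (b α).1 (d2 r hr α)) (mul_pos hK0 hp).le; linarith
  · have : Tendsto (fun r : ℝ => r ^ (K - 1)) (𝓝[>] 0) (𝓝 0) := by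
      have := (continuousAt_rpow_const 0 (K - 1) (.inr (by linarith))).tendsto; rw [zero_rpow (by linarith)] at this
      exact this.mono_left nhdsWithin_le_nhds
    simpa using this.const_mul (2 * M * K)

end Hat

open Complex (real_smul normSq_apply ofReal_im)
open Split (contDiffAt_Y eventually_abs_X_lt)
/-! ### The chart at a pole -/

namespace Split
variable (S : Split)

/-- The differential of `u`. -/
def du (p : E4) : E4 →L[ℝ] ℂ := ‖S.z p‖⁻¹ • (S.w - (Complex.reCLM.comp ((S.z p)⁻¹ • S.z)).smulRight (S.w p))

variable {S}

lemma du_apply (q v : E4) : S.du q v = ‖S.z q‖⁻¹ • (S.w v - ((S.z q)⁻¹ * S.z v).re • S.w q) := by simp [du]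

lemma u_eventuallyEq (hz : S.z q ≠ 0) : S.u =ᶠ[𝓝 q] fun p => exp (-log ‖S.z p‖) • S.w p := by
  filter_upwards [S.z.continuous.continuousAt.eventually_ne hz] with p hp; rw [u, exp_neg, exp_log (norm_pos_iff.2 hp)]

lemma contDiffAt_u (hz : S.z q ≠ 0) : ContDiffAt ℝ 1 S.u q :=
  ((contDiffAt_logNorm (S := S.swap) hz).neg.exp.smul S.w.contDiff.contDiffAt).congr_of_eventuallyEq (u_eventuallyEq hz)

lemma hasFDerivAt_u (hz : S.z q ≠ 0) : HasFDerivAt S.u (S.du q) q := by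
  refine (((hasFDerivAt_logNorm (S := S.swap) hz).neg.exp.smul S.w.hasFDerivAt).congr_of_eventuallyEq
    (u_eventuallyEq hz)).congr_fderiv ?_
  ext v; have e : exp (-log ‖S.swap.w q‖) = ‖S.z q‖⁻¹ := by
    change exp (-log ‖S.z q‖) = _; rw [exp_neg, exp_log (norm_pos_iff.2 hz)]
  rw [du_apply, smul_sub, smul_smul, sub_eq_add_neg, ← neg_smul, ← mul_neg]
  change exp (-log ‖S.swap.w q‖) • S.w v + (exp (-log ‖S.swap.w q‖) * -((S.z q)⁻¹ * S.z v).re) • S.w q = _; rw [e]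

lemma u_eq_zero (hz : S.z q ≠ 0) : S.u q = 0 ↔ S.w q = 0 := by
  rw [u, smul_eq_zero, inv_eq_zero, norm_eq_zero]; exact or_iff_right hz

lemma arg_u (hz : S.z q ≠ 0) : arg (S.u q) = arg (S.w q) := by
  rw [u, real_smul, Complex.arg_real_mul _ (inv_pos.2 (norm_pos_iff.2 hz))]

lemma norm_u : ‖S.u q‖ = ‖S.w q‖ / ‖S.z q‖ := by rw [u, norm_smul, norm_inv, norm_norm, inv_mul_eq_div]

lemma eq_zero_of_du (hz : S.z q ≠ 0) (hN : ‖q‖ ^ 2 = 1) (h1 : inner ℝ q v = 0) (h2 : S.du q v = 0)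
    (h3 : S.dφ q v = 0) : v = 0 := by
  rw [du_apply, smul_eq_zero, inv_eq_zero, norm_eq_zero, or_iff_right hz, sub_eq_zero] at h2
  have hz2 : S.z v = S.z q * ((S.z q)⁻¹ * S.z v) := by rw [mul_inv_cancel_left₀ hz]
  have hm : (S.z q)⁻¹ * S.z v = (((S.z q)⁻¹ * S.z v).re : ℂ) := Complex.ext rfl (by rw [ofReal_im]; exact h3)
  set m := ((S.z q)⁻¹ * S.z v).re
  have e : v = m • q := S.ext (by rw [hz2, hm, map_smul, real_smul, mul_comm]) (by rw [h2, map_smul])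
  rw [e, inner_smul_right, real_inner_self_eq_norm_sq, hN, mul_one] at h1; rw [e, h1, zero_smul]

/-- A tile near a pole. -/
lemma tile_local_pole {P : Profile a b} (hK : 0 < K) (ha : 0 < a) (hw : S.w q = 0) (hz : S.z q ≠ 0)
    (hb : b ∈ Ioo 0 (2 * π)) (hs : CornerSign y₀ b ε) (hang : (arg (S.z q) : Angle) = (t + y₀ : ℝ)) :
    ∀ᶠ p in 𝓝 q, p ∈ S.tile K s t P ↔ ‖p‖ ^ 2 = 1 ∧ (S.u p = 0 ∧ P.B.fn (S.Y (S.z q) p) = 0 ∨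
      S.u p ≠ 0 ∧ ∃ x ∈ Icc 0 a, (arg (S.u p) : Angle) = (s + x : ℝ) ∧
        P.B.fn (S.Y (S.z q) p) = ‖S.u p‖ ^ K * (ε * P.C.fn x)) := by
  have hεε : ε * ε = 1 := by rcases hs.abs with rfl | rfl <;> norm_num
  have hy₀ : y₀ ∈ Icc 0 b := by rcases hs with ⟨rfl, -⟩ | ⟨rfl, -⟩ <;> simp [hb.1.le]
  filter_upwards [angle_eq_iff (S := S.swap) hz hb.2 hy₀ hang, S.z.continuous.continuousAt.eventually_ne hz,
    eventually_abs_X_lt (S := S.swap) (self_div_mem hz) (X_self (S := S.swap) hz) hb.1] with p h1 hzp hYb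
  change |S.Y (S.z q) p| < b at hYb
  have h1' : ∀ y ∈ Icc 0 b, S.z p = ‖S.z p‖ * cexp ((t + y : ℝ) * I) ↔ y = y₀ + S.Y (S.z q) p :=
    fun y hy => (eq_norm_mul_exp_iff hzp _).trans (h1 y hy)
  have hzK := rpow_pos_of_pos (norm_pos_iff.2 hzp) K
  have hnu : ‖S.u p‖ ^ K = ‖S.w p‖ ^ K / ‖S.z p‖ ^ K := by rw [norm_u, div_rpow (norm_nonneg _) (norm_nonneg _)]
  have key : ∀ c, ‖S.z p‖ ^ K * P.B.fn (y₀ + S.Y (S.z q) p) = ‖S.w p‖ ^ K * c ↔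
      P.B.fn (S.Y (S.z q) p) = ‖S.u p‖ ^ K * (ε * c) := fun c => by
    rw [hs.fn_add, hnu, div_mul_eq_mul_div, eq_div_iff hzK.ne']; grind
  have hmem : 0 ≤ ε * P.B.fn (S.Y (S.z q) p) → y₀ + S.Y (S.z q) p ∈ Icc 0 b := fun h =>
    (hs.mem_Icc_iff hYb).2 ((P.B.sign_mul hYb hs.abs).1 h)
  rw [tile, mem_setOf_eq, ← S.norm_sq]; refine and_congr_right fun _ => ?_; by_cases hu : S.u p = 0
  · have hwp := (u_eq_zero hzp).1 hu
    have h0 : ∀ x, ‖S.w p‖ ^ K * P.C.fn x = ‖S.w p‖ ^ K * 0 := fun x => by rw [hwp, norm_zero, zero_rpow hK.ne', zero_mul, zero_mul]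
    simp only [hu, true_and, ne_eq, not_true_eq_false, false_and, or_false]; constructor
    · rintro ⟨x, -, y, hy, e1, -, e3⟩; obtain rfl := (h1' y hy).1 e1; rw [h0, key] at e3; simpa using e3
    · intro h; have hy := hmem (by rw [h, mul_zero])
      exact ⟨0, ⟨le_rfl, ha.le⟩, _, hy, (h1' _ hy).2 rfl, by rw [hwp, norm_zero]; simp, by rw [h0, key, h, mul_zero, mul_zero]⟩
  · have hwp := mt (u_eq_zero hzp).2 hu
    simp only [hu, false_and, false_or, ne_eq, not_false_eq_true, true_and, arg_u hzp, eq_norm_mul_exp_iff hwp]; constructor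
    · rintro ⟨x, hx, y, hy, e1, e2, e3⟩; obtain rfl := (h1' y hy).1 e1; exact ⟨x, hx, e2, (key _).1 e3⟩
    · rintro ⟨x, hx, e2, e3⟩; have hy := hmem (by
        rw [e3]
        have := mul_nonneg (rpow_nonneg (norm_nonneg (S.u p)) K) (P.C.nonneg hx)
        linear_combination this - ‖S.u p‖ ^ K * P.C.fn x * hεε)
      exact ⟨x, hx, _, hy, (h1' _ hy).2 rfl, e2, (key _).2 e3⟩

end Split

/-- Near the pole `q`, the set `F` is the union of the tiles of a fan. -/
structure PoleModel (S : Split) (K : ℝ) (F : Set E4) (q : E4) {ι : Type} (A : Fan ι) (t y₀ : ι → ℝ) : Prop where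
  one_lt : 1 < K
  w_zero : S.w q = 0
  norm : ‖q‖ ^ 2 = 1
  b_mem : ∀ i, A.b i ∈ Ioo 0 (2 * π)
  sign : ∀ i, CornerSign (y₀ i) (A.b i) (A.ε i)
  angle : ∀ i, (arg (S.z q) : Angle) = (t i + y₀ i : ℝ)
  loc : ∀ᶠ p in 𝓝 q, p ∈ F ↔ ∃ i, p ∈ S.tile K (A.s i) (t i) (A.P i)

lemma inSector_rotate_iff {l : ℝ} {u : ℂ} (hl : 0 < l) : (u = 0 ∨ InArc s l (arg u)) ↔
    InSector l (cexp (-(s * I)) * u).re (cexp (-(s * I)) * u).im := by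
  have e : ∀ (ρ x : ℝ), u = ρ * cexp ((s + x : ℝ) * I) ↔ cexp (-(s * I)) * u = ρ * cexp (x * I) := fun ρ x => by
    rw [Complex.exp_neg, inv_mul_eq_iff_eq_mul₀ (Complex.exp_ne_zero _), Complex.ofReal_add, add_mul, Complex.exp_add]; grind
  have e2 : ∀ (ρ x : ℝ), cexp (-(s * I)) * u = ρ * cexp (x * I) ↔
      (cexp (-(s * I)) * u).re = ρ * cos x ∧ (cexp (-(s * I)) * u).im = ρ * sin x := fun ρ x => by
    rw [Complex.ext_iff, re_ofReal_mul, im_ofReal_mul, Complex.exp_ofReal_mul_I_re, Complex.exp_ofReal_mul_I_im]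
  by_cases hu : u = 0
  · simp [hu, true_or, true_iff]; exact ⟨0, le_rfl, 0, ⟨le_rfl, hl.le⟩, by simp⟩
  rw [or_iff_right hu]; constructor
  · rintro ⟨x, hx, h⟩; exact ⟨‖u‖, norm_nonneg _, x, hx, (e2 _ _).1 ((e _ _).1 ((eq_norm_mul_exp_iff hu _).2 h))⟩
  · rintro ⟨ρ, hρ, x, hx, h⟩; have h' := (e _ _).2 ((e2 _ _).2 h); have hn : ‖u‖ = ρ := by
      have := congrArg norm h'; rwa [norm_mul, norm_exp_ofReal_mul_I, mul_one, norm_real, norm_of_nonneg hρ] at this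
    exact ⟨x, hx, (eq_norm_mul_exp_iff hu _).1 (by rw [hn]; exact h')⟩

namespace PoleModel
variable {S : Split} {ι : Type} {A : Fan ι} {t y₀ : ι → ℝ}

section
variable (h : PoleModel S K F q A t y₀)
include h

lemma z_ne : S.z q ≠ 0 := fun hz => by have := S.norm_sq q; rw [h.norm, hz, h.w_zero] at this; simp at this

lemma u_zero : S.u q = 0 := (Split.u_eq_zero h.z_ne).2 h.w_zero

lemma Y_zero : S.Y (S.z q) q = 0 := X_self (S := S.swap) h.z_ne

lemma eventually_u {P : ℂ → Prop} (hP : ∀ᶠ u in 𝓝 0, P u) : ∀ᶠ p in 𝓝 q, P (S.u p) :=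
  (by have := (Split.hasFDerivAt_u h.z_ne).continuousAt.tendsto; rwa [h.u_zero] at this : Tendsto S.u (𝓝 q) (𝓝 0)).eventually hP

variable [Fintype ι] (H : Hat A)

lemma local_i : ∀ᶠ p in 𝓝 q, ∀ i, p ∈ S.tile K (A.s i) (t i) (A.P i) ↔ ‖p‖ ^ 2 = 1 ∧
    (S.u p = 0 ∨ arg (S.u p) ∈ A.T i) ∧ S.Y (S.z q) p = H.ψ K (S.u p) := by
  have hK : 0 < K := by linarith [h.one_lt]
  rw [eventually_all]; intro i
  filter_upwards [Split.tile_local_pole (P := A.P i) (s := A.s i) hK (A.ha i).1 h.w_zero h.z_ne (h.b_mem i) (h.sign i) (h.angle i),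
    eventually_abs_X_lt (S := S.swap) (self_div_mem h.z_ne) h.Y_zero H.δ_pos,
    h.eventually_u (tendsto_norm_zero.eventually (H.eventually_small hK))] with p h1 hY hr
  rw [h1]; refine and_congr_right fun _ => ?_; have key := (H.chart i _ (hr (arg (S.u p)))).2.2.2.2.2 _ hY
  change (A.P i).B.fn (S.Y (S.z q) p) = _ ↔ S.Y (S.z q) p = _ at key; by_cases hu : S.u p = 0
  · rw [hu, norm_zero, zero_rpow hK.ne', zero_mul, (H.zero i).1, add_zero] at key
    simp [hu, true_and, ne_eq, not_true_eq_false, false_and, or_false, true_or, key, (H.contDiffAt_ψ h.one_lt).2.2]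
  · simp [hu, false_and, false_or, ne_eq, not_false_eq_true, true_and]
    have hV : arg (S.u p) ∈ A.T i → ((A.P i).B.fn (S.Y (S.z q) p) = ‖S.u p‖ ^ K * H.C (arg (S.u p)) ↔
        S.Y (S.z q) p = H.ψ K (S.u p)) := fun hα => by rw [key, Hat.ψ, Hat.V_eq hα]
    constructor
    · rintro ⟨x, hx, e, e'⟩; rw [← (H.arc i x hx _ e).1] at e'; exact ⟨⟨x, hx, e⟩, (hV ⟨x, hx, e⟩).1 e'⟩
    · rintro ⟨⟨x, hx, e⟩, e'⟩; exact ⟨x, hx, e, by rw [← (H.arc i x hx _ e).1]; exact (hV ⟨x, hx, e⟩).2 e'⟩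

lemma local_F [Nonempty ι] : ∀ᶠ p in 𝓝 q, p ∈ F ↔ ‖p‖ ^ 2 = 1 ∧ (S.u p = 0 ∨ A.Mem (arg (S.u p))) ∧
    S.Y (S.z q) p = H.ψ K (S.u p) := by
  filter_upwards [h.loc, h.local_i H] with p h1 h2; rw [h1]; simp [h2, Fan.Mem, Fan.T, mem_setOf_eq]; grind

lemma mem [Nonempty ι] : q ∈ F := by
  obtain ⟨H, -⟩ := Hat.exists_of_fan A
  exact (h.local_F H).self_of_nhds.2 ⟨h.norm, .inl h.u_zero, by rw [h.Y_zero, h.u_zero, (H.contDiffAt_ψ h.one_lt).2.2]⟩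

lemma sector_tangent [Nonempty ι] : (∃ β ∈ Ioc 0 (2 * π), IsSectorNear F q β) ∧
    ∀ v, v ∈ tangentPlane F q ↔ inner ℝ q v = 0 ∧ S.dφ q v = 0 := by
  obtain ⟨H, hH⟩ := Hat.exists_of_fan A; have : ∃ σ : ℝ, ∃ β ∈ Ioc 0 (2 * π), ∀ u, (u = 0 ∨ A.Mem (arg u)) ↔
      InSector β (cexp (-(σ * I)) * u).re (cexp (-(σ * I)) * u).im := by
    rcases hH with hH | ⟨s, l, hl, hH⟩
    · exact ⟨0, 2 * π, ⟨by positivity, le_rfl⟩, fun u => ⟨fun _ => inSector_two_pi _ _, fun _ => .inr (hH _)⟩⟩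
    · exact ⟨s, l, ⟨hl.1, hl.2.le⟩, fun u => by rw [hH, inSector_rotate_iff hl.1]⟩
  obtain ⟨σ, β, hβ, hσ⟩ := this; set e := cexp (-(σ * I)) with he; have he0 : e ≠ 0 := Complex.exp_ne_zero _
  obtain ⟨cψ, dψ, ψ0⟩ := H.contDiffAt_ψ h.one_lt; rw [← h.u_zero] at cψ dψ; have cu := Split.contDiffAt_u h.z_ne
  have du := Split.hasFDerivAt_u h.z_ne; set M : ℂ →L[ℝ] ℂ := ContinuousLinearMap.mul ℝ ℂ e with hM
  have dY := hasFDerivAt_Y (self_div_mem h.z_ne); have cY : ContDiffAt ℝ 1 (S.Y (S.z q)) q := contDiffAt_Y (self_div_mem h.z_ne)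
  have fin4 : ∀ {P : Fin 4 → Prop}, P 0 → P 1 → P 2 → P 3 → ∀ i, P i := by intro P h0 h1 h2 h3 i; fin_cases i <;> assumption
  obtain ⟨h1, h2⟩ := sector_of_coords (F := F) (p := q) hβ.1
    (f := ![fun p => (e * S.u p).re, fun p => (e * S.u p).im, fun p => S.Y (S.z q) p - H.ψ K (S.u p), fun p => ‖p‖ ^ 2 - 1])
    (l := ![(Complex.reCLM.comp M).comp (S.du q), (Complex.imCLM.comp M).comp (S.du q), S.dφ q, 2 • innerSL ℝ q])
    (fin4 ((Complex.reCLM.comp M).contDiff.contDiffAt.comp q cu) ((Complex.imCLM.comp M).contDiff.contDiffAt.comp q cu)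
      (cY.sub (cψ.comp q cu)) contDiff_normSq_sub_one.contDiffAt)
    (fin4 ((Complex.reCLM.comp M).hasFDerivAt.comp q du) ((Complex.imCLM.comp M).hasFDerivAt.comp q du)
      ((dY.sub (dψ.comp q du)).congr_fderiv (by simp)) (hasFDerivAt_normSq_sub_one q))
    (fin4 (by simp [h.u_zero]) (by simp [h.u_zero]) (by simp [h.u_zero, ψ0, h.Y_zero]) (by simp [h.norm]))
    (fun v hv => by
      have v0 : (e * S.du q v).re = 0 := hv 0; have v1 : (e * S.du q v).im = 0 := hv 1; have v3 : (2 • innerSL ℝ q) v = 0 := hv 3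
      exact Split.eq_zero_of_du h.z_ne h.norm (by simpa using v3) ((mul_eq_zero.1 (Complex.ext v0 v1)).resolve_left he0) (hv 2))
    (by
      filter_upwards [h.local_F H] with p hp
      rw [hp, hσ]
      simp only [Matrix.cons_val, sub_eq_zero]
      tauto)
  refine ⟨⟨β, hβ, h1⟩, fun v => (h2 v).trans ?_⟩; simp only [Matrix.cons_val]; rw [and_comm]
  simp

lemma mem_singularSet [Nonempty ι] : q ∈ singularSet F := by
  refine ⟨h.mem, ?_⟩; ext v; rw [h.sector_tangent.2, mem_contactPlane]; refine and_congr_right fun _ => ?_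
  have e : inner ℝ (contactNormal q) v = ‖S.z q‖ ^ 2 * S.dφ q v := by
    have hn := S.normal q; have e1 : S.z (contactNormal q) = I * S.z q := congrArg Prod.fst hn
    have e2 : S.w (contactNormal q) = I * S.w q := congrArg Prod.snd hn
    have hz : S.z v = S.z q * ((S.z q)⁻¹ * S.z v) := by rw [mul_inv_cancel_left₀ h.z_ne]
    rw [S.inner_eq', e1, e2, h.w_zero, mul_zero, inner_zero_left, add_zero, hz]; change _ = _ * ((S.z q)⁻¹ * S.z v).im
    generalize (S.z q)⁻¹ * S.z v = c
    rw [Complex.inner, ← normSq_eq_norm_sq, normSq_apply]; simp; ring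
  rw [e, mul_eq_zero, or_iff_right (by simpa using h.z_ne)]

end
end PoleModel

/-! ### Nodes -/

lemma norm_exp_I_sub_le (a b : ℝ) : ‖cexp (a * I) - cexp (b * I)‖ ≤ |a - b| := by
  have e : cexp (a * I) - cexp (b * I) = cexp (b * I) * (cexp (I * (a - b : ℝ)) - 1) := by
    rw [mul_sub, mul_one, ← Complex.exp_add]; push_cast; ring_nf
  rw [e, norm_mul, norm_exp_ofReal_mul_I, one_mul]; exact norm_exp_I_mul_ofReal_sub_one_le

lemma exp_I_periodic (x : ℝ) : cexp ((x + 2 * π : ℝ) * I) = cexp (x * I) := by push_cast; exact Complex.exp_mul_I_periodic x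

namespace Hat
variable {ι : Type} [Fintype ι] {A : Fan ι}

/-- The denominator of the slope of the foliation in polar coordinates. -/
def N (H : Hat A) (t r α : ℝ) : ℝ := 1 + t * H.C' α * H.D r α

/-- A local diffeomorphism that takes the rays from the origin to the leaves near a pole. -/
lemma exists_straightening (H : Hat A) (hκ : 0 < κ) : ∃ Ψ : ℂ → ℂ, ContDiffAt ℝ 1 Ψ 0 ∧
    HasFDerivAt Ψ (ContinuousLinearMap.id ℝ ℂ) 0 ∧ Ψ 0 = 0 ∧
    ∀ᶠ h in 𝓝 (0 : ℂ), h ≠ 0 → H.N (‖Ψ h‖ ^ κ) (‖Ψ h‖ ^ (2 + κ)) (arg (Ψ h)) ≠ 0 ∧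
      HasDerivAt (fun s : ℝ => Ψ (s • h)) (Ψ h * (1 + (-((2 + κ) * ‖Ψ h‖ ^ κ * H.C (arg (Ψ h)) *
        H.D (‖Ψ h‖ ^ (2 + κ)) (arg (Ψ h))) / H.N (‖Ψ h‖ ^ κ) (‖Ψ h‖ ^ (2 + κ)) (arg (Ψ h)) : ℝ) * I)) 1 := by
  obtain ⟨M₀, hM₀, b₀⟩ := H.exists_bounds; have hKκ : 0 < (2 + κ) / κ := by positivity
  obtain ⟨δ₀, hδ₀, h₀⟩ := Metric.eventually_nhds_iff.1 (H.eventually_small hKκ)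
  obtain ⟨τ, hτ, hτδ, hτM⟩ : ∃ τ > 0, τ < δ₀ ∧ τ * M₀ * 2 ≤ 1 / 2 := by
    refine ⟨min (δ₀ / 2) (1 / (4 * M₀)), lt_min (by positivity) (by positivity), (min_le_left _ _).trans_lt (by linarith), ?_⟩
    have := min_le_right (δ₀ / 2) (1 / (4 * M₀)); rw [le_div_iff₀ (by positivity)] at this; linarith
  set cl : ℝ → ℝ := fun t => max 0 (min t τ) with hcl; have clc : Continuous cl := by fun_prop
  have clm : ∀ t, cl t ∈ Icc 0 τ := by grind
  have cle : ∀ t ∈ Icc 0 τ, cl t = t := by grind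
  set R : ℝ → ℝ := fun t => cl t ^ ((2 + κ) / κ) with hR; have Rc : Continuous R := clc.rpow_const fun t => .inr hKκ.le
  have small : ∀ t α, |R t * H.C α| < H.δ := fun t => h₀ (by rw [dist_eq, sub_zero, abs_of_nonneg (clm t).1]; grind)
  have Dc : Continuous (uncurry fun t θ => H.D (R t) θ) := continuous_iff_continuousAt.2 fun ⟨t, θ⟩ =>
    ContinuousAt.comp (g := uncurry H.D) (f := fun p : ℝ × ℝ => (R p.1, p.2)) (continuousAt_D (small t θ)) (by fun_prop)
  set D' : ℝ → ℝ → ℝ := fun t θ => arcSum A.T H.C H.k'' (R t) θ * (R t * H.C' θ) with hD'; have C'c := H.cont_C'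
  have Cc := H.cont_C; have C''c := H.cont; have D'c : Continuous (uncurry D') := by
    have : Continuous (uncurry fun t θ => arcSum A.T H.C H.k'' (R t) θ) := continuous_iff_continuousAt.2 fun ⟨t, θ⟩ =>
      ContinuousAt.comp (g := uncurry (arcSum A.T H.C H.k'')) (f := fun p : ℝ × ℝ => (R p.1, p.2))
        (continuousAt_sum (fun i => (H.zero i).2.2) fun i => (H.chart i _ (small t θ)).2.2.1) (by fun_prop)
    fun_prop
  have dD : ∀ t θ, HasDerivAt (fun θ => H.D (R t) θ) (D' t θ) θ := fun t θ => hasDerivAt_D (small t θ)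
  set N : ℝ → ℝ → ℝ := fun t θ => H.N (cl t) (R t) θ with hN; have Nc : Continuous (uncurry N) := continuous_const.add
    (((clc.comp continuous_fst).mul (C'c.comp continuous_snd)).mul Dc)
  have Npos : ∀ t θ, 0 < N t θ := fun t θ => by
    have h1 := abs_le.1 (abs_D_sub_one (small t θ)); have h2 : |cl t * H.C' θ * H.D (R t) θ| ≤ τ * M₀ * 2 := by
      rw [abs_mul, abs_mul, abs_of_nonneg (clm t).1]; have hD : |H.D (R t) θ| ≤ 2 := by grind
      exact mul_le_mul (mul_le_mul (clm t).2 (b₀ θ).2 (abs_nonneg _) hτ.le) hD (abs_nonneg _) (by positivity)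
    have := (abs_le.1 h2).1; change 0 < 1 + _; linarith
  have dN : ∀ t θ, HasDerivAt (N t) (cl t * (H.C'' θ * H.D (R t) θ + H.C' θ * D' t θ)) θ := fun t θ =>
    (((((H.hC' θ).const_mul (cl t)).mul (dD t θ))).const_add 1).congr_deriv (by ring)
  set G : ℝ → ℝ → ℝ := fun t θ => -((2 + κ) / κ * (H.C θ * H.D (R t) θ)) / N t θ with hG
  set g : ℝ → ℝ → ℝ := fun t θ => (-((2 + κ) / κ * (H.C' θ * H.D (R t) θ + H.C θ * D' t θ)) * N t θ -
    -((2 + κ) / κ * (H.C θ * H.D (R t) θ)) * (cl t * (H.C'' θ * H.D (R t) θ + H.C' θ * D' t θ))) / N t θ ^ 2 with hg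
  have c1 : Continuous fun p : ℝ × ℝ => H.C p.2 := Cc.comp continuous_snd
  have c2 : Continuous fun p : ℝ × ℝ => H.C' p.2 := C'c.comp continuous_snd
  have c3 : Continuous fun p : ℝ × ℝ => H.C'' p.2 := C''c.comp continuous_snd
  have c4 : Continuous fun p : ℝ × ℝ => cl p.1 := clc.comp continuous_fst
  have Gc : Continuous (uncurry G) := ((continuous_const.mul (c1.mul Dc)).neg).div Nc fun p => (Npos _ _).ne'
  have gc : Continuous (uncurry g) := ((((continuous_const.mul ((c2.mul Dc).add (c1.mul D'c))).neg).mul Nc).sub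
    (((continuous_const.mul (c1.mul Dc)).neg).mul (c4.mul ((c3.mul Dc).add (c2.mul D'c))))).div (Nc.pow 2)
      fun p => pow_ne_zero 2 (Npos _ _).ne'
  have Gd : ∀ t θ, HasDerivAt (G t) (g t θ) θ := fun t θ =>
    ((((H.hC θ).mul (dD t θ)).const_mul _).neg).div (dN t θ) (Npos t θ).ne'
  have Gper : ∀ t, Periodic (G t) (2 * π) := fun t θ => by simp only [hG, hN, Hat.N, H.per θ, H.per' θ, H.D_periodic (R t) θ]
  have gper : ∀ t, Periodic (g t) (2 * π) := fun t θ => by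
    simp only [hg, hN, hD', Hat.N, H.per θ, H.per' θ, H.per'' θ, H.D_periodic (R t) θ, H.sum_periodic H.k'' (R t) θ]
  obtain ⟨M, hM, bM⟩ := exists_bound_of_periodic Gc Gper τ; obtain ⟨L, hL, bL⟩ := exists_bound_of_periodic gc gper τ
  have clcl : ∀ t, cl (cl t) = cl t := fun t => cle _ (clm t); have Gcl : ∀ t, G (cl t) = G t := by grind
  have gcl : ∀ t, g (cl t) = g t := by grind
  obtain ⟨φ, φ', φc, φ'c, dφt, dφa, φper, φb, φ'b⟩ := exists_flow hτ hM hL Gc gc Gd (fun t θ => Gcl t ▸ bM _ (clm t) θ)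
    (fun t θ => gcl t ▸ bL _ (clm t) θ) Gper
  have φ'per : ∀ t, Periodic (fun a => φ' a t) (2 * π) := fun t a =>
    ((dφa (a + 2 * π) t).comp_add_const a (2 * π)).unique
      (((dφa a t).add_const (2 * π)).congr_of_eventuallyEq (.of_forall fun a => φper a t))
  set δ := τ ^ κ⁻¹ with hδ; have hδ0 : 0 < δ := rpow_pos_of_pos hτ _
  have tm : ∀ r ∈ Ioo 0 δ, r ^ κ ∈ Ioo 0 τ := fun r hr => ⟨rpow_pos_of_pos hr.1 _, by
    have := rpow_lt_rpow hr.1.le hr.2 hκ; rwa [hδ, ← rpow_mul hτ.le, inv_mul_cancel₀ hκ.ne', rpow_one] at this⟩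
  have dpow : ∀ r ∈ Ioo 0 δ, HasDerivAt (fun r : ℝ => r ^ κ) (κ * r ^ (κ - 1)) r := fun r hr =>
    hasDerivAt_rpow_const (.inl hr.1.ne')
  have pw : ∀ r ∈ Ioo 0 δ, r * r ^ (κ - 1) = r ^ κ := fun r hr => by rw [mul_comm, ← rpow_add_one hr.1.ne', sub_add_cancel]
  have dE : ∀ α, ∀ r ∈ Ioo 0 δ, HasDerivAt (fun r : ℝ => cexp (φ α (r ^ κ) * I))
      (cexp (φ α (r ^ κ) * I) * ((G (r ^ κ) (φ α (r ^ κ)) * (κ * r ^ (κ - 1)) : ℝ) * I)) r := fun α r hr =>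
    (((dφt α _ (tm r hr)).comp r (h := fun r => r ^ κ) (dpow r hr)).ofReal_comp.mul_const I).cexp
  have kc : Continuous fun p : ℝ × ℝ => (p.1, p.2 ^ κ) := continuous_fst.prodMk (continuous_snd.rpow_const fun _ => .inr hκ.le)
  have e1 : Continuous fun p : ℝ × ℝ => φ p.1 (p.2 ^ κ) := φc.comp kc
  have e1' : Continuous fun p : ℝ × ℝ => (φ p.1 (p.2 ^ κ) : ℂ) := Complex.continuous_ofReal.comp e1
  have e2' : Continuous fun p : ℝ × ℝ => (φ' p.1 (p.2 ^ κ) : ℂ) := Complex.continuous_ofReal.comp (φ'c.comp kc)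
  have b1 : ∀ α, ∀ r ∈ Ioo 0 δ, ‖cexp (φ α (r ^ κ) * I) - cexp (α * I)‖ ≤ M * r ^ κ :=
    fun α r hr => (norm_exp_I_sub_le _ _).trans (φb α _ (Ioo_subset_Icc_self (tm r hr)))
  have ω1 : ∀ r ∈ Ioo 0 δ, 0 ≤ M * r ^ κ * κ := fun r hr => by have := (tm r hr).1; positivity
  have ω2 : ∀ r ∈ Ioo 0 δ, 0 ≤ exp (L * r ^ κ) - 1 := fun r hr => by
    have := (tm r hr).1; exact sub_nonneg.2 (one_le_exp (by positivity))
  have polar := contDiffAt_polar (f := fun α r => (r : ℂ) * (cexp (φ α (r ^ κ) * I) - cexp (α * I)))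
    (fa := fun α r => (r : ℂ) * (cexp (φ α (r ^ κ) * I) * (φ' α (r ^ κ) * I) - cexp (α * I) * I))
    (fr := fun α r => (cexp (φ α (r ^ κ) * I) - cexp (α * I)) +
      r * (cexp (φ α (r ^ κ) * I) * ((G (r ^ κ) (φ α (r ^ κ)) * (κ * r ^ (κ - 1)) : ℝ) * I)))
    (ω := fun r => M * r ^ κ * (1 + κ) + (exp (L * r ^ κ) - 1)) hδ0
    (fun α β r e => by
      have e1 : cexp (φ α (r ^ κ) * I) = cexp (φ β (r ^ κ) * I) :=
        periodic_eq (f := fun α : ℝ => cexp (φ α (r ^ κ) * I)) (fun α => by simp only [φper, exp_I_periodic]) e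
      have e2 : cexp (α * I) = cexp (β * I) := periodic_eq (f := fun α : ℝ => cexp (α * I)) exp_I_periodic e
      have e3 : G (r ^ κ) (φ α (r ^ κ)) = G (r ^ κ) (φ β (r ^ κ)) :=
        periodic_eq (f := fun α : ℝ => G (r ^ κ) (φ α (r ^ κ))) (fun α => by simp only [φper, Gper (r ^ κ) _]) e
      have e4 : φ' α (r ^ κ) = φ' β (r ^ κ) := periodic_eq (φ'per _) e; grind)
    (fun α r hr => ?_) (fun α r hr => ?_) (fun α r hr => ?_) (fun α r hr => ?_) (by simp) (fun α r hr => ?_) (fun α r hr => ?_)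
    (fun α r hr => ?_) ?_
  · have hΨ : ∀ h : ℂ, h + (‖h‖ : ℂ) * (cexp (φ (arg h) (‖h‖ ^ κ) * I) - cexp (arg h * I)) =
        (‖h‖ : ℂ) * cexp (φ (arg h) (‖h‖ ^ κ) * I) := fun h => by rw [mul_sub, Complex.norm_mul_exp_arg_mul_I]; ring
    refine ⟨fun h => (‖h‖ : ℂ) * cexp (φ (arg h) (‖h‖ ^ κ) * I), ?_, ?_, by simp, ?_⟩
    · exact (contDiffAt_id.add polar.1).congr_of_eventuallyEq (.of_forall fun h => (hΨ h).symm)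
    · exact (((hasFDerivAt_id (0 : ℂ)).add polar.2).congr_of_eventuallyEq (.of_forall fun h => (hΨ h).symm)).congr_fderiv
        (add_zero _)
    · filter_upwards [Metric.ball_mem_nhds (0 : ℂ) hδ0] with h hh h0
      have hr : ‖h‖ ∈ Ioo 0 δ := ⟨norm_pos_iff.2 h0, by simpa using hh⟩; set a := arg h; set x := φ a (‖h‖ ^ κ) with hx
      have n1 : ‖(‖h‖ : ℂ) * cexp (x * I)‖ = ‖h‖ := by simp
      have hne : (‖h‖ : ℂ) * cexp (x * I) ≠ 0 := norm_pos_iff.1 (by rw [n1]; exact hr.1)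
      have ang := (eq_norm_mul_exp_iff hne x).1 (by rw [n1]); rw [n1]; have eR : R (‖h‖ ^ κ) = ‖h‖ ^ (2 + κ) := by
        simp only [hR]; rw [cle _ (Ioo_subset_Icc_self (tm _ hr)), ← rpow_mul hr.1.le, mul_div_cancel₀ _ hκ.ne']
      have eN : H.N (‖h‖ ^ κ) (‖h‖ ^ (2 + κ)) (arg ((‖h‖ : ℂ) * cexp (x * I))) = N (‖h‖ ^ κ) x := by
        simp only [hN, Hat.N, eR, cle _ (Ioo_subset_Icc_self (tm _ hr)), periodic_eq H.per' ang, periodic_eq (H.D_periodic _) ang]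
      refine ⟨by grind, ?_⟩; have dE' : HasDerivAt (fun s : ℝ => ((s * ‖h‖ : ℝ) : ℂ) * cexp (φ a ((s * ‖h‖) ^ κ) * I)) _ 1 :=
        HasDerivAt.scomp (1 : ℝ) (h := fun s : ℝ => s * ‖h‖) (g₁ := fun r : ℝ => (r : ℂ) * cexp (φ a (r ^ κ) * I))
          (by rw [one_mul]; exact (hasDerivAt_id ‖h‖).ofReal_comp.mul (dE a _ hr)) ((hasDerivAt_id (1 : ℝ)).mul_const ‖h‖)
      refine (dE'.congr_of_eventuallyEq ?_).congr_deriv ?_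
      · filter_upwards [lt_mem_nhds (zero_lt_one' ℝ)] with s hs
        have e1 : arg (s • h) = a := by rw [real_smul, Complex.arg_real_mul _ hs]
        rw [e1, norm_smul, norm_of_nonneg hs.le]
      · rw [eN, periodic_eq H.per ang, periodic_eq (H.D_periodic _) ang, ← eR]; have hp := pw _ hr
        have eG : ‖h‖ * (G (‖h‖ ^ κ) x * (κ * ‖h‖ ^ (κ - 1))) =
            -((2 + κ) * ‖h‖ ^ κ * H.C x * H.D (R (‖h‖ ^ κ)) x) / N (‖h‖ ^ κ) x := by simp only [hG]; rw [← hp]; field_simp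
        rw [← eG, ← hx, real_smul]; push_cast; simp only [id, one_mul]; ring
  · exact ((((dφa α _).ofReal_comp.mul_const I).cexp.sub ((hasDerivAt_id α).ofReal_comp.mul_const I).cexp).const_mul
      (r : ℂ)).congr_deriv (by simp)
  · exact ((hasDerivAt_id r).ofReal_comp.mul ((dE α r hr).sub_const _)).congr_deriv (by simp)
  · exact Continuous.continuousAt (by unfold uncurry; fun_prop)
  · have c5 : ContinuousAt (fun p : ℝ × ℝ => ((G (p.2 ^ κ) (φ p.1 (p.2 ^ κ)) * (κ * p.2 ^ (κ - 1)) : ℝ) : ℂ)) (α, r) :=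
      Complex.continuous_ofReal.continuousAt.comp ((Gc.comp (kc.snd.prodMk e1)).continuousAt.mul
        (continuousAt_const.mul (continuousAt_snd.rpow_const (.inl hr.1.ne'))))
    exact ContinuousAt.add (Continuous.continuousAt (by fun_prop)) ((Continuous.continuousAt (by fun_prop)).mul
      (ContinuousAt.mul (by fun_prop) (c5.mul continuousAt_const)))
  · rw [norm_mul, norm_real, norm_of_nonneg hr.1.le, mul_comm]
    exact mul_le_mul_of_nonneg_right ((b1 α r hr).trans (by grind)) hr.1.le
  · rw [norm_mul, norm_real, norm_of_nonneg hr.1.le, mul_comm]; refine mul_le_mul_of_nonneg_right ?_ hr.1.le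
    have e : cexp (φ α (r ^ κ) * I) * (φ' α (r ^ κ) * I) - cexp (α * I) * I =
        (cexp (φ α (r ^ κ) * I) * (φ' α (r ^ κ) - 1 : ℝ) + (cexp (φ α (r ^ κ) * I) - cexp (α * I))) * I := by push_cast; ring
    rw [e, norm_mul, Complex.norm_I, mul_one]; refine (norm_add_le _ _).trans ?_
    rw [norm_mul, norm_exp_ofReal_mul_I, one_mul, norm_real]; have := φ'b α _ (Ioo_subset_Icc_self (tm r hr))
    rw [norm_eq_abs]; grind
  · refine (norm_add_le _ _).trans ?_
    rw [norm_mul, norm_mul, norm_mul, norm_exp_ofReal_mul_I, Complex.norm_I, mul_one, one_mul, norm_real,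
      norm_real, norm_of_nonneg hr.1.le, norm_eq_abs, abs_mul,
      abs_of_pos (mul_pos hκ (rpow_pos_of_pos hr.1 (κ - 1)))]
    have h2 := mul_le_mul_of_nonneg_right (bM _ (Ioo_subset_Icc_self (tm r hr)) (φ α (r ^ κ))) (mul_pos hκ (tm r hr).1).le
    have h3 : r * (|G (r ^ κ) (φ α (r ^ κ))| * (κ * r ^ (κ - 1))) = |G (r ^ κ) (φ α (r ^ κ))| * (κ * r ^ κ) := by
      rw [← pw r hr]; ring
    grind
  · have t0 : Tendsto (fun r : ℝ => r ^ κ) (𝓝[>] 0) (𝓝 0) := by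
      have := (continuousAt_rpow_const 0 κ (.inr hκ.le)).tendsto; rw [zero_rpow hκ.ne'] at this
      exact this.mono_left nhdsWithin_le_nhds
    have t1 : Continuous fun x : ℝ => M * x * (1 + κ) + (exp (L * x) - 1) := by fun_prop
    have := (t1.tendsto 0).comp t0; simpa [comp_def] using this

end Hat

open Split (angle_eq_iff u_eq_zero hasFDerivAt_u eq_zero_of_du contDiffAt_u norm_u)
lemma exists_local_inverse {Ψ : ℂ → ℂ} (c : ContDiffAt ℝ 1 Ψ 0) (d : HasFDerivAt Ψ (ContinuousLinearMap.id ℝ ℂ) 0) (h0 : Ψ 0 = 0) :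
    ∃ g : ℂ → ℂ, g 0 = 0 ∧ ContinuousAt g 0 ∧ (∀ᶠ h in 𝓝 0, g (Ψ h) = h) ∧ ∀ᶠ u in 𝓝 0, Ψ (g u) = u ∧ ContDiffAt ℝ 1 g u := by
  have d' : HasFDerivAt Ψ ((ContinuousLinearEquiv.refl ℝ ℂ : ℂ ≃L[ℝ] ℂ) : ℂ →L[ℝ] ℂ) 0 := d
  have hs := c.hasStrictFDerivAt' d' one_ne_zero; have hg := c.to_localInverse d' one_ne_zero; rw [h0] at hg
  have hl := hs.eventually_left_inverse; have hr := hs.eventually_right_inverse; rw [h0] at hr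
  have g0 := hl.self_of_nhds; rw [h0] at g0; exact ⟨_, g0, hg.continuousAt, hl, hr.and (hg.eventually (by simp))⟩

namespace Split
variable {S : Split}

lemma eq_of_u {p₁ p₂ : E4} (z1 : S.z p₁ / z₀ ∈ slitPlane) (z2 : S.z p₂ / z₀ ∈ slitPlane)
    (n1 : ‖p₁‖ ^ 2 = 1) (n2 : ‖p₂‖ ^ 2 = 1) (hu : S.u p₁ = S.u p₂) (hY : S.Y z₀ p₁ = S.Y z₀ p₂) : p₁ = p₂ := by
  obtain ⟨hz1, h0⟩ := ne_zero_of_slit z1; have hz2 := (ne_zero_of_slit z2).1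
  have hw : ∀ {p : E4}, S.z p ≠ 0 → S.w p = ‖S.z p‖ • S.u p := fun hz => by
    rw [u, smul_smul, mul_inv_cancel₀ (norm_ne_zero_iff.2 hz), one_smul]
  have hn : ∀ {p : E4}, S.z p ≠ 0 → ‖p‖ ^ 2 = 1 → ‖S.z p‖ ^ 2 * (1 + ‖S.u p‖ ^ 2) = 1 := fun hz hp => by
    rw [S.norm_sq, hw hz, norm_smul, norm_norm] at hp; linarith
  have e : ‖S.z p₁‖ = ‖S.z p₂‖ := by
    have h1 := hn hz1 n1; have h2 := hn hz2 n2; rw [hu] at h1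
    exact (sq_eq_sq₀ (norm_nonneg _) (norm_nonneg _)).1 (mul_right_cancel₀ (by positivity : (1 + ‖S.u p₂‖ ^ 2) ≠ 0) (h1.trans h2.symm))
  refine S.ext ?_ (by rw [hw hz1, hw hz2, e, hu]); have hlog : Complex.log (S.z p₁ / z₀) = Complex.log (S.z p₂ / z₀) :=
    Complex.ext (by rw [log_re, log_re, norm_div, norm_div, e]) hY
  have := congrArg Complex.exp hlog
  rwa [Complex.exp_log (div_ne_zero hz1 h0), Complex.exp_log (div_ne_zero hz2 h0), div_left_inj' h0] at this

lemma du_eq (hz : S.z q ≠ 0) (hw : S.w q ≠ 0) (v : E4) : S.du q v = S.u q * (S.dlam q v + S.dθ q v * I) := by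
  have e1 : S.w v = S.w q * ((S.w q)⁻¹ * S.w v) := by simp_all
  have e2 : S.dlam q v = ((S.w q)⁻¹ * S.w v).re - ((S.z q)⁻¹ * S.z v).re := rfl
  have e3 : ((((S.w q)⁻¹ * S.w v).re : ℂ) + (((S.w q)⁻¹ * S.w v).im : ℂ) * I) = (S.w q)⁻¹ * S.w v := Complex.re_add_im _
  rw [du_apply, u, e2, dθ_apply, e1, mul_inv_cancel_left₀ hw, real_smul, real_smul, real_smul, Complex.ofReal_sub]
  linear_combination (-((‖S.z q‖⁻¹ : ℝ) : ℂ) * S.w q) * e3 + ((‖S.z q‖⁻¹ : ℝ) : ℂ) * e1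

end Split

namespace PoleModel
variable {S : Split} {ι : Type} {A : Fan ι} {t y₀ : ι → ℝ} [Fintype ι] (h : PoleModel S K F q A t y₀)
include h

lemma tangent_near [Nonempty ι] (H : Hat A) (hT : ∀ᶠ p in 𝓝 q, S.w p ≠ 0 → ∀ i, p ∈ S.tile K (A.s i) (t i) (A.P i) →
      ∀ x ∈ Icc 0 (A.a i), ∀ y ∈ Icc 0 (A.b i), (arg (S.w p) : Angle) = (A.s i + x : ℝ) →
      (arg (S.z p) : Angle) = (t i + y : ℝ) → ∀ v, v ∈ tangentPlane F p ↔ inner ℝ p v = 0 ∧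
        sepForm S K p ((A.P i).C.fn x) ((A.P i).C.der x) ((A.P i).B.der y) v = 0) :
    ∀ᶠ p in 𝓝 q, p ∈ F → S.w p ≠ 0 → ∃ b', H.D (‖S.u p‖ ^ K) (arg (S.u p)) * b' = 1 ∧
      ∀ v, v ∈ tangentPlane F p ↔ inner ℝ p v = 0 ∧ sepForm S K p (H.C (arg (S.u p))) (H.C' (arg (S.u p))) b' v = 0 := by
  have hK : 0 < K := by linarith [h.one_lt]
  have hang : ∀ᶠ p in 𝓝 q, ∀ i, ∀ y ∈ Icc 0 (A.b i), ((arg (S.z p) : Angle) = (t i + y : ℝ) ↔ y = y₀ i + S.Y (S.z q) p) :=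
    eventually_all.2 fun i => angle_eq_iff (S := S.swap) h.z_ne (h.b_mem i).2
      (by rcases h.sign i with ⟨e, -⟩ | ⟨e, -⟩ <;> rw [e] <;> simp [(h.b_mem i).1.le]) (h.angle i)
  filter_upwards [hT, hang, h.loc, h.local_i H, S.z.continuous.continuousAt.eventually_ne h.z_ne,
    h.eventually_u (tendsto_norm_zero.eventually (H.eventually_small hK))] with p hT hang hl hi hz hsm hp hw
  obtain ⟨i, hpi⟩ := hl.1 hp; obtain ⟨-, x, hx, y, hy, e1, e2, -⟩ := (S.mem_tile_iff _ hz hw).1 hpi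
  obtain rfl := (hang i y hy).1 e1; obtain ⟨-, h1, h2⟩ := (hi i).1 hpi; have hα := h1.resolve_left (mt (u_eq_zero hz).1 hw)
  have hε : A.ε i * A.ε i = 1 := by rcases A.hε i with e | e <;> rw [e] <;> norm_num
  obtain ⟨c1, c2⟩ := H.arc i x hx (arg (S.u p)) (by rw [Split.arg_u hz]; exact e2)
  refine ⟨_, Hat.D_mul hα (hsm _), fun v => (hT hw i hpi x hx _ hy e2 e1 v).trans (and_congr_right fun _ => ?_)⟩
  have hY : H.V (‖S.u p‖ ^ K) (arg (S.u p)) = S.Y (S.z q) p := h2.symm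
  rw [hY, (h.sign i).der_add, c1, c2, sepForm_apply, sepForm_apply]; grind

lemma isNode [Nonempty ι] (hκ : 0 < κ) (hKκ : K = 2 + κ) (hT : ∀ᶠ p in 𝓝 q, S.w p ≠ 0 → ∀ i, p ∈ S.tile K (A.s i) (t i) (A.P i) →
      ∀ x ∈ Icc 0 (A.a i), ∀ y ∈ Icc 0 (A.b i), (arg (S.w p) : Angle) = (A.s i + x : ℝ) →
      (arg (S.z p) : Angle) = (t i + y : ℝ) → ∀ v, v ∈ tangentPlane F p ↔ inner ℝ p v = 0 ∧
        sepForm S K p ((A.P i).C.fn x) ((A.P i).C.der x) ((A.P i).B.der y) v = 0) : IsNode F q := by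
  obtain ⟨H, -⟩ := Hat.exists_of_fan A; obtain ⟨Ψ, Ψc, Ψd, Ψ0, hΨ⟩ := H.exists_straightening hκ
  obtain ⟨g, g0, gc, gΨ, hg⟩ := exists_local_inverse Ψc Ψd Ψ0
  have gt : Tendsto g (𝓝 0) (𝓝 0) := by have := gc.tendsto; rwa [g0] at this
  have hall := (((h.local_F H).and (h.tangent_near H hT)).and (eventually_slit (S := S.swap) (self_div_mem h.z_ne))).and
    (h.eventually_u (((hg.eventually_nhds.and (gt.eventually gΨ.eventually_nhds)).and (gt.eventually hΨ)).and
      (gt.eventually (Ψc.eventually (by simp)))))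
  obtain ⟨U, hU, Uo, qU⟩ := mem_nhds_iff.1 hall; set J : ℂ ≃L[ℝ] E2 := Complex.orthonormalBasisOneI.repr.toContinuousLinearEquiv
  have hz : ∀ p ∈ U, S.z p ≠ 0 := fun p hp => (ne_zero_of_slit (hU hp).1.2).1
  have dg : ∀ p ∈ U, HasFDerivAt g (fderiv ℝ g (S.u p)) (S.u p) := fun p hp =>
    ((hU hp).2.1.1.1.self_of_nhds.2.differentiableAt one_ne_zero).hasFDerivAt
  have dx : ∀ p ∈ U, ∀ v, fderiv ℝ (fun p => J (g (S.u p))) p v = J (fderiv ℝ g (S.u p) (S.du p v)) := fun p hp v => by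
    have := (J : ℂ →L[ℝ] E2).hasFDerivAt.comp p ((dg p hp).comp p (hasFDerivAt_u (hz p hp))); exact congrArg (· v) this.fderiv
  have eq_q : ∀ p ∈ F ∩ U, S.u p = 0 → p = q := fun p hp hu => by
    obtain ⟨n1, -, y1⟩ := (hU hp.2).1.1.1.1 hp.1
    refine Split.eq_of_u (hU hp.2).1.2 (hU qU).1.2 n1 h.norm (by rw [hu, h.u_zero]) ?_
    change S.Y (S.z q) p = S.Y (S.z q) q; rw [y1, hu, (H.contDiffAt_ψ h.one_lt).2.2, h.Y_zero]
  refine ⟨h.mem_singularSet, U, fun p => J (g (S.u p)), ⟨Uo, qU, fun p hp => ?_, by simp [h.u_zero, g0], fun p hp p' hp' e => ?_,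
    fun p hp v hv e => ?_⟩, fun p hp hpq => ?_⟩
  · exact ((J : ℂ →L[ℝ] E2).contDiff.contDiffAt.comp p ((hU hp).2.1.1.1.self_of_nhds.2.comp p
      (contDiffAt_u (hz p hp)))).contDiffWithinAt
  · have hu : S.u p = S.u p' := by rw [← (hU hp.2).2.1.1.1.self_of_nhds.1, ← (hU hp'.2).2.1.1.1.self_of_nhds.1, J.injective e]
    obtain ⟨n1, -, y1⟩ := (hU hp.2).1.1.1.1 hp.1; obtain ⟨n2, -, y2⟩ := (hU hp'.2).1.1.1.1 hp'.1
    refine Split.eq_of_u (hU hp.2).1.2 (hU hp'.2).1.2 n1 n2 hu ?_; change S.Y (S.z q) p = S.Y (S.z q) p'; rw [y1, y2, hu]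
  · rw [dx p hp.2] at e; have e1 : fderiv ℝ g (S.u p) (S.du p v) = 0 := J.injective (by rw [e, map_zero])
    have e2 : S.du p v = 0 := by
      have hd : HasFDerivAt (Ψ ∘ g) _ (S.u p) := (((hU hp.2).2.2.differentiableAt one_ne_zero).hasFDerivAt).comp _ (dg p hp.2)
      have := hd.unique ((hasFDerivAt_id (S.u p)).congr_of_eventuallyEq ((hU hp.2).2.1.1.1.mono fun u hu => hu.1))
      have := congrArg (· (S.du p v)) this; simp [ContinuousLinearMap.comp_apply, e1, map_zero] at this; exact this.symm
    by_cases hu : S.u p = 0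
    · obtain rfl := eq_q p hp hu; obtain ⟨v1, v2⟩ := (h.sector_tangent.2 v).1 hv; exact eq_zero_of_du h.z_ne h.norm v1 e2 v2
    · have hw := mt (u_eq_zero (hz p hp.2)).2 hu; obtain ⟨b', hb', hv'⟩ := (hU hp.2).1.1.2 hp.1 hw
      obtain ⟨v1, v2⟩ := (hv' v).1 hv; have e3 := e2; rw [Split.du_eq (hz p hp.2) hw] at e3
      have e4 := (mul_eq_zero.1 e3).resolve_left hu; have e5 : S.dlam p v = 0 := by simpa using congrArg Complex.re e4
      have e6 : S.dθ p v = 0 := by simpa using congrArg Complex.im e4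
      rw [sepForm_apply, e5, e6] at v2; have hb0 : b' ≠ 0 := by grind
      exact eq_zero_of_du (hz p hp.2) ((hU hp.2).1.1.1.1 hp.1).1 v1 e2 ((mul_eq_zero.1 (by linarith)).resolve_left hb0)
  · have hu : S.u p ≠ 0 := by grind
    have hzp := hz p hp.2; have hw := mt (u_eq_zero hzp).2 hu; obtain ⟨b', hb', hv'⟩ := (hU hp.2).1.1.2 hp.1 hw
    obtain ⟨⟨⟨hgu, hgΨ⟩, hrad⟩, -⟩ := (hU hp.2).2; have hΨg := hgu.self_of_nhds.1; have hgne : g (S.u p) ≠ 0 := by grind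
    obtain ⟨hN, hd⟩ := hrad hgne; rw [hΨg] at hN hd; set α := arg (S.u p); rw [hKκ] at hb' hv'
    set D := H.D (‖S.u p‖ ^ (2 + κ)) α; set N := H.N (‖S.u p‖ ^ κ) (‖S.u p‖ ^ (2 + κ)) α with hNdef
    have hND : N = 1 + ‖S.u p‖ ^ κ * H.C' α * D := rfl; have hb0 : b' ≠ 0 := by grind
    have hun : 0 < ‖S.u p‖ := norm_pos_iff.2 hu; have hE : exp ((2 + κ) * S.lam p) * ‖S.z p‖ ^ 2 = ‖S.w p‖ ^ 2 * ‖S.u p‖ ^ κ := by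
      rw [exp_lam hzp hw, ← div_rpow (norm_nonneg _) (norm_nonneg _), ← norm_u, rpow_add hun, rpow_two]; rw [norm_u]; field_simp
    have hA : exp ((2 + κ) * S.lam p) * H.C' α * ‖S.z p‖ ^ 2 + b' * ‖S.w p‖ ^ 2 = ‖S.w p‖ ^ 2 * (b' * N) := by
      rw [hND]; linear_combination H.C' α * hE - ‖S.w p‖ ^ 2 * ‖S.u p‖ ^ κ * H.C' α * hb'
    have hw2 : ‖S.w p‖ ^ 2 * (b' * N) ≠ 0 := mul_ne_zero (by simpa using hw) (mul_ne_zero hb0 hN)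
    obtain ⟨d, -, d1, -, d2, hline⟩ := exists_charLine_eq_span (S := S) (by linarith) hzp hw ((hU hp.2).1.1.1.1 hp.1).1 hv'
      (fun hc => hw2 (by rw [← hA]; exact hc.2))
    rw [hA] at d2; have hdu : S.du p d = S.dlam p d • (S.u p * (1 + (-((2 + κ) * ‖S.u p‖ ^ κ * H.C α * D) / N : ℝ) * I)) := by
      have hθ : S.dθ p d = S.dlam p d * (-((2 + κ) * ‖S.u p‖ ^ κ * H.C α * D) / N) := by
        rw [d1, d2]; field_simp; linear_combination H.C α * hE - H.C α * ‖S.w p‖ ^ 2 * ‖S.u p‖ ^ κ * hb'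
      rw [Split.du_eq hzp hw, hθ, real_smul]; push_cast; ring
    have hgd : fderiv ℝ g (S.u p) (S.u p * (1 + (-((2 + κ) * ‖S.u p‖ ^ κ * H.C α * D) / N : ℝ) * I)) = g (S.u p) := by
      have h1 : HasDerivAt (fun s : ℝ => g (Ψ (s • g (S.u p)))) _ 1 :=
        HasFDerivAt.comp_hasDerivAt (1 : ℝ) (l := g) (by rw [one_smul, hΨg]; exact dg p hp.2) hd
      have ts : ContinuousAt (fun s : ℝ => s • g (S.u p)) 1 := by fun_prop
      have h2 : HasDerivAt (fun s : ℝ => g (Ψ (s • g (S.u p)))) (g (S.u p)) 1 := by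
        have h3 : HasDerivAt (fun s : ℝ => s • g (S.u p)) (g (S.u p)) 1 := by simpa using (hasDerivAt_id (1 : ℝ)).smul_const (g (S.u p))
        refine h3.congr_of_eventuallyEq (Tendsto.eventually (p := fun h => g (Ψ h) = h) ts (by simpa using hgΨ))
      exact h1.unique h2
    have hd0 : S.dlam p d ≠ 0 := by rw [d2]; exact neg_ne_zero.2 hw2
    rw [hline, Submodule.map_span, image_singleton]; change Submodule.span ℝ {fderiv ℝ (fun p => J (g (S.u p))) p d} = _
    rw [dx p hp.2, hdu, map_smul, hgd, map_smul]; exact Submodule.span_singleton_smul_eq hd0.isUnit _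

end PoleModel

open Split (tile_swap)
/-! ### The poles of the surface of a diagram -/

lemma Split.mem_tile_pole (S : Split) {P : Profile a b} (hK : 0 < K) (ha : 0 < a) (hb : 0 < b)
    (hw : S.w q = 0) (hN : ‖q‖ ^ 2 = 1) : q ∈ S.tile K s t P ↔
      (arg (S.z q) : Angle) = t ∨ (arg (S.z q) : Angle) = (t + b : ℝ) := by
  have hN' := hN; rw [S.norm_sq] at hN'; have hz : S.z q ≠ 0 := fun hz => by simp [hz, hw] at hN'
  have e0 : ∀ y, ‖S.z q‖ ^ K * P.B.fn y = ‖S.w q‖ ^ K * P.C.fn 0 ↔ P.B.fn y = 0 := fun y => by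
    rw [hw, norm_zero, zero_rpow hK.ne', zero_mul, mul_eq_zero, or_iff_right (rpow_pos_of_pos (norm_pos_iff.2 hz) K).ne']
  have mk : ∀ y ∈ Icc 0 b, P.B.fn y = 0 → (arg (S.z q) : Angle) = (t + y : ℝ) → q ∈ S.tile K s t P :=
    fun y hy h h1 => ⟨hN', 0, ⟨le_rfl, ha.le⟩, y, hy, (eq_norm_mul_exp_iff hz _).2 h1, by rw [hw]; simp, (e0 y).2 h⟩
  constructor
  · rintro ⟨-, x, -, y, hy, h1, -, h3⟩; have h4 : P.B.fn y = 0 := by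
      rw [hw, norm_zero, zero_rpow hK.ne', zero_mul] at h3
      exact (mul_eq_zero.1 h3).resolve_left (rpow_pos_of_pos (norm_pos_iff.2 hz) K).ne'
    rw [eq_norm_mul_exp_iff hz] at h1; rcases (P.B.eq_zero_iff hy).1 h4 with rfl | rfl
    · left; rwa [add_zero] at h1
    · right; exact h1
  · rintro (h | h)
    · exact mk 0 ⟨le_rfl, hb.le⟩ P.B.zero (by rwa [add_zero])
    · exact mk b ⟨hb.le, le_rfl⟩ P.B.fn_len h

lemma sepForm_swap {S : Split} (h : b = exp (K * S.lam q) * c) :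
    sepForm S.swap K q b b' c' v = 0 ↔ sepForm S K q c c' b' v = 0 := by
  have e : S.swap.lam q = -S.lam q := (neg_sub _ _).symm; have e2 : S.swap.dlam q v = -S.dlam q v := (neg_sub _ _).symm
  have e3 : exp (K * -S.lam q) * exp (K * S.lam q) = 1 := by rw [← exp_add]; simp
  rw [sepForm_apply, sepForm_apply, e, e2, h]; change _ * S.dφ q v - c' * S.dθ q v + _ = 0 ↔ _; grind

namespace Diagram
variable (D : Diagram)

lemma meet (h₁ : r₁ ∈ D.rects) (h₂ : r₂ ∈ D.rects) (hne : r₁ ≠ r₂) {v : Torus} (hv₁ : v ∈ r₁.carrier)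
    (hv₂ : v ∈ r₂.carrier) (hc : ¬ r₁.Cross r₂) (hc' : ¬ r₂.Cross r₁) :
    (r₂.sgnθ v.1 = -r₁.sgnθ v.1 ∧ r₂.sgnφ v.2 = -r₁.sgnφ v.2) ∧
    (v.1 = r₁.θ₁ ∧ v.1 = r₂.θ₂ ∨ v.1 = r₂.θ₁ ∧ v.1 = r₁.θ₂) ∧ (v.2 = r₁.φ₁ ∧ v.2 = r₂.φ₂ ∨ v.2 = r₂.φ₁ ∧ v.2 = r₁.φ₂) := by
  obtain ⟨m₁, m₂⟩ := ((D.vertex_or_cross h₁ h₂ hne hv₁ hv₂).resolve_right (not_or.2 ⟨hc, hc'⟩))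
  obtain ⟨o₁, o₂⟩ := D.opposite h₁ h₂ hne m₁ m₂; refine ⟨D.opposite_sgn h₁ h₂ hne m₁ m₂, ?_⟩
  rw [Rect.mem_vertices] at m₁ m₂; grind

/-- The rectangles with a horizontal side at `φ₀`. -/
abbrev HorSide (φ₀ : Angle) : Type := {r : Rect // r ∈ D.rects ∧ (φ₀ = r.φ₁ ∨ φ₀ = r.φ₂)}

/-- The rectangles with a vertical side at `θ₀`. -/
abbrev VertSide (θ₀ : Angle) : Type := {r : Rect // r ∈ D.rects ∧ (θ₀ = r.θ₁ ∨ θ₀ = r.θ₂)}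

instance {p : Rect → Prop} : Finite {r : Rect // r ∈ D.rects ∧ p r} :=
  Finite.of_injective (fun r => (⟨r.1, r.2.1⟩ : D.rects)) fun r r' h => Subtype.ext (congrArg (fun x : D.rects => x.1) h)

/-- The arcs of the horizontal sides at `φ₀`. -/
def horFan (φ₀ : Angle) : Fan (D.HorSide φ₀) where
  s r := r.1.s
  a r := r.1.a
  b r := r.1.b
  ε r := r.1.sgnφ φ₀
  P r := r.1.P
  ha r := r.1.a_mem
  hε r := r.1.sgnφ_abs φ₀
  meet i j hij α hi hj := by
    have mem : ∀ r : D.HorSide φ₀, InArc r.1.s r.1.a α → ((α : Angle), φ₀) ∈ r.1.carrier := fun r hr =>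
      ⟨r.1.mem_cIcc_θ.2 hr, r.2.2.elim (fun h => h ▸ left_mem_cIcc _ _) (fun h => h ▸ right_mem_cIcc _ _)⟩
    obtain ⟨h1, h2, -⟩ := D.meet i.2.1 j.2.1 (fun h => hij (Subtype.ext h)) (mem i hi) (mem j hj)
      (fun h => h.ends_ne i.2.2 j.2.2) (fun h => h.ends_ne j.2.2 i.2.2)
    simp only [Rect.coe_s, Rect.coe_s_add_a]; exact ⟨h1.2, h2⟩
  free := by
    refine le_trans (encard_le_encard_of_injOn (f := fun α => (α, φ₀)) (fun α hα => ?_) fun _ _ _ _ h => congrArg Prod.fst h)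
      (D.longitude φ₀)
    simp only [Rect.coe_s, Rect.coe_s_add_a, mem_setOf_eq] at hα; obtain ⟨i, hi, hu⟩ := hα
    refine ⟨⟨i.1, ⟨i.2.1, Rect.mem_vertices.2 ⟨hi, i.2.2⟩⟩, fun r hr => ?_⟩, rfl⟩
    obtain ⟨h1, h2⟩ := Rect.mem_vertices.1 hr.2; exact congrArg Subtype.val (hu ⟨r, hr.1, h2⟩ h1)

/-- The arcs of the vertical sides at `θ₀`. -/
def vertFan (θ₀ : Angle) : Fan (D.VertSide θ₀) where
  s r := r.1.t
  a r := r.1.b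
  b r := r.1.a
  ε r := r.1.sgnθ θ₀
  P r := r.1.P.swap
  ha r := r.1.b_mem
  hε r := r.1.sgnθ_abs θ₀
  meet i j hij α hi hj := by
    have mem : ∀ r : D.VertSide θ₀, InArc r.1.t r.1.b α → (θ₀, (α : Angle)) ∈ r.1.carrier := fun r hr =>
      ⟨r.2.2.elim (fun h => h ▸ left_mem_cIcc _ _) (fun h => h ▸ right_mem_cIcc _ _), r.1.mem_cIcc_φ.2 hr⟩
    obtain ⟨h1, -, h2⟩ := D.meet i.2.1 j.2.1 (fun h => hij (Subtype.ext h)) (mem i hi) (mem j hj)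
      (fun h => h.ends_ne' i.2.2 j.2.2) (fun h => h.ends_ne' j.2.2 i.2.2)
    simp only [Rect.coe_t, Rect.coe_t_add_b]; exact ⟨h1.1, h2⟩
  free := by
    refine le_trans (encard_le_encard_of_injOn (f := fun α => (θ₀, α)) (fun α hα => ?_) fun _ _ _ _ h => congrArg Prod.snd h)
      (D.meridian θ₀)
    simp only [Rect.coe_t, Rect.coe_t_add_b, mem_setOf_eq] at hα; obtain ⟨i, hi, hu⟩ := hα
    refine ⟨⟨i.1, ⟨i.2.1, Rect.mem_vertices.2 ⟨i.2.2, hi⟩⟩, fun r hr => ?_⟩, rfl⟩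
    obtain ⟨h1, h2⟩ := Rect.mem_vertices.1 hr.2; exact congrArg Subtype.val (hu ⟨r, hr.1, h1⟩ h2)

variable {D}

lemma mem_surface : q ∈ D.surface κ ↔ ∃ r ∈ D.rects, q ∈ tile κ r := by simp [surface]

lemma norm_of_mem (hκ : 0 ≤ κ) (hq : q ∈ D.surface κ) : ‖q‖ ^ 2 = 1 := by
  obtain ⟨r, -, h⟩ := mem_surface.1 hq; rw [r.tile_eq hκ r.P] at h; rw [std.norm_sq]; exact h.1

/-- A point of the surface at a pole is a node, at least if the surface is perturbed. -/
lemma pole (hκ : 0 ≤ κ) (hq : q ∈ D.surface κ) (h : std.w q = 0 ∨ std.z q = 0) :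
    (∃ β ∈ Ioc 0 (2 * π), IsSectorNear (D.surface κ) q β) ∧ q ∈ singularSet (D.surface κ) ∧ (0 < κ → IsNode (D.surface κ) q) := by
  have hN := norm_of_mem hκ hq; have hK : 0 < 2 + κ := by linarith
  obtain ⟨r₀, hr₀, hqr₀⟩ := mem_surface.1 hq
  have ev : ∀ {S : Split}, S.z q ≠ 0 → ∀ᶠ p in 𝓝 q, S.z p ≠ 0 := fun {S} h => S.z.continuous.continuousAt.eventually_ne h
  have nz : ∀ S : Split, S.w q = 0 → S.z q ≠ 0 := fun S h hz => by rw [S.norm_sq, h, hz] at hN; simp at hN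
  rcases h with hw | hw
  · set φ₀ : Angle := (arg (std.z q) : Angle); have hmem : ∀ r : Rect, q ∈ tile κ r ↔ φ₀ = r.φ₁ ∨ φ₀ = r.φ₂ := fun r => by
      rw [r.tile_eq hκ r.P, Split.mem_tile_pole _ hK r.a_mem.1 r.b_mem.1 hw hN, r.coe_t, r.coe_t_add_b]
    haveI : Fintype (D.HorSide φ₀) := Fintype.ofFinite _
    haveI : Nonempty (D.HorSide φ₀) := ⟨⟨r₀, hr₀, (hmem r₀).1 hqr₀⟩⟩
    have hy : ∀ r : D.HorSide φ₀, ∃ y ∈ Icc 0 r.1.b, φ₀ = (r.1.t + y : ℝ) := fun r => by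
      rcases r.2.2 with e | e
      · exact ⟨0, ⟨le_rfl, r.1.b_mem.1.le⟩, by rw [add_zero, r.1.coe_t]; exact e⟩
      · exact ⟨_, ⟨r.1.b_mem.1.le, le_rfl⟩, by rw [r.1.coe_t_add_b]; exact e⟩
    choose y₀ hy₀ hφ using hy; have model : PoleModel std (2 + κ) (D.surface κ) q (D.horFan φ₀) (fun r => r.1.t) y₀ :=
      { one_lt := by linarith
        w_zero := hw
        norm := hN
        b_mem := fun r => r.1.b_mem
        sign := fun r => Rect.cornerSign_φ (hy₀ r) (hφ r) r.2.2
        angle := hφ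
        loc := (D.surface_local hκ q).mono fun p hp => by
          rw [hp]; constructor
          · rintro ⟨r, hr, h1, h2⟩; exact ⟨⟨r, hr, (hmem r).1 h1⟩, by rw [r.tile_eq hκ r.P] at h2; exact h2⟩
          · rintro ⟨r, h2⟩; exact ⟨r.1, r.2.1, (hmem r.1).2 r.2.2, by rw [r.1.tile_eq hκ r.1.P]; exact h2⟩ }
    refine ⟨model.sector_tangent.1, model.mem_singularSet, fun hκ' => model.isNode hκ' rfl ?_⟩
    filter_upwards [ev (nz _ hw)] with p hz hw r hp x hx y hy e1 e2
    exact (D.sector_tangent hκ r.2.1 hz hw (by rw [r.1.tile_eq hκ r.1.P]; exact hp) hx hy e1 e2).2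
  · set θ₀ : Angle := (arg (std.w q) : Angle); have hmem : ∀ r : Rect, q ∈ tile κ r ↔ θ₀ = r.θ₁ ∨ θ₀ = r.θ₂ := fun r => by
      rw [r.tile_eq hκ r.P, ← tile_swap, Split.mem_tile_pole _ hK r.b_mem.1 r.a_mem.1 hw hN, r.coe_s, r.coe_s_add_a]; rfl
    haveI : Fintype (D.VertSide θ₀) := Fintype.ofFinite _
    haveI : Nonempty (D.VertSide θ₀) := ⟨⟨r₀, hr₀, (hmem r₀).1 hqr₀⟩⟩
    have hy : ∀ r : D.VertSide θ₀, ∃ y ∈ Icc 0 r.1.a, θ₀ = (r.1.s + y : ℝ) := fun r => by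
      rcases r.2.2 with e | e
      · exact ⟨0, ⟨le_rfl, r.1.a_mem.1.le⟩, by rw [add_zero, r.1.coe_s]; exact e⟩
      · exact ⟨_, ⟨r.1.a_mem.1.le, le_rfl⟩, by rw [r.1.coe_s_add_a]; exact e⟩
    choose y₀ hy₀ hφ using hy; have htile : ∀ r : Rect, tile κ r = std.swap.tile (2 + κ) r.t r.s r.P.swap := fun r => by
      rw [r.tile_eq hκ r.P, tile_swap]
    have model : PoleModel std.swap (2 + κ) (D.surface κ) q (D.vertFan θ₀) (fun r => r.1.s) y₀ :=
      { one_lt := by linarith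
        w_zero := hw
        norm := hN
        b_mem := fun r => r.1.a_mem
        sign := fun r => Rect.cornerSign_θ (hy₀ r) (hφ r) r.2.2
        angle := hφ
        loc := (D.surface_local hκ q).mono fun p hp => by
          rw [hp]; constructor
          · rintro ⟨r, hr, h1, h2⟩; exact ⟨⟨r, hr, (hmem r).1 h1⟩, by rw [htile] at h2; exact h2⟩
          · rintro ⟨r, h2⟩; exact ⟨r.1, r.2.1, (hmem r.1).2 r.2.2, by rw [htile]; exact h2⟩ }
    refine ⟨model.sector_tangent.1, model.mem_singularSet, fun hκ' => model.isNode hκ' rfl ?_⟩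
    filter_upwards [ev (nz std.swap hw)] with p hz hw r hp x hx y hy e1 e2 v; have hp' : p ∈ tile κ r.1 := by rw [htile]; exact hp
    obtain ⟨y', hy', x', hx', e3, e4, e5⟩ := exists_coords hκ hw hz hp'
    obtain rfl := arc_coord_unique r.1.b_mem.2 hx hx' (e1.symm.trans e4)
    obtain rfl := arc_coord_unique r.1.a_mem.2 hy hy' (e2.symm.trans e3)
    rw [(D.sector_tangent hκ r.2.1 hw hz hp' hy hx e2 e1).2 v]; exact and_congr_right fun _ => (sepForm_swap e5).symm

lemma singular_iff (hκ : 0 ≤ κ) (hr : r ∈ D.rects) (hz : std.z q ≠ 0) (hw : std.w q ≠ 0)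
    (hq : q ∈ tile κ r) (hx : x ∈ Icc 0 r.a) (hy : y ∈ Icc 0 r.b) (h1 : (proj q).1 = (r.s + x : ℝ))
    (h2 : (proj q).2 = (r.t + y : ℝ)) (h3 : r.P.B.fn y = exp ((2 + κ) * std.lam q) * r.P.C.fn x) :
    q ∈ singularSet (D.surface κ) ↔ r.P.C.fn x = 0 ∧ exp ((2 + κ) * std.lam q) * r.P.C.der x *
      ‖std.z q‖ ^ 2 + r.P.B.der y * ‖std.w q‖ ^ 2 = 0 := by
  have hqF : q ∈ D.surface κ := mem_surface.2 ⟨r, hr, hq⟩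
  rw [← tangentPlane_eq_contactPlane_iff (by linarith) hz hw (norm_of_mem hκ hqF)
    (D.sector_tangent hκ hr hz hw hq hx hy h1 h2).2 fun hc hb => ?_]
  · exact and_iff_right hqF
  · have := r.P.B.der_sq y; simp_all

/-- The singularities outside the poles are saddles at the vertices. -/
lemma singular_nonpole (hκ : 0 < κ) (hq : q ∈ singularSet (D.surface κ)) (hz : std.z q ≠ 0) (hw : std.w q ≠ 0) :
    (∃ r ∈ D.rects, proj q ∈ r.vertices) ∧ std.lam q = 0 ∧ IsSaddle (D.surface κ) q := by
  obtain ⟨r, hr, hqr⟩ := mem_surface.1 hq.1; obtain ⟨x, hx, y, hy, h1, h2, h3⟩ := exists_coords hκ.le hz hw hqr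
  obtain ⟨hC, hA⟩ := (singular_iff hκ.le hr hz hw hqr hx hy h1 h2 h3).1 hq; have hB : r.P.B.fn y = 0 := by rw [h3, hC, mul_zero]
  have hv : proj q ∈ r.vertices := (mem_vertices_iff hx hy h1 h2).2 ⟨(r.P.C.eq_zero_iff hx).1 hC, (r.P.B.eq_zero_iff hy).1 hB⟩
  have cx := (Rect.cornerSign_θ hx h1 (Rect.mem_vertices.1 hv).1).der_add r.P.C 0
  have cy := (Rect.cornerSign_φ hy h2 (Rect.mem_vertices.1 hv).2).der_add r.P.B 0
  rw [add_zero, Arch.der_zero, mul_one] at cx cy; rw [cx, cy] at hA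
  have p1 : 0 < exp ((2 + κ) * std.lam q) * ‖std.z q‖ ^ 2 := by positivity
  have p2 : 0 < ‖std.w q‖ ^ 2 := by positivity
  have key : r.slope (proj q) = -1 ∧ exp ((2 + κ) * std.lam q) * ‖std.z q‖ ^ 2 = ‖std.w q‖ ^ 2 := by
    unfold Rect.slope
    rcases r.sgnθ_abs (proj q).1 with e | e <;> rcases r.sgnφ_abs (proj q).2 with e' | e' <;> rw [e, e'] at hA <;> rw [e, e'] <;>
      first | (exfalso; linarith) | exact ⟨by norm_num, by linarith⟩
  have hl : std.lam q = 0 := by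
    have e2 : exp (2 * std.lam q) * ‖std.z q‖ ^ 2 = ‖std.w q‖ ^ 2 := by
      rw [exp_lam hz hw, rpow_two, rpow_two, div_mul_cancel₀ _ (by positivity)]
    have := mul_right_cancel₀ (by positivity : ‖std.z q‖ ^ 2 ≠ 0) (key.2.trans e2.symm); rw [exp_eq_exp] at this; grind
  obtain ⟨c, b, hm⟩ := D.exists_vertexModel hκ.le hr hz hw hqr hv; rw [key.1] at hm
  exact ⟨⟨r, hr, hv⟩, hl, isSaddle_of_vertexModel hκ hm hz hw hq.1 hl⟩

lemma isSurfaceWithCorners (hκ : 0 ≤ κ) : IsSurfaceWithCorners (D.surface κ) where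
  subset_sphere q hq := by
    have := norm_of_mem hκ hq; simpa using (sq_eq_sq₀ (norm_nonneg q) zero_le_one).1 (this.trans (one_pow 2).symm)
  compact := D.rects.isCompact_biUnion fun r _ => isCompact_tile hκ r
  sector q hq := by
    by_cases h : std.w q = 0 ∨ std.z q = 0
    · exact (pole hκ hq h).1
    · obtain ⟨hw, hz⟩ := not_or.1 h; obtain ⟨r, hr, hqr⟩ := mem_surface.1 hq
      obtain ⟨x, hx, y, hy, h1, h2, -⟩ := exists_coords hκ hz hw hqr
      obtain ⟨⟨β, hβ, hs⟩, -⟩ := D.sector_tangent hκ hr hz hw hqr hx hy h1 h2; have := pi_pos; grind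

lemma finite_singularSet (hκ : 0 < κ) : (singularSet (D.surface κ)).Finite := by
  set Θ : Set Angle := insert ↑(0) (⋃ r ∈ D.rects, {r.θ₁, r.θ₂}); set Φ : Set Angle := insert ↑(0) (⋃ r ∈ D.rects, {r.φ₁, r.φ₂})
  have hΘ : Θ.Finite := (D.rects.finite_toSet.biUnion fun r _ => toFinite _).insert _
  have hΦ : Φ.Finite := (D.rects.finite_toSet.biUnion fun r _ => toFinite _).insert _
  set f : E4 → Torus × ℝ := fun q => (proj q, ‖std.w q‖)
  have hs : ∀ q ∈ singularSet (D.surface κ), ‖std.z q‖ ^ 2 + ‖std.w q‖ ^ 2 = 1 := fun q hq => by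
    rw [← std.norm_sq]; exact norm_of_mem hκ.le hq.1
  refine Set.Finite.of_finite_image (f := f) (((hΘ.prod hΦ).prod (toFinite {0, 1, √(1 / 2)})).subset ?_) ?_
  · rintro _ ⟨q, hq, rfl⟩; have hn := hs q hq; obtain ⟨r, hr, hqr⟩ := mem_surface.1 hq.1; have hN := norm_of_mem hκ.le hq.1
    have mΘ : ∀ r ∈ D.rects, ∀ θ : Angle, θ = r.θ₁ ∨ θ = r.θ₂ → θ ∈ Θ := fun r hr θ h => .inr (mem_biUnion hr h)
    have mΦ : ∀ r ∈ D.rects, ∀ θ : Angle, θ = r.φ₁ ∨ θ = r.φ₂ → θ ∈ Φ := fun r hr θ h => .inr (mem_biUnion hr h)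
    rw [r.tile_eq hκ.le r.P] at hqr; by_cases hw : std.w q = 0
    · refine ⟨⟨.inl (by simp [f, proj, hw]), mΦ r hr _ ?_⟩, by simp [f, hw]⟩
      rw [Split.mem_tile_pole _ (by linarith) r.a_mem.1 r.b_mem.1 hw hN, r.coe_t, r.coe_t_add_b] at hqr; exact hqr
    by_cases hz : std.z q = 0
    · refine ⟨⟨mΘ r hr _ ?_, .inl (by simp [f, proj, hz])⟩, .inr (.inl ?_)⟩
      · rw [← tile_swap, Split.mem_tile_pole std.swap (by linarith) r.b_mem.1 r.a_mem.1 hz hN, r.coe_s, r.coe_s_add_a] at hqr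
        exact hqr
      · rw [hz, norm_zero] at hn; change ‖std.w q‖ = 1; nlinarith [norm_nonneg (std.w q)]
    · obtain ⟨⟨r', hr', hv⟩, hl, -⟩ := singular_nonpole hκ hq hz hw; rw [Rect.mem_vertices] at hv
      refine ⟨⟨mΘ r' hr' _ hv.1, mΦ r' hr' _ hv.2⟩, .inr (.inr ?_)⟩; change ‖std.w q‖ = √(1 / 2); have := exp_lam (K := 2) hz hw
      rw [hl, mul_zero, exp_zero, rpow_two, rpow_two, eq_comm, div_eq_one_iff_eq (by simpa using hz)] at this
      rw [eq_comm, sqrt_eq_iff_mul_self_eq (by norm_num) (norm_nonneg _)]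
      linarith
  · intro q hq q' hq' e; have e1 : ‖std.w q‖ = ‖std.w q'‖ := congrArg Prod.snd e
    have e2 : ((arg (std.w q) : ℝ) : Angle) = (arg (std.w q') : ℝ) := congrArg (fun x => x.1.1) e
    have e3 : ((arg (std.z q) : ℝ) : Angle) = (arg (std.z q') : ℝ) := congrArg (fun x => x.1.2) e
    have e4 : ‖std.z q‖ = ‖std.z q'‖ := by
      have h1 := hs q hq; have h2 := hs q' hq'; rw [e1] at h1; exact (sq_eq_sq₀ (norm_nonneg _) (norm_nonneg _)).1 (by linarith)
    exact std.ext (Complex.ext_norm_arg e4 (Complex.arg_coe_angle_eq_iff.1 e3)) (Complex.ext_norm_arg e1 (Complex.arg_coe_angle_eq_iff.1 e2))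

lemma isNice (hκ : 0 < κ) : IsNice (D.surface κ) where
  finite := finite_singularSet hκ
  node_or_saddle q hq := by
    by_cases h : std.w q = 0 ∨ std.z q = 0
    · exact .inl ((pole hκ.le hq.1 h).2.2 hκ)
    · obtain ⟨hw, hz⟩ := not_or.1 h; exact .inr (singular_nonpole hκ hq hz hw).2.2
  corner q hq := by
    by_cases h : std.w q = 0 ∨ std.z q = 0
    · exact (pole hκ.le hq.1 h).2.2 hκ
    · obtain ⟨hw, hz⟩ := not_or.1 h; obtain ⟨r, hr, hqr⟩ := mem_surface.1 hq.1
      obtain ⟨x, hx, y, hy, h1, h2, -⟩ := exists_coords hκ.le hz hw hqr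
      obtain ⟨⟨β, hβ, hs⟩, -⟩ := D.sector_tangent hκ.le hr hz hw hqr hx hy h1 h2; exact absurd hq (not_isBoundaryCorner hβ hs)

end Diagram

open Complex (continuousAt_arg_coe_angle)
open Split (hasFDerivAt_lam arg_eq_add_X inner_contactNormal)
lemma eventually_eq_zero_of_abs_deriv_le {t₀ : ℝ}
    (h : ∀ᶠ t in 𝓝 t₀, HasDerivAt f (f' t) t ∧ |f' t| ≤ M * |f t|) (h0 : f t₀ = 0) : ∀ᶠ t in 𝓝 t₀, f t = 0 := by
  have key : ∀ {g g' : ℝ → ℝ} {a b : ℝ}, (∀ t ∈ Icc a b, HasDerivAt g (g' t) t ∧ |g' t| ≤ M * |g t|) →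
      a ≤ b → g a = 0 → g b = 0 := fun {g g' a b} h hab h0 =>
    eq_zero_of_abs_deriv_le_mul_abs_self_of_eq_zero_right (fun t ht => (h t ht).1.continuousAt.continuousWithinAt)
      (fun t ht => (h t ⟨ht.1, ht.2.le⟩).1.hasDerivWithinAt) h0 (fun t ht => (h t ⟨ht.1, ht.2.le⟩).2) b ⟨hab, le_rfl⟩
  obtain ⟨ε, hε, hb⟩ := Metric.eventually_nhds_iff_ball.1 h; filter_upwards [Metric.ball_mem_nhds t₀ hε] with t ht
  rw [ball_eq_Ioo] at hb ht; rcases le_total t₀ t with h' | h'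
  · exact key (fun s hs => hb s (by grind)) h' h0
  · have := key (g := fun s => f (-s)) (g' := fun s => -f' (-s)) (a := -t₀) (b := -t) (fun s hs => by
      obtain ⟨h1, h2⟩ := hb (-s) (by grind)
      exact ⟨by simpa [comp_def] using h1.scomp s (hasDerivAt_neg s), by simpa using h2⟩) (by linarith) (by simpa)
    simpa using this

lemma mem_tile_of_proj_mem_vertices (hκ : 0 ≤ κ) (hz : std.z q ≠ 0)
    (hw : std.w q ≠ 0) (hN : ‖q‖ ^ 2 = 1) (hv : proj q ∈ r.vertices) : q ∈ tile κ r := by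
  rw [r.tile_eq hκ r.P, Split.mem_tile_iff _ _ hz hw, ← Split.norm_sq]
  rw [Rect.mem_vertices, ← r.coe_s_add_a, ← r.coe_t_add_b, ← r.coe_s, ← r.coe_t] at hv; have ha := r.a_mem.1.le
  have hb := r.b_mem.1.le; obtain ⟨x, hx, hx0, hx'⟩ : ∃ x ∈ Icc 0 r.a, r.P.C.fn x = 0 ∧ (proj q).1 = (r.s + x : ℝ) := hv.1.elim
    (fun h => ⟨0, ⟨le_rfl, ha⟩, r.P.C.zero, by rw [h, add_zero]⟩) fun h => ⟨r.a, ⟨ha, le_rfl⟩, r.P.C.fn_len, h⟩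
  obtain ⟨y, hy, hy0, hy'⟩ : ∃ y ∈ Icc 0 r.b, r.P.B.fn y = 0 ∧ (proj q).2 = (r.t + y : ℝ) := hv.2.elim
    (fun h => ⟨0, ⟨le_rfl, hb⟩, r.P.B.zero, by rw [h, add_zero]⟩) fun h => ⟨r.b, ⟨hb, le_rfl⟩, r.P.B.fn_len, h⟩
  exact ⟨hN, x, hx, y, hy, hy', hx', by grind⟩

lemma continuousAt_proj (hz : std.z q ≠ 0) (hw : std.w q ≠ 0) : ContinuousAt proj q :=
  ((continuousAt_arg_coe_angle hw).comp std.w.continuous.continuousAt).prodMk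
    ((continuousAt_arg_coe_angle hz).comp std.z.continuous.continuousAt)

namespace IsLeafCurve

variable {I : Set ℝ} {γ : ℝ → E4}

lemma hasDerivAt (h : IsLeafCurve F I γ) (hI : IsOpen I) (ht : t ∈ I) : HasDerivAt γ (deriv γ t) t :=
  ((h.contDiffOn.contDiffAt (hI.mem_nhds ht)).differentiableAt one_ne_zero).hasDerivAt

lemma continuousAt_deriv (h : IsLeafCurve F I γ) (hI : IsOpen I) (ht : t ∈ I) : ContinuousAt (deriv γ) t :=
  (h.contDiffOn.continuousOn_deriv_of_isOpen hI le_rfl).continuousAt (hI.mem_nhds ht)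

lemma nonpole {D : Diagram} (h : IsLeafCurve (D.surface κ) I γ) (hκ : 0 ≤ κ) (ht : t ∈ I) : std.z (γ t) ≠ 0 ∧ std.w (γ t) ≠ 0 :=
  ⟨fun hz => (h.mem t ht).2 (Diagram.pole hκ (h.mem t ht).1 (.inr hz)).2.1,
    fun hw => (h.mem t ht).2 (Diagram.pole hκ (h.mem t ht).1 (.inl hw)).2.1⟩

end IsLeafCurve

namespace Diagram

variable {D : Diagram} {I : Set ℝ} {γ : ℝ → E4}

set_option maxHeartbeats 1000000 in
/-- A leaf that meets the arc over a vertex stays in it. -/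
lemma proj_eventually_const (hκ : 0 ≤ κ) (hI : IsOpen I) (hγ : IsLeafCurve (D.surface κ) I γ) {t₁ : ℝ} (ht : t₁ ∈ I) (hr : r ∈ D.rects) (hv : proj (γ t₁) ∈ r.vertices) : ∀ᶠ t in 𝓝 t₁, proj (γ t) = proj (γ t₁) := by
  obtain ⟨hz, hw⟩ := hγ.nonpole hκ ht; obtain ⟨hF, hsing⟩ := hγ.mem _ ht; have hN := norm_of_mem hκ hF
  have hq := mem_tile_of_proj_mem_vertices hκ hz hw hN hv; have hK : 0 < 2 + κ := by linarith
  obtain ⟨c, b, hm⟩ := D.exists_vertexModel hκ hr hz hw hq hv; set ε := r.slope (proj (γ t₁)) with hεdef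
  have hε : ε = 1 ∨ ε = -1 := r.slope_abs _; set q := γ t₁ with hqdef; have ev := hm.eventually_tangent hK hε hz hw
  have hc := hγ.hasDerivAt hI ht; have hcont := hc.continuousAt; set S := std
  set u : ℝ → ℝ := fun t => S.X (S.w q) (γ t); set v : ℝ → ℝ := fun t => S.Y (S.z q) (γ t); have hzz := self_div_mem hz
  have hww := self_div_mem hw; have u0 : u t₁ = 0 := X_self hw; have v0 : v t₁ = 0 := X_self (S := S.swap) hz
  set A : ℝ → ℝ := fun t => exp ((2 + κ) * S.lam (γ t)) * c.der (u t) * ‖S.z (γ t)‖ ^ 2 + ε * b.der (v t) * ‖S.w (γ t)‖ ^ 2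
  set N : ℝ → ℝ := fun t => (2 + κ) * exp ((2 + κ) * S.lam (γ t)) * ‖S.z (γ t)‖ ^ 2 * S.dlam (γ t) (deriv γ t)
  have A0 : A t₁ ≠ 0 := fun h => by
    refine hsing ⟨hF, (tangentPlane_eq_contactPlane_iff (S := S) (K := 2 + κ) (c := 0) (c' := 1) (b' := ε) hK hz hw hN (fun v => ?_) fun _ => ?_).2 ⟨rfl, ?_⟩⟩
    · have := (ev.self_of_nhds hF).2 v
      rwa [X_self hw, show S.Y (S.z q) q = 0 from v0, c.zero, c.der_zero, b.der_zero, mul_one] at this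
    · grind
    · simpa only [A, u0, v0, c.der_zero, b.der_zero, mul_one] using h
  have hu : ContinuousAt u t₁ := ContinuousAt.comp (f := γ) (hasFDerivAt_X hww).continuousAt hcont
  have hvc : ContinuousAt v t₁ := ContinuousAt.comp (f := γ) (hasFDerivAt_Y hzz).continuousAt hcont
  have hl : ContinuousAt (fun t => S.lam (γ t)) t₁ := ContinuousAt.comp (f := γ) (hasFDerivAt_lam hz hw).continuousAt hcont
  have hzc : ContinuousAt (fun t => S.z (γ t)) t₁ := by fun_prop
  have hwc : ContinuousAt (fun t => S.w (γ t)) t₁ := by fun_prop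
  have hd := hγ.continuousAt_deriv hI ht; have hAc : ContinuousAt A t₁ := by
    have h1 : ContinuousAt (fun t => c.der (u t)) t₁ := c.contDiff_der.continuous.continuousAt.comp hu
    have h2 : ContinuousAt (fun t => b.der (v t)) t₁ := b.contDiff_der.continuous.continuousAt.comp hvc; fun_prop
  have hNc : ContinuousAt N t₁ := by
    have h1 : ContinuousAt (fun t => S.dlam (γ t) (deriv γ t)) t₁ := by
      have e1 : ContinuousAt (fun t => S.z (deriv γ t)) t₁ := by fun_prop
      have e2 : ContinuousAt (fun t => S.w (deriv γ t)) t₁ := by fun_prop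
      exact (Complex.continuous_re.continuousAt.comp ((hwc.inv₀ hw).mul e2)).sub
        (Complex.continuous_re.continuousAt.comp ((hzc.inv₀ hz).mul e1))
    fun_prop
  have hcu : ∀ᶠ t in 𝓝 t₁, |c.fn (u t)| ≤ 2 * |u t| := by
    have h1 : ∀ᶠ x in 𝓝 (0 : ℝ), |c.fn x| ≤ 2 * |x| := by
      have := (c.hasDerivAt 0).isLittleO.def one_pos; filter_upwards [this] with x hx
      simp [c.zero, c.der_zero, sub_zero, smul_eq_mul, mul_one, norm_eq_abs, one_mul] at hx; grind
    exact hu.eventually (by rwa [u0])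
  have e1 : ∀ᶠ t in 𝓝 t₁, |A t₁| / 2 < |A t| := hAc.abs.eventually (lt_mem_nhds (by grind))
  have e2 : ∀ᶠ t in 𝓝 t₁, |N t| < |N t₁| + 1 := hNc.abs.eventually (gt_mem_nhds (by linarith))
  have hloc : ∀ᶠ t in 𝓝 t₁, t ∈ I ∧ HasDerivAt u (S.dθ (γ t) (deriv γ t)) t ∧ HasDerivAt v (S.dφ (γ t) (deriv γ t)) t ∧
      (proj (γ t)).1 = (proj q).1 + (u t : ℝ) ∧ (proj (γ t)).2 = (proj q).2 + (v t : ℝ) ∧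
      ‖S.z (γ t)‖ ^ 2 * S.dφ (γ t) (deriv γ t) + ‖S.w (γ t)‖ ^ 2 * S.dθ (γ t) (deriv γ t) = 0 ∧
      A t * S.dθ (γ t) (deriv γ t) = -(N t * c.fn (u t)) := by
    filter_upwards [hI.mem_nhds ht, hcont.eventually ev, hcont.eventually (eventually_slit hww), hcont.eventually (eventually_slit (S := S.swap) hzz)] with t htI h1 h2 h3
    obtain ⟨hz', hw'⟩ := hγ.nonpole hκ htI; have hγ' := hγ.hasDerivAt hI htI; obtain ⟨hT, hξ⟩ := hγ.tangent t htI
    obtain ⟨-, hform⟩ := ((h1 (hγ.mem t htI).1).2 _).1 hT; have hξ := (mem_contactPlane.1 hξ).2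
    rw [inner_contactNormal hz' hw'] at hξ; rw [sepForm_apply] at hform
    refine ⟨htI, (hasFDerivAt_X h2).comp_hasDerivAt t hγ', (hasFDerivAt_Y h3).comp_hasDerivAt t hγ',
      arg_eq_add_X h2, arg_eq_add_X (S := S.swap) h3, hξ, ?_⟩
    linear_combination ‖S.z (γ t)‖ ^ 2 * hform + ε * b.der (v t) * hξ
  have hu0 : ∀ᶠ t in 𝓝 t₁, u t = 0 := by
    refine eventually_eq_zero_of_abs_deriv_le (f' := fun t => S.dθ (γ t) (deriv γ t)) (M := 4 * (|N t₁| + 1) / |A t₁|) ?_ u0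
    filter_upwards [hloc, hcu, e1, e2] with t h1 h2 h3 h4; refine ⟨h1.2.1, ?_⟩; have h5 := congrArg abs h1.2.2.2.2.2.2
    rw [abs_neg, abs_mul, abs_mul] at h5; have hA : 0 < |A t₁| := abs_pos.2 A0; rw [div_mul_eq_mul_div, le_div_iff₀ hA]
    have h6 : |N t| * |c.fn (u t)| ≤ (|N t₁| + 1) * (2 * |u t|) := mul_le_mul h4.le h2 (abs_nonneg _) (by positivity)
    have h7 : |A t₁| / 2 * |S.dθ (γ t) (deriv γ t)| ≤ |A t| * |S.dθ (γ t) (deriv γ t)| := by gcongr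
    linarith
  have hv0 : ∀ᶠ t in 𝓝 t₁, v t = 0 := by
    refine eventually_eq_zero_of_abs_deriv_le (f' := fun t => S.dφ (γ t) (deriv γ t)) (M := 0) ?_ v0
    filter_upwards [hloc, hu0.eventually_nhds] with t h1 h2; obtain ⟨hz', -⟩ := hγ.nonpole hκ h1.1
    have h3 : S.dθ (γ t) (deriv γ t) = 0 := h1.2.1.unique ((hasDerivAt_const t (0 : ℝ)).congr_of_eventuallyEq h2)
    have h4 := h1.2.2.2.2.2.1; rw [h3, mul_zero, add_zero] at h4; refine ⟨h1.2.2.1, ?_⟩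
    rw [(mul_eq_zero.1 h4).resolve_left (by simpa using hz')]; simp
  filter_upwards [hloc, hu0, hv0] with t h1 h2 h3; refine Prod.ext ?_ ?_
  · rw [h1.2.2.2.1, h2, Angle.coe_zero, add_zero]
  · rw [h1.2.2.2.2.1, h3, Angle.coe_zero, add_zero]

/-- A leaf stays in the interior of a tile or in the arc over a vertex. -/
lemma leaf_dichotomy (hκ : 0 ≤ κ) (hI : IsOpen I) (hI' : IsPreconnected I) (hne : I.Nonempty)
    (hγ : IsLeafCurve (D.surface κ) I γ) : ∃ r ∈ D.rects, (∀ t ∈ I, γ t ∈ tile κ r) ∧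
      ((∀ t ∈ I, proj (γ t) ∉ r.vertices) ∨ ∃ v ∈ r.vertices, ∀ t ∈ I, proj (γ t) = v) := by
  obtain ⟨t₀, h₀⟩ := hne; obtain ⟨r, hr, hq⟩ := mem_surface.1 (hγ.mem _ h₀).1
  have hc : ∀ t ∈ I, ContinuousAt γ t := fun t ht => (hγ.hasDerivAt hI ht).continuousAt
  have hp : ∀ t ∈ I, ContinuousAt (fun t => proj (γ t)) t := fun t ht =>
    ContinuousAt.comp (f := γ) (continuousAt_proj (hγ.nonpole hκ ht).1 (hγ.nonpole hκ ht).2) (hc t ht)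
  refine ⟨r, hr, ?_⟩; by_cases hv : proj (γ t₀) ∈ r.vertices
  · have key : I ⊆ {t | t ∈ I ∧ proj (γ t) = proj (γ t₀)} := by
      refine hI'.subset_of_closure_inter_subset (isOpen_iff_mem_nhds.2 fun t ht => ?_) ⟨t₀, h₀, h₀, rfl⟩ ?_
      · filter_upwards [hI.mem_nhds ht.1, proj_eventually_const hκ hI hγ ht.1 hr (ht.2 ▸ hv)] with s hs hs'; simp_all
      · rintro t ⟨ht, htI⟩; by_contra h
        have : ∀ᶠ s in 𝓝 t, proj (γ s) ≠ proj (γ t₀) := (hp t htI).eventually_ne fun e => h ⟨htI, e⟩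
        obtain ⟨s, hs, hs'⟩ := mem_closure_iff_frequently.1 ht |>.and_eventually this |>.exists; exact hs' hs.2
    refine ⟨fun t ht => ?_, .inr ⟨_, hv, fun t ht => (key ht).2⟩⟩; obtain ⟨hz, hw⟩ := hγ.nonpole hκ ht
    exact mem_tile_of_proj_mem_vertices hκ hz hw (norm_of_mem hκ (hγ.mem t ht).1) ((key ht).2 ▸ hv)
  · have key : I ⊆ {t | t ∈ I ∧ γ t ∈ tile κ r ∧ proj (γ t) ∉ r.vertices} := by
      refine hI'.subset_of_closure_inter_subset (isOpen_iff_mem_nhds.2 fun t ht => ?_) ⟨t₀, h₀, h₀, hq, hv⟩ ?_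
      · have hfin : IsClosed r.vertices := ((toFinite {r.θ₁, r.θ₂}).prod (toFinite {r.φ₁, r.φ₂})).isClosed
        filter_upwards [hI.mem_nhds ht.1, (hc t ht.1).eventually (D.surface_local hκ (γ t)),
          (hp t ht.1).eventually (hfin.isOpen_compl.mem_nhds ht.2.2)] with s hs h1 h2
        obtain ⟨r', hr', m1, m2⟩ := h1.1 (hγ.mem s hs).1; obtain ⟨hz, hw⟩ := hγ.nonpole hκ ht.1; by_cases e : r' = r
        · simp_all
        · exact absurd (D.proj_mem_vertices hκ hr' hr e hz hw m1 ht.2.1).2 ht.2.2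
      · rintro t ⟨ht, htI⟩; have hcl : γ t ∈ tile κ r := by
          by_contra h; have := (hc t htI).eventually ((isCompact_tile hκ r).isClosed.isOpen_compl.mem_nhds h)
          obtain ⟨s, hs, hs'⟩ := mem_closure_iff_frequently.1 ht |>.and_eventually this |>.exists; exact hs' hs.2.1
        refine ⟨htI, hcl, fun h => ?_⟩
        obtain ⟨s, hs, hs'⟩ := mem_closure_iff_frequently.1 ht |>.and_eventually (proj_eventually_const hκ hI hγ htI hr h) |>.exists
        exact hs.2.2 (hs' ▸ h)
    exact ⟨fun t ht => (key ht).2.1, .inl fun t ht => (key ht).2.2⟩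

end Diagram

open Complex (mul_re mul_im conj_re conj_im I_im)
open Split (exists_vec inner_eq_re)
lemma volAt_rotate (q u v w : E4) : volAt q u v w = volAt q v w u := by
  simp [volAt, Matrix.det_succ_row_zero, Fin.sum_univ_succ, Fin.succAbove]; ring

lemma Split.dθ_contactNormal (S : Split) (hw : S.w q ≠ 0) : S.dθ q (contactNormal q) = 1 := by
  rw [dθ_apply, S.w_normal, mul_left_comm, inv_mul_cancel₀ hw, mul_one, I_im]

lemma Split.dlam_contactNormal (S : Split) (hz : S.z q ≠ 0) (hw : S.w q ≠ 0) : S.dlam q (contactNormal q) = 0 := by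
  change ((S.w q)⁻¹ * S.w (contactNormal q)).re - ((S.z q)⁻¹ * S.z (contactNormal q)).re = 0
  rw [S.w_normal, S.z_normal, mul_left_comm, inv_mul_cancel₀ hw, mul_left_comm, inv_mul_cancel₀ hz, sub_self]

lemma volAt_eq (hz : std.z q ≠ 0) (hw : std.w q ≠ 0) (u v : E4) :
    volAt q u (contactNormal q) v = ‖std.z q‖ ^ 2 * ‖std.w q‖ ^ 2 * ((std.dθ q u - std.dφ q u) * std.dlam q v +
        std.dlam q u * (std.dφ q v - std.dθ q v)) := by
  have key : ∀ v : E4, ∃ α β : ℝ, std.dlam q v = β - α ∧ v = !₂[q 0 * α - q 1 * std.dφ q v,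
      q 0 * std.dφ q v + q 1 * α, q 2 * β - q 3 * std.dθ q v, q 2 * std.dθ q v + q 3 * β] := fun v => by
    refine ⟨((std.z q)⁻¹ * std.z v).re, ((std.w q)⁻¹ * std.w v).re, rfl, ?_⟩
    have h1 : std.z v = std.z q * ((std.z q)⁻¹ * std.z v) := by field_simp
    have h2 : std.w v = std.w q * ((std.w q)⁻¹ * std.w v) := by field_simp
    have e1 := congrArg Complex.re h1; have e2 := congrArg Complex.im h1; have e3 := congrArg Complex.re h2
    have e4 := congrArg Complex.im h2; rw [mul_re] at e1 e3; rw [mul_im] at e2 e4; ext i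
    fin_cases i
    exacts [e1, e2, e3, e4]
  obtain ⟨α, β, h1, h2⟩ := key u; obtain ⟨α', β', h1', h2'⟩ := key v
  rw [h1, h1', ← normSq_eq_norm_sq, ← normSq_eq_norm_sq, normSq_apply, normSq_apply]
  change _ = (q 0 * q 0 + q 1 * q 1) * (q 2 * q 2 + q 3 * q 3) * _
  generalize std.dθ q u = a, std.dθ q v = a', std.dφ q u = b, std.dφ q v = b' at h2 h2' ⊢
  rw [h2, h2']; simp [volAt, contactNormal, Matrix.det_succ_row_zero, Fin.sum_univ_succ, Fin.succAbove]; ring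

lemma inner_eq_forms {S : Split} (hz : S.z q ≠ 0) (hw : S.w q ≠ 0) (hN : ‖q‖ ^ 2 = 1) {u : E4}
    (hu : inner ℝ q u = 0) (hv : inner ℝ q v = 0) : inner ℝ u v = ‖S.w q‖ ^ 2 * (S.dθ q u * S.dθ q v) +
      ‖S.z q‖ ^ 2 * (S.dφ q u * S.dφ q v) + ‖S.z q‖ ^ 2 * ‖S.w q‖ ^ 2 * (S.dlam q u * S.dlam q v) := by
  rw [S.norm_sq] at hN; rw [inner_eq_re hz hw] at hu hv
  have key : ∀ {a : ℂ} (x y : ℂ), a ≠ 0 → inner ℝ x y = ‖a‖ ^ 2 * ((a⁻¹ * x).re * (a⁻¹ * y).re + (a⁻¹ * x).im * (a⁻¹ * y).im) := by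
    intro a x y ha
    have : inner ℝ (a * (a⁻¹ * x)) (a * (a⁻¹ * y)) = ‖a‖ ^ 2 * ((a⁻¹ * x).re * (a⁻¹ * y).re + (a⁻¹ * x).im * (a⁻¹ * y).im) := by
      rw [Complex.inner, ← normSq_eq_norm_sq, normSq_apply]; simp [map_mul, mul_re, mul_im, conj_re, conj_im]; ring
    grind
  rw [S.inner_eq', key _ _ hz, key _ _ hw]
  change _ = ‖S.w q‖ ^ 2 * (((S.w q)⁻¹ * S.w u).im * ((S.w q)⁻¹ * S.w v).im) + ‖S.z q‖ ^ 2 *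
    (((S.z q)⁻¹ * S.z u).im * ((S.z q)⁻¹ * S.z v).im) + ‖S.z q‖ ^ 2 * ‖S.w q‖ ^ 2 *
    ((((S.w q)⁻¹ * S.w u).re - ((S.z q)⁻¹ * S.z u).re) * (((S.w q)⁻¹ * S.w v).re - ((S.z q)⁻¹ * S.z v).re))
  generalize ((S.z q)⁻¹ * S.z u).re = a, ((S.z q)⁻¹ * S.z v).re = a', ((S.w q)⁻¹ * S.w u).re = b, ((S.w q)⁻¹ * S.w v).re = b' at hu hv ⊢
  generalize ‖S.z q‖ ^ 2 = Z, ‖S.w q‖ ^ 2 = W at hu hv hN ⊢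
  grind

namespace Diagram

variable {D : Diagram}

/-- The data of the foliation at the point `q` of the leaf with velocity `v` in the tile of `r`: the coordinates `x`, `y`
of the point, the velocity in the angular coordinates, and the position of the contact plane. -/
structure LeafPoint (D : Diagram) (κ : ℝ) (r : Rect) (q v : E4) (x y μ : ℝ) : Prop where
  mem_x : x ∈ Icc 0 r.a
  mem_y : y ∈ Icc 0 r.b
  proj_fst : (proj q).1 = (r.s + x : ℝ)
  proj_snd : (proj q).2 = (r.t + y : ℝ)
  height : r.P.B.fn y = exp ((2 + κ) * std.lam q) * r.P.C.fn x
  ne_zero : μ ≠ 0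
  dθ_eq : std.dθ q v = μ * ((2 + κ) * exp ((2 + κ) * std.lam q) * r.P.C.fn x * ‖std.z q‖ ^ 2)
  dφ_eq : std.dφ q v = -(μ * ((2 + κ) * exp ((2 + κ) * std.lam q) * r.P.C.fn x * ‖std.w q‖ ^ 2))
  dlam_eq : std.dlam q v =
    -(μ * ‖std.w q‖ ^ 2 * (exp (κ * std.lam q) * r.P.C.der x + r.P.B.der y))
  der_ne : r.P.C.fn x = 0 → exp (κ * std.lam q) * r.P.C.der x + r.P.B.der y ≠ 0
  normal : ∃ Q : ℝ, 0 < Q ∧ ∀ N, IsUnitNormal (D.surface κ) q N → ∃ n : ℝ, n ≠ 0 ∧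
    inner ℝ N (contactNormal q) = n * (exp ((2 + κ) * std.lam q) * r.P.C.der x - r.P.B.der y) ∧
    volAt q N (contactNormal q) v = -(μ * n * Q)

lemma exists_leafPoint (hκ : 0 ≤ κ) (hr : r ∈ D.rects) (hq : q ∈ tile κ r)
    (hs : q ∉ singularSet (D.surface κ)) (hz : std.z q ≠ 0) (hw : std.w q ≠ 0)
    (hv : v ∈ charLine (D.surface κ) q) (hv0 : v ≠ 0) : ∃ x y μ, LeafPoint D κ r q v x y μ := by
  obtain ⟨x, hx, y, hy, h1, h2, h3⟩ := exists_coords hκ hz hw hq; set S := std with hS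
  have hF : q ∈ D.surface κ := mem_surface.2 ⟨r, hr, hq⟩; have hN := norm_of_mem hκ hF; have hK : 0 < 2 + κ := by linarith
  have hT := (D.sector_tangent hκ hr hz hw hq hx hy h1 h2).2
  have hreg := fun h => hs ((singular_iff hκ hr hz hw hq hx hy h1 h2 h3).2 h)
  obtain ⟨d, hd, d1, d2, d3, hspan⟩ := exists_charLine_eq_span hK hz hw hN hT hreg
  rw [hspan, Submodule.mem_span_singleton] at hv; obtain ⟨μ, rfl⟩ := hv
  have hμ : μ ≠ 0 := fun h => hv0 (by rw [h, zero_smul]); set E := exp ((2 + κ) * S.lam q) with hE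
  have hZ : 0 < ‖S.z q‖ ^ 2 := by positivity
  have hW : 0 < ‖S.w q‖ ^ 2 := by positivity
  have hEZ : E * ‖S.z q‖ ^ 2 = ‖S.w q‖ ^ 2 * exp (κ * S.lam q) := by
    have e2 : exp (2 * S.lam q) * ‖S.z q‖ ^ 2 = ‖S.w q‖ ^ 2 := by rw [exp_lam hz hw, rpow_two, rpow_two, div_mul_cancel₀ _ hZ.ne']
    rw [← e2, hE, add_mul, exp_add]; ring
  set c := r.P.C.fn x; set c' := r.P.C.der x; set b' := r.P.B.der y; set A := E * c' * ‖S.z q‖ ^ 2 + b' * ‖S.w q‖ ^ 2 with hA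
  have hA' : A = ‖S.w q‖ ^ 2 * (exp (κ * S.lam q) * c' + b') := by linear_combination c' * hEZ
  have hsum : ‖S.z q‖ ^ 2 + ‖S.w q‖ ^ 2 = 1 := by rw [← S.norm_sq, hN]
  refine ⟨x, y, μ, hx, hy, h1, h2, h3, hμ, by rw [map_smul, smul_eq_mul, d1], ?_, ?_, fun h0 h => ?_, A ^ 2 + ((2 + κ) * E * c) ^ 2, ?_, ?_⟩
  · rw [map_smul, smul_eq_mul, d2]; ring
  · rw [map_smul, smul_eq_mul, d3, hA']; ring
  · grind
  · by_cases h0 : c = 0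
    · have : A ≠ 0 := by grind
      positivity
    · positivity
  · rintro N ⟨n1, n2, n3⟩; obtain ⟨g, hg, g1, g2, g3⟩ := exists_vec hz hw hN (E * c' / ‖S.w q‖ ^ 2) (-b' / ‖S.z q‖ ^ 2)
      ((2 + κ) * E * c / (‖S.z q‖ ^ 2 * ‖S.w q‖ ^ 2))
    have hform : ∀ v, inner ℝ q v = 0 → inner ℝ g v = sepForm S (2 + κ) q c c' b' v := fun v hv => by
      rw [inner_eq_forms hz hw hN hg hv, g1, g2, g3, sepForm_apply]; field_simp; ring
    have hg0 : g ≠ 0 := by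
      rintro rfl; simp [map_zero] at g1 g2 g3; rw [eq_comm, div_eq_zero_iff] at g1 g2 g3
      have e1 : E * c' = 0 := g1.resolve_right hW.ne'; have e2 : b' = 0 := by grind
      have e3 : (2 + κ) * E * c = 0 := by grind
      exact hreg ⟨(mul_eq_zero.1 e3).resolve_left (by positivity), by rw [hA, e1, e2]; ring⟩
    have hgg : inner ℝ g g ≠ 0 := by simpa using hg0
    set n := inner ℝ g N / inner ℝ g g with hn; have hM : N - n • g = 0 := by
      have m1 : inner ℝ q (N - n • g) = 0 := by rw [inner_sub_right, inner_smul_right, n2, hg]; ring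
      have m2 : inner ℝ g (N - n • g) = 0 := by rw [inner_sub_right, inner_smul_right, hn, div_mul_cancel₀ _ hgg, sub_self]
      have m3 := n3 _ ((hT _).2 ⟨m1, by rw [← hform _ m1, m2]⟩)
      rw [← inner_self_eq_zero (𝕜 := ℝ), inner_sub_right, inner_smul_right, m3, real_inner_comm, m2]; ring
    rw [sub_eq_zero] at hM; have hnc : inner ℝ q (contactNormal q) = 0 := by
      rw [inner_eq_re hz hw, S.z_normal, S.w_normal, mul_left_comm, inv_mul_cancel₀ hz, mul_left_comm, inv_mul_cancel₀ hw]; simp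
    refine ⟨n, fun h => ?_, ?_, ?_⟩
    · rw [hM, h, zero_smul, norm_zero] at n1; exact zero_ne_one n1
    · rw [hM, inner_smul_left, hform _ hnc, sepForm_apply, S.dθ_contactNormal hw, S.dlam_contactNormal hz hw,
        show S.dφ q (contactNormal q) = 1 from S.swap.dθ_contactNormal hz]
      simp [E, hS, c', b']
    · rw [hM, volAt_eq hz hw, ← hS]; simp [map_smul, smul_eq_mul]; rw [g1, g2, g3, d1, d2, d3]
      have : E * c' / ‖S.w q‖ ^ 2 - -b' / ‖S.z q‖ ^ 2 = A / (‖S.z q‖ ^ 2 * ‖S.w q‖ ^ 2) := by rw [hA]; field_simp; ring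
      have e : n * (E * c' / ‖S.w q‖ ^ 2) - n * (-b' / ‖S.z q‖ ^ 2) = n * (A / (‖S.z q‖ ^ 2 * ‖S.w q‖ ^ 2)) := by rw [← this]; ring
      rw [e]; have hZW : ‖S.z q‖ ^ 2 * ‖S.w q‖ ^ 2 ≠ 0 := by positivity
      linear_combination -(n * μ * A) * mul_div_cancel₀ A hZW - n * μ * ((2 + κ) * E * c) * (‖S.w q‖ ^ 2 + ‖S.z q‖ ^ 2) *
        mul_div_cancel₀ ((2 + κ) * E * c) hZW - n * μ * ((2 + κ) * E * c) ^ 2 * hsum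

end Diagram

lemma hasDerivAt_arcCoord {S : Split} {γ : ℝ → E4} (hγ : HasDerivAt γ v t) (hw : S.w (γ t) ≠ 0) (h : (arg (S.w (γ t)) : Angle) ≠ α) :
    HasDerivAt (fun s => arcCoord (arg (S.w (γ s)) - α)) (S.dθ (γ t) v) t := by
  have hww := self_div_mem hw; set x₀ := arcCoord (arg (S.w (γ t)) - α) with hx₀
  have hX : HasDerivAt (fun s => S.X (S.w (γ t)) (γ s)) (S.dθ (γ t) v) t := (hasFDerivAt_X hww).comp_hasDerivAt t hγ
  have hX := hX.const_add x₀; have h0 : x₀ + S.X (S.w (γ t)) (γ t) ∈ Ioo 0 (2 * π) := by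
    rw [X_self hw, add_zero]; exact ⟨arcCoord_pos (sub_ne_zero.2 h), (arcCoord_mem _).2⟩
  refine hX.congr_of_eventuallyEq ?_; filter_upwards [hγ.continuousAt.eventually (eventually_slit hww),
    hX.continuousAt.eventually (Ioo_mem_nhds h0.1 h0.2)] with s h1 h2
  have : arg (S.w (γ t)) + S.X (S.w (γ t)) (γ s) - α = ((x₀ + S.X (S.w (γ t)) (γ s) : ℝ) : Angle) := by
    rw [coe_add, hx₀, coe_arcCoord]; abel
  rw [arg_eq_add_X h1, this, arcCoord_coe_of_mem ⟨h2.1.le, h2.2⟩]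

lemma IsLeafCurve.hasDerivAt_lam {D : Diagram} {I : Set ℝ} {γ : ℝ → E4} (hγ : IsLeafCurve (D.surface κ) I γ)
    (hκ : 0 ≤ κ) (hI : IsOpen I) (ht : t ∈ I) :
    HasDerivAt (fun t => std.lam (γ t)) (std.dlam (γ t) (deriv γ t)) t :=
  (hasFDerivAt_lam (hγ.nonpole hκ ht).1 (hγ.nonpole hκ ht).2).comp_hasDerivAt t (hγ.hasDerivAt hI ht)

lemma forall_pos_mul_of_ne_zero (h : ∀ t ∈ Ioo (0 : ℝ) 1, HasDerivAt f (f' t) t ∧ f' t ≠ 0) :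
    ∃ e : ℝ, (e = 1 ∨ e = -1) ∧ ∀ t ∈ Ioo (0 : ℝ) 1, 0 < e * f' t := by
  rcases hasDerivWithinAt_forall_lt_or_forall_gt_of_forall_ne (convex_Ioo (0 : ℝ) 1)
    (fun t ht => (h t ht).1.hasDerivWithinAt) fun t ht => (h t ht).2 with h' | h'
  · exact ⟨-1, .inr rfl, fun t ht => by grind⟩
  · exact ⟨1, .inl rfl, fun t ht => by grind⟩

lemma mul_lt_mul_of_deriv (h : ∀ t ∈ Ioo (0 : ℝ) 1, HasDerivAt f (f' t) t)
    (h' : ∀ t ∈ Ioo (0 : ℝ) 1, 0 < e * f' t) {t₁ t₂ : ℝ} (h₁ : t₁ ∈ Ioo (0 : ℝ) 1) (h₂ : t₂ ∈ Ioo (0 : ℝ) 1)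
    (ht : t₁ < t₂) : e * f t₁ < e * f t₂ := by
  refine strictMonoOn_of_deriv_pos (convex_Ioo (0 : ℝ) 1)
    (fun t ht => ((h t ht).const_mul e).continuousAt.continuousWithinAt) (fun t ht => ?_) h₁ h₂ ht
  rw [interior_Ioo] at ht; rw [((h t ht).const_mul e).deriv]; exact h' t ht

lemma exists_twist_times {ϑ : ℝ → ℝ} (hc : ContinuousOn ϑ (Ioo 0 1))
    (hs : ∀ t ∈ Ioo (0 : ℝ) 1, sin (ϑ t) ≠ 0) (ha : Tendsto ϑ (𝓝[>] 0) (𝓝 a)) (hb : Tendsto ϑ (𝓝[<] 1) (𝓝 b))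
    (hab : b - a = π) : ∃ t₁ ∈ Ioo (0 : ℝ) 1, ∃ t₂ ∈ Ioo (0 : ℝ) 1, t₁ < t₂ ∧
      0 < cos (ϑ t₁) * sin (ϑ t₁) ∧ cos (ϑ t₂) * sin (ϑ t₂) < 0 := by
  have hπ := pi_pos; have h2 : (1 / 2 : ℝ) ∈ Ioo (0 : ℝ) 1 := by norm_num
  have nz : ∀ t ∈ Ioo (0 : ℝ) 1, ∀ k : ℤ, ϑ t ≠ k * π := fun t ht k h => hs t ht (by rw [h, sin_int_mul_pi])
  set m := ⌊ϑ (1 / 2) / π⌋; have m1 : m * π ≤ ϑ (1 / 2) := (le_div_iff₀ hπ).1 (Int.floor_le _)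
  have m2 : ϑ (1 / 2) ≤ (m + 1 : ℤ) * π := by
    have := ((div_lt_iff₀ hπ).1 (Int.lt_floor_add_one (ϑ (1 / 2) / π))).le; push_cast; exact this
  have lo : ∀ t ∈ Ioo (0 : ℝ) 1, m * π ≤ ϑ t := fun t ht => by
    by_contra! h; obtain ⟨s, hs, e⟩ := isPreconnected_Ioo.intermediate_value ht h2 hc ⟨h.le, m1⟩; exact nz s hs m e
  have hi : ∀ t ∈ Ioo (0 : ℝ) 1, ϑ t ≤ (m + 1 : ℤ) * π := fun t ht => by
    by_contra! h; obtain ⟨s, hs, e⟩ := isPreconnected_Ioo.intermediate_value h2 ht hc ⟨m2, h.le⟩; exact nz s hs _ e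
  have i0 : ∀ᶠ t in 𝓝[>] (0 : ℝ), t ∈ Ioo (0 : ℝ) (1 / 2) := Ioo_mem_nhdsGT (by norm_num)
  have i1 : ∀ᶠ t in 𝓝[<] (1 : ℝ), t ∈ Ioo (1 / 2 : ℝ) 1 := Ioo_mem_nhdsLT (by norm_num)
  have a1 : m * π ≤ a := ge_of_tendsto ha (i0.mono fun t ht => lo t ⟨ht.1, by grind⟩)
  have b1 : b ≤ (m + 1 : ℤ) * π := le_of_tendsto hb (i1.mono fun t ht => hi t ⟨by grind, ht.2⟩); push_cast at b1 hi
  obtain ⟨t₁, ⟨p1, p2⟩, p3⟩ := (i0.and (ha.eventually (gt_mem_nhds (show a < m * π + π / 2 by linarith)))).exists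
  obtain ⟨t₂, ⟨q1, q2⟩, q3⟩ := (i1.and (hb.eventually (lt_mem_nhds (show m * π + π / 2 < b by linarith)))).exists
  have k1 : t₁ ∈ Ioo (0 : ℝ) 1 := ⟨p1, by linarith⟩; have k2 : t₂ ∈ Ioo (0 : ℝ) 1 := ⟨by linarith, q2⟩
  have sc : ∀ t, cos (ϑ t) * sin (ϑ t) = sin (2 * (ϑ t - m * π)) / 2 := fun t => by
    rw [show 2 * (ϑ t - m * π) = 2 * ϑ t - m * (2 * π) by ring, sin_sub_int_mul_two_pi, sin_two_mul]; ring
  have n1 := lt_of_le_of_ne (lo t₁ k1) (nz t₁ k1 m).symm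
  have n2 := lt_of_le_of_ne (hi t₂ k2) (by simpa using nz t₂ k2 (m + 1)); refine ⟨t₁, k1, t₂, k2, by linarith, ?_, ?_⟩
  · rw [sc]; exact half_pos (sin_pos_of_pos_of_lt_pi (by linarith) (by linarith))
  · rw [sc, ← sin_sub_two_pi]
    linarith [sin_neg_of_neg_of_neg_pi_lt (x := 2 * (ϑ t₂ - m * π) - 2 * π) (by linarith) (by linarith)]

lemma pos_mul_of_exp {l : ℝ} (hk : 0 ≤ k) (h : 0 < e * (exp (k * l) - 1)) : 0 < e * l := by
  rcases pos_and_pos_or_neg_and_neg_of_mul_pos h with ⟨h1, h2⟩ | ⟨h1, h2⟩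
  · have := one_lt_exp_iff.1 (sub_pos.1 h2); exact mul_pos h1 (pos_of_mul_pos_right this hk)
  · have := exp_lt_one_iff.1 (sub_neg.1 h2); exact mul_pos_of_neg_of_neg h1 (neg_of_mul_neg_right this hk)

lemma vertex_twist {l W σ τ : ℝ} (hκ : 0 ≤ κ) (hW : 0 < W) (hσ : σ = 1 ∨ σ = -1) (hτ : τ = 1 ∨ τ = -1)
    (h1 : 0 < μ * (τ - exp ((2 + κ) * l) * σ)) (h2 : 0 < e * -(μ * W * (exp (κ * l) * σ + τ))) : 0 < e * l := by
  set E := exp ((2 + κ) * l) with hEd; set x := exp (κ * l) with hxd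
  have h3 : 0 < (μ ^ 2 * W) * (e * -((τ - E * σ) * (x * σ + τ))) := by nlinarith
  have h4 := pos_of_mul_pos_right h3 (by positivity); have : 0 < e * (E - 1) ∨ 0 < e * (x - 1) := by
    rcases hσ with rfl | rfl <;> rcases hτ with rfl | rfl
    · exact .inl (pos_of_mul_pos_left (b := 1 + x) (by linarith) (by positivity))
    · exact .inr (pos_of_mul_pos_left (b := 1 + E) (by linarith) (by positivity))
    · exact .inr (pos_of_mul_pos_left (b := 1 + E) (by linarith) (by positivity))
    · exact .inl (pos_of_mul_pos_left (b := 1 + x) (by linarith) (by positivity))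
  exact this.elim (pos_mul_of_exp (by linarith)) (pos_mul_of_exp hκ)

namespace Diagram

variable {D : Diagram}

namespace LeafPoint


lemma pos (h : LeafPoint D κ r q v x y μ) (hv : proj q ∉ r.vertices) : 0 < r.P.C.fn x ∧ 0 < r.P.B.fn y := by
  have hC : 0 < r.P.C.fn x := (r.P.C.nonneg h.mem_x).lt_of_ne' fun h0 => hv <| by
    rw [mem_vertices_iff h.mem_x h.mem_y h.proj_fst h.proj_snd, ← r.P.C.eq_zero_iff h.mem_x, ← r.P.B.eq_zero_iff h.mem_y, h.height, h0]
    simp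
  exact ⟨hC, by rw [h.height]; positivity⟩

lemma mem_Ioo (h : LeafPoint D κ r q v x y μ) (hv : proj q ∉ r.vertices) : x ∈ Ioo 0 r.a ∧ y ∈ Ioo 0 r.b := by
  obtain ⟨h1, h2⟩ := h.pos hv; have h3 := mt (r.P.C.eq_zero_iff h.mem_x).2 h1.ne'
  have h4 := mt (r.P.B.eq_zero_iff h.mem_y).2 h2.ne'
  exact ⟨⟨h.mem_x.1.lt_of_ne' (not_or.1 h3).1, h.mem_x.2.lt_of_ne (not_or.1 h3).2⟩,
    ⟨h.mem_y.1.lt_of_ne' (not_or.1 h4).1, h.mem_y.2.lt_of_ne (not_or.1 h4).2⟩⟩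

lemma arcCoord_eq (h : LeafPoint D κ r q v x y μ) : arcCoord ((proj q).1 - r.θ₁) = x ∧ arcCoord ((proj q).2 - r.φ₁) = y := by
  rw [h.proj_fst, h.proj_snd, ← r.coe_s, ← r.coe_t, coe_add, coe_add, add_sub_cancel_left, add_sub_cancel_left]
  exact ⟨arcCoord_coe_of_mem ⟨h.mem_x.1, h.mem_x.2.trans_lt r.a_mem.2⟩, arcCoord_coe_of_mem ⟨h.mem_y.1, h.mem_y.2.trans_lt r.b_mem.2⟩⟩

lemma vertex (h : LeafPoint D κ r q v x y μ) (hv : proj q ∈ r.vertices) : r.P.C.fn x = 0 ∧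
    r.P.C.der x = r.sgnθ (proj q).1 ∧ r.P.B.der y = r.sgnφ (proj q).2 := by
  have hv' := Rect.mem_vertices.1 hv; have h1 := Rect.cornerSign_θ h.mem_x h.proj_fst hv'.1
  have h2 := Rect.cornerSign_φ h.mem_y h.proj_snd hv'.2; have h3 := h1.fn_add r.P.C 0; have h4 := h1.der_add r.P.C 0
  have h5 := h2.der_add r.P.B 0; rw [add_zero] at h3 h4 h5; rw [r.P.C.zero, mul_zero] at h3
  rw [r.P.C.der_zero, mul_one] at h4; rw [r.P.B.der_zero, mul_one] at h5; exact ⟨h3, h4, h5⟩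

end LeafPoint

variable {I : Set ℝ} {γ : ℝ → E4}

lemma leaf_leafPoint (hκ : 0 ≤ κ) (hγ : IsLeafCurve (D.surface κ) I γ) (hr : r ∈ D.rects) (ht : t ∈ I)
    (hq : γ t ∈ tile κ r) : ∃ x y μ, LeafPoint D κ r (γ t) (deriv γ t) x y μ :=
  exists_leafPoint hκ hr hq (hγ.mem t ht).2 (hγ.nonpole hκ ht).1 (hγ.nonpole hκ ht).2 (hγ.tangent t ht) (hγ.regular t ht)

lemma interior_leaf (hκ : 0 ≤ κ) (hI : IsOpen I) (hγ : IsLeafCurve (D.surface κ) I γ) (hr : r ∈ D.rects)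
    (ht : t ∈ I) (hq : γ t ∈ tile κ r) (hv : proj (γ t) ∉ r.vertices) :
    HasDerivAt (fun t => arcCoord ((proj (γ t)).1 - r.θ₁)) (std.dθ (γ t) (deriv γ t)) t ∧
    HasDerivAt (fun t => arcCoord ((proj (γ t)).2 - r.φ₁)) (std.dφ (γ t) (deriv γ t)) t ∧
    std.dθ (γ t) (deriv γ t) ≠ 0 := by
  obtain ⟨x, y, μ, h⟩ := leaf_leafPoint hκ hγ hr ht hq; obtain ⟨hz, hw⟩ := hγ.nonpole hκ ht
  obtain ⟨⟨h1, -⟩, ⟨h2, -⟩⟩ := h.mem_Ioo hv; rw [← h.arcCoord_eq.1] at h1; rw [← h.arcCoord_eq.2] at h2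
  have ne : ∀ {α β : Angle}, 0 < arcCoord (α - β) → α ≠ β := fun h e => by rw [e, sub_self, arcCoord_zero] at h; exact h.false
  refine ⟨hasDerivAt_arcCoord (S := std) (hγ.hasDerivAt hI ht) hw (ne h1),
    hasDerivAt_arcCoord (S := std.swap) (hγ.hasDerivAt hI ht) hz (ne h2), ?_⟩
  rw [h.dθ_eq]; have := (h.pos hv).1; exact mul_ne_zero h.ne_zero (by positivity)

lemma vertex_leaf (hκ : 0 ≤ κ) (hγ : IsLeafCurve (D.surface κ) I γ) (hr : r ∈ D.rects)
    (ht : t ∈ I) (hq : γ t ∈ tile κ r) (hv : proj (γ t) ∈ r.vertices) : std.dlam (γ t) (deriv γ t) ≠ 0 := by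
  obtain ⟨x, y, μ, h⟩ := leaf_leafPoint hκ hγ hr ht hq; have hw := (hγ.nonpole hκ ht).2; rw [h.dlam_eq]
  exact neg_ne_zero.2 (mul_ne_zero (mul_ne_zero h.ne_zero (by positivity)) (h.der_ne (h.vertex hv).1))

lemma not_hasClosedLeaf (hκ : 0 ≤ κ) : ¬ HasClosedLeaf (D.surface κ) := by
  rintro ⟨γ, hγ, hper⟩; have h01 : γ 0 = γ 1 := by simpa using (hper 0).symm
  obtain ⟨r, hr, ht, hv | ⟨v, hv, hvt⟩⟩ := leaf_dichotomy hκ isOpen_univ isPreconnected_univ univ_nonempty hγ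
  · have H := fun t => interior_leaf hκ isOpen_univ hγ hr (mem_univ t) (ht t trivial) (hv t trivial)
    obtain ⟨t, -, h⟩ := exists_hasDerivAt_eq_zero zero_lt_one (fun t _ => (H t).1.continuousAt.continuousWithinAt)
      (by rw [h01]) fun t _ => (H t).1
    exact (H t).2.2 h
  · have H := fun t => hγ.hasDerivAt_lam hκ isOpen_univ (mem_univ t)
    obtain ⟨t, -, h⟩ := exists_hasDerivAt_eq_zero zero_lt_one (fun t _ => (H t).continuousAt.continuousWithinAt)
      (by rw [h01]) fun t _ => H t
    exact vertex_leaf hκ hγ hr (mem_univ t) (ht t trivial) (hvt t trivial ▸ hv) h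

lemma not_isTwistArc (hκ : 0 ≤ κ) : ¬ ∃ γ : ℝ → E4, IsTwistArc (D.surface κ) γ 1 := by
  rintro ⟨γ, ⟨p, q, hpq⟩, ν, ϑ, a, b, -, hϑ, H, ha, hb, hab⟩; have hγ := hpq.isLeafCurve
  obtain ⟨r, hr, ht, hcase⟩ := leaf_dichotomy hκ isOpen_Ioo isPreconnected_Ioo ⟨1 / 2, by norm_num⟩ hγ
  have key : ∀ t ∈ Ioo (0 : ℝ) 1, ∃ x y μ p, LeafPoint D κ r (γ t) (deriv γ t) x y μ ∧ sin (ϑ t) ≠ 0 ∧ 0 < p ∧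
      cos (ϑ t) * sin (ϑ t) = p * (μ * (r.P.B.der y - exp ((2 + κ) * std.lam (γ t)) * r.P.C.der x)) := fun t h => by
    obtain ⟨x, y, μ, hp⟩ := leaf_leafPoint hκ hγ hr h (ht t h); obtain ⟨Q, hQ, hn⟩ := hp.normal
    obtain ⟨h1, h2, h3⟩ := H t h; obtain ⟨n, hn0, h4, h5⟩ := hn _ h1
    have hd : 0 < ‖deriv γ t‖ := norm_pos_iff.2 (hγ.regular t h); rw [volAt_rotate, h5] at h3; rw [h4] at h2
    refine ⟨x, y, μ, n ^ 2 * Q / ‖deriv γ t‖, hp, fun h0 => ?_, by positivity, ?_⟩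
    · rw [h0, mul_zero, neg_eq_zero] at h3; exact mul_ne_zero (mul_ne_zero hp.ne_zero hn0) hQ.ne' h3
    · rw [← h2, div_mul_eq_mul_div, eq_div_iff hd.ne']
      linear_combination -n * (exp ((2 + κ) * std.lam (γ t)) * r.P.C.der x - r.P.B.der y) * h3
  obtain ⟨t₁, k1, t₂, k2, hlt, s1, s2⟩ := exists_twist_times hϑ (fun t h => by grind) ha hb (by simpa using hab)
  obtain ⟨x₁, y₁, μ₁, p₁, h₁, -, hp₁, e₁⟩ := key t₁ k1; obtain ⟨x₂, y₂, μ₂, p₂, h₂, -, hp₂, e₂⟩ := key t₂ k2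
  rw [e₁] at s1; rw [e₂] at s2; replace s1 := pos_of_mul_pos_right s1 hp₁.le
  replace s2 := neg_of_mul_neg_right s2 hp₂.le; rcases hcase with hv | ⟨v, hv, hvt⟩
  · have L := fun t h => interior_leaf hκ isOpen_Ioo hγ hr h (ht t h) (hv t h)
    obtain ⟨e, he, hpos⟩ := forall_pos_mul_of_ne_zero fun t h => ⟨(L t h).1, (L t h).2.2⟩
    have hμ : ∀ t ∈ Ioo (0 : ℝ) 1, ∀ {x y μ}, LeafPoint D κ r (γ t) (deriv γ t) x y μ →
        0 < e * μ ∧ 0 < -e * std.dφ (γ t) (deriv γ t) := fun t h x y μ hp => by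
      have h1 := hpos t h; have hC := (hp.pos (hv t h)).1; have hw := (hγ.nonpole hκ h).2
      rw [hp.dθ_eq, ← mul_assoc] at h1; have h2 := pos_of_mul_pos_left h1 (by positivity); refine ⟨h2, ?_⟩
      rw [hp.dφ_eq, neg_mul_neg, ← mul_assoc]; positivity
    have hx := mul_lt_mul_of_deriv (fun t h => (L t h).1) hpos k1 k2 hlt
    have hy := mul_lt_mul_of_deriv (e := -e) (fun t h => (L t h).2.1)
      (fun t h => by obtain ⟨x, y, μ, p, hp, -⟩ := key t h; exact (hμ t h hp).2) k1 k2 hlt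
    simp [h₁.arcCoord_eq, h₂.arcCoord_eq] at hx hy; have m1 := h₁.mem_Ioo (hv t₁ k1); have m2 := h₂.mem_Ioo (hv t₂ k2)
    have G : ∀ {t x y μ}, LeafPoint D κ r (γ t) (deriv γ t) x y μ → proj (γ t) ∉ r.vertices → ∃ p : ℝ, 0 < p ∧
        r.P.B.der y - exp ((2 + κ) * std.lam (γ t)) * r.P.C.der x =
          p * (r.P.B.der y / r.P.B.fn y - r.P.C.der x / r.P.C.fn x) := fun {t x y μ} hp hv => by
      obtain ⟨c1, c2⟩ := hp.pos hv; refine ⟨r.P.B.fn y, c2, ?_⟩; rw [mul_sub, mul_div_cancel₀ _ c2.ne', hp.height]; field_simp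
    obtain ⟨g₁, hg₁, G₁⟩ := G h₁ (hv t₁ k1); obtain ⟨g₂, hg₂, G₂⟩ := G h₂ (hv t₂ k2); rw [G₁] at s1; rw [G₂] at s2
    have f1 := (hμ t₁ k1 h₁).1; have f2 := (hμ t₂ k2 h₂).1; have mC := r.P.C.strictAntiOn_logDeriv
    have mB := r.P.B.strictAntiOn_logDeriv; rcases he with rfl | rfl
    · have n1 := pos_of_mul_pos_right (pos_of_mul_pos_right s1 (by linarith)) hg₁.le
      have n2 := neg_of_mul_neg_right (neg_of_mul_neg_right s2 (by linarith)) hg₂.le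
      have := mC m1.1 m2.1 (by linarith : x₁ < x₂); have := mB m2.2 m1.2 (by linarith : y₂ < y₁); linarith
    · have n1 := neg_of_mul_pos_right s1 (by linarith); have n2 := pos_of_mul_neg_right s2 (by linarith)
      have n1 := neg_of_mul_neg_right n1 hg₁.le; have n2 := pos_of_mul_pos_right n2 hg₂.le
      have := mC m2.1 m1.1 (by linarith : x₂ < x₁); have := mB m1.2 m2.2 (by linarith : y₁ < y₂); linarith
  · have L := fun t (h : t ∈ Ioo (0 : ℝ) 1) => hγ.hasDerivAt_lam hκ isOpen_Ioo h
    obtain ⟨e, he, hpos⟩ := forall_pos_mul_of_ne_zero fun t h => ⟨L t h, vertex_leaf hκ hγ hr h (ht t h) (hvt t h ▸ hv)⟩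
    have hl := mul_lt_mul_of_deriv L hpos k1 k2 hlt; have q1 := hpos t₁ k1; have q2 := hpos t₂ k2
    have w1 := (hγ.nonpole hκ k1).2; have w2 := (hγ.nonpole hκ k2).2; obtain ⟨-, c1, b1⟩ := h₁.vertex (hvt t₁ k1 ▸ hv)
    obtain ⟨-, c2, b2⟩ := h₂.vertex (hvt t₂ k2 ▸ hv); rw [h₁.dlam_eq, c1, b1] at q1; rw [h₂.dlam_eq, c2, b2] at q2
    rw [c1, b1] at s1; rw [c2, b2] at s2; have r1 := vertex_twist hκ (by positivity) (r.sgnθ_abs _) (r.sgnφ_abs _) s1 q1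
    have r2 := vertex_twist (μ := -μ₂) (e := -e) hκ (by positivity : 0 < ‖std.w (γ t₂)‖ ^ 2) (r.sgnθ_abs _) (r.sgnφ_abs _) (by linarith) (by linarith)
    linarith

end Diagram

lemma Profile.exists_forall_lt (P : Profile a b) (hκ : 0 < κ) : ∃ Λ : ℝ, ∀ l < Λ, ∀ x ∈ Icc 0 a,
    ∀ y, P.B.fn y = exp ((2 + κ) * l) * P.C.fn x →
      0 < (P.B.der y - exp ((2 + κ) * l) * P.C.der x) * (P.B.der y + exp (κ * l) * P.C.der x) := by
  obtain ⟨M, hM⟩ := isCompact_Icc.exists_bound_of_continuousOn (s := Icc (0 : ℝ) a)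
    (f := fun x => (P.C.fn x, P.C.der x)) (P.C.continuous.prodMk P.C.continuous_der).continuousOn
  have hlim : ∀ k : ℝ, 0 < k → Tendsto (fun l => exp (k * l) * M) atBot (𝓝 0) := fun k hk => by
    simpa using (tendsto_exp_atBot.comp (tendsto_id.const_mul_atBot hk)).mul_const M
  have hv : ∀ᶠ v in 𝓝 (0 : ℝ), 1 / 2 < 1 + -P.β * v ^ 2 - P.m * v ^ 4 := by
    have : ContinuousAt (fun v : ℝ => 1 + -P.β * v ^ 2 - P.m * v ^ 4) 0 := by fun_prop
    exact this.eventually (lt_mem_nhds (by norm_num))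
  obtain ⟨δ, hδ, hv⟩ := Metric.eventually_nhds_iff.1 hv; have hK : 0 < 2 + κ := by linarith
  obtain ⟨Λ, hΛ⟩ := eventually_atBot.1 (((hlim _ hK).eventually (gt_mem_nhds hδ)).and
    (((hlim _ hK).eventually (gt_mem_nhds one_half_pos)).and ((hlim _ hκ).eventually (gt_mem_nhds one_half_pos))))
  refine ⟨Λ, fun l hl x hx y h => ?_⟩; obtain ⟨h1, h2, h3⟩ := hΛ l hl.le; obtain ⟨hc, hc'⟩ := max_le_iff.1 (hM x hx)
  simp [norm_eq_abs] at hc hc'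
  have bd : ∀ k : ℝ, ∀ u : ℝ, |u| ≤ M → |exp k * u| ≤ exp k * M := fun k u hu => by rw [abs_mul, abs_exp]; gcongr
  have e1 := abs_lt.1 ((bd _ _ hc').trans_lt h2); have e2 := abs_lt.1 ((bd _ _ hc').trans_lt h3)
  have hb := hv (y := P.B.fn y) (by rw [dist_0_eq_abs, h]; grind); rw [← P.B.der_sq] at hb
  rcases le_total 0 (P.B.der y) with h0 | h0
  · have : 1 / 2 < P.B.der y := by nlinarith
    exact mul_pos (by linarith) (by linarith)
  · have : P.B.der y < -(1 / 2) := by nlinarith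
    exact mul_pos_of_neg_of_neg (by linarith) (by linarith)

lemma nonneg_of_tendsto_zero {f₀ : ℝ} (h : ∀ᶠ t in 𝓝[<] (1 : ℝ), HasDerivAt g (g' t) t ∧ 0 < g t ∧ f t * g' t < 0)
    (hg : Tendsto g (𝓝[<] 1) (𝓝 0)) (hf : Tendsto f (𝓝[<] 1) (𝓝 f₀)) : 0 ≤ f₀ := by
  by_contra! h0; obtain ⟨a, ha, hI⟩ := mem_nhdsLT_iff_exists_Ioo_subset.1 (h.and (hf.eventually (gt_mem_nhds h0)))
  have mono : StrictMonoOn g (Ioo a 1) := by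
    refine strictMonoOn_of_deriv_pos (convex_Ioo a 1) (fun t ht => (hI ht).1.1.continuousAt.continuousWithinAt) fun t ht => ?_
    rw [interior_Ioo] at ht; rw [(hI ht).1.1.deriv]; exact pos_of_mul_neg_right (hI ht).1.2.2 (hI ht).2.le
  have hm : (a + 1) / 2 ∈ Ioo a 1 := by grind
  have : g ((a + 1) / 2) ≤ 0 := ge_of_tendsto hg (by
    filter_upwards [Ioo_mem_nhdsLT hm.2] with t ht; exact (mono hm ⟨hm.1.trans ht.1, ht.2⟩ ht.1).le)
  grind

lemma nonpos_of_tendsto_zero {f₀ : ℝ} (h : ∀ᶠ t in 𝓝[>] (0 : ℝ), HasDerivAt g (g' t) t ∧ 0 < g t ∧ f t * g' t < 0)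
    (hg : Tendsto g (𝓝[>] 0) (𝓝 0)) (hf : Tendsto f (𝓝[>] 0) (𝓝 f₀)) : f₀ ≤ 0 := by
  have ht : Tendsto (fun t : ℝ => 1 - t) (𝓝[<] 1) (𝓝[>] 0) := by
    refine tendsto_nhdsWithin_iff.2 ⟨?_, eventually_mem_nhdsWithin.mono fun t ht => sub_pos.2 (show t < 1 from ht)⟩
    exact ((continuous_const.sub continuous_id).tendsto' 1 0 (sub_self 1)).mono_left nhdsWithin_le_nhds
  have := nonneg_of_tendsto_zero (f := fun t => -f (1 - t)) (g := fun t => g (1 - t)) (g' := fun t => -g' (1 - t))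
    ((ht.eventually h).mono fun t ⟨h1, h2, h3⟩ => ⟨h1.comp_const_sub 1 t, h2, by rwa [neg_mul_neg]⟩)
    (hg.comp ht) (hf.comp ht).neg
  linarith

lemma continuous_contactNormal : Continuous contactNormal := by unfold contactNormal; fun_prop

namespace Diagram

variable {D : Diagram} {γ : ℝ → E4}

lemma inner_contactNormal_ne_zero (hp : p ∈ singularSet (D.surface κ)) {N : E4}
    (hN : IsUnitNormal (D.surface κ) p N) : inner ℝ N (contactNormal p) ≠ 0 := by
  intro h; obtain ⟨h1, h2, h3⟩ := hN; rw [hp.2] at h3; have := h3 N (mem_contactPlane.2 ⟨h2, by rwa [real_inner_comm]⟩)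
  simp_all

/-- Along an end of a leaf at a singularity there is a positive function that tends to zero and whose derivative is
determined in sign by the coorientations. -/
def Collapses (F : Set E4) (γ : ℝ → E4) (l : Filter ℝ) : Prop :=
  ∃ g g' : ℝ → ℝ, Tendsto g l (𝓝 0) ∧ ∀ᶠ t in l, HasDerivAt g (g' t) t ∧ 0 < g t ∧ ∀ N, IsUnitNormal F (γ t) N →
    0 < volAt (γ t) N (contactNormal (γ t)) (deriv γ t) → inner ℝ N (contactNormal (γ t)) * g' t < 0

lemma LeafPoint.mul_neg (h : LeafPoint D κ r q v x y μ) (hk : 0 < k)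
    (hs : 0 < (exp ((2 + κ) * std.lam q) * r.P.C.der x - r.P.B.der y) * s) {N : E4}
    (hN : IsUnitNormal (D.surface κ) q N) (hv : 0 < volAt q N (contactNormal q) v) :
    inner ℝ N (contactNormal q) * (k * (μ * s)) < 0 := by
  obtain ⟨Q, hQ, hn⟩ := h.normal; obtain ⟨n, -, h1, h2⟩ := hn N hN; have h3 : μ * n < 0 := by
    rw [h2, neg_pos] at hv; exact neg_of_mul_neg_left hv hQ.le
  rw [h1]; have := mul_neg_of_pos_of_neg (mul_pos hk hs) h3; linarith

lemma collapses_of_pole (hκ : 0 < κ) (hγ : IsLeafCurve (D.surface κ) (Ioo 0 1) γ) {l : Filter ℝ}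
    (hl : ∀ᶠ t in l, t ∈ Ioo (0 : ℝ) 1) (hp : Tendsto γ l (𝓝 p)) (hr : r ∈ D.rects)
    (ht : ∀ t ∈ Ioo (0 : ℝ) 1, γ t ∈ tile κ r) (hpF : p ∈ D.surface κ)
    (h : std.w p = 0 ∨ std.z p = 0) : Collapses (D.surface κ) γ l := by
  have hN := norm_of_mem hκ.le hpF; rw [std.norm_sq] at hN
  have hz : Tendsto (fun t => ‖std.z (γ t)‖) l (𝓝 ‖std.z p‖) := (std.z.continuous.tendsto p |>.comp hp).norm
  have hw : Tendsto (fun t => ‖std.w (γ t)‖) l (𝓝 ‖std.w p‖) := (std.w.continuous.tendsto p |>.comp hp).norm; rcases h with h | h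
  · obtain ⟨Λ, hΛ⟩ := r.P.exists_forall_lt hκ; have hz0 : ‖std.z p‖ ≠ 0 := fun h' => by simp_all
    have hlim : Tendsto (fun t => exp (std.lam (γ t))) l (𝓝 0) := by
      have := hw.div hz hz0; rw [h, norm_zero, zero_div] at this; refine this.congr' (hl.mono fun t ht => ?_)
      have := exp_lam (K := 1) (hγ.nonpole hκ.le ht).1 (hγ.nonpole hκ.le ht).2; rw [one_mul, rpow_one, rpow_one] at this
      exact this.symm
    refine ⟨_, fun t => exp (std.lam (γ t)) * std.dlam (γ t) (deriv γ t), hlim, ?_⟩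
    filter_upwards [hl, hlim.eventually (gt_mem_nhds (exp_pos Λ))] with t htI hlt
    refine ⟨(hγ.hasDerivAt_lam hκ.le isOpen_Ioo htI).exp, exp_pos _, fun N hN hv => ?_⟩
    obtain ⟨x, y, μ, hp⟩ := leaf_leafPoint hκ.le hγ hr htI (ht t htI); have hw := (hγ.nonpole hκ.le htI).2
    have := hp.mul_neg (k := exp (std.lam (γ t)) * ‖std.w (γ t)‖ ^ 2)
      (s := -(exp (κ * std.lam (γ t)) * r.P.C.der x + r.P.B.der y)) (by positivity)
      (by linarith [hΛ _ (exp_lt_exp.1 hlt) x hp.mem_x y hp.height]) hN hv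
    rw [hp.dlam_eq]; linarith
  · obtain ⟨Λ, hΛ⟩ := r.P.swap.exists_forall_lt hκ
    have hw0 : ‖std.w p‖ ≠ 0 := fun h' => by simp_all
    have hlim : Tendsto (fun t => exp (-std.lam (γ t))) l (𝓝 0) := by
      have := hz.div hw hw0; rw [h, norm_zero, zero_div] at this; refine this.congr' (hl.mono fun t ht => ?_)
      have := exp_lam (K := 1) (hγ.nonpole hκ.le ht).1 (hγ.nonpole hκ.le ht).2; rw [one_mul, rpow_one, rpow_one] at this
      change ‖std.z (γ t)‖ / ‖std.w (γ t)‖ = exp (-std.lam (γ t)); rw [exp_neg, this, inv_div]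
    refine ⟨_, fun t => exp (-std.lam (γ t)) * -std.dlam (γ t) (deriv γ t), hlim, ?_⟩
    filter_upwards [hl, hlim.eventually (gt_mem_nhds (exp_pos Λ))] with t htI hlt
    refine ⟨(hγ.hasDerivAt_lam hκ.le isOpen_Ioo htI).neg.exp, exp_pos _, fun N hN hv => ?_⟩
    obtain ⟨x, y, μ, hp⟩ := leaf_leafPoint hκ.le hγ hr htI (ht t htI); have hw := (hγ.nonpole hκ.le htI).2
    have h1 := hΛ _ (exp_lt_exp.1 hlt) y hp.mem_y x (by
      rw [mul_neg, exp_neg]; exact (eq_inv_mul_iff_mul_eq₀ (exp_pos _).ne').2 hp.height.symm)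
    have h2 := mul_pos (exp_pos (κ * std.lam (γ t))) (mul_pos (exp_pos ((2 + κ) * std.lam (γ t))) h1)
    change 0 < _ * (_ * ((r.P.C.der x - _ * r.P.B.der y) * (r.P.C.der x + _ * r.P.B.der y))) at h2
    rw [mul_neg, mul_neg, exp_neg, exp_neg] at h2; have := hp.mul_neg (k := exp (-std.lam (γ t)) * ‖std.w (γ t)‖ ^ 2)
      (s := exp (κ * std.lam (γ t)) * r.P.C.der x + r.P.B.der y) (by positivity)
      (by
        convert h2 using 1
        field_simp) hN hv
    rw [hp.dlam_eq]; linarith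

lemma collapses_of_interior (hκ : 0 < κ) (hγ : IsLeafCurve (D.surface κ) (Ioo 0 1) γ) {l : Filter ℝ} [l.NeBot]
    (hl : ∀ᶠ t in l, t ∈ Ioo (0 : ℝ) 1) (hp : Tendsto γ l (𝓝 p)) (hr : r ∈ D.rects)
    (ht : ∀ t ∈ Ioo (0 : ℝ) 1, γ t ∈ tile κ r) (hps : p ∈ singularSet (D.surface κ))
    (hz : std.z p ≠ 0) (hw : std.w p ≠ 0) (hv : ∀ t ∈ Ioo (0 : ℝ) 1, proj (γ t) ∉ r.vertices) :
    Collapses (D.surface κ) γ l := by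
  have hpr : p ∈ tile κ r := (isCompact_tile hκ.le r).isClosed.mem_of_tendsto hp (hl.mono ht)
  obtain ⟨x₀, hx, y₀, hy, h1, h2, h3⟩ := exists_coords hκ.le hz hw hpr
  obtain ⟨hC, hA⟩ := (singular_iff hκ.le hr hz hw hpr hx hy h1 h2 h3).1 hps
  have hlam := (singular_nonpole hκ hps hz hw).2.1; set S := std with hS; have hww := self_div_mem hw
  have hzz := self_div_mem hz; have c1 : r.P.C.der x₀ ^ 2 = 1 := by rw [r.P.C.der_sq, hC]; ring
  have hX : ContinuousAt (fun q => x₀ + S.X (S.w p) q) p := continuousAt_const.add (hasFDerivAt_X hww).continuousAt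
  have hY : ContinuousAt (fun q => y₀ + S.Y (S.z p) q) p := continuousAt_const.add (hasFDerivAt_Y hzz).continuousAt
  have hX0 : x₀ + S.X (S.w p) p = x₀ := by rw [X_self hw, add_zero]
  have hY0 : y₀ + S.Y (S.z p) p = y₀ := by rw [show S.Y (S.z p) p = 0 from X_self (S := S.swap) hz, add_zero]
  have hcont : ContinuousAt (fun q => r.P.C.der (x₀ + S.X (S.w p) q) *
      (exp ((2 + κ) * S.lam q) * r.P.C.der (x₀ + S.X (S.w p) q) - r.P.B.der (y₀ + S.Y (S.z p) q))) p := by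
    have hl : ContinuousAt S.lam p := (hasFDerivAt_lam hz hw).continuousAt
    have e1 : ContinuousAt (fun q => r.P.C.der (x₀ + S.X (S.w p) q)) p := r.P.C.continuous_der.continuousAt.comp hX
    have e2 : ContinuousAt (fun q => r.P.B.der (y₀ + S.Y (S.z p) q)) p := r.P.B.continuous_der.continuousAt.comp hY; fun_prop
  have hpos : 0 < r.P.C.der (x₀ + S.X (S.w p) p) *
      (exp ((2 + κ) * S.lam p) * r.P.C.der (x₀ + S.X (S.w p) p) - r.P.B.der (y₀ + S.Y (S.z p) p)) := by
    rw [hX0, hY0]; have hW : 0 < ‖S.w p‖ ^ 2 := by positivity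
    rw [hlam, mul_zero, exp_zero, one_mul] at hA ⊢; refine pos_of_mul_pos_left (b := ‖S.w p‖ ^ 2) ?_ hW.le
    have : (r.P.C.der x₀ * (r.P.C.der x₀ - r.P.B.der y₀)) * ‖S.w p‖ ^ 2 = ‖S.w p‖ ^ 2 + ‖S.z p‖ ^ 2 := by
      linear_combination (‖S.w p‖ ^ 2 + ‖S.z p‖ ^ 2) * c1 - r.P.C.der x₀ * hA
    rw [this]; positivity
  refine ⟨fun t => r.P.C.fn (x₀ + S.X (S.w p) (γ t)),
    fun t => r.P.C.der (x₀ + S.X (S.w p) (γ t)) * S.dθ (γ t) (deriv γ t), ?_, ?_⟩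
  · have : Tendsto (fun q => r.P.C.fn (x₀ + S.X (S.w p) q)) (𝓝 p) (𝓝 (r.P.C.fn (x₀ + S.X (S.w p) p))) :=
      r.P.C.continuous.continuousAt.comp hX
    rw [hX0, hC] at this; exact this.comp hp
  · filter_upwards [hl, hp.eventually (eventually_slit hww), hp.eventually (hcont.eventually (lt_mem_nhds hpos)),
      hp.eventually (angle_eq_iff (S := S) hw r.a_mem.2 hx h1),
      hp.eventually (angle_eq_iff (S := S.swap) hz r.b_mem.2 hy h2)] with t htI k1 k2 k3 k4
    obtain ⟨x, y, μ, h⟩ := leaf_leafPoint hκ.le hγ hr htI (ht t htI); have ex := (k3 x h.mem_x).1 h.proj_fst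
    have ey : y = y₀ + S.Y (S.z p) (γ t) := (k4 y h.mem_y).1 h.proj_snd
    have hd : HasDerivAt (fun t => x₀ + S.X (S.w p) (γ t)) (S.dθ (γ t) (deriv γ t)) t :=
      ((hasFDerivAt_X k1).comp_hasDerivAt t (hγ.hasDerivAt isOpen_Ioo htI)).const_add x₀
    have hCx := (h.pos (hv t htI)).1; rw [← ex, ← ey] at k2
    refine ⟨(r.P.C.hasDerivAt _).comp t hd, by rwa [← ex], fun N hN hv => ?_⟩; have hz := (hγ.nonpole hκ.le htI).1
    have := h.mul_neg (k := (2 + κ) * exp ((2 + κ) * S.lam (γ t)) * r.P.C.fn x * ‖S.z (γ t)‖ ^ 2) (s := r.P.C.der x)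
      (by positivity) (by linarith) hN hv
    rw [← ex, h.dθ_eq]; linarith

lemma not_isCoorientedTurn {δ : ℝ → E4} {p₀ p₁ : E4} (hγ : IsLeafArc (D.surface κ) γ p₀ p)
    (hδ : IsLeafArc (D.surface κ) δ p p₁) (cγ : Collapses (D.surface κ) γ (𝓝[<] 1)) (cδ : Collapses (D.surface κ) δ (𝓝[>] 0)) :
    ¬ IsCoorientedTurn (D.surface κ) p γ δ := by
  rintro ⟨U, hU, N, hN, hn, h1, h2⟩; have hp := hγ.target_mem; have hpU := mem_of_mem_nhds hU
  have lim : ∀ {l : Filter ℝ} {γ : ℝ → E4}, (∀ᶠ t in l, t ∈ Ioo (0 : ℝ) 1) → IsLeafCurve (D.surface κ) (Ioo 0 1) γ →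
      Tendsto γ l (𝓝 p) → (∀ᶠ t in l, IsUnitNormal (D.surface κ) (γ t) (N (γ t))) ∧
      Tendsto (fun t => inner ℝ (N (γ t)) (contactNormal (γ t))) l (𝓝 (inner ℝ (N p) (contactNormal p))) := by
    intro l γ hl hγ ht; have hm : ∀ᶠ t in l, γ t ∈ D.surface κ ∩ U := by
      filter_upwards [hl, ht hU] with t h1 h2; exact ⟨(hγ.mem t h1).1, h2⟩
    exact ⟨hm.mono fun t h => hn _ h, Tendsto.inner (((hN p ⟨hp.1, hpU⟩).tendsto).comp (tendsto_nhdsWithin_iff.2 ⟨ht, hm⟩))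
      ((continuous_contactNormal.tendsto p).comp ht)⟩
  obtain ⟨n1, l1⟩ := lim (Ioo_mem_nhdsLT zero_lt_one) hγ.isLeafCurve hγ.tendsto_target
  obtain ⟨n2, l2⟩ := lim (Ioo_mem_nhdsGT zero_lt_one) hδ.isLeafCurve hδ.tendsto_source; obtain ⟨g, g', hg, hev⟩ := cγ
  obtain ⟨k, k', hk, kev⟩ := cδ
  have e1 := nonneg_of_tendsto_zero (by filter_upwards [hev, n1, h1] with t a1 a2 a3; exact ⟨a1.1, a1.2.1, a1.2.2 _ a2 a3⟩) hg l1
  have e2 := nonpos_of_tendsto_zero (by filter_upwards [kev, n2, h2] with t a1 a2 a3; exact ⟨a1.1, a1.2.1, a1.2.2 _ a2 a3⟩) hk l2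
  exact inner_contactNormal_ne_zero hp (hn p ⟨hp.1, hpU⟩) (le_antisymm e2 e1)

lemma leafArc_interior (hκ : 0 < κ) (hγ : IsLeafArc (D.surface κ) γ p q) (hp : std.z p ≠ 0 ∧ std.w p ≠ 0)
    (hq : std.z q ≠ 0 ∧ std.w q ≠ 0) : ∃ r ∈ D.rects, (∀ t ∈ Ioo (0 : ℝ) 1, γ t ∈ tile κ r) ∧
      ∀ t ∈ Ioo (0 : ℝ) 1, proj (γ t) ∉ r.vertices := by
  have hL := hγ.isLeafCurve
  obtain ⟨r, hr, ht, hv | ⟨v, hv, hvt⟩⟩ := leaf_dichotomy hκ.le isOpen_Ioo isPreconnected_Ioo ⟨1 / 2, by norm_num⟩ hL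
  · exact ⟨r, hr, ht, hv⟩
  · have lim : ∀ {p}, p ∈ singularSet (D.surface κ) → std.z p ≠ 0 ∧ std.w p ≠ 0 → Tendsto std.lam (𝓝 p) (𝓝 0) :=
      fun {p} hs h => by
        have := (hasFDerivAt_lam h.1 h.2).continuousAt.tendsto; rwa [(singular_nonpole hκ hs h.1 h.2).2.1] at this
    obtain ⟨t, h, h0⟩ := exists_hasDerivAt_eq_zero' zero_lt_one ((lim hγ.source_mem hp).comp hγ.tendsto_source)
      ((lim hγ.target_mem hq).comp hγ.tendsto_target) fun t h => hL.hasDerivAt_lam hκ.le isOpen_Ioo h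
    exact absurd h0 (vertex_leaf hκ.le hL hr h (ht t h) (hvt t h ▸ hv))

lemma not_hasCoorientedSaddleCycle (hκ : 0 < κ) : ¬ HasCoorientedSaddleCycle (D.surface κ) := by
  rintro ⟨n, p, γ, hn, hp, hγ, -, ha, ht⟩; have i1 : ∀ᶠ t in 𝓝[<] (1 : ℝ), t ∈ Ioo (0 : ℝ) 1 := Ioo_mem_nhdsLT zero_lt_one
  have i0 : ∀ᶠ t in 𝓝[>] (0 : ℝ), t ∈ Ioo (0 : ℝ) 1 := Ioo_mem_nhdsGT zero_lt_one
  have arc : ∀ i ≤ n, ∃ j < n, IsLeafArc (D.surface κ) (γ i) (p i) (p (j + 1)) := by grind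
  have np : ∀ i < n, std.z (p (i + 1)) ≠ 0 ∧ std.w (p (i + 1)) ≠ 0 := fun i hi => by
    by_contra h; have hpole : std.w (p (i + 1)) = 0 ∨ std.z (p (i + 1)) = 0 := by tauto
    obtain ⟨j, -, hj⟩ := arc (i + 1) hi; have hF := (ha i hi).target_mem.1
    obtain ⟨r, hr, hrt, -⟩ := leaf_dichotomy hκ.le isOpen_Ioo isPreconnected_Ioo ⟨1 / 2, by norm_num⟩ (ha i hi).isLeafCurve
    obtain ⟨r', hr', hrt', -⟩ := leaf_dichotomy hκ.le isOpen_Ioo isPreconnected_Ioo ⟨1 / 2, by norm_num⟩ hj.isLeafCurve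
    exact not_isCoorientedTurn (ha i hi) hj (collapses_of_pole hκ (ha i hi).isLeafCurve i1 (ha i hi).tendsto_target hr hrt hF hpole)
      (collapses_of_pole hκ hj.isLeafCurve i0 hj.tendsto_source hr' hrt' hF hpole) (ht i hi)
  have n0 : std.z (p 0) ≠ 0 ∧ std.w (p 0) ≠ 0 := by have := np (n - 1) (by omega); rwa [Nat.sub_add_cancel hn, hp] at this
  obtain ⟨j, hj, hδ⟩ := arc 1 hn; have n1 := np 0 hn; obtain ⟨r, hr, hrt, hrv⟩ := leafArc_interior hκ (ha 0 hn) n0 n1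
  obtain ⟨r', hr', hrt', hrv'⟩ := leafArc_interior hκ hδ n1 (np j hj); exact not_isCoorientedTurn (ha 0 hn) hδ
    (collapses_of_interior hκ (ha 0 hn).isLeafCurve i1 (ha 0 hn).tendsto_target hr hrt (ha 0 hn).target_mem n1.1 n1.2 hrv)
    (collapses_of_interior hκ hδ.isLeafCurve i0 hδ.tendsto_source hr' hrt' hδ.source_mem n1.1 n1.2 hrv') (ht 0 hn)

end Diagram

end RectSurface

theorem mainTheorem7 (D : RectSurface.Diagram) (κ : ℝ) (hκ : 0 ≤ κ) :
    RectSurface.IsSurfaceWithCorners (D.surface κ) ∧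
    (0 < κ → RectSurface.IsVeryNice (D.surface κ)) ∧
    ¬ ∃ γ : ℝ → RectSurface.E4, RectSurface.IsTwistArc (D.surface κ) γ 1 :=
  ⟨RectSurface.Diagram.isSurfaceWithCorners hκ,
    fun h => ⟨RectSurface.Diagram.isNice h, RectSurface.Diagram.not_hasClosedLeaf hκ,
      RectSurface.Diagram.not_hasCoorientedSaddleCycle h⟩,
    RectSurface.Diagram.not_isTwistArc hκ⟩
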